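/- Let $N\ge 1$, $\mathbb R^{N+1}_+=\{x=(x_0,x'):x_0>0\}$, $x'\in\mathbb R^N$, $0\le q\le N+1$ and $s>1/2$. Forms $\phi=\sum_I\phi_I\,dx^I$ have complex coefficients, $W^s=W^s(\mathbb R^{N+1}_+)$ is the $L^2$-Sobolev space, $\|\phi\|_s^2=\sum_I\|\phi_I\|_{W^s}^2$, and $\hat f(x_0,\xi')=\int f(x_0,x')e^{-2\pi i x'\cdot\xi'}dx'$ is the tangential Fourier transform. Write $\lambda=|2\pi\xi'|$, $\mu=\sqrt{1+\lambda^2}$. Let $d^*$ be the adjoint of $d$ for the inner product $\langle\phi,\psi\rangle_1=\sum_I\bigl(\int\phi_I\overline{\psi_I}+\sum_j\int D_j\phi_I\overline{D_j\psi_I}\bigr)$ of $W^1$: $\psi\in\mathrm{dom}\,d^*$ iff $\psi$ has coefficients in $W^1$ and $u\mapsto\langle du,\psi\rangle_1$ is $W^1$-bounded on the forms $u$ that are smooth up to the boundary with compact support in the closed half-space. On forms $\psi$ that are smooth up to the boundary with compact support in the closed half-space, $\psi\in\mathrm{dom}\, d^*$ is equivalent to the boundary condition $$(\mathrm{BC})\qquad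 D_0\psi_{0J}(0,\cdot)=0\quad\text{for all } J\not\ni 0 .$$ Let $\mathcal K$ map $(q+1)$-forms to $q$-forms by $\widehat{(\mathcal K\psi)_I}(x_0,\xi')=-\mu e^{-\mu x_0}\,\widehat{\psi_{0I}}(0,\xi')$ for $0\notin I$ and $(\mathcal K\psi)_I=0$ for $0\in I$, and let $G=\mathcal Kd+d\mathcal K$. **Theorem.** Let $\alpha$ be a $q$-form with coefficients in $W^s\cap L^1(\mathbb R^{N+1}_+)$. If $N=2,3$, suppose also that $\int\alpha_I\,dx=0$ for all $I$ and $\alpha\in L^1(|x|\,dx)$. If $N=1$, suppose also that $\int\alpha_I\,dx=0$ and $\int x_i\alpha_I\,dx=0$ for all $I$ and $i=0,1$, and $\alpha\in L^1(|x|^2dx)$. Then there is a unique $q$-form $\phi$ with coefficients in $W^{s+2}$ such that $$(-\Delta+G)\phi=\alpha\ \text{ on }\mathbb R^{N+1}_+,\qquad \phi\text{ and }d\phi\text{ satisfy (BC)},$$ and $$\|\phi\|_{s+2}\le c\,\bigl(\|\alpha\|_s+\|\alpha\|_{L^1(|x|^k dx)}\bigr),\qquad k=0\text{ if }N\ge4,\quad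 k=1\text{ if }N=2,3,\quad k=2\text{ if }N=1,$$ where $c$ depends only on $N,q,s$. Moreover $\phi\in\mathrm{dom}\,d^*$; if $s\ge1$, then also $d\phi\in\mathrm{dom}\,d^*$; and for every $s>1/2$, a $q$-form $\phi'$ with coefficients in $W^{s+2}$ such that $(-\Delta+G)\phi'=\alpha$ and $\phi',d\phi'\in\mathrm{dom}\,d^*$ equals $\phi$. The solution is explicit. With $D=1+2\lambda^2+\lambda\mu$, $m_1=(1+\lambda^2+\lambda\mu)/D$, $m_2=(\lambda+\mu)/D$, $f=\alpha_I$, $F(\xi')=\int_0^\infty e^{-\lambda y}\hat f(y,\xi')\,dy$ and $\mathcal G_\sigma[g](x_0)=\frac1{2\lambda}\int_0^\infty\bigl(e^{-\lambda|x_0-y|}+\sigma e^{-\lambda(x_0+y)}\bigr)g(y)\,dy$, one has, for almost all $x_0>0$ and $\xi'$, $$\hat\phi_I(x_0,\xi')=\mathcal G_{-1}\bigl[\hat f(\cdot,\xi')+m_1\bigl(\lambda F-\hat f(0,\xi')\bigr)e^{-\mu\,\cdot}\bigr](x_0)+e^{-\lambda x_0}\Bigl(\frac{\hat f(0,\xi')}{D}+\frac{m_1}{\lambda}F\Bigr)\qquad(0\notin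 I),$$ $$\hat\phi_I(x_0,\xi')=\mathcal G_{1}\bigl[\hat f(\cdot,\xi')-(1+\lambda^2)m_2F\,e^{-\mu\,\cdot}\bigr](x_0)\qquad(0\in I).$$ In particular, if $\alpha\in W^s$ is a $q$-form supported in $\{|x|<R\}$ and the above moment conditions hold ($\int\alpha_I\,dx=0$ if $N\le3$, and $\int x_i\alpha_I\,dx=0$ if $N=1$), then all of the above holds with $\|\phi\|_{s+2}\le c\,\|\alpha\|_s$, where $c$ depends only on $N,q,s,R$. -/

import Mathlib

open MeasureTheory Filter Topology FourierTransform
open scoped ENNReal NNReal ContDiff ComplexConjugate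

noncomputable section

namespace HalfSpaceHodge

/-! ### The half space -/

/-- The ambient space `ℝ^{N+1}` with coordinates `(x_0, x_1, …, x_N)`. -/
abbrev Amb (N : ℕ) := EuclideanSpace ℝ (Fin (N + 1))

/-- The boundary `ℝ^N`, with coordinates `x' = (x_1, …, x_N)`. -/
abbrev Bdry (N : ℕ) := EuclideanSpace ℝ (Fin N)

/-- The open half space `ℝ^{N+1}_+ = {x : x_0 > 0}`. -/
def halfSpace (N : ℕ) : Set (Amb N) := {x | 0 < x 0}

/-- Lebesgue measure on the half space. -/
def halfMeasure (N : ℕ) : Measure (Amb N) := volume.restrict (halfSpace N)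

/-- The tangential part `x'` of `x = (x_0, x')`. -/
def tang {N : ℕ} (x : Amb N) : Bdry N := WithLp.toLp 2 (fun i => x i.succ)

/-- The point `(x_0, x')`. -/
def glue {N : ℕ} (x₀ : ℝ) (x' : Bdry N) : Amb N := WithLp.toLp 2 (Fin.cons x₀ (fun i => x' i))

/-! ### Sobolev spaces on the half space -/

/-- The norm of `W^s(ℝ^{N+1})`, `(∫ (1 + |ξ|²)^s |ℱF(ξ)|² dξ)^{1/2}`, of `F ∈ L²(ℝ^{N+1})`;
`F` belongs to `W^s(ℝ^{N+1})` iff this is finite. -/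
def eSobolevNormWhole {N : ℕ} (s : ℝ) (F : Lp ℂ 2 (volume : Measure (Amb N))) : ℝ≥0∞ :=
  (∫⁻ ξ, ENNReal.ofReal ((1 + ‖ξ‖ ^ 2) ^ s) *
    ‖(𝓕 F : Lp ℂ 2 (volume : Measure (Amb N))) ξ‖ₑ ^ 2) ^ (1 / 2 : ℝ)

/-- The norm of `W^s(ℝ^{N+1}_+)`, `s ≥ 0`: the infimum of the norms of the extensions of `u` that
belong to `W^s(ℝ^{N+1})`. It is `∞` if there is no such extension. -/
def eSobolevNorm {N : ℕ} (s : ℝ) (u : Amb N → ℂ) : ℝ≥0∞ :=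
  ⨅ (F : Lp ℂ 2 (volume : Measure (Amb N))) (_ : F =ᵐ[halfMeasure N] u), eSobolevNormWhole s F

/-- `u ∈ W^s(ℝ^{N+1}_+)`. -/
def MemSob {N : ℕ} (s : ℝ) (u : Amb N → ℂ) : Prop := eSobolevNorm s u < ⊤

/-- `v` is the weak derivative `D_j u` on the half space. -/
def HasWeakDeriv {N : ℕ} (j : Fin (N + 1)) (u v : Amb N → ℂ) : Prop :=
  LocallyIntegrableOn u (halfSpace N) ∧ LocallyIntegrableOn v (halfSpace N) ∧
    ∀ ψ : Amb N → ℂ, ContDiff ℝ ∞ ψ → HasCompactSupport ψ → tsupport ψ ⊆ halfSpace N →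
      ∫ x, u x * fderiv ℝ ψ x (EuclideanSpace.single j 1) ∂halfMeasure N =
        -∫ x, v x * ψ x ∂halfMeasure N

open Classical in
/-- The weak derivative `D_j u` on the half space (`0` if there is none). -/
def weakDeriv {N : ℕ} (j : Fin (N + 1)) (u : Amb N → ℂ) : Amb N → ℂ :=
  if h : ∃ v, HasWeakDeriv j u v then h.choose else 0

/-- `v` is the trace `u(0, ·)` of `u`, in the sense that
`ε⁻¹ ∫_{0 < x_0 < ε} |u(x_0, x') - v(x')|² dx → 0` as `ε → 0+`. There is at most one such `v`. -/
def IsTrace {N : ℕ} (u : Amb N → ℂ) (v : Lp ℂ 2 (volume : Measure (Bdry N))) : Prop :=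
  Tendsto (fun ε : ℝ =>
    (∫⁻ x in {x : Amb N | 0 < x 0 ∧ x 0 < ε}, ‖u x - v (tang x)‖ₑ ^ 2) / ENNReal.ofReal ε)
    (𝓝[>] 0) (𝓝 0)

open Classical in
/-- The trace `u(0, ·) ∈ L²(ℝ^N)` (`0` if there is none). -/
def trace {N : ℕ} (u : Amb N → ℂ) : Lp ℂ 2 (volume : Measure (Bdry N)) :=
  if h : ∃ v, IsTrace u v then h.choose else 0

/-! ### Differential forms -/

/-- A differential form `φ = ∑_I φ_I dx^I` (possibly of mixed degree), given by its coefficients.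
The increasing multi-index `I` is the finite set of its entries. -/
abbrev Form (N : ℕ) := Finset (Fin (N + 1)) → Amb N → ℂ

/-- `φ` is a `q`-form. -/
def IsQForm {N : ℕ} (q : ℕ) (φ : Form N) : Prop := ∀ I, I.card ≠ q → φ I = 0

/-- Exterior differentiation: the coefficient of `dx^K` in `∑_{I, j} D_j φ_I dx^j ∧ dx^I`. -/
def extD {N : ℕ} (φ : Form N) : Form N := fun K x =>
  ∑ j ∈ K, (-1 : ℂ) ^ (K.filter (· < j)).card * weakDeriv j (φ (K.erase j)) x

/-- The norm of the forms with coefficients in `W^s`. -/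
def eSobolevNormForm {N : ℕ} (s : ℝ) (φ : Form N) : ℝ≥0∞ :=
  (∑ I, eSobolevNorm s (φ I) ^ 2) ^ (1 / 2 : ℝ)

/-! ### The `W¹` inner product and the domain of the adjoint of `d` -/

/-- `u ∈ W¹`, by weak derivatives. -/
def MemW1 {N : ℕ} (u : Amb N → ℂ) : Prop :=
  MemLp u 2 (halfMeasure N) ∧ ∀ j, ∃ v, MemLp v 2 (halfMeasure N) ∧ HasWeakDeriv j u v

/-- `⟨φ, ψ⟩_1 = ∑_I (∫ φ_I conj(ψ_I) + ∑_j ∫ D_j φ_I conj(D_j ψ_I))`. -/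
def innerW1 {N : ℕ} (φ ψ : Form N) : ℂ :=
  ∑ I, (∫ x, φ I x * conj (ψ I x) ∂halfMeasure N +
    ∑ j, ∫ x, weakDeriv j (φ I) x * conj (weakDeriv j (ψ I) x) ∂halfMeasure N)

/-- `‖φ‖_1`. -/
def normW1 {N : ℕ} (φ : Form N) : ℝ := Real.sqrt (innerW1 φ φ).re

/-- `ψ ∈ dom d*`, where `d*` is the adjoint of `d` for the `W¹` inner product: `ψ` has coefficients
in `W¹`, and `u ↦ ⟨du, ψ⟩_1` is bounded in the `W¹` norm on the forms `u` that are smooth up to the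
boundary and compactly supported in the closed half space. -/
def MemDomAdjoint {N : ℕ} (ψ : Form N) : Prop :=
  (∀ I, MemW1 (ψ I)) ∧
    ∃ C : ℝ, ∀ u : Form N, (∀ I, ContDiff ℝ ∞ (u I) ∧ HasCompactSupport (u I)) →
      ‖innerW1 (extD u) ψ‖ ≤ C * normW1 u

/-- The boundary condition `∇_n ψ ⌊ n = 0`, that is, `D_0 ψ_{0J}(0, ·) = 0` for all `J ∌ 0`. -/
def BoundaryCond {N : ℕ} (ψ : Form N) : Prop :=
  ∀ J : Finset (Fin (N + 1)), 0 ∉ J → IsTrace (weakDeriv 0 (ψ (insert 0 J))) 0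

/-! ### The operators `𝒦` and `G` -/

/-- `λ = |2πξ'|`. -/
def lam {N : ℕ} (ξ : Bdry N) : ℝ := 2 * Real.pi * ‖ξ‖

/-- `√(1 + |2πξ'|²)`. -/
def mu {N : ℕ} (ξ : Bdry N) : ℝ := Real.sqrt (1 + lam ξ ^ 2)

/-- The operator `v ↦ K_{x_0} * v`, whose tangential Fourier transform is
`-√(1 + |2πξ'|²) e^{-√(1 + |2πξ'|²) x_0} v̂(ξ')`, at `x = (x_0, x')` with `x_0 > 0`. -/
def kTilde {N : ℕ} (v : Lp ℂ 2 (volume : Measure (Bdry N))) : Amb N → ℂ := fun x =>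
  𝓕⁻ (fun ξ : Bdry N => ((-mu ξ * Real.exp (-mu ξ * x 0) : ℝ) : ℂ) *
    (𝓕 v : Lp ℂ 2 (volume : Measure (Bdry N))) ξ) (tang x)

/-- The operator `𝒦`: `(𝒦ψ)_I = K_{x_0} * ψ_{0I}(0, ·)` if `0 ∉ I`, and `(𝒦ψ)_I = 0` otherwise. -/
def opK {N : ℕ} (ψ : Form N) : Form N := fun I =>
  if 0 ∈ I then 0 else kTilde (trace (ψ (insert 0 I)))

/-- `G = 𝒦d + d𝒦`. -/
def opG {N : ℕ} (φ : Form N) : Form N := opK (extD φ) + extD (opK φ)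

/-- The Laplacian, acting on each coefficient. -/
def laplace {N : ℕ} (φ : Form N) : Form N := fun I x =>
  ∑ j, weakDeriv j (weakDeriv j (φ I)) x

/-! ### The boundary value problem -/

/-- `φ` is a `q`-form in `W^{s+2}` with `(-Δ + G)φ = α` on the half space. -/
structure SolvesEquation {N : ℕ} (q : ℕ) (s : ℝ) (α φ : Form N) : Prop where
  isQForm : IsQForm q φ
  memSob : ∀ I, MemSob (s + 2) (φ I)
  eqn : ∀ I, ∀ᵐ x ∂halfMeasure N, -laplace φ I x + opG φ I x = α I x

/-- `φ` solves the problem `(-Δ + G)φ = α` and `φ`, `dφ` satisfy the boundary condition. -/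
structure IsSolution {N : ℕ} (q : ℕ) (s : ℝ) (α φ : Form N) : Prop
    extends SolvesEquation q s α φ where
  bdry : BoundaryCond φ
  bdry_d : BoundaryCond (extD φ)

/-- `φ` solves the problem `(-Δ + G)φ = α` and `φ`, `dφ` lie in the domain of the Hilbert space
adjoint of `d`. -/
structure IsHilbertSolution {N : ℕ} (q : ℕ) (s : ℝ) (α φ : Form N) : Prop
    extends SolvesEquation q s α φ where
  dom : MemDomAdjoint φ
  dom_d : MemDomAdjoint (extD φ)

/-! ### The explicit solution -/

/-- `v(x_0, ξ')` is the tangential Fourier transform of `u`: for almost every `x_0 > 0`, the slice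
`u(x_0, ·)` is in `L²(ℝ^N)` and `v(x_0, ·)` is its Fourier transform. -/
def IsTangFourier {N : ℕ} (u : Amb N → ℂ) (v : ℝ → Bdry N → ℂ) : Prop :=
  ∀ᵐ x₀ ∂(volume.restrict (Set.Ioi (0 : ℝ))),
    ∃ h : MemLp (fun x' : Bdry N => u (glue x₀ x')) 2 volume,
      (𝓕 (h.toLp _) : Lp ℂ 2 (volume : Measure (Bdry N))) =ᵐ[volume] v x₀

/-- The tangential Fourier transform `f̂(y_0, ξ') = ∫ f(y_0, x') e^{-2πi x'·ξ'} dx'` of `f ∈ L¹`. -/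
def tangFourier {N : ℕ} (f : Amb N → ℂ) (y₀ : ℝ) (ξ : Bdry N) : ℂ :=
  𝓕 (fun x' : Bdry N => f (glue y₀ x')) ξ

/-- `(2λ)⁻¹ ∫_0^∞ (e^{-λ|x_0 - y_0|} + σ e^{-λ(x_0 + y_0)}) g(y_0) dy_0`: the tangential Fourier
transform of the Green potential for the Laplacian on the half space, with the Dirichlet condition
if `σ = -1` and the Neumann condition if `σ = 1`. -/
def greenHat (σ l : ℝ) (g : ℝ → ℂ) (x₀ : ℝ) : ℂ :=
  ((1 / (2 * l) : ℝ) : ℂ) * ∫ y in Set.Ioi (0 : ℝ),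
    ((Real.exp (-l * |x₀ - y|) + σ * Real.exp (-l * (x₀ + y)) : ℝ) : ℂ) * g y

/-- `D(ξ') = 1 + 2|2πξ'|² + |2πξ'|√(1 + |2πξ'|²)`. -/
def den {N : ℕ} (ξ : Bdry N) : ℝ := 1 + 2 * lam ξ ^ 2 + lam ξ * mu ξ

/-- `m_1(ξ') = (1 + |2πξ'|² + |2πξ'|√(1 + |2πξ'|²)) / D(ξ')`. -/
def m1 {N : ℕ} (ξ : Bdry N) : ℝ := (1 + lam ξ ^ 2 + lam ξ * mu ξ) / den ξ

/-- `m_2(ξ') = (|2πξ'| + √(1 + |2πξ'|²)) / D(ξ')`. -/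
def m2 {N : ℕ} (ξ : Bdry N) : ℝ := (lam ξ + mu ξ) / den ξ

/-- `∫_0^∞ e^{-|2πξ'| y_0} f̂(y_0, ξ') dy_0`. -/
def lapHat {N : ℕ} (f : Amb N → ℂ) (ξ : Bdry N) : ℂ :=
  ∫ y in Set.Ioi (0 : ℝ), (Real.exp (-lam ξ * y) : ℂ) * tangFourier f y ξ

/-- The Fourier transform `f̂(0, ξ')` of the trace of `f`. -/
def traceHat {N : ℕ} (f : Amb N → ℂ) (ξ : Bdry N) : ℂ :=
  (𝓕 (trace f) : Lp ℂ 2 (volume : Measure (Bdry N))) ξ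

/-- The tangential Fourier transform of a component `φ_I` of the solution, where `f = α_I` and
`0 ∉ I`. -/
def solHatTang {N : ℕ} (f : Amb N → ℂ) (x₀ : ℝ) (ξ : Bdry N) : ℂ :=
  greenHat (-1) (lam ξ) (fun y => tangFourier f y ξ +
      (m1 ξ : ℂ) * ((lam ξ : ℂ) * lapHat f ξ - traceHat f ξ) * (Real.exp (-mu ξ * y) : ℂ)) x₀ +
    (Real.exp (-lam ξ * x₀) : ℂ) *
      (traceHat f ξ / (den ξ : ℂ) + (m1 ξ : ℂ) / (lam ξ : ℂ) * lapHat f ξ)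

/-- The tangential Fourier transform of a component `φ_I` of the solution, where `f = α_I` and
`0 ∈ I`. -/
def solHatNorm {N : ℕ} (f : Amb N → ℂ) (x₀ : ℝ) (ξ : Bdry N) : ℂ :=
  greenHat 1 (lam ξ) (fun y => tangFourier f y ξ -
      ((1 + lam ξ ^ 2 : ℝ) : ℂ) * (Real.exp (-mu ξ * y) : ℂ) * ((m2 ξ : ℂ) * lapHat f ξ)) x₀

/-- The tangential Fourier transforms of the coefficients of `φ` are given by the explicit
formulas. -/
def IsExplicit {N : ℕ} (α φ : Form N) : Prop :=
  ∀ I, IsTangFourier (φ I) (if 0 ∈ I then solHatNorm (α I) else solHatTang (α I))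

/-! ### Hypotheses on the data, and solvability -/

/-- `∑_I ∫ |x|^k |α_I(x)| dx`, the norm of `α` in `L¹(|x|^k dx)`. -/
def eWeightedL1 {N : ℕ} (k : ℕ) (α : Form N) : ℝ≥0∞ :=
  ∑ I, ∫⁻ x, ‖x‖ₑ ^ k * ‖α I x‖ₑ ∂halfMeasure N

/-- `∫ α_I(x) dx = 0` for all `I`. -/
def ZerothMomentsVanish {N : ℕ} (α : Form N) : Prop := ∀ I, ∫ x, α I x ∂halfMeasure N = 0

/-- `∫ x_i α_I(x) dx = 0` for all `I` and `i`. -/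
def FirstMomentsVanish {N : ℕ} (α : Form N) : Prop :=
  ∀ I, ∀ i : Fin (N + 1), ∫ x, (x i : ℂ) * α I x ∂halfMeasure N = 0

/-- The moment conditions: none if `N ≥ 4`, the zeroth moments vanish if `N ≤ 3`, and the first
moments vanish as well if `N ≤ 1`. -/
def MomentCond {N : ℕ} (α : Form N) : Prop :=
  (N ≤ 3 → ZerothMomentsVanish α) ∧ (N ≤ 1 → FirstMomentsVanish α)

/-- `α` vanishes almost everywhere outside the ball `{|x| < R}`. -/
def SupportedIn {N : ℕ} (R : ℝ) (α : Form N) : Prop :=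
  ∀ I, ∀ᵐ x ∂halfMeasure N, R ≤ ‖x‖ → α I x = 0

/-- For every `q`-form `α` in `W^s` that satisfies `adm`, the boundary value problem has a unique
solution `φ`, given by the explicit formulas, and `‖φ‖_{s+2} ≤ c (‖α‖_s + size α)`.
For `s < 1` the condition `dφ ∈ dom d*` has to be read as the boundary condition that it amounts to
on smooth forms, because `d* dφ` need not be in `W¹`; for `s ≥ 1` it holds literally. -/
def WellPosed (N q : ℕ) (s : ℝ) (adm : Form N → Prop) (size : Form N → ℝ≥0∞) : Prop :=
  ∃ c : ℝ≥0, ∀ α : Form N, IsQForm q α → (∀ I, MemSob s (α I)) → adm α →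
    ∃ φ : Form N,
      IsSolution q s α φ ∧
      MemDomAdjoint φ ∧
      (1 ≤ s → IsHilbertSolution q s α φ) ∧
      (∀ φ' : Form N, IsSolution q s α φ' ∨ IsHilbertSolution q s α φ' →
        ∀ I, φ' I =ᵐ[halfMeasure N] φ I) ∧
      eSobolevNormForm (s + 2) φ ≤ c * (eSobolevNormForm s α + size α) ∧
      IsExplicit α φ

end HalfSpaceHodge

end

/-!
The idea is to take the Fourier transform in all variables of an extension to the whole space, and
to reduce the boundary value problem to ordinary differential equations on the half line, one for
almost every tangential frequency `ξ'` and every coefficient.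

A function `u` on the half space is described by a *symbol* `V` (`HasSymbol`): the Fourier transform
of an `L²` extension of `u` for which `∫ (1 + |2πξ|²)^t |V(ξ)|² dξ` is finite. Then `u` is in `W^t`,
weak derivatives multiply the symbol by `2πi ξ_j`, and the tangential Fourier transform of `u` is
`part V`, the inverse Fourier transform of `V` in the variable `ξ_0` alone. If `t > 1/2`, almost every
line `ξ_0 ↦ V(ξ_0, ξ')` is integrable, hence `part V` is continuous in `x_0` and its value at `0` is
the Fourier transform of the trace (`HasSymbol.exists_trace`).

In `Gφ` the terms with tangential derivatives cancel, so that the problem decouples into the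
coefficients with `0 ∈ I` and those with `0 ∉ I` (`eqn_and_bdry_iff`). On the fibre over `ξ'` it reads
`-w'' + λ² w = f̂ + c e^{-μ x_0}`, where `c` is a multiple of `w(0)` or of `w'(0)`, together with
`w'(0) = 0` or `w''(0) = 0` (`FiberSol`). Bounded solutions of the homogeneous problem vanish because
`λ < μ` (`eq_zero_of_homogeneous`), and this gives uniqueness.

For existence, `P = 𝓕(1_{x_0 > 0} f) / |2πξ|²` is the symbol of the Newton potential of `f`. The moment
conditions make `𝓕(1_{x_0 > 0} f)` vanish at `0` to the order that renders `P` square integrable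
near `0` (`symInt_potSym_le`). The explicit solution is a combination of the potential, its
reflection, and the exponentials `e^{-λ x_0}` and `e^{-μ x_0}`, which provides a symbol of exponent
`min s 1` (`hasExtSymbol_base`). The differential equation then raises the exponent: since
`(μ² - ∂_0²) w = w + f̂ + c e^{-μ x_0}`, a symbol of exponent `t ≤ s` can be divided by `μ² + (2πξ_0)²`
and corrected by a multiple of the symbol of `e^{-μ x_0}`, to yield one of exponent `t + 2`
(`hasExtSymbol_add_two`).

For the domain of the adjoint, `⟨du, ψ⟩_1` contains second derivatives of `u`. One derivative can be
moved to `ψ` by integration by parts in a tangential direction, except in the term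
`∫ D_0 D_0 u_J conj(D_0 ψ_{0J})`, which has no boundary term exactly if `D_0 ψ_{0J}` has zero trace
(`memDomAdjoint_of_boundaryCond`). Conversely, the functions `u = ε b(x_0/ε) w(x')` with `b'(0) = 1` tend
to zero in `W¹` while that term tends to a pairing of `w` with the trace
(`boundaryCond_of_memDomAdjoint`).
-/

noncomputable section

open scoped SchwartzMap

namespace HalfSpaceHodge

/-! ### The Fourier transform on `L¹ ∩ L²` -/

section FourierL1L2

variable {E : Type*} [NormedAddCommGroup E] [InnerProductSpace ℝ E] [FiniteDimensional ℝ E]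
  [MeasurableSpace E] [BorelSpace E]

lemma integral_schwartz_mul_fourier (F : Lp ℂ 2 (volume : Measure E)) (g : 𝓢(E, ℂ)) :
    ∫ x, g x * (𝓕 F : Lp ℂ 2 (volume : Measure E)) x = ∫ x, (𝓕 g) x * F x := by
  have h := congrArg (fun T => T g) (Lp.fourier_toTemperedDistribution_eq F)
  simpa [TemperedDistribution.fourier_apply, Lp.toTemperedDistribution_apply] using h.symm

lemma integral_schwartz_mul_fourierInv (F : Lp ℂ 2 (volume : Measure E)) (g : 𝓢(E, ℂ)) :
    ∫ x, g x * (𝓕⁻ F : Lp ℂ 2 (volume : Measure E)) x = ∫ x, (𝓕⁻ g) x * F x := by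
  have h := congrArg (fun T => T g) (Lp.fourierInv_toTemperedDistribution_eq F)
  simpa [TemperedDistribution.fourierInv_apply, Lp.toTemperedDistribution_apply] using h.symm

lemma locallyIntegrable_of_memLp_two {f : E → ℂ} (h : MemLp f 2) : LocallyIntegrable f :=
  h.locallyIntegrable (by norm_num)

/-- On `L¹ ∩ L²` the `L²` Fourier transform is given by the Fourier integral. -/
lemma fourier_toLp_ae_eq {f : E → ℂ} (h2 : MemLp f 2) (h1 : Integrable f) :
    (𝓕 (h2.toLp f) : Lp ℂ 2 (volume : Measure E)) =ᵐ[volume] 𝓕 f := by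
  have hc : Continuous (𝓕 f) :=
    VectorFourier.fourierIntegral_continuous Real.continuous_fourierChar
      (by exact continuous_inner) h1
  refine ae_eq_of_integral_contDiff_smul_eq
    (locallyIntegrable_of_memLp_two (Lp.memLp _)) hc.locallyIntegrable ?_
  intro g hg hgs
  set gs : 𝓢(E, ℂ) := HasCompactSupport.toSchwartzMap (f := fun x => (g x : ℂ))
    (hgs.comp_left Complex.ofReal_zero) (Complex.ofRealCLM.contDiff.comp hg)
  have e1 := integral_schwartz_mul_fourier (h2.toLp f) gs
  have hgi : Integrable (gs : E → ℂ) := gs.integrable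
  have e2 := VectorFourier.integral_fourierIntegral_smul_eq_flip (μ := (volume : Measure E))
    (ν := (volume : Measure E)) (L := innerₗ E) (f := (gs : E → ℂ)) (g := f)
    Real.continuous_fourierChar (by exact continuous_inner) hgi h1
  have e3 : ∫ x, (𝓕 gs) x * (h2.toLp f) x = ∫ x, (𝓕 gs) x * f x := by
    refine integral_congr_ae ?_
    filter_upwards [h2.coeFn_toLp] with x hx
    rw [hx]
  have e4 : ∫ x, gs x * (𝓕 f) x = ∫ x, (𝓕 gs) x * f x := by
    rw [flip_innerₗ] at e2
    exact e2.symm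
  have : ∫ x, (g x : ℂ) * (𝓕 (h2.toLp f : Lp ℂ 2 (volume : Measure E)) : Lp ℂ 2 (volume : Measure E)) x = ∫ x, (g x : ℂ) * (𝓕 f) x := by
    exact e1.trans (e3.trans e4.symm)
  simpa using this

/-- On `L¹ ∩ L²` the inverse `L²` Fourier transform is given by the inverse Fourier integral. -/
lemma fourierInv_toLp_ae_eq {f : E → ℂ} (h2 : MemLp f 2) (h1 : Integrable f) :
    (𝓕⁻ (h2.toLp f) : Lp ℂ 2 (volume : Measure E)) =ᵐ[volume] 𝓕⁻ f := by
  have hmp : MeasurePreserving (fun x : E => -x) volume volume :=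
    Measure.measurePreserving_neg volume
  have h2' : MemLp (fun x => f (-x)) 2 := h2.comp_measurePreserving hmp
  have h1' : Integrable (fun x => f (-x)) := h1.comp_neg
  have hc : Continuous (𝓕 fun x => f (-x)) :=
    VectorFourier.fourierIntegral_continuous Real.continuous_fourierChar
      (by exact continuous_inner) h1'
  rw [Real.fourierInv_eq_fourier_comp_neg]
  refine ae_eq_of_integral_contDiff_smul_eq
    (locallyIntegrable_of_memLp_two (Lp.memLp _)) hc.locallyIntegrable ?_
  intro g hg hgs
  set gs : 𝓢(E, ℂ) := HasCompactSupport.toSchwartzMap (f := fun x => (g x : ℂ))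
    (hgs.comp_left Complex.ofReal_zero) (Complex.ofRealCLM.contDiff.comp hg)
  have e1 := integral_schwartz_mul_fourierInv (h2.toLp f) gs
  have hgi : Integrable (gs : E → ℂ) := gs.integrable
  have e2 := VectorFourier.integral_fourierIntegral_smul_eq_flip (μ := (volume : Measure E))
    (ν := (volume : Measure E)) (L := innerₗ E) (f := (gs : E → ℂ)) (g := fun x => f (-x))
    Real.continuous_fourierChar (by exact continuous_inner) hgi h1'
  have e3 : ∫ x, (𝓕⁻ gs) x * (h2.toLp f) x = ∫ x, (𝓕 gs) x * f (-x) := by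
    rw [← integral_neg_eq_self]
    refine integral_congr_ae ?_
    filter_upwards [hmp.quasiMeasurePreserving.ae h2.coeFn_toLp] with x hx
    rw [hx, SchwartzMap.fourierInv_apply_eq]
    simp [SchwartzMap.fourier_coe]
  have e4 : ∫ x, gs x * (𝓕 fun x => f (-x)) x = ∫ x, (𝓕 gs) x * f (-x) := by
    rw [flip_innerₗ] at e2
    exact e2.symm
  have : ∫ x, (g x : ℂ) * (𝓕⁻ (h2.toLp f : Lp ℂ 2 (volume : Measure E)) : Lp ℂ 2 (volume : Measure E)) x
      = ∫ x, (g x : ℂ) * (𝓕 fun x => f (-x)) x := by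
    exact e1.trans (e3.trans e4.symm)
  simpa using this

/-- Plancherel's theorem as an identity of integrals. -/
lemma lintegral_fourier_Lp (F : Lp ℂ 2 (volume : Measure E)) :
    ∫⁻ x, ‖(𝓕 F : Lp ℂ 2 (volume : Measure E)) x‖ₑ ^ 2 = ∫⁻ x, ‖F x‖ₑ ^ 2 := by
  have key : ∀ G : Lp ℂ 2 (volume : Measure E), ∫⁻ x, ‖G x‖ₑ ^ 2 = ‖G‖ₑ ^ 2 := by
    intro G
    rw [Lp.enorm_def, eLpNorm_eq_lintegral_rpow_enorm_toReal (by norm_num) (by norm_num)]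
    simp only [ENNReal.toReal_ofNat, ENNReal.rpow_ofNat]
    rw [← ENNReal.rpow_natCast, ← ENNReal.rpow_mul]
    norm_num
  rw [key, key]
  congr 1
  rw [← ofReal_norm, ← ofReal_norm, Lp.norm_fourier_eq]

lemma lintegral_fourier_of_integrable {f : E → ℂ} (h2 : MemLp f 2) (h1 : Integrable f) :
    ∫⁻ x, ‖𝓕 f x‖ₑ ^ 2 = ∫⁻ x, ‖f x‖ₑ ^ 2 := by
  obtain ⟨G, hG⟩ : ∃ G : Lp ℂ 2 (volume : Measure E), G = h2.toLp f := ⟨_, rfl⟩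
  have h0 := fourier_toLp_ae_eq h2 h1
  have h0' := h2.coeFn_toLp
  rw [← hG] at h0 h0'
  have h := lintegral_fourier_Lp G
  have e1 : ∫⁻ x, ‖G x‖ₑ ^ 2 = ∫⁻ x, ‖f x‖ₑ ^ 2 := by
    refine lintegral_congr_ae ?_
    filter_upwards [h0'] with x hx
    rw [hx]
  have e2 : ∫⁻ x, ‖(𝓕 G : Lp ℂ 2 (volume : Measure E)) x‖ₑ ^ 2 = ∫⁻ x, ‖𝓕 f x‖ₑ ^ 2 := by
    refine lintegral_congr_ae ?_
    filter_upwards [h0] with x hx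
    rw [hx]
  rw [← e1, ← e2, h]

end FourierL1L2

/-! ### Coordinates `(x_0, x')` -/

section Coordinates

variable {N : ℕ}

@[simp] lemma glue_zero (x₀ : ℝ) (x' : Bdry N) : glue x₀ x' 0 = x₀ := rfl

@[simp] lemma glue_succ (x₀ : ℝ) (x' : Bdry N) (i : Fin N) : glue x₀ x' i.succ = x' i := rfl

@[simp] lemma tang_apply (x : Amb N) (i : Fin N) : tang x i = x i.succ := rfl

@[simp] lemma tang_glue (x₀ : ℝ) (x' : Bdry N) : tang (glue x₀ x') = x' := by
  ext i; rfl

@[simp] lemma glue_tang (x : Amb N) : glue (x 0) (tang x) = x := by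
  ext i
  refine Fin.cases rfl (fun i => rfl) i

lemma inner_glue (x₀ y₀ : ℝ) (x' y' : Bdry N) :
    inner ℝ (glue x₀ x') (glue y₀ y') = x₀ * y₀ + inner ℝ x' y' := by
  simp only [PiLp.inner_apply, Fin.sum_univ_succ, glue_zero, glue_succ]
  simp [mul_comm]

lemma norm_glue_sq (x₀ : ℝ) (x' : Bdry N) : ‖glue x₀ x'‖ ^ 2 = x₀ ^ 2 + ‖x'‖ ^ 2 := by
  rw [← real_inner_self_eq_norm_sq, inner_glue, real_inner_self_eq_norm_sq]; ring

lemma measurable_tang : Measurable (tang : Amb N → Bdry N) := by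
  unfold tang; fun_prop

lemma continuous_tang : Continuous (tang : Amb N → Bdry N) := by
  unfold tang; fun_prop

lemma continuous_glue : Continuous (fun p : ℝ × Bdry N => glue p.1 p.2) := by
  have : Continuous (fun p : ℝ × Bdry N => (Fin.cons p.1 (fun i => p.2 i) : Fin (N + 1) → ℝ)) := by
    refine continuous_pi (fun i => ?_)
    refine Fin.cases ?_ (fun i => ?_) i
    · simpa using continuous_fst
    · simp only [Fin.cons_succ]; fun_prop
  unfold glue
  fun_prop

lemma measurable_glue : Measurable (fun p : ℝ × Bdry N => glue p.1 p.2) :=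
  continuous_glue.measurable

/-- `(x_0, x') ↦ x` as a measurable equivalence. -/
def glueEquiv (N : ℕ) : ℝ × Bdry N ≃ᵐ Amb N where
  toFun p := glue p.1 p.2
  invFun x := (x 0, tang x)
  left_inv p := by simp
  right_inv x := by simp
  measurable_toFun := measurable_glue
  measurable_invFun := by
    refine Measurable.prodMk ?_ measurable_tang
    fun_prop

lemma measurePreserving_glue :
    MeasurePreserving (glueEquiv N) ((volume : Measure ℝ).prod (volume : Measure (Bdry N)))
      (volume : Measure (Amb N)) := by
  have h1 : MeasurePreserving (MeasurableEquiv.piFinSuccAbove (fun _ : Fin (N + 1) => ℝ) 0).symm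
      volume volume :=
    (volume_preserving_piFinSuccAbove (fun _ : Fin (N + 1) => ℝ) 0).symm _
  have h2 := PiLp.volume_preserving_toLp (Fin (N + 1))
  have h3 : MeasurePreserving (Prod.map id WithLp.ofLp : ℝ × Bdry N → ℝ × (Fin N → ℝ))
      (volume.prod volume) (volume.prod volume) :=
    (MeasurePreserving.id volume).prod (PiLp.volume_preserving_ofLp (Fin N))
  have h := h2.comp (h1.comp h3)
  have he : ⇑(glueEquiv N) = WithLp.toLp 2 ∘ (MeasurableEquiv.piFinSuccAbove
      (fun _ : Fin (N + 1) => ℝ) 0).symm ∘ Prod.map id WithLp.ofLp := by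
    funext p
    ext i
    refine Fin.cases ?_ (fun i => ?_) i <;> simp [glueEquiv, MeasurableEquiv.piFinSuccAbove]
  rw [he]
  exact h

/-- The half measure is the product of Lebesgue measure on `(0, ∞)` and on `ℝ^N`. -/
lemma measurePreserving_glue_half :
    MeasurePreserving (glueEquiv N)
      ((volume.restrict (Set.Ioi (0 : ℝ))).prod (volume : Measure (Bdry N))) (halfMeasure N) := by
  have h := measurePreserving_glue (N := N)
  have h2 := h.restrict_preimage_emb (glueEquiv N).measurableEmbedding (halfSpace N)
  have : (glueEquiv N) ⁻¹' (halfSpace N) = Set.Ioi (0 : ℝ) ×ˢ Set.univ := by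
    ext p; simp [glueEquiv, halfSpace]
  rw [this, ← Measure.prod_restrict, Measure.restrict_univ] at h2
  exact h2

lemma isOpen_halfSpace : IsOpen (halfSpace N) :=
  isOpen_lt continuous_const (by fun_prop)

lemma measurableSet_halfSpace : MeasurableSet (halfSpace N) := isOpen_halfSpace.measurableSet

lemma lintegral_glue {g : Amb N → ℝ≥0∞} (hg : AEMeasurable g) :
    ∫⁻ x, g x = ∫⁻ x₀, ∫⁻ x', g (glue x₀ x') := by
  rw [← measurePreserving_glue.lintegral_comp_emb (glueEquiv N).measurableEmbedding]
  exact lintegral_prod _ (hg.comp_quasiMeasurePreserving measurePreserving_glue.quasiMeasurePreserving)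

lemma lintegral_glue' {g : Amb N → ℝ≥0∞} (hg : AEMeasurable g) :
    ∫⁻ x, g x = ∫⁻ x', ∫⁻ x₀, g (glue x₀ x') := by
  rw [← measurePreserving_glue.lintegral_comp_emb (glueEquiv N).measurableEmbedding]
  exact lintegral_prod_symm _ (hg.comp_quasiMeasurePreserving measurePreserving_glue.quasiMeasurePreserving)

lemma ae_half_glue {p : Amb N → Prop} (h : ∀ᵐ x ∂halfMeasure N, p x) :
    ∀ᵐ x₀ ∂(volume.restrict (Set.Ioi (0 : ℝ))), ∀ᵐ x' : Bdry N, p (glue x₀ x') :=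
  Measure.ae_ae_of_ae_prod (measurePreserving_glue_half.quasiMeasurePreserving.ae h)

lemma ae_half_of_ae_ae {p : Amb N → Prop} (hp : NullMeasurableSet {x | p x} (halfMeasure N))
    (h : ∀ᵐ x₀ ∂(volume.restrict (Set.Ioi (0 : ℝ))), ∀ᵐ x' : Bdry N, p (glue x₀ x')) :
    ∀ᵐ x ∂halfMeasure N, p x := by
  obtain ⟨S, hS1, hS2, hS3⟩ := hp.exists_measurable_subset_ae_eq
  have hpS : ∀ᵐ x ∂halfMeasure N, p x ↔ x ∈ S := by
    filter_upwards [hS3] with x hx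
    exact (iff_of_eq hx).symm
  have hS' := ae_half_glue hpS
  have hSm : MeasurableSet ((glueEquiv N) ⁻¹' S) := (glueEquiv N).measurable hS2
  have : ∀ᵐ z ∂((volume.restrict (Set.Ioi (0 : ℝ))).prod (volume : Measure (Bdry N))),
      (glueEquiv N) z ∈ S := by
    rw [Measure.ae_prod_iff_ae_ae hSm]
    filter_upwards [h, hS'] with x₀ h1 h2
    filter_upwards [h1, h2] with x' h3 h4
    exact h4.1 h3
  have : ∀ᵐ x ∂halfMeasure N, x ∈ S := by
    rw [← measurePreserving_glue_half.map_eq]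
    rwa [(glueEquiv N).measurableEmbedding.ae_map_iff]
  filter_upwards [this, hpS] with x h1 h2
  exact h2.2 h1

lemma ae_half_eq_of_slices {u v : Amb N → ℂ} (hu : AEStronglyMeasurable u (halfMeasure N))
    (hv : AEStronglyMeasurable v (halfMeasure N))
    (h : ∀ᵐ x₀ ∂(volume.restrict (Set.Ioi (0 : ℝ))),
      (fun x' : Bdry N => u (glue x₀ x')) =ᵐ[volume] fun x' => v (glue x₀ x')) :
    u =ᵐ[halfMeasure N] v :=
  ae_half_of_ae_ae (nullMeasurableSet_eq_fun hu.aemeasurable hv.aemeasurable) h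

/-- Swapping two almost-everywhere quantifiers on `(0, ∞) × ℝ^N`. -/
lemma ae_half_swap {p : ℝ → Bdry N → Prop}
    (hp : NullMeasurableSet {x : Amb N | p (x 0) (tang x)} (halfMeasure N))
    (h : ∀ᵐ x₀ ∂(volume.restrict (Set.Ioi (0 : ℝ))), ∀ᵐ x' : Bdry N, p x₀ x') :
    ∀ᵐ x' : Bdry N, ∀ᵐ x₀ ∂(volume.restrict (Set.Ioi (0 : ℝ))), p x₀ x' := by
  have h0 := ae_half_of_ae_ae hp (by simpa using h)
  have h1 := (measurePreserving_glue_half (N := N)).quasiMeasurePreserving.ae h0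
  have h2 := Measure.ae_ae_of_ae_prod
    ((Measure.measurePreserving_swap (μ := (volume : Measure (Bdry N)))
      (ν := (volume.restrict (Set.Ioi (0 : ℝ))))).quasiMeasurePreserving.ae h1)
  simpa [glueEquiv] using h2

lemma integrable_glue {f : Amb N → ℂ} (hf : Integrable f) :
    Integrable (fun p : ℝ × Bdry N => f (glue p.1 p.2)) (volume.prod volume) :=
  measurePreserving_glue.integrable_comp_of_integrable hf

lemma integral_glue {f : Amb N → ℂ} (hf : Integrable f) :
    ∫ x, f x = ∫ x₀, ∫ x', f (glue x₀ x') := by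
  rw [← measurePreserving_glue.integral_comp (glueEquiv N).measurableEmbedding]
  exact integral_prod _ (integrable_glue hf)

lemma integral_glue' {f : Amb N → ℂ} (hf : Integrable f) :
    ∫ x, f x = ∫ x', ∫ x₀, f (glue x₀ x') := by
  rw [← measurePreserving_glue.integral_comp (glueEquiv N).measurableEmbedding]
  exact integral_prod_symm _ (integrable_glue hf)

end Coordinates

/-! ### `L²` norms as lower integrals -/

section LTwo

variable {X : Type*} [MeasurableSpace X] {m : Measure X}

lemma eLpNorm_two_sq (f : X → ℂ) : eLpNorm f 2 m ^ 2 = ∫⁻ x, ‖f x‖ₑ ^ 2 ∂m := by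
  rw [eLpNorm_eq_lintegral_rpow_enorm_toReal (by norm_num) (by norm_num)]
  simp only [ENNReal.toReal_ofNat, ENNReal.rpow_ofNat]
  rw [← ENNReal.rpow_natCast, ← ENNReal.rpow_mul]
  norm_num

lemma memLp_two_iff {f : X → ℂ} (hf : AEStronglyMeasurable f m) :
    MemLp f 2 m ↔ ∫⁻ x, ‖f x‖ₑ ^ 2 ∂m < ⊤ := by
  rw [← eLpNorm_two_sq, MemLp, ENNReal.pow_lt_top_iff]
  simp [hf]

lemma MemLp.lintegral_sq_lt_top {f : X → ℂ} (hf : MemLp f 2 m) : ∫⁻ x, ‖f x‖ₑ ^ 2 ∂m < ⊤ :=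
  (memLp_two_iff hf.1).1 hf

lemma enorm_sq_Lp (F : Lp ℂ 2 m) : ‖F‖ₑ ^ 2 = ∫⁻ x, ‖F x‖ₑ ^ 2 ∂m := by
  rw [Lp.enorm_def, eLpNorm_two_sq]

/-- The Cauchy–Schwarz inequality with a weight `w` and its inverse `v`. -/
lemma lintegral_sq_le_of_weight {g : X → ℝ≥0∞} {w v : X → ℝ≥0∞} (hg : AEMeasurable g m)
    (hw : AEMeasurable w m) (hv : AEMeasurable v m) (hvw : ∀ x, 1 ≤ v x * w x) :
    (∫⁻ x, g x ∂m) ^ 2 ≤ (∫⁻ x, v x ∂m) * ∫⁻ x, w x * g x ^ 2 ∂m := by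
  have h := ENNReal.lintegral_mul_le_Lp_mul_Lq m (p := 2) (q := 2) Real.HolderConjugate.two_two
    (f := fun x => v x ^ (1 / 2 : ℝ)) (g := fun x => w x ^ (1 / 2 : ℝ) * g x)
    (hv.pow_const _) ((hw.pow_const _).mul hg)
  have hsq : ∀ a : ℝ≥0∞, (a ^ (1 / 2 : ℝ)) ^ (2 : ℝ) = a := fun a => by
    rw [← ENNReal.rpow_mul]; norm_num
  have hsq' : ∀ a : ℝ≥0∞, (a ^ (1 / 2 : ℝ)) ^ 2 = a := fun a => by
    rw [← ENNReal.rpow_natCast, ← ENNReal.rpow_mul]; norm_num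
  have h1 : ∫⁻ x, g x ∂m ≤
      ∫⁻ x, ((fun x => v x ^ (1 / 2 : ℝ)) * fun x => w x ^ (1 / 2 : ℝ) * g x) x ∂m := by
    refine lintegral_mono fun x => ?_
    simp only [Pi.mul_apply]
    rw [← mul_assoc, ← ENNReal.mul_rpow_of_nonneg _ _ (by norm_num)]
    calc g x = 1 * g x := (one_mul _).symm
      _ ≤ _ := by
        gcongr
        exact ENNReal.one_le_rpow (hvw x) (by norm_num)
  have h2 : ∀ x, (w x ^ (1 / 2 : ℝ) * g x) ^ (2 : ℝ) = w x * g x ^ 2 := fun x => by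
    rw [ENNReal.mul_rpow_of_nonneg _ _ (by norm_num), hsq]; norm_num
  simp only [hsq, h2] at h
  calc (∫⁻ x, g x ∂m) ^ 2 ≤ ((∫⁻ x, v x ∂m) ^ (1 / 2 : ℝ) *
        (∫⁻ x, w x * g x ^ 2 ∂m) ^ (1 / 2 : ℝ)) ^ 2 := by gcongr; exact h1.trans h
    _ = _ := by rw [mul_pow, hsq', hsq']

end LTwo

/-! ### Weighted `L²` norms of symbols -/

/-- The weighted norm `∫ (κ² + (2πτ)²)^t |g(τ)|² dτ` on a line. -/
def lineInt (t κ : ℝ) (g : ℝ → ℂ) : ℝ≥0∞ :=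
  ∫⁻ τ, ENNReal.ofReal ((κ ^ 2 + (2 * Real.pi * τ) ^ 2) ^ t) * ‖g τ‖ₑ ^ 2

/-- The weight `1 + |2πξ|²`. -/
def symWt {N : ℕ} (ξ : Amb N) : ℝ := 1 + (2 * Real.pi * ‖ξ‖) ^ 2

/-- The squared Sobolev norm `∫ (1 + |2πξ|²)^t |V(ξ)|² dξ` of the function with Fourier
transform `V`. -/
def symInt {N : ℕ} (t : ℝ) (V : Amb N → ℂ) : ℝ≥0∞ :=
  ∫⁻ ξ, ENNReal.ofReal (symWt ξ ^ t) * ‖V ξ‖ₑ ^ 2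

/-- The inverse Fourier transform of `V` in the variable `ξ_0` only. -/
def part {N : ℕ} (V : Amb N → ℂ) (x : ℝ) (ξ : Bdry N) : ℂ := 𝓕⁻ (fun τ : ℝ => V (glue τ ξ)) x

/-- `∫ (1 + (2πτ)²)^{-p} dτ`. -/
def wtConst (p : ℝ) : ℝ := ∫ τ : ℝ, (1 + (2 * Real.pi * τ) ^ 2) ^ (-p)

section Weights

variable {N : ℕ}

lemma mu_sq (ξ : Bdry N) : mu ξ ^ 2 = 1 + lam ξ ^ 2 := by
  unfold mu; rw [Real.sq_sqrt (by positivity)]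

lemma lam_nonneg (ξ : Bdry N) : 0 ≤ lam ξ := by unfold lam; positivity

lemma one_le_mu (ξ : Bdry N) : 1 ≤ mu ξ := by
  unfold mu; rw [Real.one_le_sqrt]; nlinarith [sq_nonneg (lam ξ)]

lemma mu_pos (ξ : Bdry N) : 0 < mu ξ := lt_of_lt_of_le one_pos (one_le_mu ξ)

lemma lam_lt_mu (ξ : Bdry N) : lam ξ < mu ξ := by
  have := mu_sq ξ
  nlinarith [lam_nonneg ξ, mu_pos ξ]

lemma symWt_glue (τ : ℝ) (ξ : Bdry N) : symWt (glue τ ξ) = mu ξ ^ 2 + (2 * Real.pi * τ) ^ 2 := by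
  rw [mu_sq, symWt, mul_pow, norm_glue_sq, lam]; ring

lemma one_le_symWt (ξ : Amb N) : 1 ≤ symWt ξ := by unfold symWt; nlinarith [sq_nonneg (2 * Real.pi * ‖ξ‖)]

lemma symWt_pos (ξ : Amb N) : 0 < symWt ξ := lt_of_lt_of_le one_pos (one_le_symWt ξ)

lemma continuous_symWt : Continuous (symWt : Amb N → ℝ) := by unfold symWt; fun_prop

lemma measurable_symWt : Measurable (symWt : Amb N → ℝ) := continuous_symWt.measurable

lemma continuous_lam : Continuous (lam : Bdry N → ℝ) := by unfold lam; fun_prop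

lemma continuous_mu : Continuous (mu : Bdry N → ℝ) := by
  unfold mu; exact Real.continuous_sqrt.comp (continuous_const.add (continuous_lam.pow 2))

lemma measurable_lam : Measurable (lam : Bdry N → ℝ) := continuous_lam.measurable

lemma measurable_mu : Measurable (mu : Bdry N → ℝ) := continuous_mu.measurable

lemma measurable_comp_glue {V : Amb N → ℂ} (hV : Measurable V) (ξ : Bdry N) :
    Measurable fun τ : ℝ => V (glue τ ξ) :=
  hV.comp (measurable_glue.comp (measurable_id.prodMk measurable_const))

lemma measurable_symInt_integrand (t : ℝ) {V : Amb N → ℂ} (hV : Measurable V) :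
    Measurable fun ξ => ENNReal.ofReal (symWt ξ ^ t) * ‖V ξ‖ₑ ^ 2 :=
  ((measurable_symWt.pow_const t).ennreal_ofReal).mul (hV.enorm.pow_const 2)

lemma symInt_eq (t : ℝ) {V : Amb N → ℂ} (hV : Measurable V) :
    symInt t V = ∫⁻ ξ, lineInt t (mu ξ) fun τ => V (glue τ ξ) := by
  unfold symInt
  rw [lintegral_glue' (measurable_symInt_integrand t hV).aemeasurable]
  simp_rw [symWt_glue]
  rfl

lemma measurable_lineInt (t : ℝ) {V : Amb N → ℂ} (hV : Measurable V) :
    Measurable fun ξ => lineInt t (mu ξ) fun τ => V (glue τ ξ) := by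
  have h : Measurable (Function.uncurry fun (ξ : Bdry N) (τ : ℝ) =>
      ENNReal.ofReal (symWt (glue τ ξ) ^ t) * ‖V (glue τ ξ)‖ₑ ^ 2) :=
    (measurable_symInt_integrand t hV).comp (measurable_glue.comp measurable_swap)
  have h2 := Measurable.lintegral_prod_right' (ν := (volume : Measure ℝ)) h
  simpa [Function.uncurry, symWt_glue, lineInt] using h2

lemma ae_lineInt_lt_top {t : ℝ} {V : Amb N → ℂ} (hV : Measurable V) (h : symInt t V < ⊤) :
    ∀ᵐ ξ, lineInt t (mu ξ) (fun τ => V (glue τ ξ)) < ⊤ := by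
  rw [symInt_eq t hV] at h
  exact ae_lt_top (measurable_lineInt t hV) h.ne

lemma symInt_mono {t t' : ℝ} (h : t ≤ t') (V : Amb N → ℂ) : symInt t V ≤ symInt t' V := by
  unfold symInt
  gcongr with ξ
  exact one_le_symWt ξ

lemma lineInt_mono {t t' κ : ℝ} (hκ : 1 ≤ κ) (h : t ≤ t') (g : ℝ → ℂ) :
    lineInt t κ g ≤ lineInt t' κ g := by
  unfold lineInt
  gcongr with τ
  nlinarith [sq_nonneg (2 * Real.pi * τ)]

lemma symInt_zero_left (V : Amb N → ℂ) : symInt 0 V = ∫⁻ ξ, ‖V ξ‖ₑ ^ 2 := by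
  simp [symInt]

lemma memLp_of_symInt {t : ℝ} (ht : 0 ≤ t) {V : Amb N → ℂ} (hV : Measurable V)
    (h : symInt t V < ⊤) : MemLp V 2 := by
  rw [memLp_two_iff hV.aestronglyMeasurable, ← symInt_zero_left]
  exact (symInt_mono ht V).trans_lt h

lemma integrable_wt {p : ℝ} (hp : 1 / 2 < p) :
    Integrable fun τ : ℝ => (1 + (2 * Real.pi * τ) ^ 2) ^ (-p) := by
  have h := integrable_rpow_neg_one_add_norm_sq (E := ℝ) (μ := volume) (r := 2 * p)
    (by simp; linarith)
  have h2 := h.comp_mul_left' (R := 2 * Real.pi) (by positivity)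
  refine h2.congr (Eventually.of_forall fun τ => ?_)
  simp only [Real.norm_eq_abs, sq_abs]
  congr 1; ring

lemma wtConst_nonneg (p : ℝ) : 0 ≤ wtConst p := integral_nonneg fun τ => by positivity

lemma rpow_weight_scale {κ : ℝ} (hκ : 0 < κ) (p τ : ℝ) :
    (κ ^ 2 + (2 * Real.pi * τ) ^ 2) ^ (-p)
      = κ ^ (-2 * p) * (1 + (2 * Real.pi * (κ⁻¹ * τ)) ^ 2) ^ (-p) := by
  have : κ ^ 2 + (2 * Real.pi * τ) ^ 2 = κ ^ 2 * (1 + (2 * Real.pi * (κ⁻¹ * τ)) ^ 2) := by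
    field_simp
  rw [this, Real.mul_rpow (by positivity) (by positivity), ← Real.rpow_natCast, ← Real.rpow_mul hκ.le]
  norm_num

lemma integrable_wt' {p κ : ℝ} (hp : 1 / 2 < p) (hκ : 0 < κ) :
    Integrable fun τ : ℝ => (κ ^ 2 + (2 * Real.pi * τ) ^ 2) ^ (-p) := by
  simp_rw [rpow_weight_scale hκ p]
  exact ((integrable_wt hp).comp_mul_left' (R := κ⁻¹) (by positivity)).const_mul _

lemma integral_wt {κ : ℝ} (p : ℝ) (hκ : 0 < κ) :
    ∫ τ : ℝ, (κ ^ 2 + (2 * Real.pi * τ) ^ 2) ^ (-p) = wtConst p * κ ^ (1 - 2 * p) := by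
  simp_rw [rpow_weight_scale hκ p]
  rw [integral_const_mul, Measure.integral_comp_mul_left
    (fun τ => (1 + (2 * Real.pi * τ) ^ 2) ^ (-p)) κ⁻¹]
  rw [inv_inv, abs_of_pos hκ, smul_eq_mul, ← wtConst, sub_eq_add_neg, Real.rpow_add hκ,
    Real.rpow_one]
  ring_nf

lemma lintegral_wt {p κ : ℝ} (hp : 1 / 2 < p) (hκ : 0 < κ) :
    ∫⁻ τ : ℝ, ENNReal.ofReal ((κ ^ 2 + (2 * Real.pi * τ) ^ 2) ^ (-p))
      = ENNReal.ofReal (wtConst p * κ ^ (1 - 2 * p)) := by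
  rw [← integral_wt p hκ, ofReal_integral_eq_lintegral_ofReal (integrable_wt' hp hκ)]
  exact Eventually.of_forall fun τ => by positivity

/-- The fibrewise Sobolev embedding: the `L¹` norm of `g` is controlled by its weighted `L²`
norm of exponent `t > 1/2`. -/
lemma lintegral_enorm_sq_le {t κ : ℝ} (ht : 1 / 2 < t) (hκ : 0 < κ) {g : ℝ → ℂ}
    (hg : Measurable g) :
    (∫⁻ τ, ‖g τ‖ₑ) ^ 2 ≤ ENNReal.ofReal (wtConst t * κ ^ (1 - 2 * t)) * lineInt t κ g := by
  rw [← lintegral_wt ht hκ]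
  refine lintegral_sq_le_of_weight hg.enorm.aemeasurable ?_ ?_ fun τ => ?_
  · exact Measurable.aemeasurable (by fun_prop)
  · exact Measurable.aemeasurable (by fun_prop)
  · have hp : 0 < κ ^ 2 + (2 * Real.pi * τ) ^ 2 := by positivity
    rw [← ENNReal.ofReal_mul (by positivity), ← Real.rpow_add hp]
    simp

lemma integrable_of_lineInt {t κ : ℝ} (ht : 1 / 2 < t) (hκ : 0 < κ) {g : ℝ → ℂ}
    (hg : Measurable g) (h : lineInt t κ g < ⊤) : Integrable g := by
  refine ⟨hg.aestronglyMeasurable, ?_⟩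
  have := (lintegral_enorm_sq_le ht hκ hg).trans_lt (ENNReal.mul_lt_top ENNReal.ofReal_lt_top h)
  rw [ENNReal.pow_lt_top_iff] at this
  simpa [HasFiniteIntegral] using this

lemma ae_integrable_line {t : ℝ} (ht : 1 / 2 < t) {V : Amb N → ℂ} (hV : Measurable V)
    (h : symInt t V < ⊤) : ∀ᵐ ξ, Integrable fun τ => V (glue τ ξ) := by
  filter_upwards [ae_lineInt_lt_top hV h] with ξ hξ
  exact integrable_of_lineInt ht (mu_pos ξ) (measurable_comp_glue hV ξ) hξ

/-- The trace estimate on the symbol side. -/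
lemma lintegral_weight_line_sq_le {t : ℝ} (ht : 1 / 2 < t) {V : Amb N → ℂ} (hV : Measurable V) :
    ∫⁻ ξ, ENNReal.ofReal (mu ξ ^ (2 * t - 1)) * (∫⁻ τ, ‖V (glue τ ξ)‖ₑ) ^ 2
      ≤ ENNReal.ofReal (wtConst t) * symInt t V := by
  rw [symInt_eq t hV, ← lintegral_const_mul _ (measurable_lineInt t hV)]
  refine lintegral_mono fun ξ => ?_
  calc _ ≤ ENNReal.ofReal (mu ξ ^ (2 * t - 1)) * (ENNReal.ofReal (wtConst t * mu ξ ^ (1 - 2 * t)) *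
        lineInt t (mu ξ) fun τ => V (glue τ ξ)) := by
        gcongr
        exact lintegral_enorm_sq_le ht (mu_pos ξ) (measurable_comp_glue hV ξ)
    _ = _ := by
        rw [← mul_assoc, ← ENNReal.ofReal_mul (by have := mu_pos ξ; positivity)]
        congr 2
        rw [mul_comm, mul_assoc, ← Real.rpow_add (mu_pos ξ)]
        simp

lemma enorm_part_le (V : Amb N → ℂ) (x : ℝ) (ξ : Bdry N) :
    ‖part V x ξ‖ₑ ≤ ∫⁻ τ, ‖V (glue τ ξ)‖ₑ := by
  unfold part
  rw [Real.fourierInv_eq']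
  refine (enorm_integral_le_lintegral_enorm _).trans (lintegral_mono fun τ => ?_)
  rw [enorm_smul]
  have : ‖Complex.exp (↑(2 * Real.pi * inner ℝ τ x) * Complex.I)‖ₑ = 1 := by
    rw [← ofReal_norm, Complex.norm_exp_ofReal_mul_I]; simp
  rw [this, one_mul]

lemma stronglyMeasurable_part {V : Amb N → ℂ} (hV : Measurable V) :
    StronglyMeasurable (fun p : ℝ × Bdry N => part V p.1 p.2) := by
  have h : Measurable (Function.uncurry fun (p : ℝ × Bdry N) (τ : ℝ) =>
      Complex.exp (↑(2 * Real.pi * inner ℝ τ p.1) * Complex.I) • V (glue τ p.2)) := by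
    have h1 : Measurable fun q : (ℝ × Bdry N) × ℝ => V (glue q.2 q.1.2) :=
      hV.comp (measurable_glue.comp (measurable_snd.prodMk (measurable_snd.comp measurable_fst)))
    have h2 : Measurable fun q : (ℝ × Bdry N) × ℝ =>
        Complex.exp (↑(2 * Real.pi * inner ℝ q.2 q.1.1) * Complex.I) := by
      apply Continuous.measurable
      fun_prop
    exact h2.smul h1
  have := h.stronglyMeasurable.integral_prod_right (ν := (volume : Measure ℝ))
  simpa only [part, Real.fourierInv_eq'] using this

lemma measurable_part {V : Amb N → ℂ} (hV : Measurable V) (x : ℝ) :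
    Measurable (part V x) := by
  have h : Measurable (Function.uncurry (part V)) := (stronglyMeasurable_part hV).measurable
  exact h.of_uncurry_left

lemma lintegral_part_sq_le {t : ℝ} (ht : 1 / 2 < t) {V : Amb N → ℂ} (hV : Measurable V) (x : ℝ) :
    ∫⁻ ξ, ENNReal.ofReal (mu ξ ^ (2 * t - 1)) * ‖part V x ξ‖ₑ ^ 2
      ≤ ENNReal.ofReal (wtConst t) * symInt t V := by
  refine le_trans (lintegral_mono fun ξ => ?_) (lintegral_weight_line_sq_le ht hV)
  gcongr
  exact enorm_part_le V x ξ

lemma one_le_mu_rpow {t : ℝ} (ht : 0 ≤ t) (ξ : Bdry N) : 1 ≤ ENNReal.ofReal (mu ξ ^ t) := by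
  rw [ENNReal.one_le_ofReal]
  exact Real.one_le_rpow (one_le_mu ξ) ht

lemma lintegral_part_sq_le' {t : ℝ} (ht : 1 / 2 < t) {V : Amb N → ℂ} (hV : Measurable V) (x : ℝ) :
    ∫⁻ ξ, ‖part V x ξ‖ₑ ^ 2 ≤ ENNReal.ofReal (wtConst t) * symInt t V := by
  refine le_trans (lintegral_mono fun ξ => ?_) (lintegral_part_sq_le ht hV x)
  exact le_mul_of_one_le_left zero_le (one_le_mu_rpow (by linarith) ξ)

lemma memLp_part {t : ℝ} (ht : 1 / 2 < t) {V : Amb N → ℂ} (hV : Measurable V)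
    (h : symInt t V < ⊤) (x : ℝ) : MemLp (part V x) 2 := by
  rw [memLp_two_iff (measurable_part hV x).aestronglyMeasurable]
  exact (lintegral_part_sq_le' ht hV x).trans_lt (ENNReal.mul_lt_top ENNReal.ofReal_lt_top h)

lemma continuous_fourierInv_real {g : ℝ → ℂ} (hg : Integrable g) : Continuous (𝓕⁻ g) := by
  rw [Real.fourierInv_eq_fourier_comp_neg]
  exact VectorFourier.fourierIntegral_continuous Real.continuous_fourierChar
      (by exact continuous_inner) hg.comp_neg

lemma integrable_fourierInv_integrand {g : ℝ → ℂ} (hg : Integrable g) (x : ℝ) :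
    Integrable fun τ : ℝ => Complex.exp (↑(2 * Real.pi * inner ℝ τ x) * Complex.I) • g τ := by
  refine (integrable_norm_iff ?_).1 ?_
  · have hc : Continuous fun τ : ℝ => Complex.exp (↑(2 * Real.pi * inner ℝ τ x) * Complex.I) := by
      fun_prop
    exact hc.aestronglyMeasurable.smul hg.1
  · refine hg.norm.congr (Eventually.of_forall fun τ => ?_)
    simp only
    rw [norm_smul, Complex.norm_exp_ofReal_mul_I, one_mul]

lemma fourierInv_add_real {g h : ℝ → ℂ} (hg : Integrable g) (hh : Integrable h) (x : ℝ) :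
    𝓕⁻ (fun τ => g τ + h τ) x = 𝓕⁻ g x + 𝓕⁻ h x := by
  simp only [Real.fourierInv_eq']
  rw [← integral_add (integrable_fourierInv_integrand hg x) (integrable_fourierInv_integrand hh x)]
  simp [mul_add]

lemma fourierInv_sub_real {g h : ℝ → ℂ} (hg : Integrable g) (hh : Integrable h) (x : ℝ) :
    𝓕⁻ (fun τ => g τ - h τ) x = 𝓕⁻ g x - 𝓕⁻ h x := by
  simp only [Real.fourierInv_eq']
  rw [← integral_sub (integrable_fourierInv_integrand hg x) (integrable_fourierInv_integrand hh x)]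
  simp [mul_sub]

lemma fourierInv_const_mul_real (c : ℂ) (g : ℝ → ℂ) (x : ℝ) :
    𝓕⁻ (fun τ => c * g τ) x = c * 𝓕⁻ g x := by
  simp only [Real.fourierInv_eq', smul_eq_mul]
  rw [← integral_const_mul]
  congr 1; ext τ; ring

end Weights

/-! ### Slices of functions given by their symbols -/

section Slices

variable {N : ℕ}

lemma fourierInv_glue {V : Amb N → ℂ} (hV : Integrable V) (x₀ : ℝ) (x' : Bdry N) :
    𝓕⁻ V (glue x₀ x') = 𝓕⁻ (part V x₀) x' := by
  rw [Real.fourierInv_eq', Real.fourierInv_eq']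
  have hint : Integrable fun v : Amb N =>
      Complex.exp (↑(2 * Real.pi * inner ℝ v (glue x₀ x')) * Complex.I) • V v := by
    refine (integrable_norm_iff ?_).1 ?_
    · have hc : Continuous fun v : Amb N =>
          Complex.exp (↑(2 * Real.pi * inner ℝ v (glue x₀ x')) * Complex.I) := by fun_prop
      exact hc.aestronglyMeasurable.smul hV.1
    · refine hV.norm.congr (Eventually.of_forall fun τ => ?_)
      simp only
      rw [norm_smul, Complex.norm_exp_ofReal_mul_I, one_mul]
  rw [integral_glue' hint]
  congr 1
  ext ξ
  rw [part, Real.fourierInv_eq', smul_eq_mul, ← integral_const_mul]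
  congr 1
  ext τ
  rw [inner_glue]
  simp only [smul_eq_mul]
  rw [← mul_assoc, ← Complex.exp_add]
  congr 2
  push_cast
  simp only [RCLike.inner_apply, conj_trivial]
  push_cast
  ring

/-- The symbol `V` restricted to the frequencies `|ξ| ≤ n`. -/
def truncSym (V : Amb N → ℂ) (n : ℕ) : Amb N → ℂ := (Metric.closedBall 0 n).indicator V

lemma measurable_truncSym {V : Amb N → ℂ} (hV : Measurable V) (n : ℕ) :
    Measurable (truncSym V n) := hV.indicator measurableSet_closedBall

lemma symInt_truncSym_le (t : ℝ) (V : Amb N → ℂ) (n : ℕ) : symInt t (truncSym V n) ≤ symInt t V := by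
  unfold symInt
  gcongr with ξ
  exact enorm_indicator_le_enorm_self _ _

lemma integrable_truncSym {V : Amb N → ℂ} (hV : MemLp V 2) (n : ℕ) :
    Integrable (truncSym V n) := by
  unfold truncSym
  rw [integrable_indicator_iff measurableSet_closedBall]
  exact (hV.locallyIntegrable (by norm_num)).integrableOn_isCompact (isCompact_closedBall 0 _)

lemma tendsto_symInt_truncSym {t : ℝ} {V : Amb N → ℂ} (hV : Measurable V) (h : symInt t V < ⊤) :
    Tendsto (fun n => symInt t fun ξ => V ξ - truncSym V n ξ) atTop (𝓝 0) := by
  have := tendsto_lintegral_of_dominated_convergence (μ := (volume : Measure (Amb N)))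
    (F := fun n ξ => ENNReal.ofReal (symWt ξ ^ t) * ‖V ξ - truncSym V n ξ‖ₑ ^ 2) (f := 0)
    (fun ξ => ENNReal.ofReal (symWt ξ ^ t) * ‖V ξ‖ₑ ^ 2)
    (fun n => measurable_symInt_integrand t (hV.sub (measurable_truncSym hV n)))
    (fun n => Eventually.of_forall fun ξ => ?_) h.ne (Eventually.of_forall fun ξ => ?_)
  · simpa [symInt] using this
  · simp only
    gcongr
    unfold truncSym
    by_cases hξ : ξ ∈ Metric.closedBall (0 : Amb N) n <;> simp [hξ]
  · obtain ⟨n, hn⟩ := exists_nat_ge ‖ξ‖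
    refine tendsto_const_nhds.congr' ?_
    filter_upwards [eventually_ge_atTop n] with k hk
    have : ξ ∈ Metric.closedBall (0 : Amb N) k := by
      simp only [mem_closedBall_zero_iff]
      exact hn.trans (by exact_mod_cast hk)
    simp [truncSym, this]

lemma integrable_part {V : Amb N → ℂ} (hV : Measurable V) (hi : Integrable V) (x : ℝ) :
    Integrable (part V x) := by
  refine ⟨(measurable_part hV x).aestronglyMeasurable, ?_⟩
  calc ∫⁻ ξ, ‖part V x ξ‖ₑ ≤ ∫⁻ ξ, ∫⁻ τ, ‖V (glue τ ξ)‖ₑ := lintegral_mono fun ξ =>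
        enorm_part_le V x ξ
    _ = ∫⁻ ξ, ‖V ξ‖ₑ := (lintegral_glue' hV.enorm.aemeasurable).symm
    _ < ⊤ := hi.2

lemma lt_of_sq_lt_sq_ennreal {a b : ℝ≥0∞} (h : a ^ 2 < b ^ 2) : a < b :=
  lt_of_not_ge fun hle => absurd (pow_le_pow_left' hle 2) (not_le.2 h)

/-- Almost every slice `F(x_0, ·)` of a function `F` with Fourier transform `V` in the weighted
space of exponent `t > 1/2` has the tangential Fourier transform `part V x_0`. The formula is clear
for integrable `V`; in general `V` is truncated to `|ξ| ≤ n`, and Plancherel's theorem on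
`ℝ^{N+1}` and on `ℝ^N` controls the errors of both sides. -/
theorem ae_slice_fourier {t : ℝ} (ht : 1 / 2 < t) {V : Amb N → ℂ} (hV : Measurable V)
    (h : symInt t V < ⊤) (F : Lp ℂ 2 (volume : Measure (Amb N)))
    (hF : (𝓕 F : Lp ℂ 2 (volume : Measure (Amb N))) =ᵐ[volume] V) :
    ∀ᵐ x₀ : ℝ, ∃ hm : MemLp (fun x' : Bdry N => F (glue x₀ x')) 2 volume,
      (𝓕 (hm.toLp _) : Lp ℂ 2 (volume : Measure (Bdry N))) =ᵐ[volume] part V x₀ := by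
  have ht0 : 0 ≤ t := by linarith
  have hV2 := memLp_of_symInt ht0 hV h
  have hTm := measurable_truncSym hV
  have hTs : ∀ n, symInt t (truncSym V n) < ⊤ := fun n => (symInt_truncSym_le t V n).trans_lt h
  have hT2 := fun n => memLp_of_symInt ht0 (hTm n) (hTs n)
  have hTi := integrable_truncSym hV2
  have hFm : Measurable F := (Lp.stronglyMeasurable F).measurable
  -- `f n` is the approximation with the truncated symbol, `δ n` its error
  set f : ℕ → Amb N → ℂ := fun n => 𝓕⁻ (truncSym V n) with hf
  set δ : ℕ → ℝ≥0∞ := fun n => symInt t fun ξ => V ξ - truncSym V n ξ with hδ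
  have hδ0 : Tendsto δ atTop (𝓝 0) := tendsto_symInt_truncSym hV h
  have hfc : ∀ n, Continuous (f n) := fun n => by
    simp only [hf]
    rw [Real.fourierInv_eq_fourier_comp_neg]
    exact VectorFourier.fourierIntegral_continuous Real.continuous_fourierChar
      (by exact continuous_inner) (hTi n).comp_neg
  set e : ℕ → ℝ → ℝ≥0∞ := fun n x₀ => ∫⁻ x' : Bdry N, ‖F (glue x₀ x') - f n (glue x₀ x')‖ₑ ^ 2
    with he
  have hem0 : ∀ n, Measurable fun x : Amb N => ‖F x - f n x‖ₑ ^ 2 := fun n =>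
    (hFm.sub (hfc n).measurable).enorm.pow_const 2
  have hem : ∀ n, Measurable (e n) := fun n =>
    Measurable.lintegral_prod_right' ((hem0 n).comp measurable_glue)
  have hei : ∀ n, ∫⁻ x₀, e n x₀ ≤ δ n := fun n => by
    have h1 : ∫⁻ x₀, e n x₀ = ∫⁻ x, ‖F x - f n x‖ₑ ^ 2 :=
      (lintegral_glue (hem0 n).aemeasurable).symm
    obtain ⟨G, hG⟩ : ∃ G : Lp ℂ 2 (volume : Measure (Amb N)), G = (hT2 n).toLp _ := ⟨_, rfl⟩
    have h2 := fourierInv_toLp_ae_eq (hT2 n) (hTi n)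
    have h3 := (hT2 n).coeFn_toLp
    rw [← hG] at h2 h3
    have h4 : ∫⁻ x, ‖F x - f n x‖ₑ ^ 2 = ‖F - 𝓕⁻ G‖ₑ ^ 2 := by
      rw [enorm_sq_Lp]
      refine lintegral_congr_ae ?_
      filter_upwards [Lp.coeFn_sub F (𝓕⁻ G), h2] with x hx hx2
      rw [hx, Pi.sub_apply, hx2]
    have h5 : ‖F - 𝓕⁻ G‖ₑ = ‖𝓕 F - G‖ₑ := by
      rw [← ofReal_norm, ← ofReal_norm, ← Lp.norm_fourier_eq (F - 𝓕⁻ G)]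
      congr 2
      have := (Lp.fourierTransformₗᵢ (Amb N) ℂ).map_sub F (𝓕⁻ G)
      change 𝓕 (F - 𝓕⁻ G) = 𝓕 F - 𝓕 (𝓕⁻ G) at this
      rw [this, fourier_fourierInv_eq]
    rw [h1, h4, h5, enorm_sq_Lp]
    calc ∫⁻ x, ‖(𝓕 F - G : Lp ℂ 2 (volume : Measure (Amb N))) x‖ₑ ^ 2
        = ∫⁻ x, ‖V x - truncSym V n x‖ₑ ^ 2 := by
          refine lintegral_congr_ae ?_
          filter_upwards [Lp.coeFn_sub (𝓕 F) G, h3, hF] with x hx hx2 hx3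
          rw [hx, Pi.sub_apply, hx2, hx3]
      _ = symInt 0 fun ξ => V ξ - truncSym V n ξ := (symInt_zero_left _).symm
      _ ≤ δ n := symInt_mono ht0 _
  have hlim : ∀ᵐ x₀, liminf (fun n => e n x₀) atTop = 0 := by
    have h1 : ∫⁻ x₀, liminf (fun n => e n x₀) atTop = 0 := by
      refine le_antisymm ?_ zero_le
      calc _ ≤ liminf (fun n => ∫⁻ x₀, e n x₀) atTop := lintegral_liminf_le hem
        _ ≤ liminf δ atTop := liminf_le_liminf (Eventually.of_forall hei)
        _ = 0 := hδ0.liminf_eq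
    rw [lintegral_eq_zero_iff (Measurable.liminf hem)] at h1
    exact h1
  have hslice : ∀ᵐ x₀, MemLp (fun x' : Bdry N => F (glue x₀ x')) 2 volume := by
    have h1 : ∫⁻ x, ‖F x‖ₑ ^ 2 < ⊤ := MemLp.lintegral_sq_lt_top (Lp.memLp F)
    have hm : Measurable fun x : Amb N => ‖F x‖ₑ ^ 2 := hFm.enorm.pow_const 2
    rw [lintegral_glue hm.aemeasurable] at h1
    filter_upwards [ae_lt_top (Measurable.lintegral_prod_right' (hm.comp measurable_glue)) h1.ne]
      with x₀ hx
    rw [memLp_two_iff]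
    · exact hx
    · exact (hFm.comp (measurable_glue.comp
        (measurable_const.prodMk measurable_id))).aestronglyMeasurable
  filter_upwards [hlim, hslice] with x₀ hx0 hm
  refine ⟨hm, ?_⟩
  have hP2 := memLp_part ht hV h x₀
  obtain ⟨S, hS⟩ : ∃ S : Lp ℂ 2 (volume : Measure (Bdry N)), S = hm.toLp _ := ⟨_, rfl⟩
  obtain ⟨P, hP⟩ : ∃ P : Lp ℂ 2 (volume : Measure (Bdry N)), P = hP2.toLp _ := ⟨_, rfl⟩
  rw [← hS]
  have hSae : S =ᵐ[volume] fun x' => F (glue x₀ x') := hS ▸ hm.coeFn_toLp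
  have hPae : P =ᵐ[volume] part V x₀ := hP ▸ hP2.coeFn_toLp
  refine EventuallyEq.trans ?_ hPae
  have hgoal : 𝓕 S = P := by
    rw [← sub_eq_zero, ← enorm_eq_zero]
    by_contra hne
    obtain ⟨ε, hε, hεlt⟩ : ∃ ε : ℝ≥0∞, 0 < ε ∧ ε + ε < ‖𝓕 S - P‖ₑ := by
      obtain ⟨b, hb0, hb1⟩ := exists_between (pos_iff_ne_zero.2 hne)
      exact ⟨b / 2, ENNReal.half_pos hb0.ne', by rwa [ENNReal.add_halves]⟩
    have hε2 : 0 < ε ^ 2 := by positivity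
    have hfr := frequently_lt_of_liminf_lt (b := ε ^ 2) (by isBoundedDefault) (hx0.trans_lt hε2)
    have hC : Tendsto (fun n => ENNReal.ofReal (wtConst t) * δ n) atTop (𝓝 0) := by
      have := ENNReal.Tendsto.const_mul (a := ENNReal.ofReal (wtConst t)) hδ0
        (Or.inr ENNReal.ofReal_ne_top)
      simpa using this
    obtain ⟨n, hn1, hn2⟩ := (hfr.and_eventually (hC.eventually_lt_const hε2)).exists
    have hQ2 := memLp_part ht (hTm n) (hTs n) x₀
    obtain ⟨Q, hQ⟩ : ∃ Q : Lp ℂ 2 (volume : Measure (Bdry N)), Q = hQ2.toLp _ := ⟨_, rfl⟩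
    have hQae : Q =ᵐ[volume] part (truncSym V n) x₀ := hQ ▸ hQ2.coeFn_toLp
    have hQinv : (𝓕⁻ Q : Lp ℂ 2 (volume : Measure (Bdry N))) =ᵐ[volume]
        𝓕⁻ (part (truncSym V n) x₀) := by
      have := fourierInv_toLp_ae_eq hQ2 (integrable_part (hTm n) (hTi n) x₀)
      rwa [← hQ] at this
    have h1 : ‖𝓕 S - Q‖ₑ < ε := by
      have e1 : ‖𝓕 S - Q‖ₑ = ‖S - 𝓕⁻ Q‖ₑ := by
        rw [← ofReal_norm, ← ofReal_norm, ← Lp.norm_fourier_eq (S - 𝓕⁻ Q)]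
        congr 2
        have := (Lp.fourierTransformₗᵢ (Bdry N) ℂ).map_sub S (𝓕⁻ Q)
        change 𝓕 (S - 𝓕⁻ Q) = 𝓕 S - 𝓕 (𝓕⁻ Q) at this
        rw [this, fourier_fourierInv_eq]
      have e2 : ‖S - 𝓕⁻ Q‖ₑ ^ 2 = e n x₀ := by
        rw [enorm_sq_Lp]
        refine lintegral_congr_ae ?_
        filter_upwards [Lp.coeFn_sub S (𝓕⁻ Q), hSae, hQinv] with x' h1 h2 h3
        rw [h1, Pi.sub_apply, h2, h3, ← fourierInv_glue (hTi n)]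
      rw [e1]
      exact lt_of_sq_lt_sq_ennreal (by rw [e2]; exact hn1)
    have h2 : ‖Q - P‖ₑ < ε := by
      refine lt_of_sq_lt_sq_ennreal (lt_of_le_of_lt ?_ hn2)
      rw [enorm_sq_Lp]
      calc ∫⁻ ξ, ‖(Q - P : Lp ℂ 2 (volume : Measure (Bdry N))) ξ‖ₑ ^ 2
          = ∫⁻ ξ, ‖part (fun ξ => V ξ - truncSym V n ξ) x₀ ξ‖ₑ ^ 2 := by
            refine lintegral_congr_ae ?_
            filter_upwards [Lp.coeFn_sub Q P, hQae, hPae, ae_integrable_line ht hV h,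
              ae_integrable_line ht (hTm n) (hTs n)] with ξ h1 h2 h3 h4 h5
            rw [h1, Pi.sub_apply, h2, h3, enorm_sub_rev]
            unfold part
            rw [fourierInv_sub_real h4 h5]
        _ ≤ _ := lintegral_part_sq_le' ht (hV.sub (hTm n)) x₀
    refine absurd hεlt (not_lt.2 ?_)
    calc ‖𝓕 S - P‖ₑ = ‖(𝓕 S - Q) + (Q - P)‖ₑ := by rw [sub_add_sub_cancel]
      _ ≤ ‖𝓕 S - Q‖ₑ + ‖Q - P‖ₑ := enorm_add_le _ _
      _ ≤ ε + ε := add_le_add h1.le h2.le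
  rw [hgoal]

end Slices

/-! ### Weak derivatives on the half space -/

section WeakDerivatives

variable {N : ℕ} {j : Fin (N + 1)} {u u' v v' : Amb N → ℂ}

instance : IsLocallyFiniteMeasure (halfMeasure N) := by
  unfold halfMeasure; infer_instance

lemma halfMeasure_le : halfMeasure N ≤ volume := Measure.restrict_le_self

lemma ae_halfMeasure_iff {p : Amb N → Prop} :
    (∀ᵐ x ∂halfMeasure N, p x) ↔ ∀ᵐ x : Amb N, x ∈ halfSpace N → p x :=
  ae_restrict_iff' measurableSet_halfSpace

lemma integral_half_of_support {f : Amb N → ℂ} (h : ∀ x ∉ halfSpace N, f x = 0) :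
    ∫ x, f x ∂halfMeasure N = ∫ x, f x :=
  setIntegral_eq_integral_of_forall_compl_eq_zero h

/-- The product of a locally integrable function and a test function is integrable. -/
lemma integrable_mul_test (hu : LocallyIntegrableOn u (halfSpace N)) {ψ : Amb N → ℂ}
    (hψ : Continuous ψ) (hc : HasCompactSupport ψ) (hs : tsupport ψ ⊆ halfSpace N) :
    Integrable (fun x => u x * ψ x) (halfMeasure N) := by
  have h1 : IntegrableOn u (tsupport ψ) := hu.integrableOn_compact_subset hs hc
  have h2 : IntegrableOn (fun x => u x * ψ x) (tsupport ψ) :=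
    h1.mul_continuousOn hψ.continuousOn hc
  have h3 : Integrable (fun x => u x * ψ x) volume := by
    rw [← integrableOn_iff_integrable_of_support_subset (s := tsupport ψ)]
    · exact h2
    · intro x hx
      apply subset_tsupport ψ
      intro h0
      exact hx (by simp [h0])
  exact h3.mono_measure halfMeasure_le

lemma ae_eq_of_test (hu : LocallyIntegrableOn u (halfSpace N))
    (hv : LocallyIntegrableOn v (halfSpace N))
    (h : ∀ ψ : Amb N → ℂ, ContDiff ℝ ∞ ψ → HasCompactSupport ψ → tsupport ψ ⊆ halfSpace N →
      ∫ x, u x * ψ x ∂halfMeasure N = ∫ x, v x * ψ x ∂halfMeasure N) :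
    u =ᵐ[halfMeasure N] v := by
  have h0 : ∀ᵐ x : Amb N, x ∈ halfSpace N → u x - v x = 0 := by
    refine isOpen_halfSpace.ae_eq_zero_of_integral_contDiff_smul_eq_zero (hu.sub hv) ?_
    intro g hg hgc hgs
    have hg' : ContDiff ℝ ∞ fun x => (g x : ℂ) := Complex.ofRealCLM.contDiff.comp hg
    have hgc' : HasCompactSupport fun x => (g x : ℂ) := hgc.comp_left Complex.ofReal_zero
    have hgs' : tsupport (fun x => (g x : ℂ)) ⊆ halfSpace N :=
      (closure_mono fun x hx => by simpa using hx).trans hgs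
    have h1 := h _ hg' hgc' hgs'
    rw [← sub_eq_zero, ← integral_sub (integrable_mul_test hu hg'.continuous hgc' hgs')
      (integrable_mul_test hv hg'.continuous hgc' hgs'), integral_half_of_support] at h1
    · rw [← h1]
      congr 1; ext x
      simp only [Complex.real_smul]; ring
    · intro x hx
      have : g x = 0 := image_eq_zero_of_notMem_tsupport fun h => hx (hgs h)
      simp [this]
  rw [EventuallyEq, ae_halfMeasure_iff]
  filter_upwards [h0] with x hx hx2
  exact sub_eq_zero.1 (hx hx2)

lemma HasWeakDeriv.congr (h : HasWeakDeriv j u v) (hu : u =ᵐ[halfMeasure N] u')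
    (hv : v =ᵐ[halfMeasure N] v') : HasWeakDeriv j u' v' := by
  obtain ⟨h1, h2, h3⟩ := h
  refine ⟨h1.congr hu, h2.congr hv, fun ψ hψ hc hs => ?_⟩
  have e1 : ∫ x, u x * fderiv ℝ ψ x (EuclideanSpace.single j 1) ∂halfMeasure N =
      ∫ x, u' x * fderiv ℝ ψ x (EuclideanSpace.single j 1) ∂halfMeasure N := by
    refine integral_congr_ae ?_
    filter_upwards [hu] with x hx
    rw [hx]
  have e2 : ∫ x, v x * ψ x ∂halfMeasure N = ∫ x, v' x * ψ x ∂halfMeasure N := by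
    refine integral_congr_ae ?_
    filter_upwards [hv] with x hx
    rw [hx]
  rw [← e1, ← e2]
  exact h3 ψ hψ hc hs

lemma HasWeakDeriv.unique (h : HasWeakDeriv j u v) (h' : HasWeakDeriv j u v') :
    v =ᵐ[halfMeasure N] v' := by
  refine ae_eq_of_test h.2.1 h'.2.1 fun ψ hψ hc hs => ?_
  rw [← neg_inj, ← h.2.2 ψ hψ hc hs, ← h'.2.2 ψ hψ hc hs]

lemma HasWeakDeriv.hasWeakDeriv_weakDeriv (h : HasWeakDeriv j u v) :
    HasWeakDeriv j u (weakDeriv j u) := by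
  have hex : ∃ v, HasWeakDeriv j u v := ⟨v, h⟩
  unfold weakDeriv
  rw [dif_pos hex]
  exact hex.choose_spec

lemma HasWeakDeriv.weakDeriv_ae_eq (h : HasWeakDeriv j u v) :
    weakDeriv j u =ᵐ[halfMeasure N] v :=
  h.hasWeakDeriv_weakDeriv.unique h

lemma locallyIntegrableOn_of_memLp (hu : MemLp u 2 (halfMeasure N)) :
    LocallyIntegrableOn u (halfSpace N) :=
  locallyIntegrableOn_of_locallyIntegrable_restrict (hu.locallyIntegrable (by norm_num))

end WeakDerivatives

/-! ### Functions on the half space with a given symbol -/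

/-- `u` agrees on the half space with the function on `ℝ^{N+1}` whose Fourier transform is `V`,
and `∫ (1 + |2πξ|²)^t |V|² < ∞`. For `t ≥ 0` this says that `u` belongs to the Sobolev space `W^t`
of the half space, and that `V` is the Fourier transform of an extension of `u` in `W^t`. -/
def HasSymbol {N : ℕ} (t : ℝ) (u V : Amb N → ℂ) : Prop :=
  Measurable V ∧ symInt t V < ⊤ ∧ ∃ F : Lp ℂ 2 (volume : Measure (Amb N)),
    F =ᵐ[halfMeasure N] u ∧ (𝓕 F : Lp ℂ 2 (volume : Measure (Amb N))) =ᵐ[volume] V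

/-- The symbol of the derivative `D_j`. -/
def dSym {N : ℕ} (j : Fin (N + 1)) (V : Amb N → ℂ) : Amb N → ℂ := fun ξ =>
  (2 * Real.pi * Complex.I * (ξ j : ℂ)) * V ξ

section Symbols

variable {N : ℕ} {j : Fin (N + 1)} {t : ℝ} {u u' v v' V W : Amb N → ℂ}

lemma ae_half_of_ae {p : Amb N → Prop} (h : ∀ᵐ x, p x) : ∀ᵐ x ∂halfMeasure N, p x :=
  ae_restrict_of_ae h

lemma exists_Lp_of_symInt (ht : 0 ≤ t) (hV : Measurable V) (h : symInt t V < ⊤) :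
    ∃ F : Lp ℂ 2 (volume : Measure (Amb N)),
      (𝓕 F : Lp ℂ 2 (volume : Measure (Amb N))) =ᵐ[volume] V := by
  have h2 := memLp_of_symInt ht hV h
  obtain ⟨P, hP⟩ : ∃ P : Lp ℂ 2 (volume : Measure (Amb N)), P = h2.toLp _ := ⟨_, rfl⟩
  refine ⟨𝓕⁻ P, ?_⟩
  rw [fourier_fourierInv_eq, hP]
  exact h2.coeFn_toLp

lemma exists_hasSymbol (ht : 0 ≤ t) (hV : Measurable V) (h : symInt t V < ⊤) :
    ∃ u, HasSymbol t u V := by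
  obtain ⟨F, hF⟩ := exists_Lp_of_symInt ht hV h
  exact ⟨F, hV, h, F, ae_eq_refl _, hF⟩

lemma HasSymbol.congr (h : HasSymbol t u V) (hu : u =ᵐ[halfMeasure N] u') : HasSymbol t u' V := by
  obtain ⟨h1, h2, F, h3, h4⟩ := h
  exact ⟨h1, h2, F, h3.trans hu, h4⟩

lemma HasSymbol.memLp (h : HasSymbol t u V) : MemLp u 2 (halfMeasure N) := by
  obtain ⟨h1, h2, F, h3, h4⟩ := h
  exact ((Lp.memLp F).mono_measure halfMeasure_le).ae_eq h3

lemma HasSymbol.aestronglyMeasurable (h : HasSymbol t u V) :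
    AEStronglyMeasurable u (halfMeasure N) := h.memLp.1

lemma symInt_add_le (t : ℝ) (hV : Measurable V) :
    symInt t (fun ξ => V ξ + W ξ) ≤ 2 * symInt t V + 2 * symInt t W := by
  unfold symInt
  rw [← lintegral_const_mul _ (measurable_symInt_integrand t hV),
    ← lintegral_const_mul' _ _ (by norm_num),
    ← lintegral_add_left ((measurable_symInt_integrand t hV).const_mul 2)]
  refine lintegral_mono fun ξ => ?_
  calc ENNReal.ofReal (symWt ξ ^ t) * ‖V ξ + W ξ‖ₑ ^ 2
      ≤ ENNReal.ofReal (symWt ξ ^ t) * (2 * ‖V ξ‖ₑ ^ 2 + 2 * ‖W ξ‖ₑ ^ 2) := by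
        gcongr
        calc ‖V ξ + W ξ‖ₑ ^ 2 ≤ (‖V ξ‖ₑ + ‖W ξ‖ₑ) ^ 2 := by gcongr; exact enorm_add_le _ _
          _ ≤ _ := by
            have := ENNReal.rpow_add_le_mul_rpow_add_rpow ‖V ξ‖ₑ ‖W ξ‖ₑ (p := 2) (by norm_num)
            norm_num at this
            rwa [mul_add] at this
    _ = _ := by ring

lemma symInt_const_mul (t : ℝ) (c : ℂ) (V : Amb N → ℂ) :
    symInt t (fun ξ => c * V ξ) = ‖c‖ₑ ^ 2 * symInt t V := by
  unfold symInt
  rw [← lintegral_const_mul' _ _ (by finiteness)]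
  refine lintegral_congr fun ξ => ?_
  rw [enorm_mul]; ring

lemma HasSymbol.add (h : HasSymbol t u V) (h' : HasSymbol t v W) :
    HasSymbol t (fun x => u x + v x) (fun ξ => V ξ + W ξ) := by
  obtain ⟨h1, h2, F, h3, h4⟩ := h
  obtain ⟨k1, k2, G, k3, k4⟩ := h'
  refine ⟨h1.add k1, (symInt_add_le t h1).trans_lt ?_, F + G, ?_, ?_⟩
  · exact ENNReal.add_lt_top.2 ⟨ENNReal.mul_lt_top (by norm_num) h2,
      ENNReal.mul_lt_top (by norm_num) k2⟩
  · filter_upwards [ae_half_of_ae (Lp.coeFn_add F G), h3, k3] with x e1 e2 e3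
    rw [e1, Pi.add_apply, e2, e3]
  · rw [FourierAdd.fourier_add]
    filter_upwards [Lp.coeFn_add (𝓕 F) (𝓕 G), h4, k4] with x e1 e2 e3
    rw [e1, Pi.add_apply, e2, e3]

lemma HasSymbol.const_mul (h : HasSymbol t u V) (c : ℂ) :
    HasSymbol t (fun x => c * u x) (fun ξ => c * V ξ) := by
  obtain ⟨h1, h2, F, h3, h4⟩ := h
  refine ⟨h1.const_mul c, ?_, c • F, ?_, ?_⟩
  · rw [symInt_const_mul]
    exact ENNReal.mul_lt_top (by finiteness) h2
  · filter_upwards [ae_half_of_ae (Lp.coeFn_smul c F), h3] with x e1 e2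
    rw [e1, Pi.smul_apply, e2, smul_eq_mul]
  · rw [FourierSMul.fourier_smul]
    filter_upwards [Lp.coeFn_smul c (𝓕 F), h4] with x e1 e2
    rw [e1, Pi.smul_apply, e2, smul_eq_mul]

lemma HasSymbol.zero : HasSymbol t (0 : Amb N → ℂ) 0 := by
  refine ⟨measurable_const, by simp [symInt], 0, ae_half_of_ae (Lp.coeFn_zero _ _ _), ?_⟩
  rw [FourierTransform.fourier_zero]
  exact Lp.coeFn_zero _ _ _

lemma HasSymbol.sum {ι : Type*} (S : Finset ι) {u V : ι → Amb N → ℂ}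
    (h : ∀ i ∈ S, HasSymbol t (u i) (V i)) :
    HasSymbol t (fun x => ∑ i ∈ S, u i x) (fun ξ => ∑ i ∈ S, V i ξ) := by
  classical
  induction S using Finset.induction_on with
  | empty =>
    simp only [Finset.sum_empty]
    exact HasSymbol.zero
  | insert a S ha ih =>
    simp only [Finset.sum_insert ha]
    exact (h a (by simp)).add (ih fun i hi => h i (by simp [hi]))

lemma measurable_dSym (hV : Measurable V) : Measurable (dSym j V) := by
  unfold dSym
  have : Measurable fun ξ : Amb N => (2 * Real.pi * Complex.I * (ξ j : ℂ)) := by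
    apply Continuous.measurable; fun_prop
  exact this.mul hV

lemma symInt_dSym_le (t : ℝ) (V : Amb N → ℂ) : symInt (t - 1) (dSym j V) ≤ symInt t V := by
  unfold symInt
  refine lintegral_mono fun ξ => ?_
  simp only [dSym]
  rw [enorm_mul, mul_pow, ← mul_assoc]
  gcongr
  rw [← ofReal_norm, ← ENNReal.ofReal_pow (norm_nonneg _),
    ← ENNReal.ofReal_mul (by have := symWt_pos ξ; positivity)]
  apply ENNReal.ofReal_le_ofReal
  have h1 : ‖2 * (Real.pi : ℂ) * Complex.I * (ξ j : ℂ)‖ ^ 2 ≤ symWt ξ := by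
    have : ‖2 * (Real.pi : ℂ) * Complex.I * (ξ j : ℂ)‖ = 2 * Real.pi * |ξ j| := by
      simp [abs_of_pos Real.pi_pos]
    rw [this, symWt]
    have h3 : |ξ j| ≤ ‖ξ‖ := by simpa using PiLp.norm_apply_le ξ j
    have := Real.pi_pos
    have h4 : 2 * Real.pi * |ξ j| ≤ 2 * Real.pi * ‖ξ‖ := by gcongr
    have h5 : 0 ≤ 2 * Real.pi * |ξ j| := by positivity
    nlinarith
  calc symWt ξ ^ (t - 1) * _ ≤ symWt ξ ^ (t - 1) * symWt ξ := by
        have := symWt_pos ξ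
        gcongr
    _ = symWt ξ ^ t := by
        rw [← Real.rpow_add_one (symWt_pos ξ).ne']; simp

/-- Integration by parts against a Schwartz function, on the Fourier side. -/
lemma integral_mul_lineDeriv_schwartz {F G : Lp ℂ 2 (volume : Measure (Amb N))}
    (hFG : (𝓕 G : Lp ℂ 2 (volume : Measure (Amb N))) =ᵐ[volume] dSym j (𝓕 F : Lp ℂ 2 volume))
    (g : 𝓢(Amb N, ℂ)) :
    ∫ x, F x * fderiv ℝ g x (EuclideanSpace.single j 1) = - ∫ x, G x * g x := by
  have h1 := integral_schwartz_mul_fourierInv (𝓕 F)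
    (LineDeriv.lineDerivOp (EuclideanSpace.single j (1 : ℝ)) g)
  have h2 := integral_schwartz_mul_fourierInv (𝓕 G) g
  rw [fourierInv_fourier_eq] at h1 h2
  have h3 : ∫ x, F x * fderiv ℝ g x (EuclideanSpace.single j 1) =
      ∫ x, (LineDeriv.lineDerivOp (EuclideanSpace.single j (1 : ℝ)) g) x * F x := by
    congr 1; ext x
    rw [SchwartzMap.lineDerivOp_apply_eq_fderiv, mul_comm]
  have h4 : ∫ x, G x * g x = ∫ x, g x * G x := by simp_rw [mul_comm]
  rw [h3, h4, h1, h2, ← integral_neg]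
  refine integral_congr_ae ?_
  filter_upwards [hFG] with ξ hξ
  rw [hξ, SchwartzMap.fourierInv_lineDerivOp_eq]
  have hg : (fun x : Amb N => inner ℝ x (EuclideanSpace.single j (1 : ℝ))).HasTemperateGrowth := by
    fun_prop
  simp only [_root_.smul_apply, SchwartzMap.smulLeftCLM_apply_apply hg, dSym]
  simp only [EuclideanSpace.inner_single_right, one_mul, smul_eq_mul, Complex.real_smul,
    conj_trivial]
  ring

lemma HasSymbol.hasWeakDeriv (h : HasSymbol t u V) (ht : 1 ≤ t) (j : Fin (N + 1)) :
    HasWeakDeriv j u (weakDeriv j u) ∧ HasSymbol (t - 1) (weakDeriv j u) (dSym j V) := by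
  obtain ⟨h1, h2, F, h3, h4⟩ := h
  have hd := measurable_dSym (j := j) h1
  have hds := (symInt_dSym_le (j := j) t V).trans_lt h2
  obtain ⟨G, hG⟩ := exists_Lp_of_symInt (by linarith) hd hds
  have hFG : (𝓕 G : Lp ℂ 2 (volume : Measure (Amb N))) =ᵐ[volume]
      dSym j (𝓕 F : Lp ℂ 2 volume) := by
    filter_upwards [hG, h4] with ξ e1 e2
    rw [e1, dSym, dSym, e2]
  have hw : HasWeakDeriv j u G := by
    refine HasWeakDeriv.congr ?_ h3 (ae_eq_refl _)
    refine ⟨locallyIntegrableOn_of_memLp ((Lp.memLp F).mono_measure halfMeasure_le),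
      locallyIntegrableOn_of_memLp ((Lp.memLp G).mono_measure halfMeasure_le), ?_⟩
    intro ψ hψ hc hs
    have e := integral_mul_lineDeriv_schwartz hFG (hc.toSchwartzMap hψ)
    have hz : ∀ x ∉ halfSpace N, ψ x = 0 := fun x hx =>
      image_eq_zero_of_notMem_tsupport fun h => hx (hs h)
    have hz' : ∀ x ∉ halfSpace N, fderiv ℝ ψ x = 0 := fun x hx =>
      image_eq_zero_of_notMem_tsupport fun h => hx (hs (tsupport_fderiv_subset ℝ h))
    rw [integral_half_of_support fun x hx => by simp [hz' x hx],
      integral_half_of_support fun x hx => by simp [hz x hx]]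
    exact e
  exact ⟨hw.hasWeakDeriv_weakDeriv, hd, hds, G, hw.weakDeriv_ae_eq.symm, hG⟩

lemma HasSymbol.weakDeriv (h : HasSymbol t u V) (ht : 1 ≤ t) (j : Fin (N + 1)) :
    HasSymbol (t - 1) (weakDeriv j u) (dSym j V) := (h.hasWeakDeriv ht j).2

lemma HasSymbol.memW1 (h : HasSymbol t u V) (ht : 1 ≤ t) : MemW1 u :=
  ⟨h.memLp, fun j => ⟨_, (h.weakDeriv ht j).memLp, (h.hasWeakDeriv ht j).1⟩⟩

/-- Tangential slices of a function with symbol `V` have the tangential Fourier transform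
`part V`. -/
lemma HasSymbol.isTangFourier (h : HasSymbol t u V) (ht : 1 / 2 < t) : IsTangFourier u (part V) := by
  obtain ⟨h1, h2, F, h3, h4⟩ := h
  have hs := ae_restrict_of_ae (s := Set.Ioi (0 : ℝ)) (ae_slice_fourier ht h1 h2 F h4)
  filter_upwards [hs, ae_half_glue h3] with x₀ hx1 hx2
  obtain ⟨hm, hm2⟩ := hx1
  refine ⟨hm.ae_eq hx2, ?_⟩
  rwa [← MemLp.toLp_congr hm (hm.ae_eq hx2) hx2]

/-- Two functions on the half space with symbols agree iff their tangential Fourier transforms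
do; this direction reduces identities on the half space to identities on the fibres. -/
lemma HasSymbol.ae_eq_of_part {t' : ℝ} (h : HasSymbol t u V) (ht : 1 / 2 < t)
    (h' : HasSymbol t' v W) (ht' : 1 / 2 < t')
    (he : ∀ x₀ : ℝ, 0 < x₀ → part V x₀ =ᵐ[volume] part W x₀) : u =ᵐ[halfMeasure N] v := by
  refine ae_half_eq_of_slices h.aestronglyMeasurable h'.aestronglyMeasurable ?_
  filter_upwards [h.isTangFourier ht, h'.isTangFourier ht', ae_restrict_mem measurableSet_Ioi]
    with x₀ ⟨h1, h2⟩ ⟨k1, k2⟩ hx0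
  obtain ⟨P, hP⟩ : ∃ P : Lp ℂ 2 (volume : Measure (Bdry N)), P = h1.toLp _ := ⟨_, rfl⟩
  obtain ⟨Q, hQ⟩ : ∃ Q : Lp ℂ 2 (volume : Measure (Bdry N)), Q = k1.toLp _ := ⟨_, rfl⟩
  rw [← hP] at h2
  rw [← hQ] at k2
  have e1 : 𝓕 P = 𝓕 Q := Lp.ext ((h2.trans (he x₀ hx0)).trans k2.symm)
  have e2 : P = Q := (Lp.fourierTransformₗᵢ (Bdry N) ℂ).injective e1
  have e3 : P =ᵐ[volume] fun x' => u (glue x₀ x') := hP ▸ h1.coeFn_toLp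
  have e4 : Q =ᵐ[volume] fun x' => v (glue x₀ x') := hQ ▸ k1.coeFn_toLp
  exact e3.symm.trans (e2 ▸ e4)

lemma measurable_part_comp {X : Type*} [MeasurableSpace X] (hV : Measurable V) {f : X → ℝ}
    {g : X → Bdry N} (hf : Measurable f) (hg : Measurable g) :
    Measurable fun x => part V (f x) (g x) := by
  obtain ⟨P, hP⟩ : ∃ P, P = part V := ⟨_, rfl⟩
  have h : Measurable (Function.uncurry P) := hP ▸ (stronglyMeasurable_part hV).measurable
  rw [← hP]
  exact h.comp (hf.prodMk hg)

lemma continuous_part {ξ : Bdry N} (h : Integrable fun τ => V (glue τ ξ)) :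
    Continuous fun x => part V x ξ := continuous_fourierInv_real h

lemma HasSymbol.ae_integrable_line (h : HasSymbol t u V) (ht : 1 / 2 < t) :
    ∀ᵐ ξ, Integrable fun τ => V (glue τ ξ) := HalfSpaceHodge.ae_integrable_line ht h.1 h.2.1

/-- Identities between the tangential Fourier transforms of two functions on the half space hold
for all `x_0 > 0` once the functions agree almost everywhere. -/
lemma HasSymbol.part_eq_of_ae_eq {t' : ℝ} (h : HasSymbol t u V) (ht : 1 / 2 < t)
    (h' : HasSymbol t' v W) (ht' : 1 / 2 < t') (he : u =ᵐ[halfMeasure N] v) :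
    ∀ᵐ ξ, ∀ x : ℝ, 0 ≤ x → part V x ξ = part W x ξ := by
  have h1 : ∀ᵐ x₀ ∂(volume.restrict (Set.Ioi (0 : ℝ))), ∀ᵐ ξ, part V x₀ ξ = part W x₀ ξ := by
    filter_upwards [h.isTangFourier ht, h'.isTangFourier ht', ae_half_glue he]
      with x₀ ⟨h1, h2⟩ ⟨k1, k2⟩ hx
    rw [MemLp.toLp_congr h1 k1 hx] at h2
    exact h2.symm.trans k2
  have hm : MeasurableSet {x : Amb N | part V (x 0) (tang x) = part W (x 0) (tang x)} := by
    have hp : Measurable fun x : Amb N => (x 0, tang x) := (glueEquiv N).symm.measurable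
    exact measurableSet_eq_fun (measurable_part_comp h.1 hp.fst hp.snd)
      (measurable_part_comp h'.1 hp.fst hp.snd)
  have h2 := ae_half_swap (p := fun x ξ => part V x ξ = part W x ξ) hm.nullMeasurableSet h1
  filter_upwards [h2, h.ae_integrable_line ht, h'.ae_integrable_line ht'] with ξ hξ hi hi'
  -- equality almost everywhere on `(0, ∞)` extends to `[0, ∞)` by continuity
  have hcl : IsClosed {x : ℝ | part V x ξ = part W x ξ} :=
    isClosed_eq (continuous_part hi) (continuous_part hi')
  have hd : Set.Ioi (0 : ℝ) ⊆ {x : ℝ | part V x ξ = part W x ξ} := by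
    have := Measure.eqOn_open_of_ae_eq (μ := (volume : Measure ℝ)) hξ isOpen_Ioi
      (continuous_part hi).continuousOn (continuous_part hi').continuousOn
    exact this
  intro x hx
  have := hcl.closure_subset_iff.2 hd
  rw [closure_Ioi] at this
  exact this hx

end Symbols

/-! ### Boundary traces -/

section Traces

variable {N : ℕ} {t : ℝ} {u u' V : Amb N → ℂ}

/-- The slab `{0 < x_0 < ε}`. -/
def slab (N : ℕ) (ε : ℝ) : Set (Amb N) := {x | 0 < x 0 ∧ x 0 < ε}

lemma slab_subset (ε : ℝ) : slab N ε ⊆ halfSpace N := fun _ hx => hx.1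

lemma measurableSet_slab (ε : ℝ) : MeasurableSet (slab N ε) := by
  have h : Measurable fun x : Amb N => x 0 := by fun_prop
  exact (measurableSet_lt measurable_const h).inter (measurableSet_lt h measurable_const)

lemma restrict_slab_le (ε : ℝ) : (volume : Measure (Amb N)).restrict (slab N ε) ≤ halfMeasure N :=
  Measure.restrict_mono (slab_subset ε) le_rfl

lemma lintegral_slab {g : Amb N → ℝ≥0∞} (hg : AEMeasurable g (halfMeasure N)) (ε : ℝ) :
    ∫⁻ x in slab N ε, g x = ∫⁻ x₀ in Set.Ioo 0 ε, ∫⁻ x', g (glue x₀ x') := by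
  have h2 := (measurePreserving_glue (N := N)).restrict_preimage_emb
    (glueEquiv N).measurableEmbedding (slab N ε)
  have : (glueEquiv N) ⁻¹' (slab N ε) = Set.Ioo (0 : ℝ) ε ×ˢ Set.univ := by
    ext p; simp [glueEquiv, slab]
  rw [this, ← Measure.prod_restrict, Measure.restrict_univ] at h2
  rw [← h2.lintegral_comp_emb (glueEquiv N).measurableEmbedding]
  exact lintegral_prod _ ((hg.mono_measure (restrict_slab_le ε)).comp_quasiMeasurePreserving
    h2.quasiMeasurePreserving)

lemma aemeasurable_trace_integrand (hu : AEStronglyMeasurable u (halfMeasure N))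
    (v : Lp ℂ 2 (volume : Measure (Bdry N))) :
    AEMeasurable (fun x => ‖u x - v (tang x)‖ₑ ^ 2) (halfMeasure N) :=
  (hu.aemeasurable.sub ((Lp.stronglyMeasurable v).measurable.comp
    measurable_tang).aemeasurable).enorm.pow_const 2

lemma enorm_add_sq_le (a b : ℂ) : ‖a + b‖ₑ ^ 2 ≤ 2 * ‖a‖ₑ ^ 2 + 2 * ‖b‖ₑ ^ 2 := by
  calc ‖a + b‖ₑ ^ 2 ≤ (‖a‖ₑ + ‖b‖ₑ) ^ 2 := by gcongr; exact enorm_add_le _ _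
    _ ≤ _ := by
      have := ENNReal.rpow_add_le_mul_rpow_add_rpow ‖a‖ₑ ‖b‖ₑ (p := 2) (by norm_num)
      norm_num at this
      rwa [mul_add] at this

lemma IsTrace.unique {v v' : Lp ℂ 2 (volume : Measure (Bdry N))}
    (hu : AEStronglyMeasurable u (halfMeasure N)) (h : IsTrace u v) (h' : IsTrace u v') :
    v = v' := by
  have hc : ∀ ε : ℝ, 0 < ε → ∫⁻ ξ, ‖v ξ - v' ξ‖ₑ ^ 2 ≤
      2 * ((∫⁻ x in slab N ε, ‖u x - v (tang x)‖ₑ ^ 2) / ENNReal.ofReal ε) +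
      2 * ((∫⁻ x in slab N ε, ‖u x - v' (tang x)‖ₑ ^ 2) / ENNReal.ofReal ε) := by
    intro ε hε
    have hε' : ENNReal.ofReal ε ≠ 0 := by simpa using hε
    have hm : Measurable fun x : Amb N => ‖v (tang x) - v' (tang x)‖ₑ ^ 2 :=
      (((Lp.stronglyMeasurable v).measurable.comp measurable_tang).sub
        ((Lp.stronglyMeasurable v').measurable.comp measurable_tang)).enorm.pow_const 2
    have e1 : ∫⁻ x in slab N ε, ‖v (tang x) - v' (tang x)‖ₑ ^ 2 =
        ENNReal.ofReal ε * ∫⁻ ξ, ‖v ξ - v' ξ‖ₑ ^ 2 := by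
      rw [lintegral_slab hm.aemeasurable]
      simp [mul_comm]
    have e2 : ∫⁻ x in slab N ε, ‖v (tang x) - v' (tang x)‖ₑ ^ 2 ≤
        2 * (∫⁻ x in slab N ε, ‖u x - v (tang x)‖ₑ ^ 2) +
        2 * (∫⁻ x in slab N ε, ‖u x - v' (tang x)‖ₑ ^ 2) := by
      have m1 := (aemeasurable_trace_integrand hu v).mono_measure (restrict_slab_le ε)
      rw [← lintegral_const_mul' _ _ (by norm_num), ← lintegral_const_mul' _ _ (by norm_num),
        ← lintegral_add_left' (m1.const_mul 2)]
      refine lintegral_mono fun x => ?_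
      have := enorm_add_sq_le (v (tang x) - u x) (u x - v' (tang x))
      rwa [sub_add_sub_cancel, enorm_sub_rev (v (tang x)) (u x)] at this
    rw [e1] at e2
    rw [← mul_div_assoc, ← mul_div_assoc, ← ENNReal.add_div, ENNReal.le_div_iff_mul_le
      (Or.inl hε') (Or.inl ENNReal.ofReal_ne_top), mul_comm]
    exact e2
  have hlim : Tendsto (fun ε : ℝ =>
      2 * ((∫⁻ x in slab N ε, ‖u x - v (tang x)‖ₑ ^ 2) / ENNReal.ofReal ε) +
      2 * ((∫⁻ x in slab N ε, ‖u x - v' (tang x)‖ₑ ^ 2) / ENNReal.ofReal ε)) (𝓝[>] 0) (𝓝 0) := by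
    have := (ENNReal.Tendsto.const_mul (a := 2) h (Or.inr (by norm_num))).add
      (ENNReal.Tendsto.const_mul (a := 2) h' (Or.inr (by norm_num)))
    simpa [slab] using this
  have h0 : ∫⁻ ξ, ‖v ξ - v' ξ‖ₑ ^ 2 ≤ 0 := by
    refine ge_of_tendsto hlim ?_
    filter_upwards [self_mem_nhdsWithin] with ε hε using hc ε hε
  have h1 : ‖v - v'‖ₑ ^ 2 = 0 := by
    rw [enorm_sq_Lp, ← nonpos_iff_eq_zero]
    refine le_trans (le_of_eq ?_) h0
    refine lintegral_congr_ae ?_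
    filter_upwards [Lp.coeFn_sub v v'] with x hx
    rw [hx, Pi.sub_apply]
  rw [← sub_eq_zero, ← enorm_eq_zero]
  exact pow_eq_zero_iff (two_ne_zero) |>.1 h1

lemma IsTrace.trace_eq {v : Lp ℂ 2 (volume : Measure (Bdry N))}
    (hu : AEStronglyMeasurable u (halfMeasure N)) (h : IsTrace u v) : trace u = v := by
  have hex : ∃ v, IsTrace u v := ⟨v, h⟩
  unfold trace
  rw [dif_pos hex]
  exact IsTrace.unique hu hex.choose_spec h

lemma tendsto_part_zero (ht : 1 / 2 < t) (hV : Measurable V) (h : symInt t V < ⊤) :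
    Tendsto (fun x => ∫⁻ ξ, ‖part V x ξ - part V 0 ξ‖ₑ ^ 2) (𝓝 0) (𝓝 0) := by
  have hm : Measurable fun ξ : Bdry N => ∫⁻ τ, ‖V (glue τ ξ)‖ₑ :=
    Measurable.lintegral_prod_right'
      (f := fun p : Bdry N × ℝ => ‖V (glue p.2 p.1)‖ₑ)
      ((hV.comp (measurable_glue.comp measurable_swap)).enorm)
  have hb : ∫⁻ ξ : Bdry N, (∫⁻ τ, ‖V (glue τ ξ)‖ₑ) ^ 2 < ⊤ := by
    refine lt_of_le_of_lt (le_trans (lintegral_mono fun ξ => ?_)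
      (lintegral_weight_line_sq_le ht hV)) (ENNReal.mul_lt_top ENNReal.ofReal_lt_top h)
    exact le_mul_of_one_le_left zero_le (one_le_mu_rpow (by linarith) ξ)
  have := tendsto_lintegral_filter_of_dominated_convergence (μ := (volume : Measure (Bdry N)))
    (l := 𝓝 (0 : ℝ)) (F := fun x ξ => ‖part V x ξ - part V 0 ξ‖ₑ ^ 2) (f := 0)
    (fun ξ => (2 * ∫⁻ τ, ‖V (glue τ ξ)‖ₑ) ^ 2) ?_ ?_ ?_ ?_
  · simpa using this
  · exact Eventually.of_forall fun x =>
      ((measurable_part hV x).sub (measurable_part hV 0)).enorm.pow_const 2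
  · refine Eventually.of_forall fun x => Eventually.of_forall fun ξ => ?_
    gcongr
    calc _ ≤ ‖part V x ξ‖ₑ + ‖part V 0 ξ‖ₑ := enorm_sub_le
      _ ≤ _ := by rw [two_mul]; exact add_le_add (enorm_part_le V x ξ) (enorm_part_le V 0 ξ)
  · simp only [mul_pow]
    rw [lintegral_const_mul _ (hm.pow_const 2)]
    exact (ENNReal.mul_lt_top (by norm_num) hb).ne
  · filter_upwards [ae_integrable_line ht hV h] with ξ hξ
    have hc : Continuous fun x => ‖part V x ξ - part V 0 ξ‖ₑ ^ 2 := by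
      have := continuous_part hξ
      exact (ENNReal.continuous_pow 2).comp (continuous_enorm.comp (this.sub continuous_const))
    have := hc.tendsto 0
    simpa using this

/-- A function with symbol of exponent `t > 1/2` has a trace, and the Fourier transform of the
trace is `part V 0`. -/
lemma HasSymbol.exists_trace (h : HasSymbol t u V) (ht : 1 / 2 < t) :
    ∃ v : Lp ℂ 2 (volume : Measure (Bdry N)), IsTrace u v ∧
      (𝓕 v : Lp ℂ 2 (volume : Measure (Bdry N))) =ᵐ[volume] part V 0 := by
  have hP2 := memLp_part ht h.1 h.2.1 0
  obtain ⟨P, hP⟩ : ∃ P : Lp ℂ 2 (volume : Measure (Bdry N)), P = hP2.toLp _ := ⟨_, rfl⟩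
  have hPae : P =ᵐ[volume] part V 0 := hP ▸ hP2.coeFn_toLp
  refine ⟨𝓕⁻ P, ?_, by rw [fourier_fourierInv_eq]; exact hPae⟩
  set v : Lp ℂ 2 (volume : Measure (Bdry N)) := 𝓕⁻ P with hv
  have hslab : ∀ ε : ℝ, ∫⁻ x in slab N ε, ‖u x - v (tang x)‖ₑ ^ 2 =
      ∫⁻ x₀ in Set.Ioo 0 ε, ∫⁻ ξ, ‖part V x₀ ξ - part V 0 ξ‖ₑ ^ 2 := by
    intro ε
    rw [lintegral_slab (aemeasurable_trace_integrand h.aestronglyMeasurable v)]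
    refine lintegral_congr_ae ?_
    filter_upwards [ae_restrict_of_ae_restrict_of_subset Set.Ioo_subset_Ioi_self
      (h.isTangFourier ht)] with x₀ ⟨h1, h2⟩
    obtain ⟨S, hS⟩ : ∃ S : Lp ℂ 2 (volume : Measure (Bdry N)), S = h1.toLp _ := ⟨_, rfl⟩
    rw [← hS] at h2
    have hSae : S =ᵐ[volume] fun x' => u (glue x₀ x') := hS ▸ h1.coeFn_toLp
    have e1 : ∫⁻ x', ‖u (glue x₀ x') - v (tang (glue x₀ x'))‖ₑ ^ 2 = ‖S - v‖ₑ ^ 2 := by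
      rw [enorm_sq_Lp]
      refine lintegral_congr_ae ?_
      filter_upwards [hSae, Lp.coeFn_sub S v] with x' e1 e2
      rw [e2, Pi.sub_apply, e1, tang_glue]
    have e2 : ‖S - v‖ₑ = ‖𝓕 S - P‖ₑ := by
      rw [← ofReal_norm, ← ofReal_norm, ← Lp.norm_fourier_eq (S - v)]
      congr 2
      have := (Lp.fourierTransformₗᵢ (Bdry N) ℂ).map_sub S v
      change 𝓕 (S - v) = 𝓕 S - 𝓕 v at this
      rw [this, hv, fourier_fourierInv_eq]
    rw [e1, e2, enorm_sq_Lp]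
    refine lintegral_congr_ae ?_
    filter_upwards [h2, hPae, Lp.coeFn_sub (𝓕 S) P] with ξ e1 e2 e3
    rw [e3, Pi.sub_apply, e1, e2]
  have hD := tendsto_part_zero ht h.1 h.2.1
  unfold IsTrace
  rw [ENNReal.tendsto_nhds_zero] at hD ⊢
  intro δ hδ
  obtain ⟨η, hη, hηD⟩ := Metric.eventually_nhds_iff.1 (hD δ hδ)
  filter_upwards [Ioo_mem_nhdsGT hη] with ε hε
  change (∫⁻ x in slab N ε, ‖u x - v (tang x)‖ₑ ^ 2) / ENNReal.ofReal ε ≤ δ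
  rw [hslab]
  refine ENNReal.div_le_of_le_mul ?_
  calc _ ≤ ∫⁻ x₀ in Set.Ioo 0 ε, δ := by
        refine setLIntegral_mono measurable_const fun x hx => hηD ?_
        rw [Real.dist_eq, sub_zero, abs_of_pos hx.1]
        exact hx.2.trans hε.2
    _ = _ := by simp

lemma HasSymbol.fourier_trace (h : HasSymbol t u V) (ht : 1 / 2 < t) :
    (𝓕 (trace u) : Lp ℂ 2 (volume : Measure (Bdry N))) =ᵐ[volume] part V 0 := by
  obtain ⟨v, h1, h2⟩ := h.exists_trace ht
  rwa [h1.trace_eq h.aestronglyMeasurable]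

lemma HasSymbol.isTrace_zero_iff (h : HasSymbol t u V) (ht : 1 / 2 < t) :
    IsTrace u 0 ↔ part V 0 =ᵐ[volume] 0 := by
  obtain ⟨v, h1, h2⟩ := h.exists_trace ht
  constructor
  · intro h0
    have : v = 0 := h1.unique h.aestronglyMeasurable h0
    rw [this, FourierTransform.fourier_zero] at h2
    exact h2.symm.trans (Lp.coeFn_zero _ _ _)
  · intro h0
    have : 𝓕 v = 0 := Lp.ext ((h2.trans h0).trans (Lp.coeFn_zero _ _ _).symm)
    have hv : v = 0 := by
      rw [← fourierInv_fourier_eq (F := Lp ℂ 2 (volume : Measure (Bdry N))) v, this,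
        FourierTransform.fourierInv_zero]
    rwa [hv] at h1

end Traces

/-! ### Bounded solutions of second order equations on the half line -/

section HalfLineODE

lemma exists_const_of_hasDerivAt_zero {f : ℝ → ℂ} (h : ∀ x : ℝ, 0 < x → HasDerivAt f 0 x) :
    ∃ c, ∀ x : ℝ, 0 < x → f x = c := by
  obtain ⟨a, ha⟩ := isOpen_Ioi.exists_is_const_of_deriv_eq_zero (isPreconnected_Ioi (a := (0 : ℝ)))
    (f := f) (fun x hx => (h x hx).differentiableAt.differentiableWithinAt)
    (fun x hx => (h x hx).deriv)
  exact ⟨a, fun x hx => ha x hx⟩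

lemma hasDerivAt_cexp_mul (κ x : ℝ) :
    HasDerivAt (fun x : ℝ => (Real.exp (κ * x) : ℂ)) (κ * Real.exp (κ * x) : ℂ) x := by
  have h : HasDerivAt (fun x : ℝ => Real.exp (κ * x)) (Real.exp (κ * x) * κ) x := by
    simpa using ((hasDerivAt_id x).const_mul κ).exp
  have := h.ofReal_comp
  simpa [mul_comm] using this

lemma exp_mul_exp_neg (κ x : ℝ) : (Real.exp (κ * x) : ℂ) * Real.exp (-κ * x) = 1 := by
  rw [← Complex.ofReal_mul, ← Real.exp_add]; simp

/-- A bounded solution of `y' = κ y`, `κ > 0`, on `(0, ∞)` vanishes. -/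
lemma eq_zero_of_first_order {κ : ℝ} (hκ : 0 < κ) {y : ℝ → ℂ}
    (h : ∀ x : ℝ, 0 < x → HasDerivAt y (κ * y x) x) {B : ℝ} (hB : ∀ x : ℝ, 0 < x → ‖y x‖ ≤ B) :
    ∀ x : ℝ, 0 < x → y x = 0 := by
  obtain ⟨K, hK⟩ := exists_const_of_hasDerivAt_zero
    (f := fun x => (Real.exp (-κ * x) : ℂ) * y x) (fun x hx => by
      have := (hasDerivAt_cexp_mul (-κ) x).mul (h x hx)
      refine this.congr_deriv ?_
      push_cast; ring)
  have hyK : ∀ x : ℝ, 0 < x → y x = K * Real.exp (κ * x) := fun x hx => by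
    rw [← hK x hx, mul_right_comm, mul_comm ((Real.exp (-κ * x) : ℂ)), exp_mul_exp_neg, one_mul]
  have hK0 : K = 0 := by
    by_contra hne
    have hlim : Tendsto (fun x : ℝ => ‖K‖ * Real.exp (κ * x)) atTop atTop :=
      (Real.tendsto_exp_atTop.comp (tendsto_id.const_mul_atTop hκ)).const_mul_atTop
        (norm_pos_iff.2 hne)
    obtain ⟨x, hx1, hx2⟩ := ((hlim.eventually_gt_atTop B).and (eventually_gt_atTop 0)).exists
    have := hB x hx2
    rw [hyK x hx2, norm_mul, Complex.norm_real, Real.norm_eq_abs, abs_of_pos (Real.exp_pos _)] at this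
    linarith
  intro x hx
  rw [hyK x hx, hK0, zero_mul]

/-- A bounded solution of `y'' = κ² y`, `κ > 0`, on `(0, ∞)` is a multiple of `e^{-κ x}`. -/
lemma exists_eq_exp_of_second_order {κ : ℝ} (hκ : 0 < κ) {y y₁ : ℝ → ℂ}
    (h : ∀ x : ℝ, 0 < x → HasDerivAt y (y₁ x) x)
    (h₁ : ∀ x : ℝ, 0 < x → HasDerivAt y₁ (κ ^ 2 * y x) x)
    {B : ℝ} (hB : ∀ x : ℝ, 0 < x → ‖y x‖ ≤ B) :
    ∃ C : ℂ, ∀ x : ℝ, 0 < x → y x = C * Real.exp (-κ * x) := by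
  have hκ0 : (κ : ℂ) ≠ 0 := by exact_mod_cast hκ.ne'
  -- the first integral `(y' + κ y) e^{-κ x} = K`
  obtain ⟨K, hK⟩ := exists_const_of_hasDerivAt_zero
    (f := fun x => (Real.exp (-κ * x) : ℂ) * (y₁ x + κ * y x)) (fun x hx => by
      have := (hasDerivAt_cexp_mul (-κ) x).mul ((h₁ x hx).add ((h x hx).const_mul (κ : ℂ)))
      refine this.congr_deriv ?_
      simp only [Pi.add_apply]
      push_cast; ring)
  have hz : ∀ x : ℝ, 0 < x → y₁ x + κ * y x = K * Real.exp (κ * x) := fun x hx => by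
    rw [← hK x hx, mul_right_comm, mul_comm ((Real.exp (-κ * x) : ℂ)), exp_mul_exp_neg, one_mul]
  obtain ⟨C, hC⟩ := exists_const_of_hasDerivAt_zero
    (f := fun x => (Real.exp (κ * x) : ℂ) * (y x - K / (2 * κ) * Real.exp (κ * x))) (fun x hx => by
      have := (hasDerivAt_cexp_mul κ x).mul
        ((h x hx).sub ((hasDerivAt_cexp_mul κ x).const_mul (K / (2 * κ))))
      refine this.congr_deriv ?_
      have e : y₁ x = K * Real.exp (κ * x) - κ * y x := by rw [← hz x hx]; ring
      simp only [Pi.sub_apply]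
      rw [e]
      field_simp
      ring)
  have hy : ∀ x : ℝ, 0 < x → y x = C * Real.exp (-κ * x) + K / (2 * κ) * Real.exp (κ * x) :=
    fun x hx => by
      rw [← hC x hx, mul_right_comm, exp_mul_exp_neg, one_mul]; ring
  have hK0 : ∀ x : ℝ, 0 < x → K / (2 * κ) * Real.exp (κ * x) = (0 : ℂ) := by
    refine eq_zero_of_first_order hκ (y := fun x => K / (2 * κ) * Real.exp (κ * x))
      (fun x _ => ?_) (B := B + ‖C‖) fun x hx => ?_
    · refine ((hasDerivAt_cexp_mul κ x).const_mul (K / (2 * κ))).congr_deriv ?_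
      ring
    · have e : K / (2 * κ) * Real.exp (κ * x) = y x - C * Real.exp (-κ * x) := by
        rw [hy x hx]; ring
      rw [e]
      refine (norm_sub_le _ _).trans (add_le_add (hB x hx) ?_)
      rw [norm_mul, Complex.norm_real, Real.norm_eq_abs, abs_of_pos (Real.exp_pos _)]
      refine mul_le_of_le_one_right (norm_nonneg _) ?_
      rw [Real.exp_le_one_iff]
      nlinarith
  exact ⟨C, fun x hx => by rw [hy x hx, hK0 x hx, add_zero]⟩

end HalfLineODE

/-! ### The symbols of exponentials -/

/-- The symbol `(2κ)^M / ((κ + 2πiτ)(κ - 2πiτ)^M)`. Its inverse Fourier transform is an extension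
of `e^{-κx}`, `x ≥ 0`, to the real line, of a smoothness that grows with `M`. -/
def expSym (M : ℕ) (κ τ : ℝ) : ℂ :=
  (2 * κ) ^ M / ((κ + 2 * Real.pi * Complex.I * τ) * (κ - 2 * Real.pi * Complex.I * τ) ^ M)

section ExpSym

lemma hasDerivAt_fourierInv {g : ℝ → ℂ} (hg : Integrable g)
    (hg' : Integrable fun τ : ℝ => (τ : ℂ) * g τ) (x : ℝ) :
    HasDerivAt (𝓕⁻ g) (𝓕⁻ (fun τ : ℝ => (2 * Real.pi * Complex.I * τ) * g τ) x) x := by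
  have h1 : Integrable fun τ : ℝ => g (-τ) := hg.comp_neg
  have h2 : Integrable fun τ : ℝ => τ • g (-τ) := by
    have := hg'.comp_neg.neg
    refine this.congr (Eventually.of_forall fun τ => ?_)
    simp
  have := Real.hasDerivAt_fourier h1 h2 x
  rw [Real.fourierInv_eq_fourier_comp_neg, Real.fourierInv_eq_fourier_comp_neg]
  convert this using 2
  congr 1
  ext τ
  simp

lemma norm_add_two_pi_I (κ τ : ℝ) :
    ‖(κ : ℂ) + 2 * Real.pi * Complex.I * τ‖ ^ 2 = κ ^ 2 + (2 * Real.pi * τ) ^ 2 := by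
  rw [← Complex.normSq_eq_norm_sq, Complex.normSq_apply]
  simp; ring

lemma norm_sub_two_pi_I (κ τ : ℝ) :
    ‖(κ : ℂ) - 2 * Real.pi * Complex.I * τ‖ ^ 2 = κ ^ 2 + (2 * Real.pi * τ) ^ 2 := by
  rw [← Complex.normSq_eq_norm_sq, Complex.normSq_apply]
  simp; ring

lemma add_two_pi_I_ne {κ : ℝ} (hκ : 0 < κ) (τ : ℝ) : (κ : ℂ) + 2 * Real.pi * Complex.I * τ ≠ 0 := by
  intro h
  have := norm_add_two_pi_I κ τ
  rw [h] at this
  have h2 : 0 < κ ^ 2 + (2 * Real.pi * τ) ^ 2 := by positivity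
  simp at this; linarith

lemma sub_two_pi_I_ne {κ : ℝ} (hκ : 0 < κ) (τ : ℝ) : (κ : ℂ) - 2 * Real.pi * Complex.I * τ ≠ 0 := by
  intro h
  have := norm_sub_two_pi_I κ τ
  rw [h] at this
  have h2 : 0 < κ ^ 2 + (2 * Real.pi * τ) ^ 2 := by positivity
  simp at this; linarith

lemma norm_expSym_sq (M : ℕ) (κ τ : ℝ) :
    ‖expSym M κ τ‖ ^ 2 = (2 * κ) ^ (2 * M) / (κ ^ 2 + (2 * Real.pi * τ) ^ 2) ^ (M + 1) := by
  unfold expSym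
  rw [norm_div, norm_mul, norm_pow, norm_pow, div_pow, mul_pow, ← pow_mul, ← pow_mul, mul_comm M 2,
    pow_mul ‖(κ : ℂ) - _‖, norm_sub_two_pi_I, norm_add_two_pi_I, pow_succ' _ M, pow_mul]
  congr 1
  rw [pow_mul]
  congr 1
  simp [mul_pow]

lemma measurable_expSym (M : ℕ) : Measurable fun p : ℝ × ℝ => expSym M p.1 p.2 := by
  unfold expSym
  fun_prop

lemma lineInt_expSym_le {M : ℕ} {t κ : ℝ} (hM : t + 1 / 2 < M + 1) (hκ : 0 < κ) :
    lineInt t κ (expSym M κ) ≤ ENNReal.ofReal (4 ^ M * wtConst (M + 1 - t) * κ ^ (2 * t - 1)) := by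
  unfold lineInt
  have h1 : ∀ τ : ℝ, ENNReal.ofReal ((κ ^ 2 + (2 * Real.pi * τ) ^ 2) ^ t) * ‖expSym M κ τ‖ₑ ^ 2 =
      ENNReal.ofReal ((2 * κ) ^ (2 * M)) *
        ENNReal.ofReal ((κ ^ 2 + (2 * Real.pi * τ) ^ 2) ^ (-(M + 1 - t))) := by
    intro τ
    have hp : 0 < κ ^ 2 + (2 * Real.pi * τ) ^ 2 := by positivity
    rw [← ofReal_norm, ← ENNReal.ofReal_pow (norm_nonneg _), norm_expSym_sq,
      ← ENNReal.ofReal_mul (by positivity), ← ENNReal.ofReal_mul (by positivity)]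
    congr 1
    rw [neg_sub, Real.rpow_sub hp]
    have : (κ ^ 2 + (2 * Real.pi * τ) ^ 2) ^ ((M : ℝ) + 1) =
        (κ ^ 2 + (2 * Real.pi * τ) ^ 2) ^ (M + 1) := by exact_mod_cast Real.rpow_natCast _ _
    rw [this]; ring
  simp_rw [h1]
  rw [lintegral_const_mul' _ _ ENNReal.ofReal_ne_top, lintegral_wt (by linarith) hκ,
    ← ENNReal.ofReal_mul (by positivity)]
  apply le_of_eq
  congr 1
  have e : κ ^ (1 - 2 * ((M : ℝ) + 1 - t)) = κ ^ (2 * t - 1) * (κ ^ (2 * M))⁻¹ := by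
    rw [← Real.rpow_natCast κ (2 * M), ← Real.rpow_neg hκ.le, ← Real.rpow_add hκ]
    congr 1; push_cast; ring
  rw [e, mul_pow, pow_mul (2 : ℝ) 2 M]
  have : κ ^ (2 * M) ≠ 0 := by positivity
  field_simp
  norm_num [mul_comm]

lemma measurable_expSym_right (M : ℕ) (κ : ℝ) : Measurable (expSym M κ) :=
  (measurable_expSym M).comp (measurable_const.prodMk measurable_id)

lemma integrable_expSym {M : ℕ} (hM : 1 ≤ M) {κ : ℝ} (hκ : 0 < κ) : Integrable (expSym M κ) := by
  have hM' : (1 : ℝ) ≤ M := by exact_mod_cast hM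
  refine integrable_of_lineInt (t := 1) (by norm_num) hκ (measurable_expSym_right M κ) ?_
  exact (lineInt_expSym_le (by linarith) hκ).trans_lt ENNReal.ofReal_lt_top

lemma lineInt_mul_id_le (t κ : ℝ) (hκ : 0 < κ) (g : ℝ → ℂ) :
    lineInt (t - 1) κ (fun τ => (2 * Real.pi * Complex.I * τ) * g τ) ≤ lineInt t κ g := by
  unfold lineInt
  refine lintegral_mono fun τ => ?_
  rw [enorm_mul, mul_pow ‖_‖ₑ, ← mul_assoc]
  gcongr
  have hp : 0 < κ ^ 2 + (2 * Real.pi * τ) ^ 2 := by positivity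
  rw [← ofReal_norm, ← ENNReal.ofReal_pow (norm_nonneg _), ← ENNReal.ofReal_mul (by positivity)]
  apply ENNReal.ofReal_le_ofReal
  have h1 : ‖2 * (Real.pi : ℂ) * Complex.I * τ‖ ^ 2 = (2 * Real.pi * τ) ^ 2 := by
    simp [mul_pow]
  rw [h1]
  calc _ ≤ (κ ^ 2 + (2 * Real.pi * τ) ^ 2) ^ (t - 1) * (κ ^ 2 + (2 * Real.pi * τ) ^ 2) := by
        gcongr; nlinarith [sq_nonneg κ]
    _ = _ := by rw [← Real.rpow_add_one hp.ne']; simp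

lemma measurable_two_pi_I_mul {g : ℝ → ℂ} (hg : Measurable g) :
    Measurable fun τ : ℝ => (2 * Real.pi * Complex.I * τ) * g τ := by
  have : Measurable fun τ : ℝ => (2 * Real.pi * Complex.I * (τ : ℂ)) := by fun_prop
  exact this.mul hg

lemma integrable_two_pi_I_mul {t κ : ℝ} (ht : 3 / 2 < t) (hκ : 0 < κ) {g : ℝ → ℂ}
    (hg : Measurable g) (h : lineInt t κ g < ⊤) :
    Integrable fun τ : ℝ => (2 * Real.pi * Complex.I * τ) * g τ :=
  integrable_of_lineInt (t := t - 1) (by linarith) hκ (measurable_two_pi_I_mul hg)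
    ((lineInt_mul_id_le t κ hκ g).trans_lt h)

lemma hasDerivAt_fourierInv' {t κ : ℝ} (ht : 3 / 2 < t) (hκ : 0 < κ) {g : ℝ → ℂ}
    (hg : Measurable g) (h : lineInt t κ g < ⊤) (x : ℝ) :
    HasDerivAt (𝓕⁻ g) (𝓕⁻ (fun τ : ℝ => (2 * Real.pi * Complex.I * τ) * g τ) x) x := by
  refine hasDerivAt_fourierInv (integrable_of_lineInt (by linarith) hκ hg h) ?_ x
  have := (integrable_two_pi_I_mul ht hκ hg h).const_mul (2 * Real.pi * Complex.I)⁻¹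
  refine this.congr (Eventually.of_forall fun τ => ?_)
  have : (2 * Real.pi * Complex.I : ℂ) ≠ 0 := by simp [Real.pi_ne_zero]
  field_simp

lemma norm_fourierInv_le (g : ℝ → ℂ) (x : ℝ) : ‖𝓕⁻ g x‖ ≤ ∫ τ, ‖g τ‖ := by
  rw [Real.fourierInv_eq']
  refine (norm_integral_le_integral_norm _).trans (le_of_eq ?_)
  congr 1; ext τ
  rw [norm_smul, Complex.norm_exp_ofReal_mul_I, one_mul]

lemma expSym_one (κ : ℝ) (τ : ℝ) :
    expSym 1 κ τ = 2 * κ / (κ ^ 2 + (2 * Real.pi * τ) ^ 2) := by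
  unfold expSym
  rw [pow_one, pow_one]
  congr 1
  ring_nf
  rw [Complex.I_sq]; ring

lemma integrable_exp_neg_abs {κ : ℝ} (hκ : 0 < κ) :
    Integrable fun x : ℝ => (Real.exp (-κ * |x|) : ℂ) := by
  rw [← integrableOn_univ, ← Set.Iic_union_Ioi (a := (0 : ℝ)), integrableOn_union]
  constructor
  · refine (integrableOn_exp_mul_complex_Iic (a := (κ : ℂ)) (by simpa using hκ) 0).congr_fun
      (fun x hx => ?_) measurableSet_Iic
    simp only
    rw [abs_of_nonpos hx]; push_cast; ring_nf
  · refine (integrableOn_exp_mul_complex_Ioi (a := -(κ : ℂ)) (by simpa using hκ) 0).congr_fun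
      (fun x hx => ?_) measurableSet_Ioi
    simp only
    rw [abs_of_pos hx]; push_cast; ring_nf

lemma fourier_exp_neg_abs {κ : ℝ} (hκ : 0 < κ) :
    𝓕 (fun x : ℝ => (Real.exp (-κ * |x|) : ℂ)) = expSym 1 κ := by
  ext τ
  rw [Real.fourier_real_eq_integral_exp_smul]
  have hre1 : (-(κ : ℂ) - 2 * Real.pi * Complex.I * τ).re < 0 := by simpa using hκ
  have hre2 : 0 < ((κ : ℂ) - 2 * Real.pi * Complex.I * τ).re := by simpa using hκ
  have hint : Integrable fun x : ℝ =>
      Complex.exp (↑(-2 * Real.pi * x * τ) * Complex.I) • (Real.exp (-κ * |x|) : ℂ) := by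
    refine (integrable_norm_iff ?_).1 ?_
    · apply Continuous.aestronglyMeasurable
      fun_prop
    · refine (integrable_exp_neg_abs hκ).norm.congr (Eventually.of_forall fun x => ?_)
      simp only
      rw [norm_smul, Complex.norm_exp_ofReal_mul_I, one_mul]
  have e1 : ∫ x in Set.Ioi (0 : ℝ), Complex.exp (↑(-2 * Real.pi * x * τ) * Complex.I) •
      (Real.exp (-κ * |x|) : ℂ) = 1 / (κ + 2 * Real.pi * Complex.I * τ) := by
    have : ∫ x in Set.Ioi (0 : ℝ), Complex.exp (↑(-2 * Real.pi * x * τ) * Complex.I) •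
      (Real.exp (-κ * |x|) : ℂ) =
        ∫ x in Set.Ioi (0 : ℝ), Complex.exp ((-(κ : ℂ) - 2 * Real.pi * Complex.I * τ) * x) := by
      refine setIntegral_congr_fun measurableSet_Ioi fun x hx => ?_
      rw [abs_of_pos hx, Complex.ofReal_exp, smul_eq_mul, ← Complex.exp_add]
      congr 1; push_cast; ring
    rw [this, integral_exp_mul_complex_Ioi hre1]
    simp only [Complex.ofReal_zero, mul_zero, Complex.exp_zero]
    rw [← neg_add', div_neg, neg_div, neg_neg]
  have e2 : ∫ x in Set.Iic (0 : ℝ), Complex.exp (↑(-2 * Real.pi * x * τ) * Complex.I) •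
      (Real.exp (-κ * |x|) : ℂ) = 1 / (κ - 2 * Real.pi * Complex.I * τ) := by
    have : ∫ x in Set.Iic (0 : ℝ), Complex.exp (↑(-2 * Real.pi * x * τ) * Complex.I) •
      (Real.exp (-κ * |x|) : ℂ) =
        ∫ x in Set.Iic (0 : ℝ), Complex.exp (((κ : ℂ) - 2 * Real.pi * Complex.I * τ) * x) := by
      refine setIntegral_congr_fun measurableSet_Iic fun x hx => ?_
      rw [abs_of_nonpos hx, Complex.ofReal_exp, smul_eq_mul, ← Complex.exp_add]
      congr 1; push_cast; ring
    rw [this, integral_exp_mul_complex_Iic hre2]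
    simp
  rw [← integral_add_compl measurableSet_Ioi hint, Set.compl_Ioi, e1, e2]
  have h1 := add_two_pi_I_ne hκ τ
  have h2 := sub_two_pi_I_ne hκ τ
  unfold expSym
  field_simp
  ring

lemma fourierInv_expSym_one {κ : ℝ} (hκ : 0 < κ) (x : ℝ) :
    𝓕⁻ (expSym 1 κ) x = Real.exp (-κ * |x|) := by
  have hc : Continuous fun x : ℝ => (Real.exp (-κ * |x|) : ℂ) := by fun_prop
  have := hc.fourierInv_fourier_eq (integrable_exp_neg_abs hκ)
    (by rw [fourier_exp_neg_abs hκ]; exact integrable_expSym le_rfl hκ)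
  rw [fourier_exp_neg_abs hκ] at this
  rw [this]

/-- On `x ≥ 0` the inverse Fourier transform of `expSym M κ` is `e^{-κx}`. The step from `M` to
`M + 1` holds because the difference of the two inverse Fourier transforms is a bounded solution of
`y' = κ y` on `(0, ∞)`. -/
lemma fourierInv_expSym {M : ℕ} (hM : 1 ≤ M) {κ : ℝ} (hκ : 0 < κ) {x : ℝ} (hx : 0 ≤ x) :
    𝓕⁻ (expSym M κ) x = Real.exp (-κ * x) := by
  -- it suffices to consider `x > 0`
  suffices H : ∀ x : ℝ, 0 < x → 𝓕⁻ (expSym M κ) x = Real.exp (-κ * x) by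
    have hcl : IsClosed {x : ℝ | 𝓕⁻ (expSym M κ) x = Real.exp (-κ * x)} :=
      isClosed_eq (continuous_fourierInv_real (integrable_expSym hM hκ)) (by fun_prop)
    have := hcl.closure_subset_iff.2 (show Set.Ioi (0 : ℝ) ⊆ _ from fun y hy => H y hy)
    rw [closure_Ioi] at this
    exact this hx
  clear hx x
  induction M, hM using Nat.le_induction with
  | base =>
    intro x hx
    rw [fourierInv_expSym_one hκ, abs_of_pos hx]
  | succ M hM ih =>
    have hM' : (1 : ℝ) ≤ M := by exact_mod_cast hM
    have hi := integrable_expSym (M := M + 1) (by omega) hκ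
    have hl : lineInt (9 / 5) κ (expSym (M + 1) κ) < ⊤ :=
      (lineInt_expSym_le (by push_cast; linarith) hκ).trans_lt ENNReal.ofReal_lt_top
    have hd := hasDerivAt_fourierInv' (t := 9 / 5) (by norm_num) hκ (measurable_expSym_right _ _) hl
    have hti := integrable_two_pi_I_mul (t := 9 / 5) (by norm_num) hκ
      (measurable_expSym_right _ _) hl
    have hrel : ∀ x, 𝓕⁻ (fun τ : ℝ => (2 * Real.pi * Complex.I * τ) * expSym (M + 1) κ τ) x =
        κ * 𝓕⁻ (expSym (M + 1) κ) x - 2 * κ * 𝓕⁻ (expSym M κ) x := by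
      intro x
      rw [← fourierInv_const_mul_real, ← fourierInv_const_mul_real,
        ← fourierInv_sub_real (hi.const_mul _) ((integrable_expSym hM hκ).const_mul _)]
      refine congrFun (congrArg (fun g : ℝ → ℂ => 𝓕⁻ g) ?_) x
      ext τ
      have h1 := add_two_pi_I_ne hκ τ
      have h2 := sub_two_pi_I_ne hκ τ
      unfold expSym
      field_simp
      ring
    have hz := eq_zero_of_first_order hκ
      (y := fun x => 𝓕⁻ (expSym (M + 1) κ) x - Real.exp (-κ * x)) (fun x hx => by
        refine ((hd x).sub (hasDerivAt_cexp_mul (-κ) x)).congr_deriv ?_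
        rw [hrel, ih x hx]
        push_cast; ring) (B := (∫ τ, ‖expSym (M + 1) κ τ‖) + 1) (fun x hx => by
        refine (norm_sub_le _ _).trans (add_le_add (norm_fourierInv_le _ _) ?_)
        rw [Complex.norm_real, Real.norm_eq_abs, abs_of_pos (Real.exp_pos _), Real.exp_le_one_iff]
        nlinarith)
    exact fun x hx => sub_eq_zero.1 (hz x hx)

/-- For `0 < λ ≤ μ` and `0 ≤ t ≤ 1` the symbol of `e^{-λ|x|}` has weighted norm at most
`C μ^{2t} / λ`. -/
lemma lineInt_expSym_one_le {t l m : ℝ} (ht0 : 0 ≤ t) (ht : t ≤ 1) (hl : 0 < l) (hlm : l ≤ m) :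
    lineInt t m (expSym 1 l) ≤ ENNReal.ofReal (4 * wtConst (2 - t) * (m ^ (2 * t) / l)) := by
  have hm : 0 < m := hl.trans_le hlm
  have h := lineInt_expSym_le (M := 1) (t := t) (κ := l) (by push_cast; linarith) hl
  have h2 : lineInt t m (expSym 1 l) ≤ ENNReal.ofReal ((m / l) ^ (2 * t)) *
      lineInt t l (expSym 1 l) := by
    unfold lineInt
    rw [← lintegral_const_mul' _ _ ENNReal.ofReal_ne_top]
    refine lintegral_mono fun τ => ?_
    simp only
    rw [← mul_assoc, ← ENNReal.ofReal_mul (by positivity)]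
    gcongr
    have e : (m / l) ^ (2 * t) = ((m / l) ^ 2) ^ t := by
      rw [← Real.rpow_natCast, ← Real.rpow_mul (by positivity)]; norm_num
    rw [e, ← Real.mul_rpow (by positivity) (by positivity)]
    refine Real.rpow_le_rpow (by positivity) ?_ ht0
    rw [div_pow, mul_add]
    have h1 : m ^ 2 / l ^ 2 * l ^ 2 = m ^ 2 := by field_simp
    have h3 : 1 ≤ m ^ 2 / l ^ 2 := by
      rw [one_le_div (by positivity)]; gcongr
    rw [h1]
    nlinarith [sq_nonneg (2 * Real.pi * τ)]
  refine (h2.trans (mul_le_mul_right h _)).trans (le_of_eq ?_)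
  rw [← ENNReal.ofReal_mul (by positivity)]
  congr 1
  rw [Real.div_rpow hm.le hl.le, Real.rpow_sub hl, Real.rpow_one]
  have : l ^ (2 * t) ≠ 0 := by positivity
  have e : ((1 : ℕ) : ℝ) + 1 - t = 2 - t := by push_cast; ring
  rw [e]
  field_simp

end ExpSym

/-! ### Reduction of the boundary value problem to the fibres -/

/-- The symbol of `kTilde v`, where `w` is the Fourier transform of `v`. -/
def kSym {N : ℕ} (M : ℕ) (w : Bdry N → ℂ) : Amb N → ℂ := fun ξ =>
  (-mu (tang ξ) * w (tang ξ)) * expSym M (mu (tang ξ)) (ξ 0)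

/-- The symbol of the exterior derivative. -/
def extDSym {N : ℕ} (V : Form N) : Form N := fun K ξ =>
  ∑ j ∈ K, (-1 : ℂ) ^ (K.filter (· < j)).card * dSym j (V (K.erase j)) ξ

/-- The fibrewise form of the boundary value problem for one coefficient `φ_I` with symbol `V`,
where `a` is the symbol of `α_I`. The case `normal` is `0 ∈ I`. -/
def FiberSol {N : ℕ} (normal : Prop) (V a : Amb N → ℂ) : Prop :=
  ∀ᵐ ξ : Bdry N,
    (normal → (∀ x : ℝ, 0 ≤ x → -part (dSym 0 (dSym 0 V)) x ξ + (lam ξ : ℂ) ^ 2 * part V x ξ +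
        (mu ξ : ℂ) ^ 2 * Real.exp (-mu ξ * x) * part V 0 ξ = part a x ξ) ∧
      part (dSym 0 V) 0 ξ = 0) ∧
    (¬ normal → (∀ x : ℝ, 0 ≤ x → -part (dSym 0 (dSym 0 V)) x ξ + (lam ξ : ℂ) ^ 2 * part V x ξ -
        mu ξ * Real.exp (-mu ξ * x) * part (dSym 0 V) 0 ξ = part a x ξ) ∧
      part (dSym 0 (dSym 0 V)) 0 ξ = 0)

section Reduction

variable {N : ℕ} {s t : ℝ} {u V : Amb N → ℂ}

lemma part_dSym_of_ne {j : Fin (N + 1)} (hj : j ≠ 0) (V : Amb N → ℂ) (x : ℝ) (ξ : Bdry N) :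
    part (dSym j V) x ξ = (2 * Real.pi * Complex.I * (glue 0 ξ j : ℂ)) * part V x ξ := by
  obtain ⟨i, rfl⟩ := Fin.exists_succ_eq.2 hj
  unfold part dSym
  simp only [glue_succ]
  rw [← fourierInv_const_mul_real]

lemma part_add {W : Amb N → ℂ} {ξ : Bdry N} (h : Integrable fun τ => V (glue τ ξ))
    (h' : Integrable fun τ => W (glue τ ξ)) (x : ℝ) :
    part (fun ξ => V ξ + W ξ) x ξ = part V x ξ + part W x ξ := fourierInv_add_real h h' x

lemma part_const_mul (c : ℂ) (V : Amb N → ℂ) (x : ℝ) (ξ : Bdry N) :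
    part (fun ξ => c * V ξ) x ξ = c * part V x ξ := fourierInv_const_mul_real c _ x

lemma part_zero (x : ℝ) (ξ : Bdry N) : part (0 : Amb N → ℂ) x ξ = 0 := by
  unfold part
  simp [Real.fourierInv_eq']

lemma part_zero' (x : ℝ) (ξ : Bdry N) : part (fun _ : Amb N => (0 : ℂ)) x ξ = 0 := part_zero x ξ

lemma part_sum {ι : Type*} (S : Finset ι) (c : ι → ℂ) (V : ι → Amb N → ℂ) {ξ : Bdry N}
    (h : ∀ i ∈ S, Integrable fun τ => V i (glue τ ξ)) (x : ℝ) :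
    part (fun ξ => ∑ i ∈ S, c i * V i ξ) x ξ = ∑ i ∈ S, c i * part (V i) x ξ := by
  classical
  induction S using Finset.induction_on with
  | empty => simp [part_zero']
  | insert a S ha ih =>
    simp only [Finset.sum_insert ha]
    rw [part_add ((h a (by simp)).const_mul _), part_const_mul, ih fun i hi => h i (by simp [hi])]
    exact integrable_finsetSum _ fun i hi => (h i (by simp [hi])).const_mul _

lemma hasDerivAt_part {ξ : Bdry N} (ht : 3 / 2 < t) (hV : Measurable V)
    (h : lineInt t (mu ξ) (fun τ => V (glue τ ξ)) < ⊤) (x : ℝ) :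
    HasDerivAt (fun x => part V x ξ) (part (dSym 0 V) x ξ) x :=
  hasDerivAt_fourierInv' ht (mu_pos ξ) (measurable_comp_glue hV ξ) h x

lemma measurable_kSym (M : ℕ) {w : Bdry N → ℂ} (hw : Measurable w) : Measurable (kSym M w) := by
  have h1 : Measurable fun ξ : Amb N => mu (tang ξ) := measurable_mu.comp measurable_tang
  have h0 : Measurable fun ξ : Amb N => ξ 0 := by fun_prop
  unfold kSym
  exact ((Complex.measurable_ofReal.comp h1).neg.mul (hw.comp measurable_tang)).mul
    ((measurable_expSym M).comp (h1.prodMk h0))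

lemma lineInt_const_mul (t κ : ℝ) (c : ℂ) (g : ℝ → ℂ) :
    lineInt t κ (fun τ => c * g τ) = ‖c‖ₑ ^ 2 * lineInt t κ g := by
  unfold lineInt
  rw [← lintegral_const_mul' _ _ (by finiteness)]
  refine lintegral_congr fun ξ => ?_
  rw [enorm_mul]; ring

lemma symInt_kSym_lt_top {M : ℕ} {σ : ℝ} (hM : σ + 1 / 2 < M + 1) {w : Bdry N → ℂ}
    (hw : Measurable w)
    (h : ∫⁻ ξ, ENNReal.ofReal (mu ξ ^ (2 * σ + 1)) * ‖w ξ‖ₑ ^ 2 < ⊤) :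
    symInt σ (kSym M w) < ⊤ := by
  rw [symInt_eq σ (measurable_kSym M hw)]
  refine lt_of_le_of_lt ?_ (ENNReal.mul_lt_top
    (ENNReal.ofReal_lt_top (r := 4 ^ M * wtConst (M + 1 - σ))) h)
  rw [← lintegral_const_mul' _ _ ENNReal.ofReal_ne_top]
  refine lintegral_mono fun ξ => ?_
  have hm := mu_pos ξ
  have e : (fun τ => kSym M w (glue τ ξ)) = fun τ => (-mu ξ * w ξ : ℂ) * expSym M (mu ξ) τ := by
    ext τ; simp [kSym]
  rw [e, lineInt_const_mul]
  refine (mul_le_mul_right (lineInt_expSym_le hM hm) _).trans (le_of_eq ?_)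
  rw [enorm_mul, mul_pow, enorm_neg, ← ofReal_norm (mu ξ : ℂ), Complex.norm_real,
    Real.norm_eq_abs, abs_of_pos hm, ← ENNReal.ofReal_pow hm.le]
  rw [mul_right_comm, ← ENNReal.ofReal_mul (by positivity), ← mul_assoc (ENNReal.ofReal _),
    ← ENNReal.ofReal_mul (by have := wtConst_nonneg (M + 1 - σ); positivity)]
  congr 2
  have : mu ξ ^ (2 * σ + 1) = mu ξ ^ 2 * mu ξ ^ (2 * σ - 1) := by
    rw [← Real.rpow_natCast, ← Real.rpow_add hm]; congr 1; push_cast; ring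
  rw [this]; ring

lemma part_kSym {M : ℕ} (hM : 1 ≤ M) (w : Bdry N → ℂ) {x : ℝ} (hx : 0 ≤ x) (ξ : Bdry N) :
    part (kSym M w) x ξ = -mu ξ * w ξ * Real.exp (-mu ξ * x) := by
  have e : (fun τ => kSym M w (glue τ ξ)) = fun τ => (-mu ξ * w ξ : ℂ) * expSym M (mu ξ) τ := by
    ext τ; simp [kSym]
  rw [part, e, fourierInv_const_mul_real, fourierInv_expSym hM (mu_pos ξ) hx]

lemma part_dSym_kSym {M : ℕ} (hM : 2 ≤ M) (w : Bdry N → ℂ) {x : ℝ} (hx : 0 ≤ x) (ξ : Bdry N) :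
    part (dSym 0 (kSym M w)) x ξ = (mu ξ : ℂ) ^ 2 * w ξ * Real.exp (-mu ξ * x) := by
  have hM2 : (2 : ℝ) ≤ M := by exact_mod_cast hM
  have e : (fun τ => dSym 0 (kSym M w) (glue τ ξ)) =
      fun τ : ℝ => (-mu ξ * w ξ : ℂ) * ((2 * Real.pi * Complex.I * τ) * expSym M (mu ξ) τ) := by
    ext τ; simp [kSym, dSym]; ring
  have hl : lineInt 2 (mu ξ) (expSym M (mu ξ)) < ⊤ :=
    (lineInt_expSym_le (by linarith) (mu_pos ξ)).trans_lt ENNReal.ofReal_lt_top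
  have hd := hasDerivAt_fourierInv' (t := 2) (by norm_num) (mu_pos ξ)
    (measurable_expSym_right _ _) hl
  -- equality of the derivatives on `(0, ∞)`, extended to `0` by continuity
  have H : ∀ x : ℝ, 0 < x → 𝓕⁻ (fun τ : ℝ => (2 * Real.pi * Complex.I * τ) * expSym M (mu ξ) τ) x =
      -mu ξ * Real.exp (-mu ξ * x) := by
    intro x hx
    refine (hd x).unique ?_
    have h1 : HasDerivAt (fun x : ℝ => (Real.exp (-mu ξ * x) : ℂ))
        (-mu ξ * Real.exp (-mu ξ * x)) x := by
      refine (hasDerivAt_cexp_mul (-mu ξ) x).congr_deriv ?_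
      push_cast; ring
    refine h1.congr_of_eventuallyEq ?_
    filter_upwards [Ioi_mem_nhds hx] with y hy
    exact fourierInv_expSym (by omega) (mu_pos ξ) (le_of_lt hy)
  have hcl : IsClosed {x : ℝ | 𝓕⁻ (fun τ : ℝ => (2 * Real.pi * Complex.I * τ) * expSym M (mu ξ) τ) x =
      -mu ξ * Real.exp (-mu ξ * x)} :=
    isClosed_eq (continuous_fourierInv_real (integrable_two_pi_I_mul (t := 2) (by norm_num)
      (mu_pos ξ) (measurable_expSym_right _ _) hl)) (by fun_prop)
  have := hcl.closure_subset_iff.2 (show Set.Ioi (0 : ℝ) ⊆ _ from fun y hy => H y hy)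
  rw [closure_Ioi] at this
  rw [part, e, fourierInv_const_mul_real, this hx]
  ring

/-- The function `kTilde v` on the half space in terms of symbols. -/
lemma hasSymbol_kTilde {M : ℕ} (hM1 : 1 ≤ M) {σ : ℝ} (hσ : 1 / 2 < σ) (hM : σ + 1 / 2 < M + 1)
    {w : Bdry N → ℂ} (hw : Measurable w)
    (h : ∫⁻ ξ, ENNReal.ofReal (mu ξ ^ (2 * σ + 1)) * ‖w ξ‖ₑ ^ 2 < ⊤)
    {v : Lp ℂ 2 (volume : Measure (Bdry N))}
    (hv : (𝓕 v : Lp ℂ 2 (volume : Measure (Bdry N))) =ᵐ[volume] w) :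
    HasSymbol σ (kTilde v) (kSym M w) := by
  obtain ⟨u, hu⟩ := exists_hasSymbol (by linarith) (measurable_kSym M hw)
    (symInt_kSym_lt_top hM hw h)
  refine hu.congr ?_
  obtain ⟨vh, hvh⟩ : ∃ vh : Bdry N → ℂ, vh = (𝓕 v : Lp ℂ 2 (volume : Measure (Bdry N))) := ⟨_, rfl⟩
  have hvhm : Measurable vh := hvh ▸ (Lp.stronglyMeasurable _).measurable
  have hvh2 : MemLp vh 2 := hvh ▸ Lp.memLp _
  have hk : kTilde v = fun x => 𝓕⁻ (fun ξ : Bdry N =>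
      ((-mu ξ * Real.exp (-mu ξ * x 0) : ℝ) : ℂ) * vh ξ) (tang x) := by
    rw [hvh]; rfl
  have hkm : Measurable (kTilde v) := by
    rw [hk]
    simp only [Real.fourierInv_eq']
    have hmm : Measurable (Function.uncurry fun (x : Amb N) (ξ : Bdry N) =>
        Complex.exp (↑(2 * Real.pi * inner ℝ ξ (tang x)) * Complex.I) •
          (((-mu ξ * Real.exp (-mu ξ * x 0) : ℝ) : ℂ) * vh ξ)) := by
      have m1 : Continuous fun p : Amb N × Bdry N =>
          Complex.exp (↑(2 * Real.pi * inner ℝ p.2 (tang p.1)) * Complex.I) := by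
        have := continuous_tang (N := N)
        fun_prop
      have m2 : Continuous fun p : Amb N × Bdry N =>
          ((-mu p.2 * Real.exp (-mu p.2 * p.1 0) : ℝ) : ℂ) := by
        have := continuous_mu (N := N)
        fun_prop
      exact m1.measurable.smul (m2.measurable.mul (hvhm.comp measurable_snd))
    exact (hmm.stronglyMeasurable.integral_prod_right (ν := (volume : Measure (Bdry N)))).measurable
  refine ae_half_eq_of_slices hu.aestronglyMeasurable hkm.aestronglyMeasurable ?_
  filter_upwards [hu.isTangFourier hσ, ae_restrict_mem measurableSet_Ioi] with x₀ ⟨h1, h2⟩ hx0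
  have hx0' : (0 : ℝ) < x₀ := hx0
  obtain ⟨S, hS⟩ : ∃ S : Lp ℂ 2 (volume : Measure (Bdry N)), S = h1.toLp _ := ⟨_, rfl⟩
  rw [← hS] at h2
  have hSae : S =ᵐ[volume] fun x' => u (glue x₀ x') := hS ▸ h1.coeFn_toLp
  -- the integrand of the Fourier integral is in `L¹ ∩ L²` as `x₀ > 0`
  set f : Bdry N → ℂ := fun ξ => ((-mu ξ * Real.exp (-mu ξ * x₀) : ℝ) : ℂ) * vh ξ with hf
  have hexp : ∀ ξ : Bdry N, mu ξ * Real.exp (-mu ξ * x₀) ≤ 1 / x₀ := fun ξ => by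
    have := Real.add_one_le_exp (mu ξ * x₀)
    rw [neg_mul, Real.exp_neg, ← div_eq_mul_inv, div_le_div_iff₀ (Real.exp_pos _) hx0']
    linarith
  have hfm : Measurable f := by
    have : Continuous fun ξ : Bdry N => ((-mu ξ * Real.exp (-mu ξ * x₀) : ℝ) : ℂ) := by
      have := continuous_mu (N := N)
      fun_prop
    exact this.measurable.mul hvhm
  have hf2 : MemLp f 2 := by
    refine MemLp.of_le_mul (c := 1 / x₀) hvh2 hfm.aestronglyMeasurable
      (Eventually.of_forall fun ξ => ?_)
    rw [hf, norm_mul, Complex.norm_real, Real.norm_eq_abs, abs_mul, abs_neg,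
      abs_of_pos (mu_pos ξ), abs_of_pos (Real.exp_pos _)]
    exact mul_le_mul_of_nonneg_right (hexp ξ) (norm_nonneg _)
  have hker : MemLp (fun ξ : Bdry N => ((-mu ξ * Real.exp (-mu ξ * x₀) : ℝ) : ℂ)) 2 := by
    have hc : Continuous fun ξ : Bdry N => ((-mu ξ * Real.exp (-mu ξ * x₀) : ℝ) : ℂ) := by
      have := continuous_mu (N := N)
      fun_prop
    -- `μ e^{-μ x₀}` decays faster than any power of `|ξ|`
    obtain ⟨C, hC⟩ : ∃ C : ℝ, ∀ m : ℝ, 0 < m → m * Real.exp (-m * x₀) * m ^ (N + 1) ≤ C := by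
      refine ⟨((N + 2).factorial : ℝ) / x₀ ^ (N + 2), fun m hm => ?_⟩
      have := Real.pow_div_factorial_le_exp (m * x₀) (by positivity) (N + 2)
      rw [neg_mul, Real.exp_neg, le_div_iff₀ (by positivity)]
      rw [div_le_iff₀ (by positivity)] at this
      have he := Real.exp_pos (m * x₀)
      have e : m * (Real.exp (m * x₀))⁻¹ * m ^ (N + 1) * x₀ ^ (N + 2) =
        (m * x₀) ^ (N + 2) * (Real.exp (m * x₀))⁻¹ := by ring
      rw [e, mul_inv_le_iff₀ he]
      linarith
    have hbase : MemLp (fun ξ : Bdry N => (1 + ‖ξ‖ ^ 2) ^ (-(N + 1 : ℝ) / 2)) 2 := by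
      have hcb : Continuous fun ξ : Bdry N => (1 + ‖ξ‖ ^ 2) ^ (-(N + 1 : ℝ) / 2) :=
        Continuous.rpow_const (by fun_prop) fun ξ => Or.inl (by positivity)
      rw [memLp_two_iff_integrable_sq hcb.aestronglyMeasurable]
      have := integrable_rpow_neg_one_add_norm_sq (E := Bdry N) (μ := volume)
        (r := 2 * (N + 1)) (by simp; linarith)
      refine this.congr (Eventually.of_forall fun ξ => ?_)
      simp only
      rw [← Real.rpow_natCast ((1 + ‖ξ‖ ^ 2) ^ (-(N + 1 : ℝ) / 2)) 2,
        ← Real.rpow_mul (by positivity)]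
      congr 1; push_cast; ring
    refine MemLp.of_le_mul (c := C) hbase hc.aestronglyMeasurable
      (Eventually.of_forall fun ξ => ?_)
    rw [Complex.norm_real, Real.norm_eq_abs, abs_mul, abs_neg, abs_of_pos (mu_pos ξ),
      abs_of_pos (Real.exp_pos _), Real.norm_eq_abs, abs_of_pos (by positivity)]
    have hp : 0 < 1 + ‖ξ‖ ^ 2 := by positivity
    have h3 : (1 + ‖ξ‖ ^ 2) ^ ((N + 1 : ℝ) / 2) ≤ mu ξ ^ (N + 1) := by
      have : mu ξ ^ (N + 1) = (mu ξ ^ 2) ^ ((N + 1 : ℝ) / 2) := by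
        rw [← Real.rpow_natCast (mu ξ) 2, ← Real.rpow_mul (mu_pos ξ).le, ← Real.rpow_natCast]
        congr 1; push_cast; ring
      rw [this]
      refine Real.rpow_le_rpow hp.le ?_ (by positivity)
      rw [mu_sq, lam, mul_pow]
      have : 1 ≤ (2 * Real.pi) ^ 2 := by nlinarith [Real.pi_gt_three]
      nlinarith [sq_nonneg ‖ξ‖]
    rw [neg_div, Real.rpow_neg hp.le, ← div_eq_mul_inv, le_div_iff₀ (by positivity)]
    refine le_trans ?_ (hC (mu ξ) (mu_pos ξ))
    have := mu_pos ξ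
    gcongr
  have hf1 : Integrable f := hker.integrable_mul hvh2
  have e1 : (𝓕 S : Lp ℂ 2 (volume : Measure (Bdry N))) =ᵐ[volume] f := by
    filter_upwards [h2, hv] with ξ k1 k2
    rw [k1, part_kSym hM1 w hx0'.le, hf, ← k2, ← hvh]
    push_cast; ring
  have e2 : S = 𝓕⁻ (hf2.toLp f) := by
    have : 𝓕 S = hf2.toLp f := Lp.ext (e1.trans hf2.coeFn_toLp.symm)
    rw [← this, fourierInv_fourier_eq]
  have e3 := fourierInv_toLp_ae_eq hf2 hf1
  rw [← e2] at e3
  filter_upwards [hSae, e3] with x' k1 k2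
  rw [← k1, k2, hk]
  simp [hf]

end Reduction

/-- The symbol of `opK`. -/
def opKSym {N : ℕ} (M : ℕ) (V : Form N) : Form N := fun I =>
  if 0 ∈ I then 0 else kSym M (part (V (insert 0 I)) 0)

/-- The symbol of the Laplacian. -/
def laplaceSym {N : ℕ} (V : Amb N → ℂ) : Amb N → ℂ := fun ξ => ∑ j, dSym j (dSym j V) ξ

section Forms

variable {N : ℕ} {s t : ℝ} {φ α V a : Form N}

lemma hasSymbol_extD (h : ∀ I, HasSymbol t (φ I) (V I)) (ht : 1 ≤ t) (K : Finset (Fin (N + 1))) :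
    HasSymbol (t - 1) (extD φ K) (extDSym V K) :=
  HasSymbol.sum K fun j _ => ((h (K.erase j)).weakDeriv ht j).const_mul _

lemma hasSymbol_laplace (h : ∀ I, HasSymbol t (φ I) (V I)) (ht : 2 ≤ t) (I : Finset (Fin (N + 1))) :
    HasSymbol (t - 2) (laplace φ I) (laplaceSym (V I)) := by
  refine HasSymbol.sum Finset.univ fun j _ => ?_
  have := ((h I).weakDeriv (by linarith) j).weakDeriv (by linarith) j
  rwa [show t - 1 - 1 = t - 2 by ring] at this

lemma hasSymbol_opK {M : ℕ} (h : ∀ I, HasSymbol t (φ I) (V I)) (ht : 3 / 2 < t) (hM1 : 1 ≤ M)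
    (hM : t < M + 1) (I : Finset (Fin (N + 1))) :
    HasSymbol (t - 1) (opK φ I) (opKSym M V I) := by
  unfold opK opKSym
  split_ifs with hI
  · exact HasSymbol.zero
  · have h' := h (insert 0 I)
    refine hasSymbol_kTilde hM1 (by linarith) (by linarith) (measurable_part h'.1 0) ?_
      (h'.fourier_trace (by linarith))
    have := lintegral_part_sq_le (t := t) (by linarith) h'.1 0
    rw [show 2 * (t - 1) + 1 = 2 * t - 1 by ring]
    exact this.trans_lt (ENNReal.mul_lt_top ENNReal.ofReal_lt_top h'.2.1)

lemma hasSymbol_opG {M : ℕ} (h : ∀ I, HasSymbol t (φ I) (V I)) (ht : 5 / 2 < t) (hM1 : 1 ≤ M)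
    (hM : t < M + 1) (I : Finset (Fin (N + 1))) :
    HasSymbol (t - 2) (opG φ I)
      (fun ξ => opKSym M (extDSym V) I ξ + extDSym (opKSym M V) I ξ) := by
  have h1 := hasSymbol_opK (M := M) (hasSymbol_extD h (by linarith)) (by linarith) hM1
    (by linarith) I
  have h2 := hasSymbol_extD (hasSymbol_opK h (by linarith) hM1 hM) (by linarith) I
  rw [show t - 1 - 1 = t - 2 by ring] at h1 h2
  exact h1.add h2

/-- All symbols derived from `V` by at most two differentiations are integrable along the line over
`ξ`. -/
def LineIntegrable {N : ℕ} (V : Form N) (ξ : Bdry N) : Prop :=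
  ∀ I, (Integrable fun τ => V I (glue τ ξ)) ∧ ∀ j, (Integrable fun τ => dSym j (V I) (glue τ ξ)) ∧
    ∀ i, Integrable fun τ => dSym i (dSym j (V I)) (glue τ ξ)

lemma ae_lineIntegrable (h : ∀ I, HasSymbol t (φ I) (V I)) (ht : 5 / 2 < t) :
    ∀ᵐ ξ, LineIntegrable V ξ := by
  unfold LineIntegrable
  refine ae_all_iff.2 fun I => ?_
  have h1 := (h I).ae_integrable_line (by linarith)
  have h2 : ∀ᵐ ξ : Bdry N, ∀ j, (Integrable fun τ => dSym j (V I) (glue τ ξ)) ∧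
      ∀ i, Integrable fun τ => dSym i (dSym j (V I)) (glue τ ξ) := by
    refine ae_all_iff.2 fun j => ?_
    have h3 := (h I).weakDeriv (by linarith) j
    have h4 : ∀ᵐ ξ : Bdry N, ∀ i, Integrable fun τ => dSym i (dSym j (V I)) (glue τ ξ) :=
      ae_all_iff.2 fun i => (h3.weakDeriv (by linarith) i).ae_integrable_line (by linarith)
    filter_upwards [h3.ae_integrable_line (by linarith), h4] with ξ k1 k2 using ⟨k1, k2⟩
  filter_upwards [h1, h2] with ξ k1 k2 using ⟨k1, k2⟩

lemma card_filter_lt_insert_zero {I : Finset (Fin (N + 1))} (h0 : 0 ∉ I) {j : Fin (N + 1)}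
    (hj : j ∈ I) : ((insert 0 I).filter (· < j)).card = (I.filter (· < j)).card + 1 := by
  have hj0 : 0 < j := Fin.pos_of_ne_zero fun h => h0 (h ▸ hj)
  rw [Finset.filter_insert, if_pos hj0, Finset.card_insert_of_notMem]
  simp [h0]

lemma part_laplaceSym {ξ : Bdry N} (h : LineIntegrable V ξ) (I : Finset (Fin (N + 1))) (x : ℝ) :
    part (laplaceSym (V I)) x ξ =
      part (dSym 0 (dSym 0 (V I))) x ξ - (lam ξ : ℂ) ^ 2 * part (V I) x ξ := by
  have h1 := part_sum Finset.univ (fun _ : Fin (N + 1) => (1 : ℂ))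
    (fun j => dSym j (dSym j (V I))) (fun j _ => ((h I).2 j).2 j) x
  simp only [one_mul] at h1
  unfold laplaceSym
  rw [h1, Fin.sum_univ_succ]
  have h2 : ∀ i : Fin N, part (dSym i.succ (dSym i.succ (V I))) x ξ =
      -(4 * Real.pi ^ 2) * ((ξ i ^ 2 : ℝ) : ℂ) * part (V I) x ξ := by
    intro i
    rw [part_dSym_of_ne (Fin.succ_ne_zero i), part_dSym_of_ne (Fin.succ_ne_zero i), glue_succ]
    push_cast
    linear_combination (4 * (Real.pi : ℂ) ^ 2 * (ξ i : ℂ) ^ 2 * part (V I) x ξ) * Complex.I_sq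
  simp only [h2]
  rw [← Finset.sum_mul, ← Finset.mul_sum, ← Complex.ofReal_sum,
    ← EuclideanSpace.real_norm_sq_eq, lam]
  push_cast; ring

/-- The terms of `G` that involve the derivatives along the boundary cancel. -/
lemma part_opG {M : ℕ} (hM : 2 ≤ M) {ξ : Bdry N} (h : LineIntegrable V ξ)
    (I : Finset (Fin (N + 1)))
    (hK' : ∀ j I, Integrable fun τ => dSym j (opKSym M V I) (glue τ ξ))
    (hE : ∀ I, Integrable fun τ => opKSym M (extDSym V) I (glue τ ξ)) {x : ℝ} (hx : 0 ≤ x) :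
    part (fun ξ => opKSym M (extDSym V) I ξ + extDSym (opKSym M V) I ξ) x ξ =
      if 0 ∈ I then (mu ξ : ℂ) ^ 2 * Real.exp (-mu ξ * x) * part (V I) 0 ξ
      else -mu ξ * Real.exp (-mu ξ * x) * part (dSym 0 (V I)) 0 ξ := by
  have hD : Integrable fun τ => extDSym (opKSym M V) I (glue τ ξ) :=
    integrable_finsetSum _ fun j _ => (hK' j _).const_mul _
  have e : part (extDSym (opKSym M V) I) x ξ = ∑ j ∈ I, (-1 : ℂ) ^ (I.filter (· < j)).card *
      part (dSym j (opKSym M V (I.erase j))) x ξ :=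
    part_sum I _ (fun j => dSym j (opKSym M V (I.erase j))) (fun j _ => hK' j _) x
  rw [part_add (hE I) hD, e]
  split_ifs with h0
  · have e0 : opKSym M (extDSym V) I = 0 := if_pos h0
    rw [e0, part_zero, zero_add, Finset.sum_eq_single_of_mem 0 h0]
    · have e1 : opKSym M V (I.erase 0) = kSym M (part (V I) 0) := by
        rw [opKSym, if_neg (by simp), Finset.insert_erase h0]
      rw [e1, part_dSym_kSym hM _ hx]
      simp; ring
    · intro j hj hj0
      have e1 : opKSym M V (I.erase j) = 0 := if_pos (by simp [h0, Ne.symm hj0])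
      rw [part_dSym_of_ne hj0, e1, part_zero]
      ring
  · have e0 : opKSym M (extDSym V) I = kSym M (part (extDSym V (insert 0 I)) 0) := if_neg h0
    have e1 : part (extDSym V (insert 0 I)) 0 ξ = ∑ j ∈ insert 0 I,
        (-1 : ℂ) ^ ((insert 0 I).filter (· < j)).card *
          part (dSym j (V ((insert 0 I).erase j))) 0 ξ :=
      part_sum _ _ (fun j => dSym j (V ((insert 0 I).erase j))) (fun j _ => ((h _).2 j).1) 0
    rw [e0, part_kSym (by omega) _ hx, e1, Finset.sum_insert h0, Finset.erase_insert h0]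
    have e2 : ∀ j ∈ I, (-1 : ℂ) ^ ((insert 0 I).filter (· < j)).card *
          part (dSym j (V ((insert 0 I).erase j))) 0 ξ = -((-1 : ℂ) ^ (I.filter (· < j)).card *
          ((2 * Real.pi * Complex.I * (glue 0 ξ j : ℂ)) * part (V (insert 0 (I.erase j))) 0 ξ)) := by
      intro j hj
      have hj0 : j ≠ 0 := fun h => h0 (h ▸ hj)
      rw [card_filter_lt_insert_zero h0 hj, pow_succ, Finset.erase_insert_of_ne hj0.symm,
        part_dSym_of_ne hj0]
      ring
    have e3 : ∀ j ∈ I, (-1 : ℂ) ^ (I.filter (· < j)).card *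
          part (dSym j (opKSym M V (I.erase j))) x ξ = -mu ξ * Real.exp (-mu ξ * x) *
          ((-1 : ℂ) ^ (I.filter (· < j)).card *
          ((2 * Real.pi * Complex.I * (glue 0 ξ j : ℂ)) * part (V (insert 0 (I.erase j))) 0 ξ)) := by
      intro j hj
      have hj0 : j ≠ 0 := fun h => h0 (h ▸ hj)
      have e4 : opKSym M V (I.erase j) = kSym M (part (V (insert 0 (I.erase j))) 0) :=
        if_neg (by simp [h0])
      rw [part_dSym_of_ne hj0, e4, part_kSym (by omega) _ hx]
      ring
    rw [Finset.sum_congr rfl e2, Finset.sum_congr rfl e3, Finset.sum_neg_distrib, ← Finset.mul_sum]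
    have e5 : ((insert (0 : Fin (N + 1)) I).filter (· < 0)).card = 0 := by simp
    rw [e5]
    ring

lemma equation_iff (h : ∀ I, HasSymbol (s + 2) (φ I) (V I)) (hs : 1 / 2 < s)
    {I : Finset (Fin (N + 1))} (hα : HasSymbol s (α I) (a I)) :
    (∀ᵐ x ∂halfMeasure N, -laplace φ I x + opG φ I x = α I x) ↔ ∀ᵐ ξ, ∀ x : ℝ, 0 ≤ x →
      -part (dSym 0 (dSym 0 (V I))) x ξ + (lam ξ : ℂ) ^ 2 * part (V I) x ξ +
        (if 0 ∈ I then (mu ξ : ℂ) ^ 2 * Real.exp (-mu ξ * x) * part (V I) 0 ξ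
      else -mu ξ * Real.exp (-mu ξ * x) * part (dSym 0 (V I)) 0 ξ) = part (a I) x ξ := by
  obtain ⟨M, hM⟩ := exists_nat_gt (s + 2)
  have hM2 : 2 ≤ M := by
    have : (2 : ℝ) < M := by linarith
    exact_mod_cast this.le
  have hM' : s + 2 < M + 1 := by linarith
  have hL := hasSymbol_laplace h (by linarith) I
  have hG := hasSymbol_opG h (by linarith) (by omega) hM' I
  rw [show s + 2 - 2 = s by ring] at hL hG
  have hS := (hL.const_mul (-1)).add hG
  have hK := fun I => (hasSymbol_opK h (by linarith) (by omega) hM' I)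
  have k1 : ∀ᵐ ξ, ∀ I, Integrable fun τ => opKSym M V I (glue τ ξ) :=
    ae_all_iff.2 fun I => (hK I).ae_integrable_line (by linarith)
  have k2 : ∀ᵐ ξ, ∀ j I, Integrable fun τ => dSym j (opKSym M V I) (glue τ ξ) :=
    ae_all_iff.2 fun j => ae_all_iff.2 fun I =>
      ((hK I).weakDeriv (by linarith) j).ae_integrable_line (by linarith)
  have k3 : ∀ᵐ ξ, ∀ I, Integrable fun τ => opKSym M (extDSym V) I (glue τ ξ) :=
    ae_all_iff.2 fun I => (hasSymbol_opK (M := M) (hasSymbol_extD h (by linarith)) (by linarith)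
      (by omega) (by linarith) I).ae_integrable_line (by linarith)
  have key : ∀ᵐ ξ, ∀ x : ℝ, 0 ≤ x → part (fun ξ => -1 * laplaceSym (V I) ξ +
      (opKSym M (extDSym V) I ξ + extDSym (opKSym M V) I ξ)) x ξ =
      -part (dSym 0 (dSym 0 (V I))) x ξ + (lam ξ : ℂ) ^ 2 * part (V I) x ξ +
        (if 0 ∈ I then (mu ξ : ℂ) ^ 2 * Real.exp (-mu ξ * x) * part (V I) 0 ξ
      else -mu ξ * Real.exp (-mu ξ * x) * part (dSym 0 (V I)) 0 ξ) := by
    filter_upwards [ae_lineIntegrable h (by linarith), k1, k2, k3,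
      hL.ae_integrable_line hs, hG.ae_integrable_line hs] with ξ h1 _ h3 h4 h5 h6 x hx
    rw [part_add (h5.const_mul _) h6, part_const_mul, part_opG hM2 h1 I h3 h4 hx,
      part_laplaceSym h1]
    ring
  have e : (∀ᵐ x ∂halfMeasure N, -laplace φ I x + opG φ I x = α I x) ↔
      (fun x => -1 * laplace φ I x + opG φ I x) =ᵐ[halfMeasure N] α I := by
    simp only [neg_one_mul]; rfl
  rw [e]
  constructor
  · intro he
    filter_upwards [hS.part_eq_of_ae_eq hs hα hs he, key] with ξ h1 h2 x hx
    rw [← h2 x hx, h1 x hx]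
  · intro he
    refine hS.ae_eq_of_part hs hα hs fun x hx => ?_
    filter_upwards [he, key] with ξ h1 h2
    rw [h2 x hx.le, h1 x hx.le]

lemma boundaryCond_iff (h : ∀ I, HasSymbol t (φ I) (V I)) (ht : 3 / 2 < t) :
    BoundaryCond φ ↔ ∀ J, 0 ∉ J → part (dSym 0 (V (insert 0 J))) 0 =ᵐ[volume] 0 := by
  refine forall₂_congr fun J _ => ?_
  exact ((h _).weakDeriv (by linarith) 0).isTrace_zero_iff (by linarith)

lemma boundaryCond_extD_iff (h : ∀ I, HasSymbol t (φ I) (V I)) (ht : 5 / 2 < t)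
    (hb : BoundaryCond φ) :
    BoundaryCond (extD φ) ↔ ∀ J, 0 ∉ J → part (dSym 0 (dSym 0 (V J))) 0 =ᵐ[volume] 0 := by
  rw [boundaryCond_iff h (by linarith)] at hb
  rw [boundaryCond_iff (hasSymbol_extD h (by linarith)) (by linarith)]
  refine forall₂_congr fun J h0 => ?_
  have hb' : ∀ᵐ ξ : Bdry N, ∀ J, 0 ∉ J → part (dSym 0 (V (insert 0 J))) 0 ξ = 0 := by
    refine ae_all_iff.2 fun J => ?_
    by_cases hJ : 0 ∈ J
    · exact Eventually.of_forall fun ξ h => absurd hJ h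
    · filter_upwards [hb J hJ] with ξ hξ _ using hξ
  have key : part (dSym 0 (extDSym V (insert 0 J))) 0 =ᵐ[volume]
      part (dSym 0 (dSym 0 (V J))) 0 := by
    filter_upwards [ae_lineIntegrable h ht, hb'] with ξ hI hb
    have e1 : dSym 0 (extDSym V (insert 0 J)) = fun ξ => ∑ j ∈ insert 0 J,
        (-1 : ℂ) ^ ((insert 0 J).filter (· < j)).card *
          dSym j (dSym 0 (V ((insert 0 J).erase j))) ξ := by
      ext ξ
      simp only [dSym, extDSym, Finset.mul_sum]
      exact Finset.sum_congr rfl fun j _ => by ring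
    rw [e1, part_sum _ _ (fun j => dSym j (dSym 0 (V ((insert 0 J).erase j))))
      (fun j _ => ((hI _).2 0).2 j), Finset.sum_insert h0, Finset.erase_insert h0,
      Finset.sum_eq_zero]
    · have e5 : ((insert (0 : Fin (N + 1)) J).filter (· < 0)).card = 0 := by simp
      rw [e5]; ring
    · intro j hj
      have hj0 : j ≠ 0 := fun h => h0 (h ▸ hj)
      rw [Finset.erase_insert_of_ne hj0.symm, part_dSym_of_ne hj0, hb _ (by simp [h0])]
      ring
  exact ⟨fun k => key.symm.trans k, fun k => key.trans k⟩

/-- The boundary value problem decouples into the problems for the single coefficients. -/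
theorem eqn_and_bdry_iff (h : ∀ I, HasSymbol (s + 2) (φ I) (V I)) (hs : 1 / 2 < s)
    (hα : ∀ I, HasSymbol s (α I) (a I)) :
    ((∀ I, ∀ᵐ x ∂halfMeasure N, -laplace φ I x + opG φ I x = α I x) ∧ BoundaryCond φ ∧
      BoundaryCond (extD φ)) ↔ ∀ I, FiberSol (0 ∈ I) (V I) (a I) := by
  have hE := fun I => equation_iff h hs (hα I)
  constructor
  · rintro ⟨h1, h2, h3⟩ I
    rw [boundaryCond_extD_iff h (by linarith) h2] at h3
    rw [boundaryCond_iff h (by linarith)] at h2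
    unfold FiberSol
    by_cases hI : 0 ∈ I
    · have hb := h2 (I.erase 0) (by simp)
      rw [Finset.insert_erase hI] at hb
      filter_upwards [(hE I).1 (h1 I), hb] with ξ k1 k2
      exact ⟨fun _ => ⟨fun x hx => by simpa [hI] using k1 x hx, k2⟩, fun h => absurd hI h⟩
    · filter_upwards [(hE I).1 (h1 I), h3 I hI] with ξ k1 k2
      refine ⟨fun h => absurd h hI, fun _ => ⟨fun x hx => ?_, k2⟩⟩
      have := k1 x hx
      rw [if_neg hI] at this
      rw [← this]; ring
  · intro hF
    have h2 : BoundaryCond φ := by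
      rw [boundaryCond_iff h (by linarith)]
      intro J hJ
      filter_upwards [hF (insert 0 J)] with ξ k1
      exact (k1.1 (by simp)).2
    refine ⟨fun I => (hE I).2 ?_, h2, ?_⟩
    · filter_upwards [hF I] with ξ k1 x hx
      split_ifs with hI
      · exact (k1.1 hI).1 x hx
      · rw [← (k1.2 hI).1 x hx]; ring
    · rw [boundaryCond_extD_iff h (by linarith) h2]
      intro J hJ
      filter_upwards [hF J] with ξ k1
      exact (k1.2 hJ).2

end Forms

/-! ### Regularity of the solutions of the ordinary differential equations on the fibres -/

/-- Fibrewise data `w ξ` that solve `-w'' + λ² w = â + c e^{-μ x}` on `(0, ∞)`, with the bounds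
on `c` and on `w(0)` that put the solution in the Sobolev space of exponent `s + 2`. The bounds are
relative to a density `Q` that is integrable in `ξ`. -/
structure FiberODE {N : ℕ} (s : ℝ) (K : ℝ≥0) (a : Amb N → ℂ) (c : Bdry N → ℂ)
    (w : Bdry N → ℝ → ℂ) (Q : Bdry N → ℝ≥0∞) : Prop where
  measurable_symbol : Measurable a
  measurable_coeff : Measurable c
  finite : ∀ᵐ ξ, Q ξ < ⊤
  symbol_le : ∀ᵐ ξ, lineInt s (mu ξ) (fun τ => a (glue τ ξ)) ≤ Q ξ
  coeff_le : ∀ᵐ ξ, ‖c ξ‖ₑ ^ 2 ≤ ENNReal.ofReal (mu ξ ^ (1 - 2 * s)) * (K * Q ξ)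
  zero_le : ∀ᵐ ξ, ‖w ξ 0‖ₑ ^ 2 ≤ ENNReal.ofReal (mu ξ ^ (-3 - 2 * s)) * (K * Q ξ)
  ode : ∀ᵐ ξ, ∃ w₁ : ℝ → ℂ, ∀ x : ℝ, 0 < x → HasDerivAt (w ξ) (w₁ x) x ∧
    HasDerivAt w₁ ((lam ξ : ℂ) ^ 2 * w ξ x - part a x ξ - c ξ * Real.exp (-mu ξ * x)) x

/-- `w` is, on `x ≥ 0`, the partial inverse Fourier transform of a symbol of exponent `t` that is
bounded by `C Q`. -/
def HasExtSymbol {N : ℕ} (t : ℝ) (C : ℝ≥0) (w : Bdry N → ℝ → ℂ) (Q : Bdry N → ℝ≥0∞) : Prop :=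
  ∃ Φ : Amb N → ℂ, Measurable Φ ∧
    (∀ᵐ ξ, lineInt t (mu ξ) (fun τ => Φ (glue τ ξ)) ≤ C * Q ξ) ∧
    ∀ᵐ ξ, ∀ x : ℝ, 0 ≤ x → part Φ x ξ = w ξ x

lemma lineInt_add_le (t κ : ℝ) {g : ℝ → ℂ} (hg : Measurable g) (h : ℝ → ℂ) :
    lineInt t κ (fun τ => g τ + h τ) ≤ 2 * lineInt t κ g + 2 * lineInt t κ h := by
  unfold lineInt
  have hm : Measurable fun τ : ℝ => ENNReal.ofReal ((κ ^ 2 + (2 * Real.pi * τ) ^ 2) ^ t) := by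
    fun_prop
  rw [← lintegral_const_mul' _ _ (by norm_num), ← lintegral_const_mul' _ _ (by norm_num),
    ← lintegral_add_left (by exact (hm.mul (hg.enorm.pow_const 2)).const_mul _)]
  refine lintegral_mono fun τ => ?_
  refine (mul_le_mul_right (enorm_add_sq_le (g τ) (h τ)) _).trans (le_of_eq ?_)
  ring

lemma lineInt_div_weight {κ : ℝ} (hκ : 0 < κ) (t : ℝ) (g : ℝ → ℂ) :
    lineInt (t + 2) κ (fun τ => g τ / ((κ ^ 2 + (2 * Real.pi * τ) ^ 2 : ℝ) : ℂ)) = lineInt t κ g := by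
  unfold lineInt
  refine lintegral_congr fun τ => ?_
  have hp : 0 < κ ^ 2 + (2 * Real.pi * τ) ^ 2 := by positivity
  have e : ‖g τ‖ₑ ^ 2 = ENNReal.ofReal ((κ ^ 2 + (2 * Real.pi * τ) ^ 2) ^ 2) *
      ‖g τ / ((κ ^ 2 + (2 * Real.pi * τ) ^ 2 : ℝ) : ℂ)‖ₑ ^ 2 := by
    rw [← ofReal_norm, ← ofReal_norm, ← ENNReal.ofReal_pow (norm_nonneg _),
      ← ENNReal.ofReal_pow (norm_nonneg _), ← ENNReal.ofReal_mul (by positivity), norm_div,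
      Complex.norm_real, Real.norm_eq_abs, abs_of_pos hp]
    congr 1; field_simp
  rw [e, ← mul_assoc, ← ENNReal.ofReal_mul (by positivity), Real.rpow_add hp, Real.rpow_two]

lemma ofReal_mul_coe_mul {m : ℝ} (hm : 0 ≤ m) (r : ℝ) (q : ℝ≥0∞) :
    ENNReal.ofReal (r * m) * q = ENNReal.ofReal m * ((r.toNNReal : ℝ≥0) * q) := by
  rw [mul_comm r, ENNReal.ofReal_mul hm, mul_assoc]; rfl

section Step

variable {N : ℕ} {s t : ℝ} {a : Amb N → ℂ} {c : Bdry N → ℂ} {w : Bdry N → ℝ → ℂ}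
  {Q : Bdry N → ℝ≥0∞}

lemma HasExtSymbol.mono {t' : ℝ} {C : ℝ≥0} (h : HasExtSymbol t C w Q) (ht : t' ≤ t) :
    HasExtSymbol t' C w Q := by
  obtain ⟨Φ, h1, h2, h3⟩ := h
  exact ⟨Φ, h1, h2.mono fun ξ hξ => (lineInt_mono (one_le_mu ξ) ht _).trans hξ, h3⟩

/-- The solution on the fibre: if `𝓕⁻ φ = w` on `x ≥ 0` then
`(φ + a + c E) / (μ² + (2πτ)²) + κ E`, with `E` a symbol of `e^{-μ x}` and the constant `κ` that
gives the right value at `0`, has the same property. -/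
lemma fourierInv_step {M : ℕ} (hM : 1 ≤ M) {l m : ℝ} (hm : 0 < m) (hlm : m ^ 2 = 1 + l ^ 2)
    {t : ℝ} (ht : 1 / 2 < t) {φ A Y : ℝ → ℂ} {γ : ℂ} {w w₁ : ℝ → ℂ}
    (hφ : Integrable φ) (hA : Integrable A) (hYm : Measurable Y) (hY : lineInt (t + 2) m Y < ⊤)
    (hYX : ∀ τ, ((m ^ 2 + (2 * Real.pi * τ) ^ 2 : ℝ) : ℂ) * Y τ = φ τ + A τ + γ * expSym M m τ)
    (hw : ∀ x : ℝ, 0 ≤ x → 𝓕⁻ φ x = w x)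
    (hode : ∀ x : ℝ, 0 < x → HasDerivAt w (w₁ x) x ∧
      HasDerivAt w₁ ((l : ℂ) ^ 2 * w x - 𝓕⁻ A x - γ * Real.exp (-m * x)) x)
    {x : ℝ} (hx : 0 ≤ x) :
    𝓕⁻ (fun τ => Y τ + (𝓕⁻ φ 0 - 𝓕⁻ Y 0) * expSym M m τ) x = w x := by
  have hE := integrable_expSym hM hm
  have hYi : Integrable Y := integrable_of_lineInt (by linarith) hm hYm hY
  have hY1 := hasDerivAt_fourierInv' (t := t + 2) (by linarith) hm hYm hY
  have hY2 := hasDerivAt_fourierInv' (t := t + 1) (by linarith) hm (measurable_two_pi_I_mul hYm)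
    (by have := (lineInt_mul_id_le (t + 2) m hm Y).trans_lt hY
        rwa [show t + 2 - 1 = t + 1 by ring] at this)
  have hYi2 : Integrable fun τ : ℝ =>
      (2 * Real.pi * Complex.I * τ) * ((2 * Real.pi * Complex.I * τ) * Y τ) :=
    integrable_two_pi_I_mul (t := t + 1) (by linarith) hm (measurable_two_pi_I_mul hYm)
    (by have := (lineInt_mul_id_le (t + 2) m hm Y).trans_lt hY
        rwa [show t + 2 - 1 = t + 1 by ring] at this)
  -- the equation satisfied by `𝓕⁻ Y`
  have hY3 : ∀ x : ℝ, 0 < x → 𝓕⁻ (fun τ : ℝ =>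
      (2 * Real.pi * Complex.I * τ) * ((2 * Real.pi * Complex.I * τ) * Y τ)) x =
      (m : ℂ) ^ 2 * 𝓕⁻ Y x - w x - 𝓕⁻ A x - γ * Real.exp (-m * x) := by
    intro x hx
    have e : (fun τ : ℝ => (2 * Real.pi * Complex.I * τ) * ((2 * Real.pi * Complex.I * τ) * Y τ)) =
        fun τ => (m : ℂ) ^ 2 * Y τ - ((φ τ + A τ) + γ * expSym M m τ) := by
      ext τ
      rw [← hYX]
      push_cast
      linear_combination (4 * (Real.pi : ℂ) ^ 2 * (τ : ℂ) ^ 2 * Y τ) * Complex.I_sq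
    have i1 : Integrable fun τ => φ τ + A τ := hφ.add hA
    have i2 : Integrable fun τ => φ τ + A τ + γ * expSym M m τ := i1.add (hE.const_mul γ)
    have i3 : Integrable fun τ => (m : ℂ) ^ 2 * Y τ := hYi.const_mul _
    rw [e, fourierInv_sub_real i3 i2, fourierInv_const_mul_real,
      fourierInv_add_real i1 (hE.const_mul γ), fourierInv_add_real hφ hA,
      fourierInv_const_mul_real, hw x hx.le, fourierInv_expSym hM hm hx.le]
    ring
  obtain ⟨C, hC⟩ := exists_eq_exp_of_second_order hm (y := fun x => 𝓕⁻ Y x - w x)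
    (y₁ := fun x => 𝓕⁻ (fun τ : ℝ => (2 * Real.pi * Complex.I * τ) * Y τ) x - w₁ x)
    (fun x hx => (hY1 x).sub (hode x hx).1)
    (fun x hx => by
      refine ((hY2 x).sub (hode x hx).2).congr_deriv ?_
      have hlm' : (m : ℂ) ^ 2 = 1 + (l : ℂ) ^ 2 := by exact_mod_cast hlm
      rw [hY3 x hx]
      linear_combination (w x) * hlm')
    (B := (∫ τ, ‖Y τ‖) + ∫ τ, ‖φ τ‖) (fun x hx => by
      have h2 := norm_fourierInv_le φ x
      rw [hw x hx.le] at h2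
      exact (norm_sub_le _ _).trans (add_le_add (norm_fourierInv_le Y x) h2))
  -- equality on `(0, ∞)` extends to `0` by continuity, which gives the constant
  have hcl : IsClosed {x : ℝ | 𝓕⁻ Y x - 𝓕⁻ φ x = C * Real.exp (-m * x)} :=
    isClosed_eq ((continuous_fourierInv_real hYi).sub (continuous_fourierInv_real hφ))
      (by fun_prop)
  have hsub := hcl.closure_subset_iff.2 (show Set.Ioi (0 : ℝ) ⊆ _ from fun y hy => by
    have hy' : 0 < y := hy
    have := hC y hy'
    rwa [← hw y hy'.le] at this)
  rw [closure_Ioi] at hsub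
  have h0 : 𝓕⁻ Y 0 - 𝓕⁻ φ 0 = C := by
    have := hsub (Set.mem_Ici.2 le_rfl : (0 : ℝ) ∈ Set.Ici 0)
    simpa using this
  have hx' : 𝓕⁻ Y x - 𝓕⁻ φ x = C * Real.exp (-m * x) := hsub hx
  rw [fourierInv_add_real hYi (hE.const_mul _), fourierInv_const_mul_real,
    fourierInv_expSym hM hm hx, ← hw x hx, ← neg_sub (𝓕⁻ Y 0), h0]
  linear_combination hx'

set_option maxHeartbeats 1000000 in
/-- One step of the regularity argument gains two derivatives. -/
lemma hasExtSymbol_step (ht : 1 / 2 < t) (hts : t ≤ s) (K C : ℝ≥0) :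
    ∃ C' : ℝ≥0, ∀ (a : Amb N → ℂ) (c : Bdry N → ℂ) (w : Bdry N → ℝ → ℂ) (Q : Bdry N → ℝ≥0∞),
      FiberODE s K a c w Q → HasExtSymbol t C w Q → HasExtSymbol (t + 2) C' w Q := by
  obtain ⟨M, hM⟩ := exists_nat_gt (t + 2)
  have hM1 : 1 ≤ M := by
    have : (0 : ℝ) < M := by linarith
    exact_mod_cast this
  obtain ⟨r₁, hr₁⟩ : ∃ r : ℝ, r = 4 ^ M * wtConst (M + 1 - t) := ⟨_, rfl⟩
  obtain ⟨r₂, hr₂⟩ : ∃ r : ℝ, r = 4 ^ M * wtConst (M + 1 - (t + 2)) := ⟨_, rfl⟩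
  obtain ⟨r₃, hr₃⟩ : ∃ r : ℝ, r = wtConst (t + 2) := ⟨_, rfl⟩
  have hr₁0 : 0 ≤ r₁ := hr₁ ▸ mul_nonneg (by positivity) (wtConst_nonneg _)
  have hr₂0 : 0 ≤ r₂ := hr₂ ▸ mul_nonneg (by positivity) (wtConst_nonneg _)
  have hr₃0 : 0 ≤ r₃ := hr₃ ▸ wtConst_nonneg _
  obtain ⟨C₁, hC₁⟩ : ∃ r : ℝ≥0, r = 2 * (2 * C + 2 * 1) + 2 * (K * r₁.toNNReal) := ⟨_, rfl⟩
  obtain ⟨C₂, hC₂⟩ : ∃ r : ℝ≥0, r = 2 * K + 2 * (r₃.toNNReal * C₁) := ⟨_, rfl⟩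
  refine ⟨2 * C₁ + 2 * (C₂ * r₂.toNNReal), fun a c w Q h ⟨Φ, hΦm, hΦ, hΦw⟩ => ?_⟩
  obtain ⟨X, hX⟩ : ∃ X : Amb N → ℂ, X = fun ξ =>
    (Φ ξ + a ξ + c (tang ξ) * expSym M (mu (tang ξ)) (ξ 0)) := ⟨_, rfl⟩
  obtain ⟨Y, hY⟩ : ∃ Y : Amb N → ℂ, Y = fun ξ => X ξ / (symWt ξ : ℂ) := ⟨_, rfl⟩
  have h0 : Measurable fun ξ : Amb N => ξ 0 := by fun_prop
  have hEm : Measurable fun ξ : Amb N => expSym M (mu (tang ξ)) (ξ 0) :=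
    (measurable_expSym M).comp ((measurable_mu.comp measurable_tang).prodMk h0)
  have hXm : Measurable X := by
    rw [hX]
    exact (hΦm.add h.measurable_symbol).add ((h.measurable_coeff.comp measurable_tang).mul hEm)
  have hYm : Measurable Y := by
    rw [hY]
    exact hXm.div (Complex.measurable_ofReal.comp measurable_symWt)
  have hYfib : ∀ ξ : Bdry N, (fun τ => Y (glue τ ξ)) =
      fun τ => X (glue τ ξ) / ((mu ξ ^ 2 + (2 * Real.pi * τ) ^ 2 : ℝ) : ℂ) := fun ξ => by
    ext τ; rw [hY]; simp only [symWt_glue]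
  have hXfib : ∀ ξ : Bdry N, (fun τ => X (glue τ ξ)) =
      fun τ => (Φ (glue τ ξ) + a (glue τ ξ)) + c ξ * expSym M (mu ξ) τ := fun ξ => by
    ext τ; simp [hX]
  -- the bound for `Φ + a + c E`
  have hXle : ∀ᵐ ξ, lineInt t (mu ξ) (fun τ => X (glue τ ξ)) ≤ C₁ * Q ξ := by
    filter_upwards [hΦ, h.symbol_le, h.coeff_le] with ξ k1 k2 k3
    have hm := mu_pos ξ
    have e1 : ‖c ξ‖ₑ ^ 2 * lineInt t (mu ξ) (expSym M (mu ξ)) ≤ (K * r₁.toNNReal : ℝ≥0) * Q ξ := by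
      calc _ ≤ ENNReal.ofReal (mu ξ ^ (1 - 2 * s)) * (K * Q ξ) *
            ENNReal.ofReal (r₁ * mu ξ ^ (2 * t - 1)) :=
            hr₁ ▸ mul_le_mul' k3 (lineInt_expSym_le (by linarith) hm)
        _ = ENNReal.ofReal (mu ξ ^ (1 - 2 * s) * mu ξ ^ (2 * t - 1)) *
            (K * ENNReal.ofReal r₁ * Q ξ) := by
            rw [ENNReal.ofReal_mul hr₁0, ENNReal.ofReal_mul (p := mu ξ ^ (1 - 2 * s)) (by positivity)]
            ring
        _ ≤ 1 * (K * ENNReal.ofReal r₁ * Q ξ) := by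
            gcongr
            rw [← Real.rpow_add hm, ENNReal.ofReal_le_one]
            exact Real.rpow_le_one_of_one_le_of_nonpos (one_le_mu ξ) (by linarith)
        _ = _ := by rw [one_mul, ENNReal.coe_mul]; rfl
    rw [hXfib]
    have hfm : Measurable fun τ => Φ (glue τ ξ) + a (glue τ ξ) :=
      (measurable_comp_glue hΦm ξ).add (measurable_comp_glue h.measurable_symbol ξ)
    calc _ ≤ 2 * lineInt t (mu ξ) (fun τ => Φ (glue τ ξ) + a (glue τ ξ)) +
          2 * lineInt t (mu ξ) (fun τ => c ξ * expSym M (mu ξ) τ) := lineInt_add_le _ _ hfm _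
      _ ≤ 2 * (2 * (C * Q ξ) + 2 * Q ξ) + 2 * ((K * r₁.toNNReal : ℝ≥0) * Q ξ) := by
          rw [lineInt_const_mul]
          gcongr
          refine (lineInt_add_le _ _ (measurable_comp_glue hΦm ξ) _).trans ?_
          gcongr
          exact (lineInt_mono (one_le_mu ξ) hts _).trans k2
      _ = _ := by rw [hC₁]; push_cast; ring
  have hYle : ∀ᵐ ξ, lineInt (t + 2) (mu ξ) (fun τ => Y (glue τ ξ)) ≤ C₁ * Q ξ := by
    filter_upwards [hXle] with ξ k
    rwa [hYfib, lineInt_div_weight (mu_pos ξ)]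
  obtain ⟨κ, hκ⟩ : ∃ κ : Bdry N → ℂ, κ = fun ξ => part Φ 0 ξ - part Y 0 ξ := ⟨_, rfl⟩
  have hκm : Measurable κ := by
    rw [hκ]; exact (measurable_part hΦm 0).sub (measurable_part hYm 0)
  have hκle : ∀ᵐ ξ, ‖κ ξ‖ₑ ^ 2 ≤ ENNReal.ofReal (mu ξ ^ (-3 - 2 * t)) * (C₂ * Q ξ) := by
    filter_upwards [hYle, h.zero_le, hΦw] with ξ k1 k2 k3
    have hm := mu_pos ξ
    have e1 : ‖part Y 0 ξ‖ₑ ^ 2 ≤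
        ENNReal.ofReal (mu ξ ^ (-3 - 2 * t)) * ((r₃.toNNReal * C₁ : ℝ≥0) * Q ξ) := by
      calc _ ≤ (∫⁻ τ, ‖Y (glue τ ξ)‖ₑ) ^ 2 := by gcongr; exact enorm_part_le _ _ _
        _ ≤ _ := lintegral_enorm_sq_le (t := t + 2) (by linarith) hm (measurable_comp_glue hYm ξ)
        _ ≤ ENNReal.ofReal (wtConst (t + 2) * mu ξ ^ (1 - 2 * (t + 2))) * (C₁ * Q ξ) := by gcongr
        _ = _ := by
          rw [← hr₃, ofReal_mul_coe_mul (by positivity), show 1 - 2 * (t + 2) = -3 - 2 * t by ring,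
            ENNReal.coe_mul]
          ring
    have e2 : ‖part Φ 0 ξ‖ₑ ^ 2 ≤ ENNReal.ofReal (mu ξ ^ (-3 - 2 * t)) * (K * Q ξ) := by
      rw [k3 0 le_rfl]
      refine k2.trans ?_
      gcongr
      exact one_le_mu ξ
    calc _ ≤ 2 * ‖part Φ 0 ξ‖ₑ ^ 2 + 2 * ‖-part Y 0 ξ‖ₑ ^ 2 := by
          rw [hκ]; simp only [sub_eq_add_neg]; exact enorm_add_sq_le _ _
      _ ≤ 2 * (ENNReal.ofReal (mu ξ ^ (-3 - 2 * t)) * (K * Q ξ)) +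
          2 * (ENNReal.ofReal (mu ξ ^ (-3 - 2 * t)) * ((r₃.toNNReal * C₁ : ℝ≥0) * Q ξ)) := by
          rw [enorm_neg]; gcongr
      _ = _ := by rw [hC₂]; push_cast; ring
  refine ⟨fun ξ => Y ξ + κ (tang ξ) * expSym M (mu (tang ξ)) (ξ 0),
    hYm.add ((hκm.comp measurable_tang).mul hEm), ?_, ?_⟩
  · filter_upwards [hYle, hκle] with ξ k1 k2
    have hm := mu_pos ξ
    simp only [tang_glue, glue_zero]
    calc _ ≤ 2 * lineInt (t + 2) (mu ξ) (fun τ => Y (glue τ ξ)) +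
          2 * lineInt (t + 2) (mu ξ) (fun τ => κ ξ * expSym M (mu ξ) τ) :=
          lineInt_add_le _ _ (measurable_comp_glue hYm ξ) _
      _ ≤ 2 * (C₁ * Q ξ) + 2 * (ENNReal.ofReal (mu ξ ^ (-3 - 2 * t)) * (C₂ * Q ξ) *
          ENNReal.ofReal (r₂ * mu ξ ^ (2 * (t + 2) - 1))) := by
          rw [lineInt_const_mul]
          gcongr
          rw [hr₂]
          exact lineInt_expSym_le (by linarith) hm
      _ = 2 * (C₁ * Q ξ) + 2 * (ENNReal.ofReal (mu ξ ^ (-3 - 2 * t) * mu ξ ^ (2 * (t + 2) - 1)) *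
          (C₂ * (r₂.toNNReal : ℝ≥0) * Q ξ)) := by
          rw [ENNReal.ofReal_mul hr₂0,
            ENNReal.ofReal_mul (p := mu ξ ^ (-3 - 2 * t)) (by positivity)]
          change _ = 2 * (C₁ * Q ξ) + 2 * (_ * (C₂ * ENNReal.ofReal r₂ * Q ξ))
          ring
      _ = _ := by
          rw [← Real.rpow_add hm, show -3 - 2 * t + (2 * (t + 2) - 1) = 0 by ring, Real.rpow_zero]
          simp; ring
  · have hΦfin : ∀ᵐ ξ, lineInt t (mu ξ) (fun τ => Φ (glue τ ξ)) < ⊤ := by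
      filter_upwards [hΦ, h.finite] with ξ k1 k2
      exact k1.trans_lt (ENNReal.mul_lt_top ENNReal.coe_lt_top k2)
    filter_upwards [hΦfin, h.symbol_le, h.finite, hYle, hΦw, h.ode] with ξ k1 k2 k3 k4 k5 ⟨w₁, k6⟩
      x hx
    have hm := mu_pos ξ
    have := fourierInv_step hM1 hm (mu_sq ξ) ht (φ := fun τ => Φ (glue τ ξ))
      (A := fun τ => a (glue τ ξ)) (Y := fun τ => Y (glue τ ξ)) (γ := c ξ) (w := w ξ) (w₁ := w₁)
      (integrable_of_lineInt ht hm (measurable_comp_glue hΦm ξ) k1)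
      (integrable_of_lineInt (by linarith) hm (measurable_comp_glue h.measurable_symbol ξ)
        (k2.trans_lt k3)) (measurable_comp_glue hYm ξ)
      (k4.trans_lt (ENNReal.mul_lt_top ENNReal.coe_lt_top k3)) (fun τ => by
        have hp : ((mu ξ ^ 2 + (2 * Real.pi * τ) ^ 2 : ℝ) : ℂ) ≠ 0 := by
          exact_mod_cast (by positivity : mu ξ ^ 2 + (2 * Real.pi * τ) ^ 2 ≠ 0)
        have e1 := congrFun (hYfib ξ) τ
        have e2 := congrFun (hXfib ξ) τ
        rw [e1, mul_div_cancel₀ _ hp]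
        exact e2) k5 k6 hx
    have e : (fun τ => Y (glue τ ξ) + κ (tang (glue τ ξ)) *
        expSym M (mu (tang (glue τ ξ))) (glue τ ξ 0)) =
        fun τ => Y (glue τ ξ) + (part Φ 0 ξ - part Y 0 ξ) * expSym M (mu ξ) τ := by
      ext τ; simp only [tang_glue, glue_zero, hκ]
    exact (congrArg (fun g : ℝ → ℂ => (𝓕⁻ g : ℝ → ℂ) x) e).trans this

/-- The solution on the fibres is in the Sobolev space of exponent `s + 2` as soon as it is in some
Sobolev space of exponent `t₀ > 1/2`. -/
lemma hasExtSymbol_add_two {t₀ : ℝ} (ht : 1 / 2 < t₀) (hts : t₀ ≤ s) (K C : ℝ≥0) :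
    ∃ C' : ℝ≥0, ∀ (a : Amb N → ℂ) (c : Bdry N → ℂ) (w : Bdry N → ℝ → ℂ) (Q : Bdry N → ℝ≥0∞),
      FiberODE s K a c w Q → HasExtSymbol t₀ C w Q → HasExtSymbol (s + 2) C' w Q := by
  have H : ∀ n : ℕ, ∃ C' : ℝ≥0, ∀ (a : Amb N → ℂ) (c : Bdry N → ℂ) (w : Bdry N → ℝ → ℂ)
      (Q : Bdry N → ℝ≥0∞), FiberODE s K a c w Q → HasExtSymbol t₀ C w Q →
        HasExtSymbol (min (t₀ + 2 * n) s) C' w Q := by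
    intro n
    induction n with
    | zero => exact ⟨C, fun a c w Q _ h => h.mono (by simp)⟩
    | succ n ih =>
      obtain ⟨C₁, h₁⟩ := ih
      have hn : (0 : ℝ) ≤ n := n.cast_nonneg
      obtain ⟨C₂, h₂⟩ := hasExtSymbol_step (N := N) (t := min (t₀ + 2 * n) s) (s := s)
        (lt_min (by linarith) (by linarith)) (min_le_right _ _) K C₁
      refine ⟨C₂, fun a c w Q hF h => (h₂ a c w Q hF (h₁ a c w Q hF h)).mono ?_⟩
      push_cast
      rw [← min_add_add_right]
      exact min_le_min (by linarith) (by linarith)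
  obtain ⟨n, hn⟩ := exists_nat_gt s
  obtain ⟨C₁, h₁⟩ := H n
  obtain ⟨C₂, h₂⟩ := hasExtSymbol_step (N := N) (t := s) (s := s) (by linarith) le_rfl K C₁
  refine ⟨C₂, fun a c w Q hF h => h₂ a c w Q hF ?_⟩
  have := h₁ a c w Q hF h
  rwa [min_eq_right (by linarith)] at this

end Step

/-! ### The Newton potential of the data -/

/-- The extension of `f` by zero. -/
def zeroExt {N : ℕ} (f : Amb N → ℂ) : Amb N → ℂ := (halfSpace N).indicator f

/-- The symbol of the solution `u` of `-Δu = f` on the whole space, where `f` is extended by zero. -/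
def potSym {N : ℕ} (f : Amb N → ℂ) : Amb N → ℂ := fun ξ =>
  𝓕 (zeroExt f) ξ / (((2 * Real.pi * ‖ξ‖) ^ 2 : ℝ) : ℂ)

/-- `∫ |x|^k |f(x)| dx` over the half space. -/
def absMoment {N : ℕ} (k : ℕ) (f : Amb N → ℂ) : ℝ≥0∞ :=
  ∫⁻ x, ‖x‖ₑ ^ k * ‖f x‖ₑ ∂halfMeasure N

/-- The moments of order less than `k` vanish, for `k ≤ 2`. -/
def MomentsVanish {N : ℕ} (k : ℕ) (f : Amb N → ℂ) : Prop :=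
  (1 ≤ k → ∫ x, f x ∂halfMeasure N = 0) ∧
    (2 ≤ k → ∀ i : Fin (N + 1), ∫ x, (x i : ℂ) * f x ∂halfMeasure N = 0)

lemma norm_exp_I_sub_one_sub_le (θ : ℝ) :
    ‖Complex.exp (θ * Complex.I) - 1 - θ * Complex.I‖ ≤ 3 * |θ| ^ 2 := by
  have hn : ‖(θ : ℂ) * Complex.I‖ = |θ| := by simp
  by_cases h : |θ| ≤ 1
  · have := Complex.norm_exp_sub_one_sub_id_le (x := θ * Complex.I) (by rwa [hn])
    rw [hn] at this
    nlinarith [sq_nonneg |θ|]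
  · push Not at h
    calc _ ≤ ‖Complex.exp (θ * Complex.I)‖ + ‖(1 : ℂ)‖ + ‖(θ : ℂ) * Complex.I‖ :=
          (norm_sub_le _ _).trans (add_le_add_left (norm_sub_le _ _) _)
      _ = 1 + 1 + |θ| := by rw [hn, Complex.norm_exp_ofReal_mul_I, norm_one]
      _ ≤ _ := by nlinarith

section Potential

variable {N : ℕ} {f : Amb N → ℂ}

lemma integrable_zeroExt (hf : Integrable f (halfMeasure N)) : Integrable (zeroExt f) :=
  (integrable_indicator_iff measurableSet_halfSpace).2 hf

lemma memLp_zeroExt (hf : MemLp f 2 (halfMeasure N)) : MemLp (zeroExt f) 2 :=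
  (memLp_indicator_iff_restrict measurableSet_halfSpace).2 hf

lemma continuous_fourier_zeroExt (hf : Integrable f (halfMeasure N)) : Continuous (𝓕 (zeroExt f)) :=
  VectorFourier.fourierIntegral_continuous Real.continuous_fourierChar
    (by exact continuous_inner) (integrable_zeroExt hf)

lemma measurable_potSym (hf : Integrable f (halfMeasure N)) : Measurable (potSym f) := by
  unfold potSym
  refine (continuous_fourier_zeroExt hf).measurable.div ?_
  fun_prop

lemma fourier_zeroExt_eq (f : Amb N → ℂ) (ξ : Amb N) :
    𝓕 (zeroExt f) ξ = ∫ x, Complex.exp ((-(2 * Real.pi * inner ℝ x ξ) : ℝ) * Complex.I) * f x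
      ∂halfMeasure N := by
  rw [Real.fourier_eq', halfMeasure, ← integral_indicator measurableSet_halfSpace]
  congr 1; ext x
  by_cases hx : x ∈ halfSpace N
  · simp [zeroExt, hx]
  · simp [zeroExt, hx]

lemma lintegral_fourier_zeroExt (hf : Integrable f (halfMeasure N)) (h2 : MemLp f 2 (halfMeasure N)) :
    ∫⁻ ξ, ‖𝓕 (zeroExt f) ξ‖ₑ ^ 2 = ∫⁻ x, ‖f x‖ₑ ^ 2 ∂halfMeasure N := by
  rw [lintegral_fourier_of_integrable (memLp_zeroExt h2) (integrable_zeroExt hf), halfMeasure,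
    ← lintegral_indicator measurableSet_halfSpace]
  congr 1; ext x
  by_cases hx : x ∈ halfSpace N <;> simp [zeroExt, hx]

/-- Vanishing moments make the Fourier transform of the data vanish at the origin to the
corresponding order. -/
lemma enorm_fourier_zeroExt_le {k : ℕ} (hk : k ≤ 2) (hf : Integrable f (halfMeasure N))
    (hM : absMoment k f < ⊤) (hv : MomentsVanish k f) (ξ : Amb N) :
    ‖𝓕 (zeroExt f) ξ‖ₑ ≤ ENNReal.ofReal (3 * (2 * Real.pi * ‖ξ‖) ^ k) * absMoment k f := by
  have hθ : ∀ x : Amb N, |-(2 * Real.pi * inner ℝ x ξ)| ≤ 2 * Real.pi * ‖ξ‖ * ‖x‖ := fun x => by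
    rw [abs_neg, abs_mul, abs_of_pos (by positivity : (0 : ℝ) < 2 * Real.pi), mul_assoc _ ‖ξ‖]
    refine mul_le_mul_of_nonneg_left ?_ (by positivity)
    rw [mul_comm]
    exact abs_real_inner_le_norm x ξ
  have key : ∃ T : Amb N → ℂ, 𝓕 (zeroExt f) ξ = ∫ x, T x * f x ∂halfMeasure N ∧
      ∀ x, ‖T x‖ ≤ 3 * |-(2 * Real.pi * inner ℝ x ξ)| ^ k := by
    have hint : Integrable (fun x =>
        Complex.exp ((-(2 * Real.pi * inner ℝ x ξ) : ℝ) * Complex.I) * f x) (halfMeasure N) := by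
      refine hf.bdd_mul (c := 1) ?_ (Eventually.of_forall fun x => ?_)
      · exact Continuous.aestronglyMeasurable (by fun_prop)
      · rw [Complex.norm_exp_ofReal_mul_I]
    rw [fourier_zeroExt_eq]
    interval_cases k
    · refine ⟨_, rfl, fun x => ?_⟩
      rw [Complex.norm_exp_ofReal_mul_I]; norm_num
    · refine ⟨fun x => Complex.exp ((-(2 * Real.pi * inner ℝ x ξ) : ℝ) * Complex.I) - 1, ?_,
        fun x => ?_⟩
      · simp only [sub_mul, one_mul]
        rw [integral_sub hint hf, hv.1 le_rfl, sub_zero]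
      · have := Real.norm_exp_I_mul_ofReal_sub_one_le (x := -(2 * Real.pi * inner ℝ x ξ))
        rw [mul_comm Complex.I] at this
        refine this.trans ?_
        rw [pow_one, Real.norm_eq_abs]
        linarith [abs_nonneg (-(2 * Real.pi * inner ℝ x ξ))]
    · have hcoord : ∀ i : Fin (N + 1), Integrable (fun x => (x i : ℂ) * f x) (halfMeasure N) := by
        intro i
        have hm : AEStronglyMeasurable (fun x : Amb N => (x i : ℂ) * f x) (halfMeasure N) :=
          AEStronglyMeasurable.mul (Continuous.aestronglyMeasurable (by fun_prop)) hf.1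
        refine ⟨hm, ?_⟩
        have hb : ∫⁻ x, ‖(x i : ℂ) * f x‖ₑ ∂halfMeasure N ≤
            ∫⁻ x, (‖f x‖ₑ + ‖x‖ₑ ^ 2 * ‖f x‖ₑ) ∂halfMeasure N := by
          refine lintegral_mono fun x => ?_
          rw [enorm_mul, ← one_add_mul]
          gcongr
          rw [← ofReal_norm, ← ofReal_norm x, ← ENNReal.ofReal_pow (norm_nonneg _),
            ← ENNReal.ofReal_one, ← ENNReal.ofReal_add (by norm_num) (by positivity),
            Complex.norm_real]
          refine ENNReal.ofReal_le_ofReal ?_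
          have := PiLp.norm_apply_le x i
          nlinarith [sq_nonneg (‖x‖ - 1)]
        refine hb.trans_lt ?_
        rw [lintegral_add_left' hf.1.enorm]
        exact ENNReal.add_lt_top.2 ⟨hf.2, hM⟩
      have hsum : ∀ x : Amb N, ((-(2 * Real.pi * inner ℝ x ξ) : ℝ) : ℂ) * Complex.I * f x =
          ∑ i, (-(2 * Real.pi * ξ i) * Complex.I) * ((x i : ℂ) * f x) := fun x => by
        simp only [PiLp.inner_apply, Real.inner_apply]
        push_cast
        rw [Finset.mul_sum, ← Finset.sum_neg_distrib, Finset.sum_mul, Finset.sum_mul]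
        exact Finset.sum_congr rfl fun i _ => by ring
      have hi2 : Integrable (fun x => ((-(2 * Real.pi * inner ℝ x ξ) : ℝ) : ℂ) * Complex.I * f x)
          (halfMeasure N) := by
        simp only [hsum]
        exact integrable_finsetSum _ fun i _ => (hcoord i).const_mul _
      have h0 : ∫ x, ((-(2 * Real.pi * inner ℝ x ξ) : ℝ) : ℂ) * Complex.I * f x ∂halfMeasure N = 0 := by
        simp only [hsum]
        rw [integral_finsetSum _ fun i _ => (hcoord i).const_mul _]
        refine Finset.sum_eq_zero fun i _ => ?_
        rw [integral_const_mul, hv.2 le_rfl i, mul_zero]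
      refine ⟨fun x => Complex.exp ((-(2 * Real.pi * inner ℝ x ξ) : ℝ) * Complex.I) - 1 -
        ((-(2 * Real.pi * inner ℝ x ξ) : ℝ) : ℂ) * Complex.I, ?_, fun x =>
          norm_exp_I_sub_one_sub_le _⟩
      simp only [sub_mul, one_mul]
      have hs : Integrable (fun x =>
          Complex.exp ((-(2 * Real.pi * inner ℝ x ξ) : ℝ) * Complex.I) * f x - f x)
          (halfMeasure N) := hint.sub hf
      rw [integral_sub hs hi2, integral_sub hint hf, hv.1 (by norm_num), h0]
      simp
  obtain ⟨T, hT, hTb⟩ := key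
  rw [hT]
  refine (enorm_integral_le_lintegral_enorm _).trans ?_
  rw [absMoment, ← lintegral_const_mul' _ _ ENNReal.ofReal_ne_top]
  refine lintegral_mono fun x => ?_
  rw [enorm_mul, ← mul_assoc]
  gcongr
  rw [← ofReal_norm, ← ofReal_norm x, ← ENNReal.ofReal_pow (norm_nonneg _),
    ← ENNReal.ofReal_mul (by positivity)]
  refine ENNReal.ofReal_le_ofReal ((hTb x).trans ?_)
  rw [mul_assoc 3, ← mul_pow]
  have := hθ x
  gcongr

/-- The integral that controls the potential at low frequencies; it is finite as
`N + 2k ≥ 4`. -/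
lemma lintegral_ball_lt_top {k : ℕ} (hk : 4 ≤ N + 2 * k) :
    ∫⁻ ξ in Metric.ball (0 : Amb N) 1,
      ENNReal.ofReal (36 * ((2 * Real.pi * ‖ξ‖) ^ (2 * k) / (2 * Real.pi * ‖ξ‖) ^ 4)) < ⊤ := by
  have h := (integrableOn_fun_norm_addHaar (E := Amb N) (volume : Measure (Amb N)) (r := 1)
    (f := fun y : ℝ => 36 * ((2 * Real.pi * y) ^ (2 * k) / (2 * Real.pi * y) ^ 4))).2 (by
      have e : Set.EqOn (fun y : ℝ => y ^ (Module.finrank ℝ (Amb N) - 1) •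
          (36 * ((2 * Real.pi * y) ^ (2 * k) / (2 * Real.pi * y) ^ 4)))
          (fun y => 36 * (2 * Real.pi) ^ (2 * k) / (2 * Real.pi) ^ 4 * y ^ (N + 2 * k - 4))
          (Set.Ioo 0 1) := by
        intro y hy
        have hy0 : y ≠ 0 := hy.1.ne'
        have hfr : Module.finrank ℝ (Amb N) - 1 = N := by simp
        obtain ⟨m, hm⟩ := Nat.exists_eq_add_of_le hk
        simp only [smul_eq_mul, hfr]
        have e2 : y ^ N * y ^ (2 * k) = y ^ 4 * y ^ m := by rw [← pow_add, ← pow_add, hm]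
        rw [show N + 2 * k - 4 = m by omega, mul_pow, mul_pow]
        field_simp
        linear_combination e2
      rw [integrableOn_congr_fun e measurableSet_Ioo]
      have hc : Continuous fun y : ℝ =>
        36 * (2 * Real.pi) ^ (2 * k) / (2 * Real.pi) ^ 4 * y ^ (N + 2 * k - 4) := by fun_prop
      exact (hc.integrableOn_Icc (a := 0) (b := 1)).mono_set Set.Ioo_subset_Icc_self)
  have := h.2
  refine lt_of_le_of_lt (lintegral_mono fun ξ => ?_) this
  rw [← ofReal_norm, Real.norm_eq_abs]
  exact ENNReal.ofReal_le_ofReal (le_abs_self _)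

lemma symInt_potSym_le {k : ℕ} (hk : k ≤ 2) (hkN : 4 ≤ N + 2 * k) :
    ∃ C : ℝ≥0, ∀ f : Amb N → ℂ, Integrable f (halfMeasure N) → MemLp f 2 (halfMeasure N) →
      absMoment k f < ⊤ → MomentsVanish k f →
      symInt 2 (potSym f) ≤ C * (∫⁻ x, ‖f x‖ₑ ^ 2 ∂halfMeasure N + absMoment k f ^ 2) := by
  obtain ⟨I, hI⟩ : ∃ I, I = ∫⁻ ξ in Metric.ball (0 : Amb N) 1,
      ENNReal.ofReal (36 * ((2 * Real.pi * ‖ξ‖) ^ (2 * k) / (2 * Real.pi * ‖ξ‖) ^ 4)) := ⟨_, rfl⟩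
  have hIt : I < ⊤ := hI ▸ lintegral_ball_lt_top hkN
  refine ⟨max 4 I.toNNReal, fun f hf h2 hM hv => ?_⟩
  have hpt : ∀ ξ : Amb N, ENNReal.ofReal (symWt ξ ^ (2 : ℝ)) * ‖potSym f ξ‖ₑ ^ 2 ≤
      4 * ‖𝓕 (zeroExt f) ξ‖ₑ ^ 2 + (Metric.ball (0 : Amb N) 1).indicator (fun ξ =>
        ENNReal.ofReal (36 * ((2 * Real.pi * ‖ξ‖) ^ (2 * k) / (2 * Real.pi * ‖ξ‖) ^ 4))) ξ *
          absMoment k f ^ 2 := by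
    intro ξ
    by_cases hξ0 : ξ = 0
    · simp [hξ0, potSym]
    set r := 2 * Real.pi * ‖ξ‖ with hr
    have hr0 : 0 < r := by positivity
    have e : ENNReal.ofReal (symWt ξ ^ (2 : ℝ)) * ‖potSym f ξ‖ₑ ^ 2 =
        ENNReal.ofReal ((1 + r ^ 2) ^ 2 / r ^ 4) * ‖𝓕 (zeroExt f) ξ‖ₑ ^ 2 := by
      rw [Real.rpow_two, potSym, ← ofReal_norm, ← ofReal_norm, ← ENNReal.ofReal_pow (norm_nonneg _),
        ← ENNReal.ofReal_pow (norm_nonneg _), ← ENNReal.ofReal_mul (by positivity),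
        ← ENNReal.ofReal_mul (by positivity), norm_div, Complex.norm_real, Real.norm_eq_abs,
        abs_of_nonneg (by positivity), symWt, ← hr]
      congr 1; field_simp
    rw [e]
    by_cases h1 : 1 ≤ r
    · refine le_trans ?_ le_self_add
      gcongr
      rw [ENNReal.ofReal_le_ofNat, div_le_iff₀ (by positivity)]
      have : 1 ≤ r ^ 2 := by nlinarith
      nlinarith
    · push Not at h1
      refine le_trans ?_ le_add_self
      have hb : ξ ∈ Metric.ball (0 : Amb N) 1 := by
        rw [mem_ball_zero_iff]
        have : (1 : ℝ) ≤ 2 * Real.pi := by nlinarith [Real.pi_gt_three]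
        nlinarith [norm_nonneg ξ]
      rw [Set.indicator_of_mem hb]
      have h3 := enorm_fourier_zeroExt_le hk hf hM hv ξ
      calc _ ≤ ENNReal.ofReal (4 / r ^ 4) *
            (ENNReal.ofReal (3 * r ^ k) * absMoment k f) ^ 2 := by
            have h4 : (1 + r ^ 2) ^ 2 ≤ 4 := by
              have : r ^ 2 ≤ 1 := by nlinarith
              nlinarith [sq_nonneg r]
            gcongr
        _ = _ := by
            rw [mul_pow (ENNReal.ofReal _), ← ENNReal.ofReal_pow (by positivity), ← mul_assoc,
              ← ENNReal.ofReal_mul (by positivity)]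
            congr 2
            rw [mul_pow 3, ← pow_mul, mul_comm k 2, ← hr]
            ring
  unfold symInt
  refine (lintegral_mono hpt).trans ?_
  have hm1 : Measurable fun ξ : Amb N => 4 * ‖𝓕 (zeroExt f) ξ‖ₑ ^ 2 :=
    ((continuous_fourier_zeroExt hf).measurable.enorm.pow_const 2).const_mul 4
  rw [lintegral_add_left hm1, lintegral_const_mul' _ _ (by norm_num),
    lintegral_fourier_zeroExt hf h2, lintegral_mul_const' _ _ (by finiteness),
    lintegral_indicator Metric.isOpen_ball.measurableSet, ← hI, mul_add]
  gcongr
  · exact_mod_cast le_max_left _ _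
  · rw [← ENNReal.coe_toNNReal hIt.ne]
    exact_mod_cast le_max_right _ _

/-- The function `y ↦ f̂(y, ξ)` on `y > 0`, extended by zero. -/
def tangExt {N : ℕ} (f : Amb N → ℂ) (ξ : Bdry N) : ℝ → ℂ :=
  (Set.Ioi 0).indicator fun y => tangFourier f y ξ

lemma tangExt_eq (f : Amb N → ℂ) (ξ : Bdry N) (y : ℝ) :
    tangExt f ξ y = ∫ x', Complex.exp ((-(2 * Real.pi * inner ℝ x' ξ) : ℝ) * Complex.I) *
      zeroExt f (glue y x') := by
  by_cases hy : 0 < y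
  · have : ∀ x' : Bdry N, glue y x' ∈ halfSpace N := fun x' => hy
    simp only [tangExt, Set.indicator_of_mem (Set.mem_Ioi.2 hy), tangFourier, Real.fourier_eq',
      zeroExt, Set.indicator_of_mem (this _), smul_eq_mul, neg_mul]
  · have : ∀ x' : Bdry N, glue y x' ∉ halfSpace N := fun x' h => hy h
    simp [tangExt, Set.indicator_of_notMem (show y ∉ Set.Ioi 0 from hy), zeroExt, this]

lemma integrable_tangExt (hf : Integrable f (halfMeasure N)) (ξ : Bdry N) :
    Integrable (tangExt f ξ) := by
  have hi : Integrable fun x : Amb N =>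
      Complex.exp ((-(2 * Real.pi * inner ℝ (tang x) ξ) : ℝ) * Complex.I) * zeroExt f x := by
    refine (integrable_zeroExt hf).bdd_mul (c := 1) ?_ (Eventually.of_forall fun x => ?_)
    · have := continuous_tang (N := N)
      exact Continuous.aestronglyMeasurable (by fun_prop)
    · rw [Complex.norm_exp_ofReal_mul_I]
  refine (integrable_glue hi).integral_prod_left.congr (Eventually.of_forall fun y => ?_)
  simp only [tangExt_eq, tang_glue]

lemma fourier_zeroExt_glue (hf : Integrable f (halfMeasure N)) (τ : ℝ) (ξ : Bdry N) :
    𝓕 (zeroExt f) (glue τ ξ) = 𝓕 (tangExt f ξ) τ := by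
  have hi : Integrable fun x : Amb N =>
      Complex.exp ((-(2 * Real.pi * inner ℝ x (glue τ ξ)) : ℝ) * Complex.I) * zeroExt f x := by
    refine (integrable_zeroExt hf).bdd_mul (c := 1) ?_ (Eventually.of_forall fun x => ?_)
    · exact Continuous.aestronglyMeasurable (by fun_prop)
    · rw [Complex.norm_exp_ofReal_mul_I]
  rw [Real.fourier_eq', Real.fourier_eq']
  simp only [smul_eq_mul, neg_mul]
  rw [show ∫ x : Amb N, Complex.exp (((-(2 * Real.pi * inner ℝ x (glue τ ξ)) : ℝ) : ℂ) *
    Complex.I) * zeroExt f x = _ from integral_glue hi]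
  refine integral_congr_ae (Eventually.of_forall fun y => ?_)
  simp only
  rw [tangExt_eq, ← integral_const_mul]
  refine integral_congr_ae (Eventually.of_forall fun x' => ?_)
  simp only
  rw [inner_glue, ← mul_assoc, ← Complex.exp_add, Real.inner_apply]
  congr 2
  push_cast; ring

/-- The inverse Fourier transform of a product is a convolution. -/
lemma fourierInv_fourier_mul {g k : ℝ → ℂ} (hg : Integrable g) (hk : Integrable k) (x : ℝ) :
    𝓕⁻ (fun τ => 𝓕 g τ * k τ) x = ∫ y, g y * 𝓕⁻ k (x - y) := by
  have hk' : Integrable fun τ : ℝ => Complex.exp ((2 * Real.pi * (τ * x) : ℝ) * Complex.I) * k τ := by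
    refine hk.bdd_mul (c := 1) ?_ (Eventually.of_forall fun x => ?_)
    · exact Continuous.aestronglyMeasurable (by fun_prop)
    · rw [Complex.norm_exp_ofReal_mul_I]
  have h := VectorFourier.integral_fourierIntegral_smul_eq_flip (μ := volume) (ν := volume)
    (L := innerₗ ℝ) Real.continuous_fourierChar continuous_inner hg hk'
  rw [flip_innerₗ] at h
  have h' : ∫ τ, 𝓕 g τ • (Complex.exp ((2 * Real.pi * (τ * x) : ℝ) * Complex.I) * k τ) =
    ∫ y, g y • 𝓕 (fun τ : ℝ => Complex.exp ((2 * Real.pi * (τ * x) : ℝ) * Complex.I) * k τ) y := h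
  rw [Real.fourierInv_eq']
  refine (Eq.trans ?_ h').trans ?_
  · refine integral_congr_ae (Eventually.of_forall fun τ => ?_)
    simp only [smul_eq_mul, Real.inner_apply]
    ring
  · refine integral_congr_ae (Eventually.of_forall fun y => ?_)
    simp only [smul_eq_mul]
    congr 1
    rw [Real.fourier_eq', Real.fourierInv_eq']
    refine integral_congr_ae (Eventually.of_forall fun τ => ?_)
    simp only [smul_eq_mul, Real.inner_apply]
    rw [← mul_assoc, ← Complex.exp_add]
    congr 2
    push_cast; ring

lemma part_potSym (hf : Integrable f (halfMeasure N)) {ξ : Bdry N} (hξ : 0 < lam ξ) (x : ℝ) :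
    part (potSym f) x ξ = ((1 / (2 * lam ξ) : ℝ) : ℂ) * ∫ y in Set.Ioi (0 : ℝ),
      (Real.exp (-lam ξ * |x - y|) : ℂ) * tangFourier f y ξ := by
  have e : (fun τ => potSym f (glue τ ξ)) = fun τ => ((1 / (2 * lam ξ) : ℝ) : ℂ) *
      (𝓕 (tangExt f ξ) τ * expSym 1 (lam ξ) τ) := by
    ext τ
    have h1 : (2 * Real.pi * ‖glue τ ξ‖) ^ 2 = lam ξ ^ 2 + (2 * Real.pi * τ) ^ 2 := by
      rw [mul_pow, norm_glue_sq, lam]; ring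
    have hl : (lam ξ : ℂ) ≠ 0 := by exact_mod_cast hξ.ne'
    have hp : (lam ξ : ℂ) ^ 2 + (2 * Real.pi * τ) ^ 2 ≠ 0 := by
      exact_mod_cast (by positivity : lam ξ ^ 2 + (2 * Real.pi * τ) ^ 2 ≠ 0)
    rw [potSym, h1, fourier_zeroExt_glue hf, expSym_one]
    push_cast
    field_simp
  rw [part, e, fourierInv_const_mul_real,
    fourierInv_fourier_mul (integrable_tangExt hf ξ) (integrable_expSym le_rfl hξ)]
  congr 1
  rw [← integral_indicator measurableSet_Ioi]
  refine integral_congr_ae (Eventually.of_forall fun y => ?_)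
  simp only
  rw [fourierInv_expSym_one hξ, tangExt]
  by_cases hy : y ∈ Set.Ioi (0 : ℝ)
  · rw [Set.indicator_of_mem hy, Set.indicator_of_mem hy, mul_comm]
  · rw [Set.indicator_of_notMem hy, Set.indicator_of_notMem hy, zero_mul]

/-- For almost every `ξ` the function `part a · ξ` coincides with `f̂(·, ξ)` on the half line. -/
lemma HasSymbol.ae_tangFourier {s : ℝ} {a : Amb N → ℂ} (h : HasSymbol s f a) (hs : 1 / 2 < s)
    (hf : Integrable f (halfMeasure N)) :
    ∀ᵐ ξ : Bdry N, ∀ᵐ y ∂(volume.restrict (Set.Ioi (0 : ℝ))), part a y ξ = tangFourier f y ξ := by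
  obtain ⟨f', hf'm, hf'⟩ := h.aestronglyMeasurable
  have h1 : ∀ᵐ y ∂(volume.restrict (Set.Ioi (0 : ℝ))), ∀ ξ, tangFourier f y ξ = tangFourier f' y ξ := by
    filter_upwards [ae_half_glue hf'] with y hy ξ
    unfold tangFourier
    rw [Real.fourier_eq', Real.fourier_eq']
    exact integral_congr_ae (hy.mono fun x' hx' => by simp only; rw [hx'])
  have h2 : ∀ᵐ y ∂(volume.restrict (Set.Ioi (0 : ℝ))), ∀ᵐ ξ : Bdry N,
      part a y ξ = tangFourier f' y ξ := by
    have hi : ∀ᵐ y ∂(volume.restrict (Set.Ioi (0 : ℝ))), Integrable fun x' : Bdry N =>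
        f (glue y x') :=
      (measurePreserving_glue_half.integrable_comp_of_integrable hf).prod_right_ae
    filter_upwards [h.isTangFourier hs, hi, h1] with y ⟨k1, k2⟩ k3 k4
    filter_upwards [k2, fourier_toLp_ae_eq k1 k3] with ξ e1 e2
    rw [← k4, tangFourier, ← e2, e1]
  have hm : Measurable fun x : Amb N => tangFourier f' (x 0) (tang x) := by
    unfold tangFourier
    simp only [Real.fourier_eq']
    have : Measurable (Function.uncurry fun (x : Amb N) (x' : Bdry N) =>
        Complex.exp (↑(-2 * Real.pi * inner ℝ x' (tang x)) * Complex.I) • f' (glue (x 0) x')) := by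
      have h0 : Measurable fun x : Amb N => x 0 := by fun_prop
      have h1 : Measurable fun p : Amb N × Bdry N => f' (glue (p.1 0) p.2) :=
        hf'm.measurable.comp
          (measurable_glue.comp ((h0.comp measurable_fst).prodMk measurable_snd))
      have h2 : Continuous fun p : Amb N × Bdry N =>
          Complex.exp (↑(-2 * Real.pi * inner ℝ p.2 (tang p.1)) * Complex.I) := by
        have := continuous_tang (N := N)
        fun_prop
      exact h2.measurable.smul h1
    exact (this.stronglyMeasurable.integral_prod_right (ν := (volume : Measure (Bdry N)))).measurable
  have hp : Measurable fun x : Amb N => (x 0, tang x) := (glueEquiv N).symm.measurable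
  have h3 := ae_half_swap (p := fun y ξ => part a y ξ = tangFourier f' y ξ)
    (measurableSet_eq_fun (measurable_part_comp h.1 hp.fst hp.snd) hm).nullMeasurableSet h2
  filter_upwards [h3] with ξ hξ
  filter_upwards [hξ, h1] with y e1 e2
  rw [e1, e2]

end Potential

/-! ### The explicit solution on a fibre -/

/-- The bounded solution of `-y'' + l² y = g` on the half line given by the Green function
`e^{-l|x - y|} / (2l)`, continued to the real line as a solution of the differential equation. -/
def greenODE (l : ℝ) (g : ℝ → ℂ) (x : ℝ) : ℂ :=
  (1 / (2 * l) : ℂ) * ((Real.exp (-l * x) : ℂ) * (∫ y in (0 : ℝ)..x, (Real.exp (l * y) : ℂ) * g y) +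
    (Real.exp (l * x) : ℂ) * ((∫ y in Set.Ioi (0 : ℝ), (Real.exp (-l * y) : ℂ) * g y) -
      ∫ y in (0 : ℝ)..x, (Real.exp (-l * y) : ℂ) * g y))

/-- The derivative of `greenODE`. -/
def greenODEDeriv (l : ℝ) (g : ℝ → ℂ) (x : ℝ) : ℂ :=
  (1 / 2 : ℂ) * (-(Real.exp (-l * x) : ℂ) * (∫ y in (0 : ℝ)..x, (Real.exp (l * y) : ℂ) * g y) +
    (Real.exp (l * x) : ℂ) * ((∫ y in Set.Ioi (0 : ℝ), (Real.exp (-l * y) : ℂ) * g y) -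
      ∫ y in (0 : ℝ)..x, (Real.exp (-l * y) : ℂ) * g y))

section Green

variable {l m : ℝ} {g : ℝ → ℂ}

lemma hasDerivAt_integral_exp (hg : Continuous g) (κ x : ℝ) :
    HasDerivAt (fun x => ∫ y in (0 : ℝ)..x, (Real.exp (κ * y) : ℂ) * g y)
      ((Real.exp (κ * x) : ℂ) * g x) x := by
  have hc : Continuous fun y : ℝ => (Real.exp (κ * y) : ℂ) * g y := by fun_prop
  exact intervalIntegral.integral_hasDerivAt_right (hc.intervalIntegrable _ _)
    (hc.stronglyMeasurableAtFilter _ _) hc.continuousAt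

lemma hasDerivAt_greenODE (hl : l ≠ 0) (hg : Continuous g) (x : ℝ) :
    HasDerivAt (greenODE l g) (greenODEDeriv l g x) x := by
  have h1 := (hasDerivAt_cexp_mul (-l) x).mul (hasDerivAt_integral_exp hg l x)
  have h2 := (hasDerivAt_cexp_mul l x).mul ((hasDerivAt_integral_exp hg (-l) x).const_sub
    (∫ y in Set.Ioi (0 : ℝ), (Real.exp (-l * y) : ℂ) * g y))
  have h3 := (h1.add h2).const_mul (1 / (2 * l) : ℂ)
  refine h3.congr_deriv ?_
  have hl' : (l : ℂ) ≠ 0 := by exact_mod_cast hl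
  have he := exp_mul_exp_neg l x
  unfold greenODEDeriv
  simp only [Complex.ofReal_neg]
  field_simp
  ring

lemma hasDerivAt_greenODEDeriv (hl : l ≠ 0) (hg : Continuous g) (x : ℝ) :
    HasDerivAt (greenODEDeriv l g) ((l : ℂ) ^ 2 * greenODE l g x - g x) x := by
  have h1 := (hasDerivAt_cexp_mul (-l) x).neg.mul (hasDerivAt_integral_exp hg l x)
  have h2 := (hasDerivAt_cexp_mul l x).mul ((hasDerivAt_integral_exp hg (-l) x).const_sub
    (∫ y in Set.Ioi (0 : ℝ), (Real.exp (-l * y) : ℂ) * g y))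
  have h3 := (h1.add h2).const_mul (1 / 2 : ℂ)
  refine h3.congr_deriv ?_
  have hl' : (l : ℂ) ≠ 0 := by exact_mod_cast hl
  have he := exp_mul_exp_neg l x
  unfold greenODE
  simp only [Complex.ofReal_neg, Pi.neg_apply]
  generalize (Real.exp (-l * x) : ℂ) = A at he ⊢
  generalize (Real.exp (l * x) : ℂ) = B at he ⊢
  field_simp
  linear_combination (-2 * g x) * he

lemma integrableOn_exp_mul (hl : 0 ≤ l) (hg : IntegrableOn g (Set.Ioi 0)) :
    IntegrableOn (fun y : ℝ => (Real.exp (-l * y) : ℂ) * g y) (Set.Ioi 0) := by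
  refine Integrable.bdd_mul (c := 1) hg (Continuous.aestronglyMeasurable (by fun_prop)) ?_
  filter_upwards [ae_restrict_mem measurableSet_Ioi] with y hy
  have hy' : 0 < y := hy
  rw [Complex.norm_real, Real.norm_eq_abs, abs_of_pos (Real.exp_pos _), Real.exp_le_one_iff]
  nlinarith

lemma integrableOn_exp_abs_mul (hl : 0 ≤ l) (hg : IntegrableOn g (Set.Ioi 0)) (x : ℝ) :
    IntegrableOn (fun y : ℝ => (Real.exp (-l * |x - y|) : ℂ) * g y) (Set.Ioi 0) := by
  refine Integrable.bdd_mul (c := 1) hg (Continuous.aestronglyMeasurable (by fun_prop)) ?_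
  refine Eventually.of_forall fun y => ?_
  rw [Complex.norm_real, Real.norm_eq_abs, abs_of_pos (Real.exp_pos _), Real.exp_le_one_iff]
  nlinarith [abs_nonneg (x - y)]

lemma greenHat_eq (hl : 0 < l) (hi : IntegrableOn g (Set.Ioi 0)) (σ : ℝ)
    {x : ℝ} (hx : 0 ≤ x) :
    greenHat σ l g x = greenODE l g x + σ / (2 * l) * Real.exp (-l * x) *
      ∫ y in Set.Ioi (0 : ℝ), (Real.exp (-l * y) : ℂ) * g y := by
  have hI := integrableOn_exp_mul hl.le hi
  have hA := integrableOn_exp_abs_mul hl.le hi x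
  have e1 : ∫ y in Set.Ioi (0 : ℝ),
      ((Real.exp (-l * |x - y|) + σ * Real.exp (-l * (x + y)) : ℝ) : ℂ) * g y =
      (∫ y in Set.Ioi (0 : ℝ), (Real.exp (-l * |x - y|) : ℂ) * g y) +
      σ * Real.exp (-l * x) * ∫ y in Set.Ioi (0 : ℝ), (Real.exp (-l * y) : ℂ) * g y := by
    rw [← integral_const_mul, ← integral_add hA (hI.const_mul _)]
    refine integral_congr_ae (Eventually.of_forall fun y => ?_)
    simp only
    rw [mul_add, Real.exp_add]; push_cast; ring
  have e2 : ∫ y in Set.Ioi (0 : ℝ), (Real.exp (-l * |x - y|) : ℂ) * g y =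
      (Real.exp (-l * x) : ℂ) * (∫ y in (0 : ℝ)..x, (Real.exp (l * y) : ℂ) * g y) +
      (Real.exp (l * x) : ℂ) * ((∫ y in Set.Ioi (0 : ℝ), (Real.exp (-l * y) : ℂ) * g y) -
      ∫ y in (0 : ℝ)..x, (Real.exp (-l * y) : ℂ) * g y) := by
    have hsub : ∀ φ : ℝ → ℂ, IntegrableOn φ (Set.Ioi 0) → ∫ y in Set.Ioi (0 : ℝ), φ y =
        (∫ y in (0 : ℝ)..x, φ y) + ∫ y in Set.Ioi x, φ y := fun φ hφ => by
      rw [intervalIntegral.integral_of_le hx, ← setIntegral_union Set.Ioc_disjoint_Ioi_same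
        measurableSet_Ioi (hφ.mono_set Set.Ioc_subset_Ioi_self)
        (hφ.mono_set (Set.Ioi_subset_Ioi hx)), Set.Ioc_union_Ioi_eq_Ioi hx]
    rw [hsub _ hA, hsub _ hI, add_sub_cancel_left]
    congr 1
    · rw [← intervalIntegral.integral_const_mul]
      refine intervalIntegral.integral_congr fun y hy => ?_
      rw [Set.uIcc_of_le hx] at hy
      rw [abs_of_nonneg (by linarith [hy.2]), ← mul_assoc, ← Complex.ofReal_mul, ← Real.exp_add]
      congr 3; ring
    · rw [← integral_const_mul]
      refine setIntegral_congr_fun measurableSet_Ioi fun y hy => ?_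
      have hy' : x < y := hy
      rw [abs_of_neg (by linarith), ← mul_assoc, ← Complex.ofReal_mul, ← Real.exp_add]
      congr 3; ring
  rw [greenHat, e1, e2, greenODE]
  push_cast
  ring

lemma integral_exp_Ioi (hm : 0 < m) :
    ∫ y in Set.Ioi (0 : ℝ), (Real.exp (-m * y) : ℂ) = 1 / m := by
  have := integral_exp_mul_complex_Ioi (a := (-m : ℂ)) (by simpa using hm) 0
  have e : ∀ y : ℝ, (Real.exp (-m * y) : ℂ) = Complex.exp (-m * y) := fun y => by push_cast; rfl
  simp only [e, this]
  have hm' : (m : ℂ) ≠ 0 := by exact_mod_cast hm.ne'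
  simp

lemma integrableOn_exp_Ioi (hm : 0 < m) :
    IntegrableOn (fun y : ℝ => (Real.exp (-m * y) : ℂ)) (Set.Ioi 0) := by
  have := integrableOn_exp_mul_complex_Ioi (a := (-m : ℂ)) (by simpa using hm) 0
  refine this.congr_fun (fun y _ => ?_) measurableSet_Ioi
  push_cast; rfl

/-- The Green potential of `e^{-m x}`, where `m² = 1 + l²`. -/
lemma greenHat_exp (hl : 0 < l) (hm : 0 < m) (hlm : m ^ 2 = 1 + l ^ 2) (σ : ℝ) {x : ℝ} (hx : 0 ≤ x) :
    greenHat σ l (fun y => (Real.exp (-m * y) : ℂ)) x =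
      ((m + l + σ * (m - l)) / (2 * l) : ℂ) * Real.exp (-l * x) - Real.exp (-m * x) := by
  have hlt : l < m := by nlinarith
  rw [greenHat_eq hl (integrableOn_exp_Ioi hm) σ hx, greenODE]
  have hlC : (l : ℂ) ≠ 0 := by exact_mod_cast hl.ne'
  have hlm' : (m : ℂ) ^ 2 = 1 + (l : ℂ) ^ 2 := by exact_mod_cast hlm
  have i1 : ∀ κ : ℝ, κ - m ≠ 0 → ∫ y in (0 : ℝ)..x, (Real.exp (κ * y) : ℂ) * Real.exp (-m * y) =
      (Real.exp (κ * x) * Real.exp (-m * x) - 1) / (κ - m) := fun κ hκ => by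
    have hκ' : ((κ - m : ℝ) : ℂ) ≠ 0 := by exact_mod_cast hκ
    have e : ∀ y : ℝ, (Real.exp (κ * y) : ℂ) * Real.exp (-m * y) =
        Complex.exp (((κ - m : ℝ) : ℂ) * y) := fun y => by
      rw [← Complex.ofReal_mul, ← Real.exp_add]
      push_cast; congr 1; ring
    simp only [e]
    rw [integral_exp_mul_complex hκ']
    simp
  have i2 : ∫ y in Set.Ioi (0 : ℝ), (Real.exp (-l * y) : ℂ) * Real.exp (-m * y) = 1 / (l + m) := by
    have e : ∀ y : ℝ, (Real.exp (-l * y) : ℂ) * Real.exp (-m * y) =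
        (Real.exp (-(l + m) * y) : ℂ) := fun y => by
      rw [← Complex.ofReal_mul, ← Real.exp_add]
      congr 2; ring
    simp only [e]
    rw [integral_exp_Ioi (by linarith)]
    push_cast; rfl
  rw [i1 l (by linarith), i1 (-l) (by linarith), i2]
  have he := exp_mul_exp_neg l x
  have h1 : (l : ℂ) - m ≠ 0 := by exact_mod_cast (by linarith : l - m ≠ 0)
  have h2 : (l : ℂ) + m ≠ 0 := by exact_mod_cast (by linarith : l + m ≠ 0)
  have h3 : ((-l : ℝ) : ℂ) - m ≠ 0 := by exact_mod_cast (by linarith : -l - m ≠ 0)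
  -- `(m - l) (m + l) = 1`
  have r1 : 1 / ((l : ℂ) - m) = -(l + m) := by
    field_simp; linear_combination -hlm'
  have r2 : 1 / ((l : ℂ) + m) = m - l := by
    field_simp; linear_combination -hlm'
  have r3 : 1 / (((-l : ℝ) : ℂ) - m) = l - m := by
    rw [← neg_sub (m : ℂ) l, ← r2, ← neg_div_neg_eq]; push_cast; ring_nf
  rw [div_eq_mul_one_div _ ((l : ℂ) - m), div_eq_mul_one_div _ (((-l : ℝ) : ℂ) - m), r1, r2, r3]
  generalize (Real.exp (-l * x) : ℂ) = A at he ⊢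
  generalize (Real.exp (l * x) : ℂ) = B at he ⊢
  generalize (Real.exp (-m * x) : ℂ) = E
  field_simp
  linear_combination (-2 * l * E) * he

lemma greenHat_add_const_mul (hl : 0 < l) {h : ℝ → ℂ} (hg : IntegrableOn g (Set.Ioi 0))
    (hh : IntegrableOn h (Set.Ioi 0)) (c : ℂ) (σ : ℝ) {x : ℝ} (hx : 0 ≤ x) :
    greenHat σ l (fun y => g y + c * h y) x = greenHat σ l g x + c * greenHat σ l h x := by
  have hb : ∀ φ : ℝ → ℂ, IntegrableOn φ (Set.Ioi 0) → IntegrableOn (fun y : ℝ =>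
      ((Real.exp (-l * |x - y|) + σ * Real.exp (-l * (x + y)) : ℝ) : ℂ) * φ y) (Set.Ioi 0) := by
    intro φ hφ
    refine Integrable.bdd_mul (c := 1 + |σ|) hφ (Continuous.aestronglyMeasurable (by fun_prop)) ?_
    filter_upwards [ae_restrict_mem measurableSet_Ioi] with y hy
    have hy' : 0 < y := hy
    rw [Complex.norm_real]
    refine (norm_add_le _ _).trans (add_le_add ?_ ?_)
    · rw [Real.norm_eq_abs, abs_of_pos (Real.exp_pos _), Real.exp_le_one_iff]
      nlinarith [abs_nonneg (x - y)]
    · rw [norm_mul, Real.norm_eq_abs, Real.norm_eq_abs, abs_of_pos (Real.exp_pos _)]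
      refine mul_le_of_le_one_right (abs_nonneg _) ?_
      rw [Real.exp_le_one_iff]
      nlinarith
  unfold greenHat
  rw [mul_left_comm c, ← mul_add]
  congr 1
  rw [← integral_const_mul, ← integral_add (hb g hg) ((hb h hh).const_mul c)]
  exact integral_congr_ae (Eventually.of_forall fun y => by simp only; ring)

end Green

/-- The data of the explicit solution on a fibre: the coefficients `c` of `-e^{-μ x}` and `k` and
`b` of the exponential `(k F / (2λ) + λ b) e^{-λ x}`; here `F = ∫_0^∞ e^{-λ y} f̂(y) dy` and
`f₀ = f̂(0)`. -/
structure FiberCoeff where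
  k : ℝ
  b : ℂ
  c : ℂ

open Classical in
/-- The coefficients of the explicit solution, for the normal and the tangential components. -/
def fiberCoeff {N : ℕ} (normal : Prop) (ξ : Bdry N) (F f₀ : ℂ) : FiberCoeff :=
  if normal then ⟨1 - 2 * m1 ξ, -m1 ξ * F, -mu ξ * m1 ξ * F⟩
  else ⟨2 * m1 ξ - 1, m1 ξ * F - ((lam ξ + mu ξ) / den ξ : ℝ) * f₀, m1 ξ * (lam ξ * F - f₀)⟩

/-- The explicit solution on the fibre over `ξ` for the right-hand side `g`. -/
def fiberSol {N : ℕ} (normal : Prop) (ξ : Bdry N) (g : ℝ → ℂ) (x : ℝ) : ℂ :=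
  let F := ∫ y in Set.Ioi (0 : ℝ), (Real.exp (-lam ξ * y) : ℂ) * g y
  let K := fiberCoeff normal ξ F (g 0)
  greenODE (lam ξ) g x + (K.k * F / (2 * lam ξ) + lam ξ * K.b) * Real.exp (-lam ξ * x) -
    K.c * Real.exp (-mu ξ * x)

/-- The derivative of `fiberSol`. -/
def fiberSolDeriv {N : ℕ} (normal : Prop) (ξ : Bdry N) (g : ℝ → ℂ) (x : ℝ) : ℂ :=
  let F := ∫ y in Set.Ioi (0 : ℝ), (Real.exp (-lam ξ * y) : ℂ) * g y
  let K := fiberCoeff normal ξ F (g 0)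
  greenODEDeriv (lam ξ) g x - lam ξ * (K.k * F / (2 * lam ξ) + lam ξ * K.b) *
    Real.exp (-lam ξ * x) + mu ξ * K.c * Real.exp (-mu ξ * x)

section Solution

variable {N : ℕ} {ξ : Bdry N} {g : ℝ → ℂ} (normal : Prop)

lemma den_pos (ξ : Bdry N) : 0 < den ξ := by
  unfold den
  have := mul_nonneg (lam_nonneg ξ) (mu_pos ξ).le
  positivity

lemma hasDerivAt_fiberSol (hξ : 0 < lam ξ) (hg : Continuous g) (x : ℝ) :
    HasDerivAt (fiberSol normal ξ g) (fiberSolDeriv normal ξ g x) x := by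
  unfold fiberSol fiberSolDeriv
  simp only
  refine (((hasDerivAt_greenODE hξ.ne' hg x).add
    ((hasDerivAt_cexp_mul (-lam ξ) x).const_mul _)).sub
    ((hasDerivAt_cexp_mul (-mu ξ) x).const_mul _)).congr_deriv ?_
  push_cast; ring

lemma hasDerivAt_fiberSolDeriv (hξ : 0 < lam ξ) (hg : Continuous g) (x : ℝ) :
    HasDerivAt (fiberSolDeriv normal ξ g) ((lam ξ : ℂ) ^ 2 * fiberSol normal ξ g x - g x -
      (fiberCoeff normal ξ (∫ y in Set.Ioi (0 : ℝ), (Real.exp (-lam ξ * y) : ℂ) * g y) (g 0)).c *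
        Real.exp (-mu ξ * x)) x := by
  unfold fiberSol fiberSolDeriv
  simp only
  refine (((hasDerivAt_greenODEDeriv hξ.ne' hg x).sub
    ((hasDerivAt_cexp_mul (-lam ξ) x).const_mul _)).add
    ((hasDerivAt_cexp_mul (-mu ξ) x).const_mul _)).congr_deriv ?_
  have h : (mu ξ : ℂ) ^ 2 = 1 + (lam ξ : ℂ) ^ 2 := by exact_mod_cast mu_sq ξ
  simp only [Complex.ofReal_neg]
  linear_combination (-(fiberCoeff normal ξ (∫ y in Set.Ioi (0 : ℝ),
    (Real.exp (-lam ξ * y) : ℂ) * g y) (g 0)).c * Real.exp (-mu ξ * x)) * h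

lemma fiberSol_zero (hξ : 0 < lam ξ) :
    fiberSol normal ξ g 0 =
      (∫ y in Set.Ioi (0 : ℝ), (Real.exp (-lam ξ * y) : ℂ) * g y) / (2 * lam ξ) +
      ((fiberCoeff normal ξ (∫ y in Set.Ioi (0 : ℝ), (Real.exp (-lam ξ * y) : ℂ) * g y) (g 0)).k *
        (∫ y in Set.Ioi (0 : ℝ), (Real.exp (-lam ξ * y) : ℂ) * g y) / (2 * lam ξ) + lam ξ *
      (fiberCoeff normal ξ (∫ y in Set.Ioi (0 : ℝ), (Real.exp (-lam ξ * y) : ℂ) * g y) (g 0)).b) -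
      (fiberCoeff normal ξ (∫ y in Set.Ioi (0 : ℝ), (Real.exp (-lam ξ * y) : ℂ) * g y) (g 0)).c := by
  have hl : (lam ξ : ℂ) ≠ 0 := by exact_mod_cast hξ.ne'
  simp [fiberSol, greenODE]
  ring

lemma fiberSolDeriv_zero (hξ : 0 < lam ξ) :
    fiberSolDeriv normal ξ g 0 =
      (∫ y in Set.Ioi (0 : ℝ), (Real.exp (-lam ξ * y) : ℂ) * g y) / 2 -
      lam ξ * ((fiberCoeff normal ξ (∫ y in Set.Ioi (0 : ℝ), (Real.exp (-lam ξ * y) : ℂ) * g y) (g 0)).k *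
        (∫ y in Set.Ioi (0 : ℝ), (Real.exp (-lam ξ * y) : ℂ) * g y) / (2 * lam ξ) + lam ξ *
      (fiberCoeff normal ξ (∫ y in Set.Ioi (0 : ℝ), (Real.exp (-lam ξ * y) : ℂ) * g y) (g 0)).b) +
      mu ξ * (fiberCoeff normal ξ (∫ y in Set.Ioi (0 : ℝ), (Real.exp (-lam ξ * y) : ℂ) * g y) (g 0)).c := by
  have hl : (lam ξ : ℂ) ≠ 0 := by exact_mod_cast hξ.ne'
  simp [fiberSolDeriv, greenODEDeriv]
  ring

/-- The rational parametrisation of the hyperbola `μ² - λ² = 1`. -/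
lemma exists_rational_param (ξ : Bdry N) (hξ : 0 < lam ξ) : ∃ e : ℝ, 0 < e ∧ e < 1 ∧
    lam ξ = (1 - e ^ 2) / (2 * e) ∧ mu ξ = (1 + e ^ 2) / (2 * e) := by
  have h := mu_sq ξ
  have he : 0 < mu ξ - lam ξ := by linarith [lam_lt_mu ξ]
  refine ⟨mu ξ - lam ξ, he, by nlinarith [mu_pos ξ], ?_, ?_⟩
  · field_simp; nlinarith
  · field_simp; nlinarith

/-- The boundary conditions and the values of the coefficient `c`: for the normal components
`w'(0) = 0` and `c = -μ² w(0)`, for the tangential components `λ² w(0) = f₀ + c` (that is,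
`w''(0) = 0`) and `c = μ w'(0)`. -/
lemma fiberSol_bdry (hξ : 0 < lam ξ) {F : ℂ}
    (hF : F = ∫ y in Set.Ioi (0 : ℝ), (Real.exp (-lam ξ * y) : ℂ) * g y) :
    (normal → fiberSolDeriv normal ξ g 0 = 0 ∧ fiberSol normal ξ g 0 = m1 ξ * F / mu ξ ∧
      (fiberCoeff normal ξ F (g 0)).c = -(mu ξ : ℂ) ^ 2 * fiberSol normal ξ g 0) ∧
    (¬ normal → fiberSol normal ξ g 0 = g 0 / den ξ + m1 ξ * F / lam ξ ∧
      (lam ξ : ℂ) ^ 2 * fiberSol normal ξ g 0 = g 0 + (fiberCoeff normal ξ F (g 0)).c ∧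
      (fiberCoeff normal ξ F (g 0)).c = mu ξ * fiberSolDeriv normal ξ g 0) := by
  obtain ⟨e, he0, he1, hl, hm⟩ := exists_rational_param ξ hξ
  have hDe : den ξ = (3 + e ^ 4) / (4 * e ^ 2) := by
    rw [den, hl, hm]; field_simp; ring
  have hm1 : m1 ξ = (2 * (1 + e ^ 2)) / (3 + e ^ 4) := by
    rw [m1, hDe, hl, hm]; field_simp; ring
  rw [fiberSol_zero normal hξ, fiberSolDeriv_zero normal hξ, ← hF]
  have c0 : (e : ℂ) ≠ 0 := by exact_mod_cast he0.ne'
  have c1 : (1 : ℂ) - e ^ 2 ≠ 0 := by exact_mod_cast (by nlinarith : (0 : ℝ) < 1 - e ^ 2).ne'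
  have c2 : (1 : ℂ) + e ^ 2 ≠ 0 := by exact_mod_cast (by positivity : (0 : ℝ) < 1 + e ^ 2).ne'
  have c3 : (3 : ℂ) + e ^ 4 ≠ 0 := by exact_mod_cast (by positivity : (0 : ℝ) < 3 + e ^ 4).ne'
  constructor <;> intro hn <;>
    simp only [fiberCoeff, hn, if_true, if_false, hm1, hDe, hl, hm] <;> push_cast <;>
    refine ⟨?_, ?_, ?_⟩ <;> field_simp <;> ring

/-- The explicit formulas for the solution. -/
lemma fiberSol_eq_solHat {f : Amb N → ℂ} (hξ : 0 < lam ξ)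
    (hf : IntegrableOn (fun y => tangFourier f y ξ) (Set.Ioi 0))
    (he : ∀ᵐ y ∂(volume.restrict (Set.Ioi (0 : ℝ))), g y = tangFourier f y ξ)
    (h0 : traceHat f ξ = g 0) {x : ℝ} (hx : 0 ≤ x) :
    (normal → solHatNorm f x ξ = fiberSol normal ξ g x) ∧
      (¬ normal → solHatTang f x ξ = fiberSol normal ξ g x) := by
  have hgi : IntegrableOn g (Set.Ioi 0) := hf.congr (he.mono fun y hy => hy.symm)
  have hei := integrableOn_exp_Ioi (mu_pos ξ)
  have hF : lapHat f ξ = ∫ y in Set.Ioi (0 : ℝ), (Real.exp (-lam ξ * y) : ℂ) * g y :=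
    integral_congr_ae (he.mono fun y hy => by simp only; rw [hy])
  have hG : ∀ σ c : ℂ, ∀ (σ' : ℝ), σ = σ' → greenHat σ' (lam ξ) (fun y => tangFourier f y ξ +
      c * (Real.exp (-mu ξ * y) : ℂ)) x = greenODE (lam ξ) g x + σ / (2 * lam ξ) *
        Real.exp (-lam ξ * x) * lapHat f ξ + c * (((mu ξ + lam ξ + σ * (mu ξ - lam ξ)) / (2 * lam ξ) : ℂ)
        * Real.exp (-lam ξ * x) - Real.exp (-mu ξ * x)) := by
    rintro σ c σ' rfl
    rw [greenHat_add_const_mul hξ hf hei c σ' hx, greenHat_exp hξ (mu_pos ξ) (mu_sq ξ) σ' hx, hF,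
      ← greenHat_eq hξ hgi σ' hx]
    congr 1
    unfold greenHat
    congr 1
    exact integral_congr_ae (he.mono fun y hy => by simp only; rw [hy])
  obtain ⟨e, he0, he1, hl, hm⟩ := exists_rational_param ξ hξ
  have hDe : den ξ = (3 + e ^ 4) / (4 * e ^ 2) := by
    rw [den, hl, hm]; field_simp; ring
  have hm1 : m1 ξ = (2 * (1 + e ^ 2)) / (3 + e ^ 4) := by
    rw [m1, hDe, hl, hm]; field_simp; ring
  have hm2 : m2 ξ = (4 * e) / (3 + e ^ 4) := by
    rw [m2, hDe, hl, hm]; field_simp; ring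
  have c0 : (e : ℂ) ≠ 0 := by exact_mod_cast he0.ne'
  have c1 : (1 : ℂ) - e ^ 2 ≠ 0 := by exact_mod_cast (by nlinarith : (0 : ℝ) < 1 - e ^ 2).ne'
  have c2 : (1 : ℂ) + e ^ 2 ≠ 0 := by exact_mod_cast (by positivity : (0 : ℝ) < 1 + e ^ 2).ne'
  have c3 : (3 : ℂ) + e ^ 4 ≠ 0 := by exact_mod_cast (by positivity : (0 : ℝ) < 3 + e ^ 4).ne'
  constructor <;> intro hn
  · have e1 : solHatNorm f x ξ = greenHat 1 (lam ξ) (fun y => tangFourier f y ξ +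
        (-((1 + lam ξ ^ 2 : ℝ) : ℂ) * (m2 ξ * lapHat f ξ)) * (Real.exp (-mu ξ * y) : ℂ)) x := by
      unfold solHatNorm
      congr 1; ext y; ring
    rw [e1, hG 1 _ 1 (by simp)]
    unfold fiberSol
    simp only [fiberCoeff, hn, if_true, ← hF]
    generalize (Real.exp (-lam ξ * x) : ℂ) = A
    generalize (Real.exp (-mu ξ * x) : ℂ) = B
    rw [hm1, hm2, hl, hm]
    push_cast
    field_simp
    ring
  · have e1 : solHatTang f x ξ = greenHat (-1) (lam ξ) (fun y => tangFourier f y ξ +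
        ((m1 ξ : ℂ) * ((lam ξ : ℂ) * lapHat f ξ - g 0)) * (Real.exp (-mu ξ * y) : ℂ)) x +
        (Real.exp (-lam ξ * x) : ℂ) * (g 0 / (den ξ : ℂ) + (m1 ξ : ℂ) / (lam ξ : ℂ) * lapHat f ξ) := by
      unfold solHatTang
      rw [h0]
    rw [e1, hG (-1) _ (-1) (by simp)]
    unfold fiberSol
    simp only [fiberCoeff, hn, if_false, ← hF]
    generalize (Real.exp (-lam ξ * x) : ℂ) = A
    generalize (Real.exp (-mu ξ * x) : ℂ) = B
    rw [hm1, hDe, hl, hm]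
    push_cast
    field_simp
    ring

end Solution

/-! ### Bounds for the explicit solution, and existence for a single coefficient -/

section Bounds

variable {N : ℕ}

lemma m1_nonneg (ξ : Bdry N) : 0 ≤ m1 ξ := by
  unfold m1
  have := mul_nonneg (lam_nonneg ξ) (mu_pos ξ).le
  exact div_nonneg (by positivity) (den_pos ξ).le

lemma m1_le_one (ξ : Bdry N) : m1 ξ ≤ 1 := by
  unfold m1
  rw [div_le_one (den_pos ξ), den]
  nlinarith [sq_nonneg (lam ξ)]

lemma mu_sq_le_den (ξ : Bdry N) : mu ξ ^ 2 ≤ den ξ := by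
  rw [mu_sq, den]
  nlinarith [sq_nonneg (lam ξ), mul_nonneg (lam_nonneg ξ) (mu_pos ξ).le]

lemma mu_mul_le_den (ξ : Bdry N) : mu ξ * (lam ξ + mu ξ) ≤ den ξ := by
  have := mu_sq ξ
  rw [den]
  nlinarith [sq_nonneg (lam ξ)]

lemma norm_add_sq_le' (x y : ℂ) : ‖x + y‖ ^ 2 ≤ 2 * ‖x‖ ^ 2 + 2 * ‖y‖ ^ 2 := by
  have := norm_add_le x y
  nlinarith [norm_nonneg (x + y), sq_nonneg (‖x‖ - ‖y‖), norm_nonneg x, norm_nonneg y]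

/-- Bounds for `F = ∫_0^∞ e^{-λ y} f̂(y) dy`. At high frequencies they come from
`λ |F| ≤ sup |f̂|`, and at low frequencies from `F = 2 λ p(0)`, where `p` is the potential of the
data: here the vanishing moments enter. -/
lemma lapHat_bounds {s Ks Kp : ℝ} (hs : 1 / 2 < s) (hKs : 0 ≤ Ks) (hKp : 0 ≤ Kp) {ξ : Bdry N}
    {F : ℝ} {A p q : ℝ} (hF : 0 ≤ F) (h2 : lam ξ * F ≤ A) (h3 : F ≤ 2 * lam ξ * p)
    (hq : 0 ≤ q) (hA : A ^ 2 ≤ Ks * mu ξ ^ (1 - 2 * s) * q) (hp : p ^ 2 ≤ Kp * mu ξ ^ (-3 : ℝ) * q) :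
    mu ξ ^ 2 * F ^ 2 ≤ (4 * Ks + 16 * Kp * 2 ^ (2 * s - 1)) * mu ξ ^ (1 - 2 * s) * q ∧
    mu ξ ^ 4 * F ^ 2 ≤
      lam ξ ^ 2 * ((4 * Ks + 16 * Kp * 2 ^ (2 * s - 1)) * mu ξ ^ (1 - 2 * s) * q) := by
  have hm := mu_pos ξ
  have hl := lam_nonneg ξ
  have hml := mu_sq ξ
  set R := mu ξ ^ (1 - 2 * s) with hR
  have hR0 : 0 < R := by positivity
  have hT0 : (0 : ℝ) < 2 ^ (2 * s - 1) := by positivity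
  set A2 := Ks * R * q with hA2
  have hA20 : 0 ≤ A2 := by positivity
  set B2 := 4 * Kp * 2 ^ (2 * s - 1) * R * q with hB2
  have hB20 : 0 ≤ B2 := by positivity
  have hE : (4 * Ks + 16 * Kp * 2 ^ (2 * s - 1)) * R * q = 4 * A2 + 4 * B2 := by rw [hA2, hB2]; ring
  rw [hE]
  have hFA : lam ξ ^ 2 * F ^ 2 ≤ A2 := by
    refine le_trans ?_ hA
    rw [← mul_pow]
    exact pow_le_pow_left₀ (by positivity) h2 2
  by_cases h1 : 1 ≤ lam ξ
  · have hl2 : 1 ≤ lam ξ ^ 2 := by nlinarith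
    have hm2 : mu ξ ^ 2 ≤ 2 * lam ξ ^ 2 := by linarith
    constructor
    · nlinarith [sq_nonneg F, mul_le_mul_of_nonneg_right hm2 (sq_nonneg F)]
    · have h4 : mu ξ ^ 4 ≤ 4 * lam ξ ^ 4 := by
        have := pow_le_pow_left₀ (by positivity) hm2 2
        nlinarith
      calc _ ≤ 4 * lam ξ ^ 4 * F ^ 2 := by gcongr
        _ = lam ξ ^ 2 * (4 * (lam ξ ^ 2 * F ^ 2)) := by ring
        _ ≤ lam ξ ^ 2 * (4 * A2 + 4 * B2) := by gcongr; linarith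
  · push Not at h1
    have hm2 : mu ξ ^ 2 ≤ 2 := by nlinarith
    have hm2' : mu ξ ≤ 2 := by nlinarith
    have hR1 : 1 ≤ 2 ^ (2 * s - 1) * R := by
      have e : (2 : ℝ) ^ (2 * s - 1) * 2 ^ (1 - 2 * s) = 1 := by
        rw [← Real.rpow_add (by norm_num)]; norm_num
      refine e.symm.le.trans ?_
      rw [hR]
      refine mul_le_mul_of_nonneg_left ?_ hT0.le
      refine Real.rpow_le_rpow_of_nonpos hm hm2' ?_
      linarith
    have hm3 : mu ξ ^ (-3 : ℝ) ≤ 1 :=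
      Real.rpow_le_one_of_one_le_of_nonpos (one_le_mu ξ) (by norm_num)
    have hp0 : 4 * p ^ 2 ≤ B2 := by
      calc 4 * p ^ 2 ≤ 4 * (Kp * 1 * q) := by
            refine mul_le_mul_of_nonneg_left (hp.trans ?_) (by norm_num)
            gcongr
        _ ≤ 4 * (Kp * (2 ^ (2 * s - 1) * R) * q) := by gcongr
        _ = B2 := by rw [hB2]; ring
    have hF2 : F ^ 2 ≤ lam ξ ^ 2 * B2 := by
      calc F ^ 2 ≤ (2 * lam ξ * p) ^ 2 := pow_le_pow_left₀ hF h3 2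
        _ = lam ξ ^ 2 * (4 * p ^ 2) := by ring
        _ ≤ _ := by gcongr
    have hl2 : lam ξ ^ 2 ≤ 1 := by nlinarith
    constructor
    · calc _ ≤ 2 * (1 * B2) := by
            have : lam ξ ^ 2 * B2 ≤ 1 * B2 := by gcongr
            gcongr
            exact hF2.trans this
        _ ≤ _ := by linarith
    · have h4 : mu ξ ^ 4 ≤ 4 := by
        have := pow_le_pow_left₀ (by positivity) hm2 2
        nlinarith
      calc _ ≤ 4 * (lam ξ ^ 2 * B2) := by gcongr
        _ ≤ _ := by nlinarith [sq_nonneg (lam ξ)]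

/-- The bounds for the coefficients and for the initial value of the explicit solution. -/
lemma fiberCoeff_bounds (normal : Prop) {ξ : Bdry N} (hξ : 0 < lam ξ) {F f₀ : ℂ} {E : ℝ}
    (h1 : mu ξ ^ 2 * ‖F‖ ^ 2 ≤ E) (h2 : mu ξ ^ 4 * ‖F‖ ^ 2 ≤ lam ξ ^ 2 * E) (h3 : ‖f₀‖ ^ 2 ≤ E) :
    |(fiberCoeff normal ξ F f₀).k| ≤ 1 ∧ ‖(fiberCoeff normal ξ F f₀).c‖ ^ 2 ≤ 4 * E ∧
    mu ξ ^ 2 * ‖(fiberCoeff normal ξ F f₀).b‖ ^ 2 ≤ 4 * E ∧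
    (normal → mu ξ ^ 4 * ‖m1 ξ * F / mu ξ‖ ^ 2 ≤ 4 * E) ∧
    (¬ normal → mu ξ ^ 4 * ‖f₀ / den ξ + m1 ξ * F / lam ξ‖ ^ 2 ≤ 4 * E) := by
  have hm := mu_pos ξ
  have hl := lam_lt_mu ξ
  have hD := den_pos ξ
  have hE : 0 ≤ E := le_trans (by positivity) h3
  have k0 := m1_nonneg ξ
  have k1 := m1_le_one ξ
  have nm : ‖(mu ξ : ℂ)‖ = mu ξ := by rw [Complex.norm_real, Real.norm_eq_abs, abs_of_pos hm]
  have nl : ‖(lam ξ : ℂ)‖ = lam ξ := by rw [Complex.norm_real, Real.norm_eq_abs, abs_of_pos hξ]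
  have nD : ‖(den ξ : ℂ)‖ = den ξ := by rw [Complex.norm_real, Real.norm_eq_abs, abs_of_pos hD]
  have n1 : ‖(m1 ξ : ℂ)‖ ≤ 1 := by rwa [Complex.norm_real, Real.norm_eq_abs, abs_of_nonneg k0]
  have hmF : ‖(m1 ξ : ℂ) * F‖ ≤ ‖F‖ := by
    rw [norm_mul]; exact mul_le_of_le_one_left (norm_nonneg _) n1
  have hmF2 : ‖(m1 ξ : ℂ) * F‖ ^ 2 ≤ ‖F‖ ^ 2 := pow_le_pow_left₀ (norm_nonneg _) hmF 2
  have hlF : lam ξ ^ 2 * ‖F‖ ^ 2 ≤ E := by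
    refine le_trans ?_ h1
    gcongr
  by_cases hn : normal
  · simp only [fiberCoeff, hn, if_true, not_true, false_imp_iff, true_imp_iff, and_true]
    refine ⟨abs_le.2 ⟨by linarith, by linarith⟩, ?_, ?_, ?_⟩
    · rw [neg_mul, neg_mul, norm_neg, mul_assoc, norm_mul, nm, mul_pow]
      nlinarith [mul_le_mul_of_nonneg_left hmF2 (sq_nonneg (mu ξ))]
    · rw [neg_mul, norm_neg]
      nlinarith [mul_le_mul_of_nonneg_left hmF2 (sq_nonneg (mu ξ))]
    · rw [norm_div, nm, div_pow]
      have : mu ξ ^ 4 * (‖(m1 ξ : ℂ) * F‖ ^ 2 / mu ξ ^ 2) = mu ξ ^ 2 * ‖(m1 ξ : ℂ) * F‖ ^ 2 := by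
        field_simp
      rw [this]
      nlinarith [mul_le_mul_of_nonneg_left hmF2 (sq_nonneg (mu ξ))]
  · simp only [fiberCoeff, hn, if_false, false_imp_iff, true_and, not_false_iff, true_imp_iff]
    refine ⟨abs_le.2 ⟨by linarith, by linarith⟩, ?_, ?_, ?_⟩
    · rw [norm_mul, mul_pow, sub_eq_add_neg]
      have h := norm_add_sq_le' (lam ξ * F) (-f₀)
      rw [norm_neg, norm_mul, nl, mul_pow] at h
      have h5 : ‖(m1 ξ : ℂ)‖ ^ 2 ≤ 1 := pow_le_one₀ (norm_nonneg _) n1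
      nlinarith [mul_le_mul_of_nonneg_right h5 (sq_nonneg ‖(lam ξ : ℂ) * F + -f₀‖)]
    · rw [sub_eq_add_neg]
      have h := norm_add_sq_le' (m1 ξ * F) (-((((lam ξ + mu ξ) / den ξ : ℝ) : ℂ) * f₀))
      have h6 : mu ξ ^ 2 * ‖(((lam ξ + mu ξ) / den ξ : ℝ) : ℂ) * f₀‖ ^ 2 ≤ ‖f₀‖ ^ 2 := by
        rw [norm_mul, Complex.norm_real, Real.norm_eq_abs, abs_of_nonneg (by positivity), mul_pow,
          ← mul_assoc, ← mul_pow]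
        refine mul_le_of_le_one_left (by positivity) (pow_le_one₀ (by positivity) ?_)
        rw [← mul_div_assoc, div_le_one hD]
        exact mu_mul_le_den ξ
      rw [norm_neg] at h
      nlinarith [mul_le_mul_of_nonneg_left hmF2 (sq_nonneg (mu ξ)),
        mul_le_mul_of_nonneg_left h (sq_nonneg (mu ξ))]
    · have h := norm_add_sq_le' (f₀ / den ξ) (m1 ξ * F / lam ξ)
      rw [norm_div, norm_div _ (lam ξ : ℂ), nD, nl, div_pow, div_pow] at h
      have h6 : mu ξ ^ 4 * (‖f₀‖ ^ 2 / den ξ ^ 2) ≤ E := by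
        rw [← mul_div_assoc, div_le_iff₀ (by positivity)]
        have : mu ξ ^ 4 ≤ den ξ ^ 2 := by
          have := pow_le_pow_left₀ (by positivity) (mu_sq_le_den ξ) 2
          rwa [← pow_mul] at this
        rw [mul_comm E]
        gcongr
      have h7 : mu ξ ^ 4 * (‖(m1 ξ : ℂ) * F‖ ^ 2 / lam ξ ^ 2) ≤ E := by
        rw [← mul_div_assoc, div_le_iff₀ (by positivity), mul_comm E]
        refine le_trans ?_ h2
        gcongr
      have h8 := mul_le_mul_of_nonneg_left h (show 0 ≤ mu ξ ^ 4 by positivity)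
      linarith

lemma sq_integral_norm_le {t κ : ℝ} (ht : 1 / 2 < t) (hκ : 0 < κ) {g : ℝ → ℂ} (hg : Measurable g)
    (h : lineInt t κ g < ⊤) :
    (∫ τ, ‖g τ‖) ^ 2 ≤ wtConst t * κ ^ (1 - 2 * t) * (lineInt t κ g).toReal := by
  have hw : 0 ≤ wtConst t * κ ^ (1 - 2 * t) := mul_nonneg (wtConst_nonneg t) (by positivity)
  rw [integral_norm_eq_lintegral_enorm hg.aestronglyMeasurable, ← ENNReal.toReal_pow]
  refine (ENNReal.toReal_mono (ENNReal.mul_lt_top ENNReal.ofReal_lt_top h).ne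
    (lintegral_enorm_sq_le ht hκ hg)).trans (le_of_eq ?_)
  rw [ENNReal.toReal_mul, ENNReal.toReal_ofReal hw]

lemma enorm_sq_le_of_norm_sq_le {z : ℂ} {r K : ℝ} {q : ℝ≥0∞} (hq : q < ⊤) (hr : 0 ≤ r)
    (h : ‖z‖ ^ 2 ≤ K * r * q.toReal) : ‖z‖ₑ ^ 2 ≤ ENNReal.ofReal r * ((K.toNNReal : ℝ≥0) * q) := by
  rw [← ofReal_norm, ← ENNReal.ofReal_pow (norm_nonneg _), ← ofReal_mul_coe_mul hr,
    ← ENNReal.ofReal_toReal hq.ne]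
  by_cases hK : 0 ≤ K
  · rw [← ENNReal.ofReal_mul (by positivity)]
    exact ENNReal.ofReal_le_ofReal h
  · have : ‖z‖ ^ 2 ≤ 0 := h.trans
      (mul_nonpos_of_nonpos_of_nonneg (mul_nonpos_of_nonpos_of_nonneg (by linarith) hr)
        ENNReal.toReal_nonneg)
    rw [ENNReal.ofReal_of_nonpos this]
    exact zero_le

end Bounds

section Existence

variable {N : ℕ} {s : ℝ} {f : Amb N → ℂ} {a : Amb N → ℂ}

/-- The symbol `V(-ξ_0, ξ')`. -/
def flipSym {N : ℕ} (V : Amb N → ℂ) : Amb N → ℂ := fun ξ => V (glue (-ξ 0) (tang ξ))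

lemma measurable_flipSym {V : Amb N → ℂ} (hV : Measurable V) : Measurable (flipSym V) := by
  have h0 : Measurable fun ξ : Amb N => -ξ 0 := by fun_prop
  exact hV.comp (measurable_glue.comp (h0.prodMk measurable_tang))

lemma lineInt_comp_neg (t κ : ℝ) (g : ℝ → ℂ) : lineInt t κ (fun τ => g (-τ)) = lineInt t κ g := by
  unfold lineInt
  have := (Measure.measurePreserving_neg (volume : Measure ℝ)).lintegral_comp_emb
    (MeasurableEquiv.neg ℝ).measurableEmbedding
    (fun τ => ENNReal.ofReal ((κ ^ 2 + (2 * Real.pi * τ) ^ 2) ^ t) * ‖g τ‖ₑ ^ 2)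
  rw [← this]
  refine lintegral_congr fun τ => ?_
  simp

lemma fourierInv_comp_neg_real (g : ℝ → ℂ) (x : ℝ) : 𝓕⁻ (fun τ => g (-τ)) x = 𝓕⁻ g (-x) := by
  rw [Real.fourierInv_eq', Real.fourierInv_eq', ← integral_neg_eq_self]
  refine integral_congr_ae (Eventually.of_forall fun τ => ?_)
  simp

/-- The coefficient functions of the explicit solution with symbol data. -/
def solCoeff {N : ℕ} (normal : Prop) (f a : Amb N → ℂ) (ξ : Bdry N) : FiberCoeff :=
  fiberCoeff normal ξ (2 * lam ξ * part (potSym f) 0 ξ) (part a 0 ξ)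

lemma measurable_den : Measurable (den : Bdry N → ℝ) := by
  unfold den
  have := measurable_lam (N := N)
  have := measurable_mu (N := N)
  fun_prop

lemma measurable_m1 : Measurable (m1 : Bdry N → ℝ) := by
  unfold m1
  have := measurable_lam (N := N)
  have := measurable_mu (N := N)
  have := measurable_den (N := N)
  fun_prop

lemma measurable_solCoeff (normal : Prop) (hf : Integrable f (halfMeasure N)) (ha : Measurable a) :
    Measurable (fun ξ => (solCoeff normal f a ξ).k) ∧ Measurable (fun ξ => (solCoeff normal f a ξ).b) ∧
      Measurable (fun ξ => (solCoeff normal f a ξ).c) := by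
  have h1 := measurable_lam (N := N)
  have h2 := measurable_mu (N := N)
  have h3 := measurable_den (N := N)
  have h4 := measurable_m1 (N := N)
  have h5 := measurable_part (measurable_potSym hf) 0
  have h6 := measurable_part ha 0
  have c1 := Complex.measurable_ofReal.comp h1
  have c2 := Complex.measurable_ofReal.comp h2
  have c4 := Complex.measurable_ofReal.comp h4
  have c5 : Measurable fun ξ : Bdry N => (((lam ξ + mu ξ) / den ξ : ℝ) : ℂ) :=
    Complex.measurable_ofReal.comp ((h1.add h2).div h3)
  have cF : Measurable fun ξ : Bdry N => 2 * (lam ξ : ℂ) * part (potSym f) 0 ξ :=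
    (c1.const_mul 2).mul h5
  by_cases hn : normal
  · simp only [solCoeff, fiberCoeff, hn, if_true]
    exact ⟨by fun_prop, c4.neg.mul cF, (c2.neg.mul c4).mul cF⟩
  · simp only [solCoeff, fiberCoeff, hn, if_false]
    exact ⟨by fun_prop, (c4.mul cF).sub (c5.mul h6), c4.mul ((c1.mul cF).sub h6)⟩

/-- The facts about the fibres that are needed to solve the problem there. -/
structure FiberData (s : ℝ) (f a : Amb N → ℂ) (ξ : Bdry N) : Prop where
  lam_pos : 0 < lam ξ
  symbol_fin : lineInt s (mu ξ) (fun τ => a (glue τ ξ)) < ⊤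
  pot_fin : lineInt 2 (mu ξ) (fun τ => potSym f (glue τ ξ)) < ⊤
  tang_eq : ∀ᵐ y ∂(volume.restrict (Set.Ioi (0 : ℝ))), part a y ξ = tangFourier f y ξ
  trace_eq : traceHat f ξ = part a 0 ξ

lemma ae_fiberData (hN : 1 ≤ N) (hs : 1 / 2 < s) (h : HasSymbol s f a)
    (hf : Integrable f (halfMeasure N)) (hP : symInt 2 (potSym f) < ⊤) :
    ∀ᵐ ξ, FiberData s f a ξ := by
  have h0 : ∀ᵐ ξ : Bdry N, ξ ≠ 0 := by
    have : Nonempty (Fin N) := ⟨⟨0, hN⟩⟩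
    have : Nontrivial (Bdry N) := inferInstance
    rw [ae_iff]
    simp
  filter_upwards [h0, ae_lineInt_lt_top h.1 h.2.1, ae_lineInt_lt_top (measurable_potSym hf) hP,
    h.ae_tangFourier hs hf, h.fourier_trace hs] with ξ k0 k1 k2 k3 k4
  exact ⟨by unfold lam; positivity, k1, k2, k3, k4⟩

section Fiber

variable {ξ : Bdry N}

lemma FiberData.integrable_symbol (h : FiberData s f a ξ) (hs : 1 / 2 < s) (ha : Measurable a) :
    Integrable fun τ => a (glue τ ξ) :=
  integrable_of_lineInt hs (mu_pos ξ) (measurable_comp_glue ha ξ) h.symbol_fin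

lemma FiberData.integrableOn (h : FiberData s f a ξ) (hf : Integrable f (halfMeasure N)) :
    IntegrableOn (fun y => tangFourier f y ξ) (Set.Ioi 0) ∧
      IntegrableOn (fun y => part a y ξ) (Set.Ioi 0) := by
  have h1 : IntegrableOn (fun y => tangFourier f y ξ) (Set.Ioi 0) :=
    (integrable_indicator_iff (measurableSet_Ioi (a := (0 : ℝ)))).1 (integrable_tangExt hf ξ)
  exact ⟨h1, h1.congr (h.tang_eq.mono fun y hy => hy.symm)⟩

lemma FiberData.part_pot (h : FiberData s f a ξ) (hf : Integrable f (halfMeasure N)) (x : ℝ) :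
    part (potSym f) x ξ = ((1 / (2 * lam ξ) : ℝ) : ℂ) * ∫ y in Set.Ioi (0 : ℝ),
      (Real.exp (-lam ξ * |x - y|) : ℂ) * part a y ξ := by
  rw [part_potSym hf h.lam_pos]
  congr 1
  exact integral_congr_ae (h.tang_eq.mono fun y hy => by simp only; rw [hy])

lemma FiberData.part_pot_eq (h : FiberData s f a ξ) (hf : Integrable f (halfMeasure N)) {x : ℝ}
    (hx : 0 ≤ x) : part (potSym f) x ξ = greenODE (lam ξ) (fun y => part a y ξ) x := by
  have := greenHat_eq h.lam_pos (h.integrableOn hf).2 0 hx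
  simp only [Complex.ofReal_zero, zero_div, zero_mul, add_zero] at this
  rw [← this, h.part_pot hf, greenHat]
  simp

lemma FiberData.part_pot_neg (h : FiberData s f a ξ) (hf : Integrable f (halfMeasure N)) {x : ℝ}
    (hx : 0 ≤ x) : part (potSym f) (-x) ξ = ((1 / (2 * lam ξ) : ℝ) : ℂ) * Real.exp (-lam ξ * x) *
      ∫ y in Set.Ioi (0 : ℝ), (Real.exp (-lam ξ * y) : ℂ) * part a y ξ := by
  rw [h.part_pot hf, mul_assoc, ← integral_const_mul (Real.exp (-lam ξ * x) : ℂ)]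
  congr 1
  refine setIntegral_congr_fun measurableSet_Ioi fun y hy => ?_
  have hy' : 0 < y := hy
  rw [abs_of_neg (by linarith), ← mul_assoc, ← Complex.ofReal_mul, ← Real.exp_add]
  congr 3; ring

lemma FiberData.lap_eq (h : FiberData s f a ξ) (hf : Integrable f (halfMeasure N)) :
    2 * lam ξ * part (potSym f) 0 ξ =
      ∫ y in Set.Ioi (0 : ℝ), (Real.exp (-lam ξ * y) : ℂ) * part a y ξ := by
  have := h.part_pot_neg hf le_rfl
  have hl : (lam ξ : ℂ) ≠ 0 := by exact_mod_cast h.lam_pos.ne'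
  rw [neg_zero] at this
  rw [this]
  push_cast
  simp
  field_simp

end Fiber

/-- A constant for the bounds of the explicit solution. -/
def boundConst (s : ℝ) : ℝ := 4 * wtConst s + 16 * wtConst 2 * 2 ^ (2 * s - 1)

lemma boundConst_nonneg (s : ℝ) : 0 ≤ boundConst s := by
  have := wtConst_nonneg s
  have := wtConst_nonneg 2
  unfold boundConst
  positivity

lemma FiberData.bounds {ξ : Bdry N} (h : FiberData s f a ξ) (hs : 1 / 2 < s)
    (hf : Integrable f (halfMeasure N)) (ha : Measurable a) (normal : Prop) {q : ℝ}
    (hq1 : (lineInt s (mu ξ) (fun τ => a (glue τ ξ))).toReal ≤ q)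
    (hq2 : (lineInt 2 (mu ξ) (fun τ => potSym f (glue τ ξ))).toReal ≤ q) :
    |(solCoeff normal f a ξ).k| ≤ 1 ∧
    ‖(solCoeff normal f a ξ).c‖ ^ 2 ≤ 4 * boundConst s * mu ξ ^ (1 - 2 * s) * q ∧
    ‖(solCoeff normal f a ξ).b‖ ^ 2 ≤ 4 * boundConst s * mu ξ ^ (-1 - 2 * s) * q ∧
    ‖fiberSol normal ξ (fun y => part a y ξ) 0‖ ^ 2 ≤
      4 * boundConst s * mu ξ ^ (-3 - 2 * s) * q := by
  have hl := h.lam_pos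
  have hm := mu_pos ξ
  have hq0 : 0 ≤ q := ENNReal.toReal_nonneg.trans hq1
  obtain ⟨F, hF⟩ : ∃ F, F = 2 * lam ξ * part (potSym f) 0 ξ := ⟨_, rfl⟩
  have hFe := hF.trans (h.lap_eq hf)
  set A := ∫ τ, ‖a (glue τ ξ)‖ with hA
  set p := ∫ τ, ‖potSym f (glue τ ξ)‖ with hp
  have hA0 : ∀ y, ‖part a y ξ‖ ≤ A := fun y => norm_fourierInv_le _ y
  have hAle : A ^ 2 ≤ wtConst s * mu ξ ^ (1 - 2 * s) * q := by
    refine (sq_integral_norm_le hs hm (measurable_comp_glue ha ξ) h.symbol_fin).trans ?_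
    have := wtConst_nonneg s
    gcongr
  have hple : p ^ 2 ≤ wtConst 2 * mu ξ ^ (-3 : ℝ) * q := by
    refine (sq_integral_norm_le (t := 2) (by norm_num) hm
      (measurable_comp_glue (measurable_potSym hf) ξ) h.pot_fin).trans ?_
    have := wtConst_nonneg 2
    rw [show (1 : ℝ) - 2 * 2 = -3 by norm_num]
    gcongr
  have nl : ‖(lam ξ : ℂ)‖ = lam ξ := by rw [Complex.norm_real, Real.norm_eq_abs, abs_of_pos hl]
  have hF3 : ‖F‖ ≤ 2 * lam ξ * p := by
    rw [hF, norm_mul, norm_mul, nl, Complex.norm_ofNat]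
    gcongr
    exact norm_fourierInv_le _ 0
  have hF2 : lam ξ * ‖F‖ ≤ A := by
    have e1 : ‖F‖ ≤ ∫ y in Set.Ioi (0 : ℝ), A * Real.exp (-lam ξ * y) := by
      rw [hFe]
      refine norm_integral_le_of_norm_le ?_ (Eventually.of_forall fun y => ?_)
      · exact (integrableOn_exp_mul_Ioi (a := -lam ξ) (by linarith) 0).const_mul A
      · rw [norm_mul, Complex.norm_real, Real.norm_eq_abs, abs_of_pos (Real.exp_pos _), mul_comm]
        gcongr
        exact hA0 y
    have e2 : ∫ y in Set.Ioi (0 : ℝ), A * Real.exp (-lam ξ * y) = A / lam ξ := by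
      rw [integral_const_mul, integral_exp_mul_Ioi (by linarith)]
      simp [div_eq_mul_inv]
    rw [e2, le_div_iff₀ hl] at e1
    linarith
  obtain ⟨b1, b2⟩ := lapHat_bounds hs (wtConst_nonneg s) (wtConst_nonneg 2) (norm_nonneg F) hF2 hF3
    hq0 hAle hple
  change mu ξ ^ 2 * ‖F‖ ^ 2 ≤ boundConst s * _ * q at b1
  change mu ξ ^ 4 * ‖F‖ ^ 2 ≤ lam ξ ^ 2 * (boundConst s * _ * q) at b2
  have b3 : ‖part a 0 ξ‖ ^ 2 ≤ boundConst s * mu ξ ^ (1 - 2 * s) * q := by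
    refine (pow_le_pow_left₀ (norm_nonneg _) (hA0 0) 2).trans (hAle.trans ?_)
    have := wtConst_nonneg s
    have : wtConst s ≤ boundConst s := by
      have := wtConst_nonneg 2
      have : 0 ≤ 16 * wtConst 2 * 2 ^ (2 * s - 1) := by positivity
      unfold boundConst
      linarith
    gcongr
  obtain ⟨c1, c2, c3, c4, c5⟩ := fiberCoeff_bounds normal hl b1 b2 b3
  have hb := fiberSol_bdry normal (g := fun y => part a y ξ) hl hFe
  have r1 : mu ξ ^ (1 - 2 * s) = mu ξ ^ 2 * mu ξ ^ (-1 - 2 * s) := by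
    rw [← Real.rpow_natCast, ← Real.rpow_add hm]; congr 1; push_cast; ring
  have r2 : mu ξ ^ (1 - 2 * s) = mu ξ ^ 4 * mu ξ ^ (-3 - 2 * s) := by
    rw [← Real.rpow_natCast, ← Real.rpow_add hm]; congr 1; push_cast; ring
  have hsc : solCoeff normal f a ξ = fiberCoeff normal ξ F (part a 0 ξ) := by
    rw [solCoeff, ← hF]
  rw [hsc]
  refine ⟨c1, by linarith, ?_, ?_⟩
  · rw [r1] at c3
    have : 0 < mu ξ ^ 2 := by positivity
    nlinarith
  · have h4 : 0 < mu ξ ^ 4 := by positivity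
    by_cases hn : normal
    · have := c4 hn
      rw [(hb.1 hn).2.1]
      rw [r2] at this
      nlinarith
    · have := c5 hn
      rw [(hb.2 hn).1]
      rw [r2] at this
      nlinarith

/-- The density that dominates all quantities on the fibres. -/
def density (s : ℝ) (f a : Amb N → ℂ) (ξ : Bdry N) : ℝ≥0∞ :=
  lineInt s (mu ξ) (fun τ => a (glue τ ξ)) + lineInt 2 (mu ξ) (fun τ => potSym f (glue τ ξ))

lemma density_toReal {ξ : Bdry N} (h : FiberData s f a ξ) :
    density s f a ξ < ⊤ ∧
    (lineInt s (mu ξ) (fun τ => a (glue τ ξ))).toReal ≤ (density s f a ξ).toReal ∧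
    (lineInt 2 (mu ξ) (fun τ => potSym f (glue τ ξ))).toReal ≤ (density s f a ξ).toReal := by
  have ht : density s f a ξ < ⊤ := ENNReal.add_lt_top.2 ⟨h.symbol_fin, h.pot_fin⟩
  exact ⟨ht, ENNReal.toReal_mono ht.ne le_self_add, ENNReal.toReal_mono ht.ne le_add_self⟩

lemma fiberODE_of_fiberData (hs : 1 / 2 < s) (hf : Integrable f (halfMeasure N)) (ha : Measurable a)
    (h : ∀ᵐ ξ, FiberData s f a ξ) (normal : Prop) :
    FiberODE s (4 * boundConst s).toNNReal a (fun ξ => (solCoeff normal f a ξ).c)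
      (fun ξ => fiberSol normal ξ (fun y => part a y ξ)) (density s f a) where
  measurable_symbol := ha
  measurable_coeff := (measurable_solCoeff normal hf ha).2.2
  finite := h.mono fun ξ hξ => (density_toReal hξ).1
  symbol_le := Eventually.of_forall fun ξ => le_self_add
  coeff_le := h.mono fun ξ hξ => by
    obtain ⟨h1, h2, h3⟩ := density_toReal hξ
    exact enorm_sq_le_of_norm_sq_le h1 (by have := mu_pos ξ; positivity)
      (hξ.bounds hs hf ha normal h2 h3).2.1
  zero_le := h.mono fun ξ hξ => by
    obtain ⟨h1, h2, h3⟩ := density_toReal hξ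
    exact enorm_sq_le_of_norm_sq_le h1 (by have := mu_pos ξ; positivity)
      (hξ.bounds hs hf ha normal h2 h3).2.2.2
  ode := h.mono fun ξ hξ => by
    have hg := continuous_part (hξ.integrable_symbol hs ha)
    refine ⟨fiberSolDeriv normal ξ (fun y => part a y ξ), fun x _ =>
      ⟨hasDerivAt_fiberSol normal hξ.lam_pos hg x, ?_⟩⟩
    have := hasDerivAt_fiberSolDeriv normal hξ.lam_pos hg x
    rwa [← hξ.lap_eq hf] at this

lemma measurable_expSym_comp {X : Type*} [MeasurableSpace X] {κ τ : X → ℝ} (hκ : Measurable κ)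
    (hτ : Measurable τ) (M : ℕ) : Measurable fun x => expSym M (κ x) (τ x) := by
  unfold expSym
  fun_prop
lemma measurable_coord_zero : Measurable fun ξ : Amb N => ξ 0 := by fun_prop

lemma measurable_real_comp_tang {κ : Bdry N → ℝ} (hκ : Measurable κ) :
    Measurable fun ξ : Amb N => κ (tang ξ) := hκ.comp measurable_tang

lemma measurable_expSym_tang {κ : Bdry N → ℝ} (hκ : Measurable κ) :
    Measurable fun ξ : Amb N => expSym 1 (κ (tang ξ)) (ξ 0) := 
  measurable_expSym_comp (measurable_real_comp_tang hκ) measurable_coord_zero 1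
lemma measurable_reflection_sum {c : Bdry N → FiberCoeff} {P : Amb N → ℂ} (hP : Measurable P)
    (mk : Measurable fun ξ => (c ξ).k) (mb : Measurable fun ξ => (c ξ).b)
    (mc : Measurable fun ξ => (c ξ).c) :
    Measurable fun ξ : Amb N => (P ξ + (c (tang ξ)).k * flipSym P ξ) +
      (lam (tang ξ) * (c (tang ξ)).b * expSym 1 (lam (tang ξ)) (ξ 0) +
        -(c (tang ξ)).c * expSym 1 (mu (tang ξ)) (ξ 0)) := by
  have h1 := measurable_expSym_tang (N := N) measurable_lam
  have h2 := measurable_expSym_tang (N := N) measurable_mu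
  have h3 := measurable_real_comp_tang (N := N) measurable_lam
  have h4 := measurable_real_comp_tang (N := N) mk
  have h5 : Measurable fun ξ : Amb N => (c (tang ξ)).b := mb.comp measurable_tang
  have h6 : Measurable fun ξ : Amb N => (c (tang ξ)).c := mc.comp measurable_tang
  have h7 := measurable_flipSym hP
  have h8 := Complex.measurable_ofReal.comp h3
  have h9 := Complex.measurable_ofReal.comp h4
  exact (hP.add (h9.mul h7)).add (((h8.mul h5).mul h1).add (h6.neg.mul h2))

/-- A symbol of the explicit solution, of exponent `min s 1` only: the potential, its reflection,
and two exponentials. -/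
def baseSym {N : ℕ} (normal : Prop) (f a : Amb N → ℂ) : Amb N → ℂ := fun ξ =>
  (potSym f ξ + (solCoeff normal f a (tang ξ)).k * flipSym (potSym f) ξ) +
    (lam (tang ξ) * (solCoeff normal f a (tang ξ)).b * expSym 1 (lam (tang ξ)) (ξ 0) +
      -(solCoeff normal f a (tang ξ)).c * expSym 1 (mu (tang ξ)) (ξ 0))

lemma measurable_baseSym (hf : Integrable f (halfMeasure N)) (ha : Measurable a) (normal : Prop) :
    Measurable (baseSym normal f a) := by
  obtain ⟨mk, mb, mc⟩ := measurable_solCoeff normal hf ha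
  have hP := measurable_potSym hf
  unfold baseSym
  exact measurable_reflection_sum hP mk mb mc

set_option maxHeartbeats 1000000 in
lemma lineInt_baseSym_le (hs : 1 / 2 < s) {t r K : ℝ} (ht0 : 1 / 2 < t) (ht1 : t ≤ 1) (hts : t ≤ s)
    (hr : r = 4 * wtConst (2 - t)) (hK : K = 4 * boundConst s)
    (hf : Integrable f (halfMeasure N)) (ha : Measurable a) (normal : Prop) {ξ : Bdry N}
    (hξ : FiberData s f a ξ) :
    lineInt t (mu ξ) (fun τ => baseSym normal f a (glue τ ξ)) ≤
      2 * (2 * density s f a ξ + 2 * density s f a ξ) +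
          2 * (2 * ((K * r).toNNReal * density s f a ξ) +
            2 * ((K * r).toNNReal * density s f a ξ)) := by
  have hr0 : 0 ≤ r := hr ▸ mul_nonneg (by norm_num) (wtConst_nonneg _)
  have hK0 : 0 ≤ K := hK ▸ mul_nonneg (by norm_num) (boundConst_nonneg s)
  have mP := measurable_potSym hf
  have hm := mu_pos ξ
  have hl := hξ.lam_pos
  have hlm := lam_lt_mu ξ
  obtain ⟨q1, q2, q3⟩ := density_toReal hξ
  obtain ⟨b1, b2, b3, -⟩ := hξ.bounds hs hf ha normal q2 q3
  obtain ⟨C, hC⟩ : ∃ C, C = solCoeff normal f a ξ := ⟨_, rfl⟩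
  obtain ⟨q, hq⟩ : ∃ q, q = (density s f a ξ).toReal := ⟨_, rfl⟩
  have hq0 : 0 ≤ q := hq ▸ ENNReal.toReal_nonneg
  rw [← hC, ← hq, ← hK] at b2 b3
  rw [← hC] at b1
  simp only [baseSym, tang_glue, glue_zero, flipSym]
  rw [← hC]
  have mPf := measurable_comp_glue mP ξ
  have lP : lineInt t (mu ξ) (fun τ => potSym f (glue τ ξ)) ≤ density s f a ξ :=
    (lineInt_mono (one_le_mu ξ) (by linarith) _).trans le_add_self
  have lPn : lineInt t (mu ξ) (fun τ => (C.k : ℂ) * potSym f (glue (-τ) ξ)) ≤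
      density s f a ξ := by
    rw [lineInt_const_mul, lineInt_comp_neg t (mu ξ) fun τ => potSym f (glue τ ξ)]
    refine le_trans (mul_le_of_le_one_left zero_le ?_) lP
    refine pow_le_one₀ zero_le ?_
    rw [← ofReal_norm, Complex.norm_real, Real.norm_eq_abs]
    exact ENNReal.ofReal_le_one.2 b1
  -- a common bound for the two exponentials
  have key : ∀ (z : ℂ) (κ : ℝ), 0 < κ → κ ≤ mu ξ →
      ‖z‖ ^ 2 * (r * (mu ξ ^ (2 * t) / κ)) ≤ K * r * q →
      lineInt t (mu ξ) (fun τ => z * expSym 1 κ τ) ≤ (K * r).toNNReal * density s f a ξ := by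
    intro z κ hκ hκm hz
    rw [lineInt_const_mul]
    calc _ ≤ ‖z‖ₑ ^ 2 * ENNReal.ofReal (r * (mu ξ ^ (2 * t) / κ)) := by
          rw [hr]
          gcongr
          exact lineInt_expSym_one_le (by linarith) ht1 hκ hκm
      _ = ENNReal.ofReal (‖z‖ ^ 2 * (r * (mu ξ ^ (2 * t) / κ))) := by
          rw [← ofReal_norm, ← ENNReal.ofReal_pow (norm_nonneg _),
            ← ENNReal.ofReal_mul (by positivity)]
      _ ≤ ENNReal.ofReal (K * r * q) := ENNReal.ofReal_le_ofReal hz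
      _ = _ := by
          rw [ENNReal.ofReal_mul (by positivity), hq, ENNReal.ofReal_toReal q1.ne]; rfl
  have hrp : ∀ e : ℝ, e ≤ 0 → mu ξ ^ e ≤ 1 := fun e he =>
    Real.rpow_le_one_of_one_le_of_nonpos (one_le_mu ξ) he
  have lEm := key (-C.c) (mu ξ) hm le_rfl (by
    rw [norm_neg]
    have e : mu ξ ^ (1 - 2 * s) * (mu ξ ^ (2 * t) / mu ξ) ≤ 1 := by
      rw [← Real.rpow_sub_one hm.ne', ← Real.rpow_add hm]
      exact hrp _ (by linarith)
    calc _ ≤ K * mu ξ ^ (1 - 2 * s) * q * (r * (mu ξ ^ (2 * t) / mu ξ)) := by gcongr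
      _ = K * r * q * (mu ξ ^ (1 - 2 * s) * (mu ξ ^ (2 * t) / mu ξ)) := by ring
      _ ≤ K * r * q * 1 := by gcongr
      _ = _ := mul_one _)
  have lEl := key (lam ξ * C.b) (lam ξ) hl hlm.le (by
    have e : mu ξ * mu ξ ^ (-1 - 2 * s) * mu ξ ^ (2 * t) ≤ 1 := by
      rw [← Real.rpow_one_add' hm.le (by linarith), ← Real.rpow_add hm]
      exact hrp _ (by linarith)
    rw [norm_mul, Complex.norm_real, Real.norm_eq_abs, abs_of_pos hl, mul_pow]
    have e2 : lam ξ ^ 2 * ‖C.b‖ ^ 2 * (r * (mu ξ ^ (2 * t) / lam ξ)) =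
        lam ξ * ‖C.b‖ ^ 2 * (r * mu ξ ^ (2 * t)) := by field_simp
    rw [e2]
    calc _ ≤ mu ξ * (K * mu ξ ^ (-1 - 2 * s) * q) * (r * mu ξ ^ (2 * t)) := by gcongr
      _ = K * r * q * (mu ξ * mu ξ ^ (-1 - 2 * s) * mu ξ ^ (2 * t)) := by ring
      _ ≤ K * r * q * 1 := by gcongr
      _ = _ := mul_one _)
  have hneg : Measurable fun τ : ℝ => potSym f (glue (-τ) ξ) := mPf.comp measurable_neg
  refine (lineInt_add_le t (mu ξ) (mPf.add (hneg.const_mul _)) _).trans ?_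
  have g1 := lineInt_add_le t (mu ξ) mPf (fun τ => (C.k : ℂ) * potSym f (glue (-τ) ξ))
  have g2 := lineInt_add_le t (mu ξ) (g := fun τ => (lam ξ * C.b) * expSym 1 (lam ξ) τ)
    ((measurable_expSym_right 1 _).const_mul _) (fun τ => -C.c * expSym 1 (mu ξ) τ)
  refine add_le_add (mul_le_mul_right ?_ _) (mul_le_mul_right ?_ _)
  · exact g1.trans (by gcongr)
  · exact g2.trans (by gcongr)

lemma part_baseSym (hf : Integrable f (halfMeasure N))
    (normal : Prop) {ξ : Bdry N} (hξ : FiberData s f a ξ) {x : ℝ} (hx : 0 ≤ x) :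
    part (baseSym normal f a) x ξ = fiberSol normal ξ (fun y => part a y ξ) x := by
  have mP := measurable_potSym hf
  have hm := mu_pos ξ
  have hl := hξ.lam_pos
  have hPi : Integrable fun τ => potSym f (glue τ ξ) :=
    integrable_of_lineInt (t := 2) (by norm_num) hm (measurable_comp_glue mP ξ) hξ.pot_fin
  have hPn : Integrable fun τ => potSym f (glue (-τ) ξ) := hPi.comp_neg
  have hEl := integrable_expSym le_rfl hl
  have hEm := integrable_expSym le_rfl hm
  obtain ⟨C, hC⟩ : ∃ C, C = solCoeff normal f a ξ := ⟨_, rfl⟩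
  have hsol : fiberSol normal ξ (fun y => part a y ξ) x =
      greenODE (lam ξ) (fun y => part a y ξ) x +
        (C.k * (2 * lam ξ * part (potSym f) 0 ξ) / (2 * lam ξ) + lam ξ * C.b) *
          Real.exp (-lam ξ * x) - C.c * Real.exp (-mu ξ * x) := by
    rw [fiberSol, ← hξ.lap_eq hf, hC]
    rfl
  rw [hsol]
  unfold part baseSym
  simp only [tang_glue, glue_zero, flipSym]
  rw [← hC]
  clear hsol hC
  have i1 : Integrable fun τ => potSym f (glue τ ξ) +
      (C.k : ℂ) * potSym f (glue (-τ) ξ) := hPi.add (hPn.const_mul _)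
  have i2 : Integrable fun τ => lam ξ * C.b * expSym 1 (lam ξ) τ +
      -C.c * expSym 1 (mu ξ) τ := (hEl.const_mul _).add (hEm.const_mul _)
  rw [fourierInv_add_real i1 i2, fourierInv_add_real hPi (hPn.const_mul _),
    fourierInv_add_real (hEl.const_mul _) (hEm.const_mul _), fourierInv_const_mul_real,
    fourierInv_const_mul_real, fourierInv_const_mul_real,
    fourierInv_comp_neg_real (fun τ => potSym f (glue τ ξ)), fourierInv_expSym le_rfl hl hx,
    fourierInv_expSym le_rfl hm hx]
  have e1 := hξ.part_pot_eq hf hx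
  have e2 := hξ.part_pot_neg hf hx
  rw [← hξ.lap_eq hf] at e2
  unfold part at e1 e2
  rw [e1, e2]
  have hlC : (lam ξ : ℂ) ≠ 0 := by exact_mod_cast hl.ne'
  simp only [Complex.ofReal_div, Complex.ofReal_mul, Complex.ofReal_ofNat, Complex.ofReal_one]
  generalize (Real.exp (-lam ξ * x) : ℂ) = A
  generalize (Real.exp (-mu ξ * x) : ℂ) = B
  field_simp
  ring

/-- The explicit solution has a symbol of exponent `min s 1`. -/
lemma hasExtSymbol_base (hs : 1 / 2 < s) : ∃ C : ℝ≥0, ∀ (f a : Amb N → ℂ),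
    Integrable f (halfMeasure N) → Measurable a → (∀ᵐ ξ, FiberData s f a ξ) → ∀ normal : Prop,
      HasExtSymbol (min s 1) C (fun ξ => fiberSol normal ξ (fun y => part a y ξ))
        (density s f a) := by
  obtain ⟨r, hr⟩ : ∃ r : ℝ, r = 4 * wtConst (2 - min s 1) := ⟨_, rfl⟩
  obtain ⟨K, hK⟩ : ∃ K : ℝ, K = 4 * boundConst s := ⟨_, rfl⟩
  refine ⟨2 * (2 * 1 + 2 * 1) + 2 * (2 * (K * r).toNNReal + 2 * (K * r).toNNReal),
    fun f a hf ha h normal => ⟨baseSym normal f a, measurable_baseSym hf ha normal, ?_, ?_⟩⟩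
  · filter_upwards [h] with ξ hξ
    refine (lineInt_baseSym_le hs (lt_min hs (by norm_num)) (min_le_right _ _) (min_le_left _ _)
      hr hK hf ha normal hξ).trans (le_of_eq ?_)
    push_cast; ring
  · filter_upwards [h] with ξ hξ x hx using part_baseSym hf normal hξ hx

end Existence

section ScalarSolution

variable {N : ℕ} {s : ℝ} {f : Amb N → ℂ} {a V : Amb N → ℂ}

lemma eqOn_Ici_of_eqOn_Ioi {u v : ℝ → ℂ} (hu : Continuous u) (hv : Continuous v)
    (h : ∀ x, 0 < x → u x = v x) {x : ℝ} (hx : 0 ≤ x) : u x = v x := by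
  have : Set.EqOn u v (closure (Set.Ioi (0 : ℝ))) := Set.EqOn.closure (fun y hy => h y hy) hu hv
  rw [closure_Ioi] at this
  exact this hx

/-- A symbol whose tangential Fourier transform is the explicit solution solves the problem on the
fibres. -/
lemma fiberSol_of_part_eq (hs : 1 / 2 < s) (ha : Measurable a)
    (h : ∀ᵐ ξ, FiberData s f a ξ) (normal : Prop) (hV : Measurable V) (hVs : symInt (s + 2) V < ⊤)
    (hp : ∀ᵐ ξ, ∀ x : ℝ, 0 ≤ x → part V x ξ = fiberSol normal ξ (fun y => part a y ξ) x) :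
    FiberSol normal V a := by
  have d1 : symInt (s + 1) (dSym 0 V) < ⊤ := by
    have := (symInt_dSym_le (j := 0) (s + 2) V).trans_lt hVs
    rwa [show s + 2 - 1 = s + 1 by ring] at this
  have d2 : symInt s (dSym 0 (dSym 0 V)) < ⊤ := by
    have := (symInt_dSym_le (j := 0) (s + 1) (dSym 0 V)).trans_lt d1
    rwa [add_sub_cancel_right] at this
  have m1 := measurable_dSym (j := 0) hV
  have m2 := measurable_dSym (j := 0) m1
  filter_upwards [h, hp, ae_lineInt_lt_top hV hVs, ae_lineInt_lt_top m1 d1,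
    ae_integrable_line hs m2 d2] with ξ hξ hw l0 l1 i2
  obtain ⟨g, hg⟩ : ∃ g : ℝ → ℂ, g = fun y => part a y ξ := ⟨_, rfl⟩
  have hgc : Continuous g := hg ▸ continuous_part (hξ.integrable_symbol hs ha)
  rw [← hg] at hw
  have hgx : ∀ x, part a x ξ = g x := fun x => by rw [hg]
  have D0 := hasDerivAt_part (by linarith : 3 / 2 < s + 2) hV l0
  have D1 := hasDerivAt_part (by linarith : 3 / 2 < s + 1) m1 l1
  have E0 := hasDerivAt_fiberSol normal hξ.lam_pos hgc
  have E1 := hasDerivAt_fiberSolDeriv normal hξ.lam_pos hgc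
  obtain ⟨F, hF⟩ : ∃ F, F = ∫ y in Set.Ioi (0 : ℝ), (Real.exp (-lam ξ * y) : ℂ) * g y := ⟨_, rfl⟩
  have B := fiberSol_bdry normal hξ.lam_pos hF
  rw [← hF] at E1
  obtain ⟨c, hc⟩ : ∃ c, c = (fiberCoeff normal ξ F (g 0)).c := ⟨_, rfl⟩
  rw [← hc] at B
  simp only [← hc] at E1
  have w1 : ∀ x, 0 ≤ x → part (dSym 0 V) x ξ = fiberSolDeriv normal ξ g x := fun x hx => by
    refine eqOn_Ici_of_eqOn_Ioi (continuous_iff_continuousAt.2 fun y => (D1 y).continuousAt)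
      (continuous_iff_continuousAt.2 fun y => (E1 y).continuousAt) (fun y hy => ?_) hx
    refine (D0 y).unique ((E0 y).congr_of_eventuallyEq ?_)
    filter_upwards [Ioi_mem_nhds hy] with z hz using hw z (le_of_lt hz)
  have w2 : ∀ x, 0 ≤ x → part (dSym 0 (dSym 0 V)) x ξ =
      (lam ξ : ℂ) ^ 2 * fiberSol normal ξ g x - g x - c * Real.exp (-mu ξ * x) := fun x hx => by
    have hcont : Continuous fun x => (lam ξ : ℂ) ^ 2 * fiberSol normal ξ g x - g x -
        c * Real.exp (-mu ξ * x) := by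
      have : Continuous (fiberSol normal ξ g) :=
        continuous_iff_continuousAt.2 fun y => (E0 y).continuousAt
      fun_prop
    refine eqOn_Ici_of_eqOn_Ioi (continuous_part i2) hcont (fun y hy => ?_) hx
    refine (D1 y).unique ((E1 y).congr_of_eventuallyEq ?_)
    filter_upwards [Ioi_mem_nhds hy] with z hz using w1 z (le_of_lt hz)
  constructor
  · intro hn
    obtain ⟨b1, -, b3⟩ := B.1 hn
    refine ⟨fun x hx => ?_, by rw [w1 0 le_rfl, b1]⟩
    rw [w2 x hx, hw x hx, hw 0 le_rfl, hgx, b3]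
    ring
  · intro hn
    obtain ⟨-, b2, b3⟩ := B.2 hn
    refine ⟨fun x hx => ?_, ?_⟩
    · rw [w2 x hx, hw x hx, w1 0 le_rfl, hgx, b3]
      ring
    · rw [w2 0 le_rfl, b2]
      simp

lemma HasSymbol.lintegral_sq_le (h : HasSymbol s f a) (hs : 0 ≤ s) :
    ∫⁻ x, ‖f x‖ₑ ^ 2 ∂halfMeasure N ≤ symInt s a := by
  obtain ⟨h1, h2, F, h3, h4⟩ := h
  calc ∫⁻ x, ‖f x‖ₑ ^ 2 ∂halfMeasure N = ∫⁻ x, ‖F x‖ₑ ^ 2 ∂halfMeasure N :=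
        lintegral_congr_ae (h3.mono fun x hx => by simp only; rw [hx])
    _ ≤ ∫⁻ x, ‖F x‖ₑ ^ 2 := setLIntegral_le_lintegral _ _
    _ = ∫⁻ ξ, ‖a ξ‖ₑ ^ 2 := by
        rw [← lintegral_fourier_Lp]
        exact lintegral_congr_ae (h4.mono fun x hx => by simp only; rw [hx])
    _ ≤ symInt s a := symInt_zero_left a ▸ symInt_mono hs a

/-- Existence for one coefficient, with the estimate and the explicit formula. -/
lemma exists_scalar_solution (hN : 1 ≤ N) (hs : 1 / 2 < s) {k : ℕ} (hk : k ≤ 2)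
    (hkN : 4 ≤ N + 2 * k) :
    ∃ C : ℝ≥0, ∀ f a : Amb N → ℂ, HasSymbol s f a → Integrable f (halfMeasure N) →
      absMoment k f < ⊤ → MomentsVanish k f → ∀ normal : Prop, ∃ φ V : Amb N → ℂ,
        HasSymbol (s + 2) φ V ∧ symInt (s + 2) V ≤ C * (symInt s a + absMoment k f ^ 2) ∧
        FiberSol normal V a ∧ (normal → IsTangFourier φ (solHatNorm f)) ∧
        (¬ normal → IsTangFourier φ (solHatTang f)) := by
  obtain ⟨C₁, hC₁⟩ := symInt_potSym_le hk hkN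
  obtain ⟨C₂, hC₂⟩ := hasExtSymbol_base (N := N) hs
  obtain ⟨C₃, hC₃⟩ := hasExtSymbol_add_two (N := N) (lt_min hs (by norm_num)) (min_le_left s 1)
    (4 * boundConst s).toNNReal C₂
  refine ⟨C₃ * (1 + C₁), fun f a h hf hM hv normal => ?_⟩
  have h2 : MemLp f 2 (halfMeasure N) := h.memLp
  have hsq := h.lintegral_sq_le (by linarith)
  have hp := hC₁ f hf h2 hM hv
  have hpt : symInt 2 (potSym f) < ⊤ := hp.trans_lt (ENNReal.mul_lt_top ENNReal.coe_lt_top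
    (ENNReal.add_lt_top.2 ⟨hsq.trans_lt h.2.1, ENNReal.pow_lt_top hM⟩))
  have hfd := ae_fiberData hN hs h hf hpt
  obtain ⟨V, mV, lV, pV⟩ := hC₃ a _ _ _ (fiberODE_of_fiberData hs hf h.1 hfd normal)
    (hC₂ f a hf h.1 hfd normal)
  have hVle : symInt (s + 2) V ≤ (C₃ * (1 + C₁) : ℝ≥0) * (symInt s a + absMoment k f ^ 2) := by
    calc symInt (s + 2) V ≤ ∫⁻ ξ, C₃ * density s f a ξ := by
          rw [symInt_eq _ mV]
          exact lintegral_mono_ae lV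
      _ = C₃ * (symInt s a + symInt 2 (potSym f)) := by
          rw [lintegral_const_mul' _ _ ENNReal.coe_ne_top, symInt_eq _ h.1,
            symInt_eq _ (measurable_potSym hf)]
          congr 1
          exact lintegral_add_left (measurable_lineInt s h.1) _
      _ ≤ C₃ * ((symInt s a + absMoment k f ^ 2) + C₁ * (symInt s a + absMoment k f ^ 2)) := by
          gcongr
          · exact le_self_add
          · exact hp.trans (by gcongr)
      _ = _ := by push_cast; ring
  have hVt : symInt (s + 2) V < ⊤ := hVle.trans_lt (ENNReal.mul_lt_top ENNReal.coe_lt_top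
    (ENNReal.add_lt_top.2 ⟨h.2.1, ENNReal.pow_lt_top hM⟩))
  obtain ⟨φ, hφ⟩ := exists_hasSymbol (by linarith : 0 ≤ s + 2) mV hVt
  have hexp : ∀ v : ℝ → Bdry N → ℂ, (∀ ξ, FiberData s f a ξ → ∀ x, 0 ≤ x →
      v x ξ = fiberSol normal ξ (fun y => part a y ξ) x) → IsTangFourier φ v := by
    intro v hv
    filter_upwards [hφ.isTangFourier (by linarith), ae_restrict_mem measurableSet_Ioi]
      with x ⟨h1, h2⟩ hx
    refine ⟨h1, h2.trans ?_⟩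
    filter_upwards [pV, hfd] with ξ k1 k2
    have hx0 : 0 ≤ x := le_of_lt hx
    rw [k1 x hx0, hv ξ k2 x hx0]
  have hsol : ∀ ξ, FiberData s f a ξ → ∀ x : ℝ, 0 ≤ x → _ := fun ξ hξ x hx =>
    fiberSol_eq_solHat normal hξ.lam_pos (hξ.integrableOn hf).1 hξ.tang_eq hξ.trace_eq hx
  exact ⟨φ, V, hφ, hVle, fiberSol_of_part_eq hs h.1 hfd normal mV hVt pV,
    fun hn => hexp _ fun ξ hξ x hx => (hsol ξ hξ x hx).1 hn,
    fun hn => hexp _ fun ξ hξ x hx => (hsol ξ hξ x hx).2 hn⟩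

end ScalarSolution

/-! ### Uniqueness on the fibres -/

section Uniqueness

variable {N : ℕ} {s : ℝ}

/-- A bounded solution of the homogeneous problem on a fibre is a combination of two decaying
exponentials, and the boundary conditions leave only zero. -/
lemma eq_zero_of_homogeneous {l m : ℝ} (hl : 0 < l) (hlm : l < m) (hm : m ^ 2 = 1 + l ^ 2)
    {y y₁ y₂ : ℝ → ℂ} {B : ℝ} (D0 : ∀ x, HasDerivAt y (y₁ x) x) (D1 : ∀ x, HasDerivAt y₁ (y₂ x) x)
    (hB : ∀ x, ‖y x‖ ≤ B) {c : ℂ}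
    (heq : ∀ x, 0 ≤ x → y₂ x = (l : ℂ) ^ 2 * y x + c * Real.exp (-m * x))
    (hbd : (c = (m : ℂ) ^ 2 * y 0 ∧ y₁ 0 = 0) ∨ (c = -m * y₁ 0 ∧ y₂ 0 = 0))
    {x : ℝ} (hx : 0 ≤ x) : y x = 0 := by
  have hm0 : 0 < m := hl.trans hlm
  have hmC : (m : ℂ) ^ 2 = 1 + (l : ℂ) ^ 2 := by exact_mod_cast hm
  obtain ⟨C, hC⟩ := exists_eq_exp_of_second_order hl
    (y := fun x => y x - c * Real.exp (-m * x)) (y₁ := fun x => y₁ x - c * (-m * Real.exp (-m * x)))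
    (fun x _ => by
      refine ((D0 x).sub ((hasDerivAt_cexp_mul (-m) x).const_mul c)).congr_deriv ?_
      push_cast; ring)
    (fun x hx => by
      refine ((D1 x).sub (((hasDerivAt_cexp_mul (-m) x).const_mul (-m : ℂ)).const_mul c)).congr_deriv ?_
      rw [heq x hx.le]
      simp only [Complex.ofReal_neg]
      linear_combination (-c * Real.exp (-m * x)) * hmC)
    (B := B + ‖c‖) (fun x hx => by
      refine (norm_sub_le _ _).trans (add_le_add (hB x) ?_)
      rw [norm_mul, Complex.norm_real, Real.norm_eq_abs, abs_of_pos (Real.exp_pos _)]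
      exact mul_le_of_le_one_right (norm_nonneg _) (Real.exp_le_one_iff.2 (by nlinarith)))
  have hd : ∀ x : ℝ, HasDerivAt (fun x : ℝ => C * (Real.exp (-l * x) : ℂ) + c * Real.exp (-m * x))
      (C * (-l * Real.exp (-l * x)) + c * (-m * Real.exp (-m * x))) x := fun x => by
    refine (((hasDerivAt_cexp_mul (-l) x).const_mul C).add
      ((hasDerivAt_cexp_mul (-m) x).const_mul c)).congr_deriv ?_
    push_cast; ring
  have hy : ∀ x, 0 ≤ x → y x = C * (Real.exp (-l * x) : ℂ) + c * Real.exp (-m * x) := fun x hx => by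
    refine eqOn_Ici_of_eqOn_Ioi (continuous_iff_continuousAt.2 fun z => (D0 z).continuousAt)
      (v := fun x => C * (Real.exp (-l * x) : ℂ) + c * Real.exp (-m * x)) (by fun_prop)
      (fun z hz => ?_) hx
    linear_combination hC z hz
  have hy₁ : ∀ x, 0 ≤ x → y₁ x = C * (-l * (Real.exp (-l * x) : ℂ)) +
      c * (-m * Real.exp (-m * x)) := fun x hx => by
    refine eqOn_Ici_of_eqOn_Ioi (continuous_iff_continuousAt.2 fun z => (D1 z).continuousAt)
      (v := fun x => C * (-l * (Real.exp (-l * x) : ℂ)) + c * (-m * Real.exp (-m * x)))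
      (by fun_prop) (fun z hz => ?_) hx
    refine (D0 z).unique ((hd z).congr_of_eventuallyEq ?_)
    filter_upwards [Ioi_mem_nhds hz] with w hw using hy w (le_of_lt hw)
  have e0 := hy 0 le_rfl
  have e1 := hy₁ 0 le_rfl
  have e2 := heq 0 le_rfl
  simp only [mul_zero, Real.exp_zero, Complex.ofReal_one, mul_one] at e0 e1 e2
  have hlC : (l : ℂ) ≠ 0 := by exact_mod_cast hl.ne'
  have hne : (m : ℂ) ^ 3 - (l : ℂ) ^ 3 ≠ 0 := by
    have : l ^ 3 < m ^ 3 := pow_lt_pow_left₀ hlm hl.le (by norm_num)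
    exact_mod_cast (sub_pos.2 this).ne'
  have hcC : c = 0 ∧ C = 0 := by
    rcases hbd with ⟨b1, b2⟩ | ⟨b1, b2⟩
    · have hc : c = 0 := by
        have : ((m : ℂ) ^ 3 - (l : ℂ) ^ 3) * c = 0 := by
          rw [e0] at b1
          rw [e1] at b2
          linear_combination (l : ℂ) * b1 - (m : ℂ) ^ 2 * b2 + (l : ℂ) * c * hmC
        exact (mul_eq_zero.1 this).resolve_left hne
      refine ⟨hc, ?_⟩
      rw [e1, hc] at b2
      simpa [hlC] using b2
    · have hc : c = 0 := by
        have : ((m : ℂ) ^ 3 - (l : ℂ) ^ 3) * c = 0 := by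
          rw [e1] at b1
          rw [e2, e0] at b2
          linear_combination (l : ℂ) * b1 + (m : ℂ) * b2 + ((l : ℂ) * c + m * c) * hmC
        exact (mul_eq_zero.1 this).resolve_left hne
      refine ⟨hc, ?_⟩
      rw [e2, e0, hc] at b2
      simpa [hlC] using b2
  rw [hy x hx, hcC.1, hcC.2]
  simp

lemma lam_pos_ae (hN : 1 ≤ N) : ∀ᵐ ξ : Bdry N, 0 < lam ξ := by
  have h0 : ∀ᵐ ξ : Bdry N, ξ ≠ 0 := by
    have : Nonempty (Fin N) := ⟨⟨0, hN⟩⟩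
    have : Nontrivial (Bdry N) := inferInstance
    rw [ae_iff]
    simp
  filter_upwards [h0] with ξ hξ
  unfold lam
  positivity

lemma FiberSol.ae_eq (hN : 1 ≤ N) (hs : 1 / 2 < s) {normal : Prop} {u v V W a : Amb N → ℂ}
    (hu : HasSymbol (s + 2) u V) (hv : HasSymbol (s + 2) v W) (h : FiberSol normal V a)
    (h' : FiberSol normal W a) : u =ᵐ[halfMeasure N] v := by
  have hv1 := hv.weakDeriv (by linarith) 0
  have hu1 := hu.weakDeriv (by linarith) 0
  have key : ∀ᵐ ξ : Bdry N, ∀ x : ℝ, 0 ≤ x → part V x ξ = part W x ξ := by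
    filter_upwards [h, h', lam_pos_ae hN, ae_lineInt_lt_top hu.1 hu.2.1,
      ae_lineInt_lt_top hv.1 hv.2.1, ae_lineInt_lt_top hu1.1 hu1.2.1,
      ae_lineInt_lt_top hv1.1 hv1.2.1] with ξ k1 k2 hl l1 l2 l3 l4 x hx
    have hB : ∀ x, ‖part V x ξ - part W x ξ‖ ≤
        (∫ τ, ‖V (glue τ ξ)‖) + ∫ τ, ‖W (glue τ ξ)‖ := fun x =>
      (norm_sub_le _ _).trans (add_le_add (norm_fourierInv_le _ x) (norm_fourierInv_le _ x))
    have D0 := fun x => (hasDerivAt_part (by linarith) hu.1 l1 x).sub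
      (hasDerivAt_part (by linarith) hv.1 l2 x)
    have D1 := fun x => (hasDerivAt_part (by linarith) hu1.1 l3 x).sub
      (hasDerivAt_part (by linarith) hv1.1 l4 x)
    rw [← sub_eq_zero]
    by_cases hn : normal
    · obtain ⟨a1, a2⟩ := k1.1 hn
      obtain ⟨b1, b2⟩ := k2.1 hn
      refine eq_zero_of_homogeneous hl (lam_lt_mu ξ) (mu_sq ξ) D0 D1 hB
        (c := (mu ξ : ℂ) ^ 2 * (part V 0 ξ - part W 0 ξ)) (fun x hx => ?_)
        (Or.inl ⟨rfl, by rw [a2, b2, sub_zero]⟩) hx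
      simp only [Pi.sub_apply]
      linear_combination b1 x hx - a1 x hx
    · obtain ⟨a1, a2⟩ := k1.2 hn
      obtain ⟨b1, b2⟩ := k2.2 hn
      refine eq_zero_of_homogeneous hl (lam_lt_mu ξ) (mu_sq ξ) D0 D1 hB
        (c := -mu ξ * (part (dSym 0 V) 0 ξ - part (dSym 0 W) 0 ξ)) (fun x hx => ?_)
        (Or.inr ⟨rfl, by rw [a2, b2, sub_zero]⟩) hx
      simp only [Pi.sub_apply]
      linear_combination b1 x hx - a1 x hx
  refine hu.ae_eq_of_part (by linarith) hv (by linarith) fun x hx => ?_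
  filter_upwards [key] with ξ hξ using hξ x hx.le

end Uniqueness

/-! ### Test functions -/

/-- The classical derivative `∂_j u`. -/
def cDeriv {N : ℕ} (j : Fin (N + 1)) (u : Amb N → ℂ) : Amb N → ℂ := fun x =>
  fderiv ℝ u x (EuclideanSpace.single j 1)

/-- `u` is smooth with compact support. -/
def IsTest {E : Type*} [NormedAddCommGroup E] [NormedSpace ℝ E] (u : E → ℂ) : Prop :=
  ContDiff ℝ ∞ u ∧ HasCompactSupport u

section Classical

variable {N : ℕ} {u v : Amb N → ℂ}

lemma IsTest.cDeriv (h : IsTest u) (j : Fin (N + 1)) : IsTest (cDeriv j u) := by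
  refine ⟨?_, ?_⟩
  · exact (h.1.fderiv_right (m := ∞) (by rfl)).clm_apply contDiff_const
  · exact h.2.fderiv_apply (𝕜 := ℝ) _

lemma IsTest.add (h : IsTest u) (h' : IsTest v) : IsTest (fun x => u x + v x) :=
  ⟨h.1.add h'.1, h.2.add h'.2⟩

lemma IsTest.const_mul (h : IsTest u) (c : ℂ) : IsTest (fun x => c * u x) :=
  ⟨contDiff_const.mul h.1, h.2.mul_left⟩

lemma IsTest.zero : IsTest (0 : Amb N → ℂ) := ⟨contDiff_const, HasCompactSupport.zero⟩

lemma IsTest.sum {ι : Type*} (S : Finset ι) {c : ι → ℂ} {u : ι → Amb N → ℂ}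
    (h : ∀ i ∈ S, IsTest (u i)) : IsTest (fun x => ∑ i ∈ S, c i * u i x) := by
  classical
  induction S using Finset.induction_on with
  | empty => simpa using! IsTest.zero
  | insert i S hi ih =>
    simp only [Finset.sum_insert hi]
    exact ((h i (by simp)).const_mul _).add (ih fun j hj => h j (by simp [hj]))

lemma IsTest.conj (h : IsTest u) : IsTest (fun x => conj (u x)) :=
  ⟨Complex.conjCLE.contDiff.comp h.1, h.2.comp_left (map_zero _)⟩

lemma IsTest.continuous (h : IsTest u) : Continuous u := h.1.continuous

lemma IsTest.memLp (h : IsTest u) : MemLp u 2 (halfMeasure N) :=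
  (h.continuous.memLp_of_hasCompactSupport h.2).mono_measure halfMeasure_le

lemma IsTest.differentiable (h : IsTest u) : Differentiable ℝ u := h.1.differentiable (by simp)

lemma cDeriv_conj (h : IsTest u) (j : Fin (N + 1)) :
    HalfSpaceHodge.cDeriv j (fun x => conj (u x)) = fun x => conj (HalfSpaceHodge.cDeriv j u x) := by
  ext x
  have := (Complex.conjCLE.toContinuousLinearMap.hasFDerivAt.comp x (h.differentiable x).hasFDerivAt)
  unfold HalfSpaceHodge.cDeriv
  rw [show (fun x => conj (u x)) = Complex.conjCLE.toContinuousLinearMap ∘ u from rfl, this.fderiv]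
  rfl

lemma cDeriv_sum {ι : Type*} (S : Finset ι) {c : ι → ℂ} {u : ι → Amb N → ℂ}
    (h : ∀ i ∈ S, IsTest (u i)) (j : Fin (N + 1)) :
    cDeriv j (fun x => ∑ i ∈ S, c i * u i x) = fun x => ∑ i ∈ S, c i * cDeriv j (u i) x := by
  ext x
  have := HasFDerivAt.fun_sum (u := S) fun i hi =>
    ((h i hi).differentiable x).hasFDerivAt.const_mul (c i)
  unfold cDeriv
  rw [this.fderiv]
  simp

lemma cDeriv_comm (h : IsTest u) (i j : Fin (N + 1)) : cDeriv i (cDeriv j u) = cDeriv j (cDeriv i u) := by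
  ext x
  have hd : DifferentiableAt ℝ (fderiv ℝ u) x :=
    (h.1.fderiv_right (m := 1) (by norm_cast)).differentiable (by norm_num) x
  have hs : IsSymmSndFDerivAt ℝ u x := h.1.contDiffAt.isSymmSndFDerivAt (by rw [minSmoothness_of_isRCLikeNormedField]; norm_cast)
  have e : ∀ i j : Fin (N + 1), cDeriv i (cDeriv j u) x =
      fderiv ℝ (fderiv ℝ u) x (EuclideanSpace.single i 1) (EuclideanSpace.single j 1) := by
    intro i j
    unfold cDeriv
    have := (hd.hasFDerivAt.clm_apply (hasFDerivAt_const (EuclideanSpace.single j (1 : ℝ)) x))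
    rw [this.fderiv]
    simp
  rw [e, e]
  exact hs _ _

lemma IsTest.hasWeakDeriv (h : IsTest u) (j : Fin (N + 1)) : HasWeakDeriv j u (HalfSpaceHodge.cDeriv j u) := by
  refine ⟨locallyIntegrableOn_of_memLp h.memLp, locallyIntegrableOn_of_memLp (h.cDeriv j).memLp,
    fun ψ hψ hc hs => ?_⟩
  have hz : ∀ x ∉ halfSpace N, ψ x = 0 := fun x hx =>
    image_eq_zero_of_notMem_tsupport fun h => hx (hs h)
  have hz' : ∀ x ∉ halfSpace N, fderiv ℝ ψ x = 0 := fun x hx =>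
    image_eq_zero_of_notMem_tsupport fun h => hx (hs (tsupport_fderiv_subset ℝ h))
  rw [integral_half_of_support fun x hx => by simp [hz' x hx],
    integral_half_of_support fun x hx => by simp [hz x hx]]
  have hT : IsTest ψ := ⟨hψ, hc⟩
  refine integral_mul_fderiv_eq_neg_fderiv_mul_of_integrable ?_ ?_ ?_ (fun x _ => h.differentiable x)
    (fun x _ => hT.differentiable x)
  · exact ((h.cDeriv j).continuous.mul hT.continuous).integrable_of_hasCompactSupport hc.mul_left
  · exact (h.continuous.mul (hT.cDeriv j).continuous).integrable_of_hasCompactSupport h.2.mul_right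
  · exact (h.continuous.mul hT.continuous).integrable_of_hasCompactSupport h.2.mul_right

lemma IsTest.weakDeriv_ae (h : IsTest u) (j : Fin (N + 1)) :
    weakDeriv j u =ᵐ[halfMeasure N] HalfSpaceHodge.cDeriv j u := (h.hasWeakDeriv j).weakDeriv_ae_eq

/-- A weak derivative may be computed after changing the function on a null set. -/
lemma weakDeriv_congr_test (h : IsTest u) (hv : v =ᵐ[halfMeasure N] u) (j : Fin (N + 1)) :
    weakDeriv j v =ᵐ[halfMeasure N] cDeriv j u :=
  ((h.hasWeakDeriv j).congr hv.symm (ae_eq_refl _)).weakDeriv_ae_eq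

lemma MemW1.memLp_weakDeriv (h : MemW1 v) (j : Fin (N + 1)) : MemLp (weakDeriv j v) 2 (halfMeasure N) := by
  obtain ⟨w, h1, h2⟩ := h.2 j
  exact h1.ae_eq h2.weakDeriv_ae_eq.symm

lemma MemLp.integrable_mul_conj (h : MemLp u 2 (halfMeasure N)) (h' : MemLp v 2 (halfMeasure N)) :
    Integrable (fun x => u x * conj (v x)) (halfMeasure N) := by
  have h2 : MemLp (fun x => conj (v x)) 2 (halfMeasure N) := h'.star
  exact h.integrable_mul h2

/-- The Cauchy–Schwarz inequality. -/
lemma norm_integral_mul_conj_le (h : MemLp u 2 (halfMeasure N)) (h' : MemLp v 2 (halfMeasure N)) :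
    ‖∫ x, u x * conj (v x) ∂halfMeasure N‖ ≤
      (eLpNorm u 2 (halfMeasure N)).toReal * (eLpNorm v 2 (halfMeasure N)).toReal := by
  have e : ∫ x, u x * conj (v x) ∂halfMeasure N = inner ℂ (h'.toLp v) (h.toLp u) := by
    rw [L2.inner_def]
    refine integral_congr_ae ?_
    filter_upwards [h.coeFn_toLp, h'.coeFn_toLp] with x h1 h2
    rw [h1, h2]
    simp
  rw [e]
  refine (norm_inner_le_norm _ _).trans (le_of_eq ?_)
  rw [Lp.norm_toLp, Lp.norm_toLp, mul_comm]

end Classical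

/-! ### The pairing `⟨du, ψ⟩_1` for test forms -/

section Forms

variable {N : ℕ} {u ψ : Form N}

lemma extD_ae_test (hu : ∀ I, IsTest (u I)) (K : Finset (Fin (N + 1))) :
    extD u K =ᵐ[halfMeasure N] fun x =>
      ∑ j ∈ K, (-1 : ℂ) ^ (K.filter (· < j)).card * cDeriv j (u (K.erase j)) x := by
  have h : ∀ᵐ x ∂halfMeasure N, ∀ j, weakDeriv j (u (K.erase j)) x = cDeriv j (u (K.erase j)) x :=
    ae_all_iff.2 fun j => (hu _).weakDeriv_ae j
  filter_upwards [h] with x hx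
  exact Finset.sum_congr rfl fun j _ => by rw [hx]

lemma weakDeriv_extD_ae_test (hu : ∀ I, IsTest (u I)) (K : Finset (Fin (N + 1)))
    (i : Fin (N + 1)) : weakDeriv i (extD u K) =ᵐ[halfMeasure N] fun x =>
      ∑ j ∈ K, (-1 : ℂ) ^ (K.filter (· < j)).card * cDeriv i (cDeriv j (u (K.erase j))) x := by
  have h := weakDeriv_congr_test (IsTest.sum K (c := fun j => (-1 : ℂ) ^ (K.filter (· < j)).card)
    fun j _ => (hu (K.erase j)).cDeriv j) (extD_ae_test hu K) i
  rwa [cDeriv_sum K fun j _ => (hu (K.erase j)).cDeriv j] at h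

lemma integral_sum_mul_conj {S : Finset (Fin (N + 1))} {c : Fin (N + 1) → ℂ}
    {w : Fin (N + 1) → Amb N → ℂ} {g U : Amb N → ℂ} (hw : ∀ j ∈ S, MemLp (w j) 2 (halfMeasure N))
    (hg : MemLp g 2 (halfMeasure N)) (hU : U =ᵐ[halfMeasure N] fun x => ∑ j ∈ S, c j * w j x) :
    ∫ x, U x * conj (g x) ∂halfMeasure N =
      ∑ j ∈ S, c j * ∫ x, w j x * conj (g x) ∂halfMeasure N := by
  have h1 : ∫ x, U x * conj (g x) ∂halfMeasure N =
      ∫ x, ∑ j ∈ S, c j * (w j x * conj (g x)) ∂halfMeasure N := by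
    refine integral_congr_ae ?_
    filter_upwards [hU] with x hx
    rw [hx, Finset.sum_mul]
    exact Finset.sum_congr rfl fun j _ => by ring
  rw [h1, integral_finsetSum _ fun j hj => (MemLp.integrable_mul_conj (hw j hj) hg).const_mul _]
  exact Finset.sum_congr rfl fun j _ => integral_const_mul _ _

/-- `⟨du, ψ⟩_1` for a test form `u`. -/
lemma innerW1_extD (hu : ∀ I, IsTest (u I)) (hψ : ∀ I, MemW1 (ψ I)) :
    innerW1 (extD u) ψ = ∑ K, ∑ j ∈ K, (-1 : ℂ) ^ (K.filter (· < j)).card *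
      (∫ x, cDeriv j (u (K.erase j)) x * conj (ψ K x) ∂halfMeasure N +
        ∑ i, ∫ x, cDeriv i (cDeriv j (u (K.erase j))) x *
          conj (weakDeriv i (ψ K) x) ∂halfMeasure N) := by
  unfold innerW1
  refine Finset.sum_congr rfl fun K _ => ?_
  rw [integral_sum_mul_conj (fun j _ => ((hu (K.erase j)).cDeriv j).memLp) (hψ K).1
    (extD_ae_test hu K)]
  have h : ∀ i, ∫ x, weakDeriv i (extD u K) x * conj (weakDeriv i (ψ K) x) ∂halfMeasure N =
      ∑ j ∈ K, (-1 : ℂ) ^ (K.filter (· < j)).card *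
        ∫ x, cDeriv i (cDeriv j (u (K.erase j))) x * conj (weakDeriv i (ψ K) x) ∂halfMeasure N :=
    fun i => integral_sum_mul_conj (fun j _ => (((hu (K.erase j)).cDeriv j).cDeriv i).memLp)
      ((hψ K).memLp_weakDeriv i) (weakDeriv_extD_ae_test hu K i)
  rw [Finset.sum_congr rfl fun i _ => h i, Finset.sum_comm, ← Finset.sum_add_distrib]
  refine Finset.sum_congr rfl fun j _ => ?_
  rw [mul_add, Finset.mul_sum]

lemma integral_mul_conj_self {u : Amb N → ℂ} (h : MemLp u 2 (halfMeasure N)) :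
    ∫ x, u x * conj (u x) ∂halfMeasure N = (((eLpNorm u 2 (halfMeasure N)).toReal ^ 2 : ℝ) : ℂ) := by
  have e : ∫ x, u x * conj (u x) ∂halfMeasure N = inner ℂ (h.toLp u) (h.toLp u) := by
    rw [L2.inner_def]
    refine integral_congr_ae ?_
    filter_upwards [h.coeFn_toLp] with x h1
    rw [h1]
    simp [Complex.mul_conj, Complex.normSq_eq_norm_sq]
  rw [e, inner_self_eq_norm_sq_to_K, Lp.norm_toLp]
  simp

lemma normW1_test (hu : ∀ I, IsTest (u I)) :
    normW1 u ^ 2 = ∑ I, ((eLpNorm (u I) 2 (halfMeasure N)).toReal ^ 2 +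
      ∑ j, (eLpNorm (cDeriv j (u I)) 2 (halfMeasure N)).toReal ^ 2) := by
  have h : (innerW1 u u).re = ∑ I, ((eLpNorm (u I) 2 (halfMeasure N)).toReal ^ 2 +
      ∑ j, (eLpNorm (cDeriv j (u I)) 2 (halfMeasure N)).toReal ^ 2) := by
    unfold innerW1
    rw [← Complex.ofReal_re (∑ I, _)]
    congr 1
    rw [Complex.ofReal_sum]
    refine Finset.sum_congr rfl fun I _ => ?_
    rw [Complex.ofReal_add, Complex.ofReal_sum, integral_mul_conj_self (hu I).memLp]
    congr 1
    refine Finset.sum_congr rfl fun j _ => ?_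
    rw [← integral_mul_conj_self ((hu I).cDeriv j).memLp]
    refine integral_congr_ae ?_
    filter_upwards [(hu I).weakDeriv_ae j] with x hx
    rw [hx]
  unfold normW1
  rw [Real.sq_sqrt (h ▸ by positivity), h]

lemma normW1_nonneg (u : Form N) : 0 ≤ normW1 u := Real.sqrt_nonneg _

lemma eLpNorm_cDeriv_le_normW1 (hu : ∀ I, IsTest (u I)) (I : Finset (Fin (N + 1)))
    (j : Fin (N + 1)) : (eLpNorm (cDeriv j (u I)) 2 (halfMeasure N)).toReal ≤ normW1 u := by
  refine le_of_sq_le_sq ?_ (normW1_nonneg u)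
  rw [normW1_test hu]
  refine le_trans ?_ (Finset.single_le_sum (fun I _ => by positivity) (Finset.mem_univ I))
  refine le_add_of_nonneg_of_le (by positivity) ?_
  exact Finset.single_le_sum (f := fun j => (eLpNorm (cDeriv j (u I)) 2 (halfMeasure N)).toReal ^ 2)
    (fun j _ => by positivity) (Finset.mem_univ j)

end Forms

/-! ### Integration by parts on the half space -/

section Parts

variable {N : ℕ} {t : ℝ} {g v V : Amb N → ℂ}

/-- A smooth function of `x_0`, zero for `x_0 ≤ 1` and one for `x_0 ≥ 2`. -/
def cutoff (x : ℝ) : ℝ := Real.smoothTransition (x - 1)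

lemma cutoff_contDiff : ContDiff ℝ ∞ cutoff :=
  Real.smoothTransition.contDiff.comp (contDiff_id.sub contDiff_const)

lemma cutoff_mem (x : ℝ) : 0 ≤ cutoff x ∧ cutoff x ≤ 1 :=
  ⟨Real.smoothTransition.nonneg _, Real.smoothTransition.le_one _⟩

lemma cutoff_of_le {x : ℝ} (h : x ≤ 1) : cutoff x = 0 :=
  Real.smoothTransition.zero_of_nonpos (by linarith)

lemma cutoff_of_ge {x : ℝ} (h : 2 ≤ x) : cutoff x = 1 :=
  Real.smoothTransition.one_of_one_le (by linarith)

lemma exists_deriv_cutoff_le : ∃ B : ℝ, ∀ x, |deriv cutoff x| ≤ B ∧ (2 < x → deriv cutoff x = 0) := by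
  have h2 : ∀ x, 2 < x → deriv cutoff x = 0 := fun x hx => by
    have : cutoff =ᶠ[𝓝 x] fun _ => 1 := by
      filter_upwards [Ioi_mem_nhds hx] with y hy using cutoff_of_ge (le_of_lt hy)
    rw [this.deriv_eq]; simp
  have h1 : ∀ x, x < 1 → deriv cutoff x = 0 := fun x hx => by
    have : cutoff =ᶠ[𝓝 x] fun _ => 0 := by
      filter_upwards [Iio_mem_nhds hx] with y hy using cutoff_of_le (le_of_lt hy)
    rw [this.deriv_eq]; simp
  have hc : Continuous (deriv cutoff) := cutoff_contDiff.continuous_deriv (by simp)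
  obtain ⟨B, hB⟩ := isCompact_Icc.exists_bound_of_continuousOn (s := Set.Icc (1 : ℝ) 2) hc.continuousOn
  refine ⟨B, fun x => ⟨?_, h2 x⟩⟩
  have hB0 : 0 ≤ B := (norm_nonneg _).trans (hB 1 (by simp))
  by_cases hx1 : x < 1
  · rw [h1 x hx1]; simpa using hB0
  by_cases hx2 : 2 < x
  · rw [h2 x hx2]; simpa using hB0
  exact hB x ⟨not_lt.1 hx1, not_lt.1 hx2⟩

/-- On a slab of width `ε`, the square integral of a test function is `O(ε)`. -/
lemma IsTest.lintegral_slab_le (hg : IsTest g) :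
    ∃ M : ℝ≥0, ∀ ε : ℝ, 0 < ε → ∫⁻ x in slab N ε, ‖g x‖ₑ ^ 2 ≤ M * ENNReal.ofReal ε := by
  obtain ⟨C, hC⟩ := hg.2.exists_bound_of_continuous hg.continuous
  obtain ⟨R, hR⟩ := hg.2.isCompact.isBounded.subset_closedBall (0 : Amb N)
  obtain ⟨W, hW⟩ : ∃ W, W = (volume : Measure (Bdry N)) (Metric.closedBall 0 R) := ⟨_, rfl⟩
  have hWt : W < ⊤ := hW ▸ measure_closedBall_lt_top
  refine ⟨(ENNReal.ofReal C ^ 2 * W).toNNReal, fun ε hε => ?_⟩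
  rw [ENNReal.coe_toNNReal (ENNReal.mul_lt_top (by finiteness) hWt).ne,
    lintegral_slab (hg.continuous.enorm.measurable.pow_const 2).aemeasurable]
  have h1 : ∀ x₀, ∫⁻ x', ‖g (glue x₀ x')‖ₑ ^ 2 ≤ ENNReal.ofReal C ^ 2 * W := by
    intro x₀
    rw [hW, ← setLIntegral_const, ← lintegral_indicator measurableSet_closedBall]
    refine lintegral_mono fun x' => ?_
    by_cases hx : x' ∈ Metric.closedBall (0 : Bdry N) R
    · rw [Set.indicator_of_mem hx, ← ofReal_norm]
      gcongr
      exact hC _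
    · have : g (glue x₀ x') = 0 := by
        by_contra hne
        have h2 := hR (subset_tsupport g hne)
        rw [mem_closedBall_zero_iff] at h2 hx
        refine hx (le_trans (abs_le_of_sq_le_sq' ?_ (norm_nonneg _)).2 h2)
        rw [norm_glue_sq]
        nlinarith [sq_nonneg x₀]
      simp [this]
  calc _ ≤ ∫⁻ _ in Set.Ioo 0 ε, ENNReal.ofReal C ^ 2 * W := lintegral_mono fun x₀ => h1 x₀
    _ = _ := by rw [setLIntegral_const, Real.volume_Ioo, sub_zero]

/-- Boundary layers of width `ε` and height `ε⁻¹` do not see a function with zero trace. -/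
lemma tendsto_boundary_layer {f g : Amb N → ℂ} {b : ℝ → ℂ} {B R : ℝ} (hR : 0 < R)
    (hb : ∀ x, 0 < x → ‖b x‖ ≤ B) (hb0 : ∀ x, R ≤ x → b x = 0)
    (hfm : AEStronglyMeasurable f (halfMeasure N)) (hgm : AEStronglyMeasurable g (halfMeasure N))
    (hf : Tendsto (fun ε : ℝ => (∫⁻ x in slab N ε, ‖f x‖ₑ ^ 2) / ENNReal.ofReal ε) (𝓝[>] 0) (𝓝 0))
    (hg : ∃ M : ℝ≥0, ∀ ε : ℝ, 0 < ε → ∫⁻ x in slab N ε, ‖g x‖ₑ ^ 2 ≤ M * ENNReal.ofReal ε) :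
    Tendsto (fun ε : ℝ => (ε : ℂ)⁻¹ * ∫ x, b (x 0 / ε) * (f x * g x) ∂halfMeasure N)
      (𝓝[>] 0) (𝓝 0) := by
  obtain ⟨M, hM⟩ := hg
  have hB0 : 0 ≤ B := (norm_nonneg _).trans (hb 1 one_pos)
  have hscale : Tendsto (fun ε : ℝ => R * ε) (𝓝[>] 0) (𝓝[>] 0) := by
    refine tendsto_nhdsWithin_iff.2 ⟨?_, ?_⟩
    · have : Tendsto (fun ε : ℝ => R * ε) (𝓝 0) (𝓝 (R * 0)) := tendsto_id.const_mul R
      rw [mul_zero] at this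
      exact this.mono_left nhdsWithin_le_nhds
    · filter_upwards [self_mem_nhdsWithin] with ε hε using mul_pos hR hε
  have hT := hf.comp hscale
  -- the square of the integral is at most `B² R² M` times the mean over a slab
  have key : ∀ ε : ℝ, 0 < ε → ‖(ε : ℂ)⁻¹ * ∫ x, b (x 0 / ε) * (f x * g x) ∂halfMeasure N‖ₑ ^ 2 ≤
      (ENNReal.ofReal (B ^ 2 * R ^ 2) * M) *
        ((∫⁻ x in slab N (R * ε), ‖f x‖ₑ ^ 2) / ENNReal.ofReal (R * ε)) := by
    intro ε hε
    have hRε := mul_pos hR hε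
    have h1 : ‖∫ x, b (x 0 / ε) * (f x * g x) ∂halfMeasure N‖ₑ ≤
        ENNReal.ofReal B * ∫⁻ x in slab N (R * ε), ‖f x‖ₑ * ‖g x‖ₑ := by
      refine (enorm_integral_le_lintegral_enorm _).trans ?_
      rw [← lintegral_const_mul' _ _ ENNReal.ofReal_ne_top, halfMeasure,
        ← lintegral_indicator measurableSet_halfSpace,
        ← lintegral_indicator (measurableSet_slab _)]
      refine lintegral_mono fun x => ?_
      by_cases hx : x ∈ slab N (R * ε)
      · rw [Set.indicator_of_mem hx, Set.indicator_of_mem (slab_subset _ hx), enorm_mul, enorm_mul]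
        gcongr
        rw [← ofReal_norm]
        exact ENNReal.ofReal_le_ofReal (hb _ (div_pos hx.1 hε))
      · rw [Set.indicator_of_notMem hx]
        by_cases hx0 : x ∈ halfSpace N
        · have h3 : R ≤ x 0 / ε := by
            rw [le_div_iff₀ hε]
            exact not_lt.1 fun h => hx ⟨hx0, h⟩
          simp [Set.indicator_of_mem hx0, hb0 _ h3]
        · simp [Set.indicator_of_notMem hx0]
    have h2 : (∫⁻ x in slab N (R * ε), ‖f x‖ₑ * ‖g x‖ₑ) ^ 2 ≤
        (∫⁻ x in slab N (R * ε), ‖f x‖ₑ ^ 2) * ∫⁻ x in slab N (R * ε), ‖g x‖ₑ ^ 2 := by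
      have := ENNReal.lintegral_mul_le_Lp_mul_Lq (volume.restrict (slab N (R * ε)))
        Real.HolderConjugate.two_two
        (hfm.mono_measure (restrict_slab_le _)).enorm (hgm.mono_measure (restrict_slab_le _)).enorm
      simp only [Pi.mul_apply, ENNReal.rpow_ofNat] at this
      calc _ ≤ _ := pow_le_pow_left₀ zero_le this 2
        _ = _ := by
          rw [mul_pow, ← ENNReal.rpow_natCast, ← ENNReal.rpow_mul, ← ENNReal.rpow_natCast,
            ← ENNReal.rpow_mul]
          norm_num
    rw [enorm_mul, mul_pow]
    have h3 : ‖(ε : ℂ)⁻¹‖ₑ ^ 2 = (ENNReal.ofReal ε)⁻¹ ^ 2 := by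
      rw [enorm_inv (by exact_mod_cast hε.ne'), ← ofReal_norm, Complex.norm_real, Real.norm_eq_abs,
        abs_of_pos hε]
    have hε0 : ENNReal.ofReal ε ≠ 0 := by simpa using hε
    have hR0 : ENNReal.ofReal R ≠ 0 := by simpa using hR
    rw [h3]
    calc _ ≤ (ENNReal.ofReal ε)⁻¹ ^ 2 * (ENNReal.ofReal B ^ 2 *
          ((∫⁻ x in slab N (R * ε), ‖f x‖ₑ ^ 2) * (M * ENNReal.ofReal (R * ε)))) := by
          gcongr
          calc _ ≤ _ := pow_le_pow_left₀ zero_le h1 2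
            _ ≤ _ := by
              rw [mul_pow]
              gcongr
              exact h2.trans (by gcongr; exact hM _ hRε)
      _ = _ := by
          rw [ENNReal.ofReal_mul hR.le, ENNReal.ofReal_mul (by positivity),
            ENNReal.ofReal_pow hB0, ENNReal.ofReal_pow hR.le, div_eq_mul_inv,
            ENNReal.mul_inv (Or.inl hR0) (Or.inl ENNReal.ofReal_ne_top)]
          have hr := ENNReal.mul_inv_cancel hR0 ENNReal.ofReal_ne_top
          have he := ENNReal.mul_inv_cancel hε0 ENNReal.ofReal_ne_top
          generalize ENNReal.ofReal ε = e at *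
          generalize ENNReal.ofReal R = r at *
          generalize ∫⁻ x in slab N (R * ε), ‖f x‖ₑ ^ 2 = F
          calc _ = (e * e⁻¹) * (e⁻¹ * ENNReal.ofReal B ^ 2 * F * M * r) := by ring
            _ = (r * r⁻¹) * (e⁻¹ * ENNReal.ofReal B ^ 2 * F * M * r) := by rw [he, hr]
            _ = _ := by ring
  have hlim : Tendsto (fun ε : ℝ => ‖(ε : ℂ)⁻¹ * ∫ x, b (x 0 / ε) * (f x * g x) ∂halfMeasure N‖ₑ ^ 2)
      (𝓝[>] 0) (𝓝 0) := by
    have h0 := ENNReal.Tendsto.const_mul (a := ENNReal.ofReal (B ^ 2 * R ^ 2) * M) hT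
      (Or.inr (by finiteness))
    rw [mul_zero] at h0
    refine tendsto_of_tendsto_of_tendsto_of_le_of_le' tendsto_const_nhds h0
      (Eventually.of_forall fun _ => zero_le) ?_
    filter_upwards [self_mem_nhdsWithin] with ε hε using key ε hε
  rw [tendsto_zero_iff_enorm_tendsto_zero]
  have h2 := hlim.ennrpow_const (1 / 2)
  rw [ENNReal.zero_rpow_of_pos (by norm_num)] at h2
  refine h2.congr fun ε => ?_
  rw [← ENNReal.rpow_natCast, ← ENNReal.rpow_mul]
  norm_num

lemma ae_tang {p : Bdry N → Prop} (h : ∀ᵐ x', p x') : ∀ᵐ x : Amb N, p (tang x) := by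
  have h1 : Measure.QuasiMeasurePreserving (Prod.snd : ℝ × Bdry N → Bdry N)
      (volume.prod volume) volume := Measure.quasiMeasurePreserving_snd
  have h2 := h1.comp (measurePreserving_glue.symm (glueEquiv N)).quasiMeasurePreserving
  exact h2.ae h

lemma tendsto_integral_cutoff {h : Amb N → ℂ} (hh : Integrable h (halfMeasure N)) :
    Tendsto (fun ε : ℝ => ∫ x, (cutoff (x 0 / ε) : ℂ) * h x ∂halfMeasure N) (𝓝[>] 0)
      (𝓝 (∫ x, h x ∂halfMeasure N)) := by
  have hm : ∀ ε : ℝ, Measurable fun x : Amb N => (cutoff (x 0 / ε) : ℂ) := fun ε =>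
    Complex.measurable_ofReal.comp
      (cutoff_contDiff.continuous.measurable.comp (measurable_coord_zero.div_const ε))
  refine tendsto_integral_filter_of_dominated_convergence (fun x => ‖h x‖)
    (Eventually.of_forall fun ε => (hm ε).aestronglyMeasurable.mul hh.1)
    (Eventually.of_forall fun ε => Eventually.of_forall fun x => ?_) hh.norm ?_
  · rw [norm_mul, Complex.norm_real, Real.norm_eq_abs, abs_of_nonneg (cutoff_mem _).1]
    exact mul_le_of_le_one_left (norm_nonneg _) (cutoff_mem _).2
  · filter_upwards [ae_restrict_mem measurableSet_halfSpace] with x hx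
    have hx0 : 0 < x 0 := hx
    refine tendsto_const_nhds.congr' ?_
    filter_upwards [Ioo_mem_nhdsGT (half_pos hx0)] with ε hε
    rw [cutoff_of_ge, Complex.ofReal_one, one_mul]
    rw [le_div_iff₀ hε.1]
    linarith [hε.2]

lemma coordZero_hasFDerivAt (x : Amb N) (ε : ℝ) : HasFDerivAt (fun x : Amb N => x 0 / ε)
    (ε⁻¹ • (EuclideanSpace.proj 0 : Amb N →L[ℝ] ℝ)) x := by
  have h := ((EuclideanSpace.proj 0 : Amb N →L[ℝ] ℝ).hasFDerivAt (x := x)).const_mul ε⁻¹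
  refine h.congr_of_eventuallyEq (Eventually.of_forall fun y => ?_)
  simp [div_eq_inv_mul]

lemma contDiff_coordZero (ε : ℝ) : ContDiff ℝ ∞ fun x : Amb N => x 0 / ε :=
  ((EuclideanSpace.proj 0 : Amb N →L[ℝ] ℝ).contDiff).div_const ε

/-- The derivative of a product with a function of `x_0 / ε`. -/
lemma cDeriv_layer_mul {b : ℝ → ℂ} (hb : Differentiable ℝ b) {g : Amb N → ℂ}
    (hg : Differentiable ℝ g) (ε : ℝ) (j : Fin (N + 1)) (x : Amb N) :
    cDeriv j (fun x => b (x 0 / ε) * g x) x =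
      b (x 0 / ε) * cDeriv j g x + if j = 0 then (ε : ℂ)⁻¹ * (deriv b (x 0 / ε) * g x) else 0 := by
  have h1 := ((hb (x 0 / ε)).hasFDerivAt.comp x (coordZero_hasFDerivAt x ε)).mul
    (hg x).hasFDerivAt
  unfold cDeriv
  have e : fderiv ℝ (fun x : Amb N => b (x 0 / ε) * g x) x = _ := h1.fderiv
  rw [e]
  by_cases hj : j = 0
  · subst hj
    simp [fderiv_eq_smul_deriv]
    ring
  · have hj' : (0 : Fin (N + 1)) ≠ j := Ne.symm hj
    simp [hj, hj']

/-- Integration by parts on the half space: the boundary term is absent for tangential derivatives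
and for functions with zero trace. -/
lemma integral_mul_cDeriv (hg : IsTest g) {v v' : Amb N → ℂ} {j : Fin (N + 1)}
    (hv : MemLp v 2 (halfMeasure N)) (hv' : MemLp v' 2 (halfMeasure N)) (hw : HasWeakDeriv j v v')
    (hj : j ≠ 0 ∨ IsTrace v 0) :
    ∫ x, v x * cDeriv j g x ∂halfMeasure N = -∫ x, v' x * g x ∂halfMeasure N := by
  have hcut : ContDiff ℝ ∞ fun x : ℝ => (cutoff x : ℂ) := Complex.ofRealCLM.contDiff.comp cutoff_contDiff
  have hdcut : ∀ x, deriv (fun x : ℝ => (cutoff x : ℂ)) x = (deriv cutoff x : ℝ) := fun x =>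
    ((cutoff_contDiff.differentiable (by simp) x).hasDerivAt.ofReal_comp).deriv
  have i1 : Integrable (fun x => v x * cDeriv j g x) (halfMeasure N) :=
    hv.integrable_mul (hg.cDeriv j).memLp
  have i2 : Integrable (fun x => v' x * g x) (halfMeasure N) := hv'.integrable_mul hg.memLp
  have i3 : Integrable (fun x => v x * g x) (halfMeasure N) := hv.integrable_mul hg.memLp
  obtain ⟨B, hB⟩ := exists_deriv_cutoff_le
  have hcb : ∀ ε : ℝ, Measurable fun x : Amb N => (cutoff (x 0 / ε) : ℂ) := fun ε =>
    Complex.measurable_ofReal.comp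
      (cutoff_contDiff.continuous.measurable.comp (measurable_coord_zero.div_const ε))
  have hdb : ∀ ε : ℝ, Measurable fun x : Amb N => deriv (fun x : ℝ => (cutoff x : ℂ)) (x 0 / ε) :=
    fun ε => (hcut.continuous_deriv (by simp)).measurable.comp (measurable_coord_zero.div_const ε)
  -- the identity with the cutoff
  have key : ∀ ε : ℝ, 0 < ε →
      (∫ x, (cutoff (x 0 / ε) : ℂ) * (v x * cDeriv j g x) ∂halfMeasure N) +
        (if j = 0 then (ε : ℂ)⁻¹ * ∫ x, deriv (fun x : ℝ => (cutoff x : ℂ)) (x 0 / ε) *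
          (v x * g x) ∂halfMeasure N else 0) =
      -∫ x, (cutoff (x 0 / ε) : ℂ) * (v' x * g x) ∂halfMeasure N := by
    intro ε hε
    have hψ : ContDiff ℝ ∞ fun x : Amb N => (cutoff (x 0 / ε) : ℂ) * g x :=
      (hcut.comp (contDiff_coordZero ε)).mul hg.1
    have hsub : tsupport (fun x : Amb N => (cutoff (x 0 / ε) : ℂ) * g x) ⊆ halfSpace N := by
      have hcl : IsClosed {x : Amb N | ε ≤ x 0} :=
        isClosed_le continuous_const (EuclideanSpace.proj (𝕜 := ℝ) (0 : Fin (N + 1))).continuous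
      refine (closure_minimal (fun x hx => ?_) hcl).trans fun x hx => lt_of_lt_of_le hε hx
      by_contra hne
      refine hx ?_
      have : x 0 / ε ≤ 1 := (div_le_one₀ hε).2 (le_of_lt (not_le.1 hne))
      simp [cutoff_of_le this]
    have h1 := hw.2.2 _ hψ hg.2.mul_left hsub
    have h2 : ∀ x : Amb N, v x * fderiv ℝ (fun x : Amb N => (cutoff (x 0 / ε) : ℂ) * g x) x
        (EuclideanSpace.single j 1) = (cutoff (x 0 / ε) : ℂ) * (v x * cDeriv j g x) +
          if j = 0 then (ε : ℂ)⁻¹ * (deriv (fun x : ℝ => (cutoff x : ℂ)) (x 0 / ε) * (v x * g x))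
            else 0 := by
      intro x
      have := cDeriv_layer_mul (hcut.differentiable (by simp)) hg.differentiable ε j x
      unfold cDeriv at this ⊢
      rw [this]
      split_ifs <;> ring
    have j1 : Integrable (fun x => (cutoff (x 0 / ε) : ℂ) * (v x * cDeriv j g x)) (halfMeasure N) := by
      refine i1.bdd_mul (c := 1) (hcb ε).aestronglyMeasurable (Eventually.of_forall fun x => ?_)
      rw [Complex.norm_real, Real.norm_eq_abs, abs_of_nonneg (cutoff_mem _).1]
      exact (cutoff_mem _).2
    have j2 : Integrable (fun x => deriv (fun x : ℝ => (cutoff x : ℂ)) (x 0 / ε) * (v x * g x))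
        (halfMeasure N) := by
      refine i3.bdd_mul (c := B) (hdb ε).aestronglyMeasurable (Eventually.of_forall fun x => ?_)
      rw [hdcut, Complex.norm_real]
      exact (hB _).1
    simp_rw [h2] at h1
    have e3 : ∫ x, v' x * ((cutoff (x 0 / ε) : ℂ) * g x) ∂halfMeasure N =
        ∫ x, (cutoff (x 0 / ε) : ℂ) * (v' x * g x) ∂halfMeasure N :=
      integral_congr_ae (Eventually.of_forall fun x => by simp only; ring)
    rw [e3] at h1
    rw [← h1]
    split_ifs
    · rw [integral_add j1 (j2.const_mul _), integral_const_mul]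
    · simp
  have L1 := tendsto_integral_cutoff i1
  have L2 := (tendsto_integral_cutoff i2).neg
  have L3 : Tendsto (fun ε : ℝ => if j = 0 then (ε : ℂ)⁻¹ * ∫ x,
      deriv (fun x : ℝ => (cutoff x : ℂ)) (x 0 / ε) * (v x * g x) ∂halfMeasure N else 0)
      (𝓝[>] 0) (𝓝 0) := by
    rcases hj with hj | hj
    · simp [hj]
    · split_ifs
      · refine tendsto_boundary_layer (B := B) (R := 3) (by norm_num) (fun x _ => ?_) (fun x hx => ?_)
          hv.1 hg.memLp.1 ?_ hg.lintegral_slab_le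
        · rw [hdcut, Complex.norm_real]
          exact (hB x).1
        · rw [hdcut, (hB x).2 (by linarith), Complex.ofReal_zero]
        · refine Tendsto.congr (fun ε => ?_) hj
          congr 1
          refine lintegral_congr_ae ?_
          have h0 : ∀ᵐ x ∂halfMeasure N, (0 : Lp ℂ 2 (volume : Measure (Bdry N))) (tang x) = 0 :=
            ae_half_of_ae (ae_tang (Lp.coeFn_zero ℂ 2 volume))
          filter_upwards [ae_mono (restrict_slab_le ε) h0] with x hx
          rw [hx, sub_zero]
      · exact tendsto_const_nhds
  have L := L1.add L3
  rw [add_zero] at L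
  refine tendsto_nhds_unique_of_eventuallyEq L L2 ?_
  filter_upwards [self_mem_nhdsWithin] with ε hε using key ε hε

end Parts

/-! ### The boundary condition suffices for the domain of the adjoint -/

section Adjoint

variable {N : ℕ} {t : ℝ} {ψ W : Form N}

lemma integral_cDeriv_mul_conj {g w w' : Amb N → ℂ} (hg : IsTest g) {k : Fin (N + 1)}
    (hv : MemLp w 2 (halfMeasure N)) (hv' : MemLp w' 2 (halfMeasure N)) (hw : HasWeakDeriv k w w')
    (hk : k ≠ 0 ∨ IsTrace w 0) :
    ∫ x, cDeriv k g x * conj (w x) ∂halfMeasure N = -∫ x, g x * conj (w' x) ∂halfMeasure N := by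
  have h := congrArg conj (integral_mul_cDeriv hg.conj hv hv' hw hk)
  rw [cDeriv_conj hg, map_neg, ← integral_conj, ← integral_conj] at h
  simpa [mul_comm] using h

/-- The second order terms of `⟨du, ψ⟩_1` are bounded by first order terms of `u`: one derivative
is moved to `ψ`, a tangential one if there is any. -/
lemma exists_bound_second_order {v V : Amb N → ℂ} (h : HasSymbol t v V) (ht : 2 ≤ t)
    (i j : Fin (N + 1)) (hj : j = 0 → IsTrace (weakDeriv 0 v) 0) :
    ∃ C : ℝ, 0 ≤ C ∧ ∀ u : Amb N → ℂ, IsTest u →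
      ‖∫ x, cDeriv i (cDeriv j u) x * conj (weakDeriv i v x) ∂halfMeasure N‖ ≤
        C * max (eLpNorm (cDeriv i u) 2 (halfMeasure N)).toReal
          (eLpNorm (cDeriv j u) 2 (halfMeasure N)).toReal := by
  have h1 := h.weakDeriv (by linarith) i
  have h2 := fun k => h1.hasWeakDeriv (by linarith) k
  by_cases hj0 : j = 0
  · refine ⟨_, ENNReal.toReal_nonneg (a := eLpNorm (weakDeriv i (weakDeriv i v)) 2 (halfMeasure N)),
      fun u hu => ?_⟩
    rw [integral_cDeriv_mul_conj (hu.cDeriv j) h1.memLp (h2 i).2.memLp (h2 i).1 ?_, norm_neg]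
    · refine (norm_integral_mul_conj_le (hu.cDeriv j).memLp (h2 i).2.memLp).trans ?_
      rw [mul_comm]
      gcongr
      exact le_max_right _ _
    · by_cases hi : i = 0
      · subst hi; exact Or.inr (hj hj0)
      · exact Or.inl hi
  · refine ⟨_, ENNReal.toReal_nonneg (a := eLpNorm (weakDeriv j (weakDeriv i v)) 2 (halfMeasure N)),
      fun u hu => ?_⟩
    rw [cDeriv_comm hu, integral_cDeriv_mul_conj (hu.cDeriv i) h1.memLp (h2 j).2.memLp (h2 j).1
      (Or.inl hj0), norm_neg]
    refine (norm_integral_mul_conj_le (hu.cDeriv i).memLp (h2 j).2.memLp).trans ?_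
    rw [mul_comm]
    gcongr
    exact le_max_left _ _

/-- The boundary condition is sufficient for membership in the domain of the adjoint. -/
lemma memDomAdjoint_of_boundaryCond (h : ∀ I, HasSymbol t (ψ I) (W I)) (ht : 2 ≤ t)
    (hb : BoundaryCond ψ) : MemDomAdjoint ψ := by
  have hW : ∀ I, MemW1 (ψ I) := fun I => (h I).memW1 (by linarith)
  refine ⟨hW, ?_⟩
  have hex : ∀ (K : Finset (Fin (N + 1))) (i j : Fin (N + 1)), ∃ C : ℝ, 0 ≤ C ∧ (j ∈ K →
      ∀ u : Amb N → ℂ, IsTest u →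
      ‖∫ x, cDeriv i (cDeriv j u) x * conj (weakDeriv i (ψ K) x) ∂halfMeasure N‖ ≤
        C * max (eLpNorm (cDeriv i u) 2 (halfMeasure N)).toReal
          (eLpNorm (cDeriv j u) 2 (halfMeasure N)).toReal) := by
    intro K i j
    by_cases hjK : j ∈ K
    · obtain ⟨C, hC0, hC⟩ := exists_bound_second_order (h K) ht i j (fun hj => by
        subst hj
        have := hb (K.erase 0) (Finset.notMem_erase 0 K)
        rwa [Finset.insert_erase hjK] at this)
      exact ⟨C, hC0, fun _ => hC⟩
    · exact ⟨0, le_rfl, fun h => absurd h hjK⟩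
  choose C hC0 hC using hex
  refine ⟨∑ K, ∑ j ∈ K, ((eLpNorm (ψ K) 2 (halfMeasure N)).toReal + ∑ i, C K i j), fun u hu' => ?_⟩
  have hu : ∀ I, IsTest (u I) := hu'
  rw [innerW1_extD hu hW, Finset.sum_mul]
  refine (norm_sum_le _ _).trans (Finset.sum_le_sum fun K _ => ?_)
  rw [Finset.sum_mul]
  refine (norm_sum_le _ _).trans (Finset.sum_le_sum fun j hj => ?_)
  rw [norm_mul, norm_pow, norm_neg, norm_one, one_pow, one_mul, add_mul, Finset.sum_mul]
  refine (norm_add_le _ _).trans (add_le_add ?_ ((norm_sum_le _ _).trans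
    (Finset.sum_le_sum fun i _ => ?_)))
  · refine (norm_integral_mul_conj_le ((hu _).cDeriv j).memLp (hW K).1).trans ?_
    rw [mul_comm]
    gcongr
    exact eLpNorm_cDeriv_le_normW1 hu _ j
  · refine (hC K i j hj _ (hu _)).trans ?_
    have := hC0 K i j
    gcongr
    exact max_le (eLpNorm_cDeriv_le_normW1 hu _ i) (eLpNorm_cDeriv_le_normW1 hu _ j)

end Adjoint

/-! ### Boundary layers -/

section Layer

variable {N : ℕ}

/-- The function `b(x_0 / ε) w(x')`. -/
def layer (ε : ℝ) (b : ℝ → ℂ) (w : Bdry N → ℂ) : Amb N → ℂ := fun x => b (x 0 / ε) * w (tang x)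

/-- The derivative `∂_i w` of a function on the boundary. -/
def tDeriv (i : Fin N) (w : Bdry N → ℂ) : Bdry N → ℂ := fun x =>
  fderiv ℝ w x (EuclideanSpace.single i 1)

/-- The linear map `tang`. -/
def tangL (N : ℕ) : Amb N →L[ℝ] Bdry N :=
  LinearMap.toContinuousLinearMap
    { toFun := tang
      map_add' := fun x y => by ext i; simp [tang]
      map_smul' := fun c x => by ext i; simp [tang] }

variable {b : ℝ → ℂ} {w : Bdry N → ℂ} {ε : ℝ}

lemma IsTest.deriv (h : IsTest b) : IsTest (deriv b) :=
  ⟨(contDiff_infty_iff_deriv.1 h.1).2, h.2.deriv⟩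

lemma IsTest.tDeriv (h : IsTest w) (i : Fin N) : IsTest (tDeriv i w) :=
  ⟨(h.1.fderiv_right (m := ∞) (by rfl)).clm_apply contDiff_const, h.2.fderiv_apply (𝕜 := ℝ) _⟩

lemma isTest_layer (hb : IsTest b) (hw : IsTest w) (hε : 0 < ε) : IsTest (layer ε b w) := by
  refine ⟨(hb.1.comp (contDiff_coordZero ε)).mul (hw.1.comp (tangL N).contDiff), ?_⟩
  have hK : IsCompact ((fun p : ℝ × Bdry N => glue (ε * p.1) p.2) '' (tsupport b ×ˢ tsupport w)) := by
    refine (hb.2.isCompact.prod hw.2.isCompact).image ?_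
    have : Continuous fun p : ℝ × Bdry N => glue p.1 p.2 := continuous_glue
    exact this.comp (f := fun p : ℝ × Bdry N => (ε * p.1, p.2)) (by fun_prop)
  refine HasCompactSupport.intro hK fun x hx => ?_
  by_contra hne
  refine hx ⟨(x 0 / ε, tang x), ⟨subset_tsupport _ fun h => hne ?_, subset_tsupport _ fun h => hne ?_⟩, ?_⟩
  · simp [layer, h]
  · simp only at h
    simp [layer, h]
  · simp only
    rw [mul_div_cancel₀ _ hε.ne', glue_tang]

lemma tang_single_succ (i : Fin N) :
    tang (EuclideanSpace.single i.succ (1 : ℝ) : Amb N) = EuclideanSpace.single i 1 := by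
  ext k
  simp [tang]

lemma tang_single_zero : tang (EuclideanSpace.single 0 (1 : ℝ) : Amb N) = 0 := by
  ext k
  simp [tang]

lemma cDeriv_tang (hw : IsTest w) (j : Fin (N + 1)) (x : Amb N) :
    cDeriv j (fun x => w (tang x)) x = fderiv ℝ w (tang x) (tang (EuclideanSpace.single j (1 : ℝ))) := by
  have h1 : HasFDerivAt (fun x => w (tang x)) _ x :=
    ((hw.1.differentiable (by simp)) (tangL N x)).hasFDerivAt.comp x (tangL N).hasFDerivAt
  unfold cDeriv
  rw [h1.fderiv]
  rfl

lemma cDeriv_layer_zero (hb : IsTest b) (hw : IsTest w) :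
    cDeriv 0 (layer ε b w) = fun x => (ε : ℂ)⁻¹ * layer ε (deriv b) w x := by
  ext x
  have hd : Differentiable ℝ fun x : Amb N => w (tang x) :=
    (hw.1.comp (tangL N).contDiff).differentiable (by simp)
  have := cDeriv_layer_mul (hb.1.differentiable (by simp)) hd ε 0 x
  unfold layer
  rw [this, cDeriv_tang hw, tang_single_zero]
  simp

lemma cDeriv_layer_succ (hb : IsTest b) (hw : IsTest w) (i : Fin N) :
    cDeriv i.succ (layer ε b w) = layer ε b (tDeriv i w) := by
  ext x
  have hd : Differentiable ℝ fun x : Amb N => w (tang x) :=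
    (hw.1.comp (tangL N).contDiff).differentiable (by simp)
  have := cDeriv_layer_mul (hb.1.differentiable (by simp)) hd ε i.succ x
  unfold layer
  rw [this, cDeriv_tang hw, tang_single_succ]
  simp [tDeriv]

lemma eLpNorm_layer_sq (hb : IsTest b) (hw : IsTest w) :
    ∃ M : ℝ≥0, ∀ ε : ℝ, 0 < ε → eLpNorm (layer ε b w) 2 (halfMeasure N) ^ 2 ≤ M * ENNReal.ofReal ε := by
  have hbm := MemLp.lintegral_sq_lt_top
    (hb.1.continuous.memLp_of_hasCompactSupport (p := 2) (μ := volume) hb.2)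
  have hwm := MemLp.lintegral_sq_lt_top
    (hw.1.continuous.memLp_of_hasCompactSupport (p := 2) (μ := volume) hw.2)
  refine ⟨((∫⁻ x, ‖b x‖ₑ ^ 2) * ∫⁻ x, ‖w x‖ₑ ^ 2).toNNReal, fun ε hε => ?_⟩
  rw [ENNReal.coe_toNNReal (ENNReal.mul_lt_top hbm hwm).ne, eLpNorm_two_sq]
  have hm : Measurable fun x : Amb N => ‖layer ε b w x‖ₑ ^ 2 :=
    (isTest_layer hb hw hε).continuous.enorm.measurable.pow_const 2
  have hs : ∫⁻ x₀, ‖b (x₀ / ε)‖ₑ ^ 2 = ENNReal.ofReal ε * ∫⁻ x, ‖b x‖ₑ ^ 2 := by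
    have h1 := Real.map_volume_mul_left (inv_ne_zero hε.ne')
    rw [inv_inv, abs_of_pos hε] at h1
    rw [← smul_eq_mul, ← lintegral_smul_measure, ← h1, lintegral_map]
    · simp [div_eq_inv_mul]
    · exact hb.1.continuous.enorm.measurable.pow_const 2
    · fun_prop
  calc ∫⁻ x, ‖layer ε b w x‖ₑ ^ 2 ∂halfMeasure N ≤ ∫⁻ x, ‖layer ε b w x‖ₑ ^ 2 :=
        lintegral_mono' halfMeasure_le le_rfl
    _ = ∫⁻ x₀, ∫⁻ x', ‖b (x₀ / ε)‖ₑ ^ 2 * ‖w x'‖ₑ ^ 2 := by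
        rw [lintegral_glue hm.aemeasurable]
        simp [layer, enorm_mul, mul_pow]
    _ = (∫⁻ x₀, ‖b (x₀ / ε)‖ₑ ^ 2) * ∫⁻ x', ‖w x'‖ₑ ^ 2 := by
        rw [← lintegral_mul_const' _ _ hwm.ne]
        exact lintegral_congr fun x₀ => lintegral_const_mul' _ _ (by finiteness)
    _ = _ := by rw [hs]; ring

lemma tendsto_eLpNorm_layer (hb : IsTest b) (hw : IsTest w) :
    Tendsto (fun ε : ℝ => (eLpNorm (layer ε b w) 2 (halfMeasure N)).toReal) (𝓝[>] 0) (𝓝 0) := by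
  obtain ⟨M, hM⟩ := eLpNorm_layer_sq hb hw
  have h1 : Tendsto (fun ε : ℝ => Real.sqrt (M * ε)) (𝓝[>] 0) (𝓝 0) := by
    have : Tendsto (fun ε : ℝ => Real.sqrt (M * ε)) (𝓝 0) (𝓝 (Real.sqrt (M * 0))) :=
      (Real.continuous_sqrt.comp (continuous_const.mul continuous_id)).tendsto 0
    rw [mul_zero, Real.sqrt_zero] at this
    exact this.mono_left nhdsWithin_le_nhds
  refine squeeze_zero' (Eventually.of_forall fun _ => ENNReal.toReal_nonneg) ?_ h1
  filter_upwards [self_mem_nhdsWithin] with ε hε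
  have h2 := ENNReal.toReal_mono (by finiteness) (hM ε hε)
  rw [ENNReal.toReal_pow, ENNReal.toReal_mul, ENNReal.coe_toReal,
    ENNReal.toReal_ofReal (le_of_lt hε)] at h2
  exact Real.le_sqrt_of_sq_le h2

lemma tendsto_integral_layer (hb : IsTest b) (hw : IsTest w) {g : Amb N → ℂ}
    (hg : MemLp g 2 (halfMeasure N)) :
    Tendsto (fun ε : ℝ => ∫ x, layer ε b w x * conj (g x) ∂halfMeasure N) (𝓝[>] 0) (𝓝 0) := by
  have h := (tendsto_eLpNorm_layer hb hw).mul_const (eLpNorm g 2 (halfMeasure N)).toReal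
  rw [zero_mul] at h
  refine squeeze_zero_norm' ?_ h
  filter_upwards [self_mem_nhdsWithin] with ε hε
  exact norm_integral_mul_conj_le (isTest_layer hb hw hε).memLp hg

lemma tendsto_smul_zero {F : ℝ → ℂ} (hF : Tendsto F (𝓝[>] 0) (𝓝 0)) :
    Tendsto (fun ε : ℝ => (ε : ℂ) * F ε) (𝓝[>] 0) (𝓝 0) := by
  have h1 : Tendsto (fun ε : ℝ => (ε : ℂ)) (𝓝[>] 0) (𝓝 0) :=
    (Complex.continuous_ofReal.tendsto' 0 0 (by simp)).mono_left nhdsWithin_le_nhds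
  simpa using h1.mul hF

lemma IsTest.exists_bound (hb : IsTest b) :
    ∃ B R : ℝ, 0 < R ∧ (∀ x, ‖b x‖ ≤ B) ∧ ∀ x, R ≤ x → b x = 0 := by
  obtain ⟨B, hB⟩ := hb.2.exists_bound_of_continuous hb.1.continuous
  obtain ⟨R, hR⟩ := hb.2.isCompact.isBounded.subset_closedBall (0 : ℝ)
  refine ⟨B, |R| + 1, by positivity, hB, fun x hx => ?_⟩
  by_contra hne
  have h := hR (subset_tsupport b hne)
  rw [mem_closedBall_zero_iff, Real.norm_eq_abs] at h
  linarith [le_abs_self x, le_abs_self R]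

/-- A boundary layer of second derivatives sees the trace. -/
lemma tendsto_integral_layer_trace (hb : IsTest b) (hw : IsTest w) {f : Amb N → ℂ}
    (hf : MemLp f 2 (halfMeasure N)) {v : Lp ℂ 2 (volume : Measure (Bdry N))} (hv : IsTrace f v) :
    Tendsto (fun ε : ℝ => (ε : ℂ)⁻¹ * ∫ x, layer ε (deriv b) w x * conj (f x) ∂halfMeasure N)
      (𝓝[>] 0) (𝓝 (-b 0 * ∫ x', w x' * conj (v x'))) := by
  obtain ⟨B, R, hR, hB, hB0⟩ := hb.deriv.exists_bound
  have hwm := hw.1.continuous.memLp_of_hasCompactSupport (p := 2) (μ := volume) hw.2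
  have hvm : Measurable fun x : Amb N => v (tang x) :=
    (Lp.stronglyMeasurable v).measurable.comp measurable_tang
  have hwt : Measurable fun x : Amb N => w (tang x) :=
    hw.1.continuous.measurable.comp measurable_tang
  have hwv : Integrable fun x' => w x' * conj (v x') := hwm.integrable_mul (Lp.memLp v).star
  have h1 : Tendsto (fun ε : ℝ => (ε : ℂ)⁻¹ * ∫ x, deriv b (x 0 / ε) *
      (conj (f x - v (tang x)) * w (tang x)) ∂halfMeasure N) (𝓝[>] 0) (𝓝 0) := by
    refine tendsto_boundary_layer hR (fun x _ => hB x) hB0 ?_ hwt.aestronglyMeasurable ?_ ?_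
    · exact Complex.continuous_conj.comp_aestronglyMeasurable
        (hf.1.sub hvm.aestronglyMeasurable)
    · refine Tendsto.congr (fun ε => ?_) hv
      simp only [slab]
      congr 1
      refine lintegral_congr fun x => ?_
      rw [← ofReal_norm, ← ofReal_norm, RCLike.norm_conj]
    · have hwl := MemLp.lintegral_sq_lt_top hwm
      refine ⟨(∫⁻ x', ‖w x'‖ₑ ^ 2).toNNReal, fun ε hε => ?_⟩
      rw [ENNReal.coe_toNNReal hwl.ne, lintegral_slab (hwt.enorm.pow_const 2).aemeasurable]
      simp
  have key : ∀ ε : ℝ, 0 < ε → (ε : ℂ)⁻¹ * ∫ x, layer ε (deriv b) w x * conj (f x) ∂halfMeasure N =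
      (ε : ℂ)⁻¹ * (∫ x, deriv b (x 0 / ε) * (conj (f x - v (tang x)) * w (tang x)) ∂halfMeasure N) +
        -b 0 * ∫ x', w x' * conj (v x') := by
    intro ε hε
    have hdi : Integrable fun x₀ : ℝ => deriv b (x₀ / ε) :=
      (hb.deriv.1.continuous.integrable_of_hasCompactSupport hb.deriv.2).comp_div hε.ne'
    have i1 : Integrable (fun x => layer ε (deriv b) w x * conj (f x)) (halfMeasure N) :=
      MemLp.integrable_mul_conj (isTest_layer hb.deriv hw hε).memLp hf
    have i2 : Integrable (fun p : ℝ × Bdry N => deriv b (p.1 / ε) * (w p.2 * conj (v p.2)))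
        ((volume.restrict (Set.Ioi 0)).prod volume) := hdi.restrict.mul_prod hwv
    have i3 : Integrable (fun x => layer ε (deriv b) w x * conj (v (tang x))) (halfMeasure N) := by
      rw [← measurePreserving_glue_half.integrable_comp_emb (glueEquiv N).measurableEmbedding]
      refine i2.congr (Eventually.of_forall fun p => ?_)
      simp [layer, mul_assoc, glueEquiv]
    have e3 : ∫ x, layer ε (deriv b) w x * conj (v (tang x)) ∂halfMeasure N =
        (∫ x₀ in Set.Ioi (0 : ℝ), deriv b (x₀ / ε)) * ∫ x', w x' * conj (v x') := by
      rw [← measurePreserving_glue_half.integral_comp (glueEquiv N).measurableEmbedding,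
        ← integral_prod_mul]
      refine integral_congr_ae (Eventually.of_forall fun p => ?_)
      simp [layer, mul_assoc, glueEquiv]
    have e4 : ∫ x₀ in Set.Ioi (0 : ℝ), deriv b (x₀ / ε) = ε * -b 0 := by
      have h := integral_comp_mul_left_Ioi (deriv b) 0 (inv_pos.2 hε)
      rw [mul_zero, inv_inv, HasCompactSupport.integral_Ioi_deriv_eq
        (hb.1.of_le (by norm_cast)) hb.2 0] at h
      simpa [div_eq_inv_mul] using h
    have e5 : ∫ x, layer ε (deriv b) w x * conj (f x) ∂halfMeasure N =
        (∫ x, deriv b (x 0 / ε) * (conj (f x - v (tang x)) * w (tang x)) ∂halfMeasure N) +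
          ∫ x, layer ε (deriv b) w x * conj (v (tang x)) ∂halfMeasure N := by
      rw [← sub_eq_iff_eq_add, ← integral_sub i1 i3]
      refine integral_congr_ae (Eventually.of_forall fun x => ?_)
      simp only [layer, map_sub]
      ring
    have hεC : (ε : ℂ) ≠ 0 := by exact_mod_cast hε.ne'
    rw [e5, e3, e4]
    field_simp
  have h2 := h1.add_const (-b 0 * ∫ x', w x' * conj (v x'))
  rw [zero_add] at h2
  refine h2.congr' ?_
  filter_upwards [self_mem_nhdsWithin] with ε hε using (key ε hε).symm

end Layer

/-! ### The boundary condition is necessary for the domain of the adjoint -/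

section Necessity

variable {N : ℕ} {b : ℝ → ℂ} {w : Bdry N → ℂ} {ε : ℝ}

lemma cDeriv_const_mul {u : Amb N → ℂ} (hu : IsTest u) (c : ℂ) (j : Fin (N + 1)) :
    cDeriv j (fun x => c * u x) = fun x => c * cDeriv j u x := by
  have := cDeriv_sum (Finset.univ : Finset Unit) (c := fun _ => c) (u := fun _ => u)
    (fun _ _ => hu) j
  simpa using this

lemma cDeriv_zero (j : Fin (N + 1)) : cDeriv j (0 : Amb N → ℂ) = 0 := by
  ext x
  unfold cDeriv
  simp

/-- The function `ε b(x_0 / ε) w(x')`. -/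
def tallLayer (ε : ℝ) (b : ℝ → ℂ) (w : Bdry N → ℂ) : Amb N → ℂ := fun x => ε * layer ε b w x

lemma isTest_tallLayer (hb : IsTest b) (hw : IsTest w) (hε : 0 < ε) :
    IsTest (tallLayer ε b w) := (isTest_layer hb hw hε).const_mul _

lemma cDeriv_tallLayer_zero (hb : IsTest b) (hw : IsTest w) (hε : 0 < ε) :
    cDeriv 0 (tallLayer ε b w) = layer ε (deriv b) w := by
  have hεC : (ε : ℂ) ≠ 0 := by exact_mod_cast hε.ne'
  unfold tallLayer
  rw [cDeriv_const_mul (isTest_layer hb hw hε), cDeriv_layer_zero hb hw]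
  ext x
  rw [mul_inv_cancel_left₀ hεC]

lemma cDeriv_tallLayer_succ (hb : IsTest b) (hw : IsTest w) (hε : 0 < ε) (i : Fin N) :
    cDeriv i.succ (tallLayer ε b w) = tallLayer ε b (tDeriv i w) := by
  unfold tallLayer
  rw [cDeriv_const_mul (isTest_layer hb hw hε), cDeriv_layer_succ hb hw]

lemma tendsto_eLpNorm_tallLayer (hb : IsTest b) (hw : IsTest w) :
    Tendsto (fun ε : ℝ => (eLpNorm (tallLayer ε b w) 2 (halfMeasure N)).toReal) (𝓝[>] 0) (𝓝 0) := by
  refine squeeze_zero' (Eventually.of_forall fun _ => ENNReal.toReal_nonneg) ?_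
    (tendsto_eLpNorm_layer hb hw)
  filter_upwards [Ioo_mem_nhdsGT one_pos] with ε hε
  have e : eLpNorm (tallLayer ε b w) 2 (halfMeasure N) =
      ‖(ε : ℂ)‖ₑ * eLpNorm (layer ε b w) 2 (halfMeasure N) := eLpNorm_const_smul (ε : ℂ) _ _ _
  rw [e, ENNReal.toReal_mul, toReal_enorm, Complex.norm_real, Real.norm_eq_abs, abs_of_pos hε.1]
  exact mul_le_of_le_one_left ENNReal.toReal_nonneg hε.2.le

lemma tendsto_integral_tallLayer (hb : IsTest b) (hw : IsTest w) {g : Amb N → ℂ}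
    (hg : MemLp g 2 (halfMeasure N)) :
    Tendsto (fun ε : ℝ => ∫ x, tallLayer ε b w x * conj (g x) ∂halfMeasure N) (𝓝[>] 0) (𝓝 0) := by
  refine (tendsto_smul_zero (tendsto_integral_layer hb hw hg)).congr fun ε => ?_
  rw [← integral_const_mul]
  simp only [tallLayer, mul_assoc]

lemma tendsto_integral_cDeriv_tallLayer (hb : IsTest b) (hw : IsTest w) {g : Amb N → ℂ}
    (hg : MemLp g 2 (halfMeasure N)) (j : Fin (N + 1)) :
    Tendsto (fun ε : ℝ => ∫ x, cDeriv j (tallLayer ε b w) x * conj (g x) ∂halfMeasure N) (𝓝[>] 0)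
      (𝓝 0) := by
  refine Fin.cases ?_ (fun i => ?_) j
  · refine (tendsto_integral_layer hb.deriv hw hg).congr' ?_
    filter_upwards [self_mem_nhdsWithin] with ε hε
    rw [cDeriv_tallLayer_zero hb hw hε]
  · refine (tendsto_integral_tallLayer hb (hw.tDeriv i) hg).congr' ?_
    filter_upwards [self_mem_nhdsWithin] with ε hε
    rw [cDeriv_tallLayer_succ hb hw hε]

lemma tendsto_eLpNorm_cDeriv_tallLayer (hb : IsTest b) (hw : IsTest w) (j : Fin (N + 1)) :
    Tendsto (fun ε : ℝ => (eLpNorm (cDeriv j (tallLayer ε b w)) 2 (halfMeasure N)).toReal) (𝓝[>] 0)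
      (𝓝 0) := by
  refine Fin.cases ?_ (fun i => ?_) j
  · refine (tendsto_eLpNorm_layer hb.deriv hw).congr' ?_
    filter_upwards [self_mem_nhdsWithin] with ε hε
    rw [cDeriv_tallLayer_zero hb hw hε]
  · refine (tendsto_eLpNorm_tallLayer hb (hw.tDeriv i)).congr' ?_
    filter_upwards [self_mem_nhdsWithin] with ε hε
    rw [cDeriv_tallLayer_succ hb hw hε]

/-- Among the second derivatives of a layer, only the second normal derivative matters. -/
lemma tendsto_integral_second_tallLayer (hb : IsTest b) (hw : IsTest w) {g : Amb N → ℂ}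
    (hg : MemLp g 2 (halfMeasure N)) (i j : Fin (N + 1)) (hij : ¬ (j = 0 ∧ i = 0)) :
    Tendsto (fun ε : ℝ => ∫ x, cDeriv i (cDeriv j (tallLayer ε b w)) x * conj (g x) ∂halfMeasure N)
      (𝓝[>] 0) (𝓝 0) := by
  rcases Fin.eq_zero_or_eq_succ j with rfl | ⟨j, rfl⟩
  · rcases Fin.eq_zero_or_eq_succ i with rfl | ⟨i, rfl⟩
    · exact absurd ⟨rfl, rfl⟩ hij
    · refine (tendsto_integral_layer hb.deriv (hw.tDeriv i) hg).congr' ?_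
      filter_upwards [self_mem_nhdsWithin] with ε hε
      rw [cDeriv_tallLayer_zero hb hw hε, cDeriv_layer_succ hb.deriv hw]
  · refine (tendsto_integral_cDeriv_tallLayer hb (hw.tDeriv j) hg i).congr' ?_
    filter_upwards [self_mem_nhdsWithin] with ε hε
    rw [cDeriv_tallLayer_succ hb hw hε]

lemma exists_isTest_deriv_one : ∃ b : ℝ → ℂ, IsTest b ∧ deriv b 0 = 1 := by
  let χ : ContDiffBump (0 : ℝ) := ⟨1, 2, one_pos, one_lt_two⟩
  have hχ : ContDiff ℝ ∞ fun x : ℝ => ((χ x : ℝ) : ℂ) := Complex.ofRealCLM.contDiff.comp χ.contDiff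
  have hid : ContDiff ℝ ∞ fun x : ℝ => (x : ℂ) := Complex.ofRealCLM.contDiff
  refine ⟨fun x => (x : ℂ) * (χ x : ℂ), ⟨hid.mul hχ, ?_⟩, ?_⟩
  · exact (χ.hasCompactSupport.comp_left (g := fun r : ℝ => (r : ℂ)) Complex.ofReal_zero).mul_left
  · have h1 := (hid.differentiable (by simp) 0).hasDerivAt.mul
      (hχ.differentiable (by simp) 0).hasDerivAt
    have h2 : deriv (fun x : ℝ => (x : ℂ)) 0 = 1 := (hasDerivAt_id (0 : ℝ)).ofReal_comp.deriv
    have h3 : χ 0 = 1 := χ.one_of_mem_closedBall (by simp [χ])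
    have e := h1.deriv
    rw [h2, h3] at e
    simpa using! e

open Classical in
/-- The form whose only nonzero coefficient is `ε b(x_0 / ε) w(x') dx^J`. -/
def layerForm (J : Finset (Fin (N + 1))) (b : ℝ → ℂ) (w : Bdry N → ℂ) (ε : ℝ) : Form N :=
  fun I => if I = J then tallLayer ε b w else 0

lemma isTest_layerForm (J : Finset (Fin (N + 1))) (hb : IsTest b) (hw : IsTest w)
    (hε : 0 < ε) (I : Finset (Fin (N + 1))) : IsTest (layerForm J b w ε I) := by
  unfold layerForm
  split_ifs
  · exact isTest_tallLayer hb hw hε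
  · exact IsTest.zero

lemma tendsto_normW1_layerForm (J : Finset (Fin (N + 1))) (hb : IsTest b) (hw : IsTest w) :
    Tendsto (fun ε : ℝ => normW1 (layerForm J b w ε)) (𝓝[>] 0) (𝓝 0) := by
  have h1 : Tendsto (fun ε : ℝ => ∑ I, ((eLpNorm (layerForm J b w ε I) 2 (halfMeasure N)).toReal ^ 2 +
      ∑ j, (eLpNorm (cDeriv j (layerForm J b w ε I)) 2 (halfMeasure N)).toReal ^ 2)) (𝓝[>] 0)
      (𝓝 (∑ I : Finset (Fin (N + 1)), ((0 : ℝ) ^ 2 + ∑ _j : Fin (N + 1), (0 : ℝ) ^ 2))) := by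
    refine tendsto_finsetSum _ fun I _ => ?_
    by_cases hI : I = J
    · simp only [layerForm, if_pos hI]
      exact ((tendsto_eLpNorm_tallLayer hb hw).pow 2).add (tendsto_finsetSum _ fun j _ =>
        (tendsto_eLpNorm_cDeriv_tallLayer hb hw j).pow 2)
    · simp [layerForm, if_neg hI, cDeriv_zero]
  have h2 : Tendsto (fun ε : ℝ => normW1 (layerForm J b w ε) ^ 2) (𝓝[>] 0) (𝓝 0) := by
    simp only [ne_eq, OfNat.ofNat_ne_zero, not_false_eq_true, zero_pow, Finset.sum_const_zero,
      add_zero] at h1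
    refine h1.congr' ?_
    filter_upwards [self_mem_nhdsWithin] with ε hε
    rw [normW1_test (isTest_layerForm J hb hw hε)]
  have h3 := h2.sqrt
  rw [Real.sqrt_zero] at h3
  exact h3.congr fun ε => Real.sqrt_sq (normW1_nonneg _)

lemma tendsto_innerW1_layerForm {J : Finset (Fin (N + 1))} (hJ : 0 ∉ J) (hb : IsTest b)
    (hw : IsTest w) {ψ : Form N} (hψ : ∀ I, MemW1 (ψ I))
    {v : Lp ℂ 2 (volume : Measure (Bdry N))} (hv : IsTrace (weakDeriv 0 (ψ (insert 0 J))) v) :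
    Tendsto (fun ε : ℝ => innerW1 (extD (layerForm J b w ε)) ψ) (𝓝[>] 0)
      (𝓝 (-deriv b 0 * ∫ x', w x' * conj (v x'))) := by
  classical
  obtain ⟨L, hL⟩ : ∃ L, L = -deriv b 0 * ∫ x', w x' * conj (v x') := ⟨_, rfl⟩
  rw [← hL]
  have h1 : ∀ (K : Finset (Fin (N + 1))) (j : Fin (N + 1)), Tendsto (fun ε : ℝ =>
      ∫ x, cDeriv j (layerForm J b w ε (K.erase j)) x * conj (ψ K x) ∂halfMeasure N) (𝓝[>] 0)
      (𝓝 0) := by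
    intro K j
    by_cases hK : K.erase j = J
    · simp only [layerForm, if_pos hK]
      exact tendsto_integral_cDeriv_tallLayer hb hw (hψ K).1 j
    · simp [layerForm, if_neg hK, cDeriv_zero]
  have h2 : ∀ (K : Finset (Fin (N + 1))) (j : Fin (N + 1)), j ∈ K → ∀ i : Fin (N + 1),
      Tendsto (fun ε : ℝ => ∫ x, cDeriv i (cDeriv j (layerForm J b w ε (K.erase j))) x *
        conj (weakDeriv i (ψ K) x) ∂halfMeasure N) (𝓝[>] 0)
      (𝓝 (if K = insert 0 J ∧ j = 0 ∧ i = 0 then L else 0)) := by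
    intro K j hj i
    by_cases hK : K.erase j = J
    · simp only [layerForm, if_pos hK]
      by_cases hij : j = 0 ∧ i = 0
      · obtain ⟨rfl, rfl⟩ := hij
        have hKJ : K = insert 0 J := by rw [← hK, Finset.insert_erase hj]
        rw [if_pos ⟨hKJ, rfl, rfl⟩, hL, hKJ]
        refine (tendsto_integral_layer_trace hb.deriv hw ((hψ _).memLp_weakDeriv 0) hv).congr' ?_
        filter_upwards [self_mem_nhdsWithin] with ε hε
        rw [cDeriv_tallLayer_zero hb hw hε, cDeriv_layer_zero hb.deriv hw, ← integral_const_mul]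
        simp only [mul_assoc]
      · rw [if_neg fun h => hij h.2]
        exact tendsto_integral_second_tallLayer hb hw ((hψ K).memLp_weakDeriv i) i j hij
    · have : ¬ (K = insert 0 J ∧ j = 0 ∧ i = 0) := by
        rintro ⟨rfl, rfl, -⟩
        exact hK (Finset.erase_insert hJ)
      rw [if_neg this]
      simp [layerForm, if_neg hK, cDeriv_zero]
  have h3 : Tendsto (fun ε : ℝ => ∑ K, ∑ j ∈ K, (-1 : ℂ) ^ (K.filter (· < j)).card *
      (∫ x, cDeriv j (layerForm J b w ε (K.erase j)) x * conj (ψ K x) ∂halfMeasure N +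
        ∑ i, ∫ x, cDeriv i (cDeriv j (layerForm J b w ε (K.erase j))) x *
          conj (weakDeriv i (ψ K) x) ∂halfMeasure N)) (𝓝[>] 0)
      (𝓝 (∑ K, ∑ j ∈ K, (-1 : ℂ) ^ (K.filter (· < j)).card *
        (0 + ∑ i : Fin (N + 1), if K = insert 0 J ∧ j = 0 ∧ i = 0 then L else 0))) :=
    tendsto_finsetSum _ fun K _ => tendsto_finsetSum _ fun j hj =>
      ((h1 K j).add (tendsto_finsetSum _ fun i _ => h2 K j hj i)).const_mul _
  have h4 : (∑ K : Finset (Fin (N + 1)), ∑ j ∈ K, (-1 : ℂ) ^ (K.filter (· < j)).card *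
        (0 + ∑ i : Fin (N + 1), if K = insert 0 J ∧ j = 0 ∧ i = 0 then L else 0)) = L := by
    rw [Finset.sum_eq_single (insert 0 J), Finset.sum_eq_single 0, Finset.sum_eq_single 0]
    · simp
    · intro i _ hi; simp [hi]
    · simp
    · intro j _ hj; simp [hj]
    · simp
    · intro K _ hK; simp [hK]
    · simp
  rw [h4] at h3
  refine h3.congr' ?_
  filter_upwards [self_mem_nhdsWithin] with ε hε
  rw [innerW1_extD (isTest_layerForm J hb hw hε) hψ]

/-- The boundary condition is necessary for membership in the domain of the adjoint. -/
lemma boundaryCond_of_memDomAdjoint {ψ : Form N} (h : MemDomAdjoint ψ)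
    (ht : ∀ I, ∃ v, IsTrace (weakDeriv 0 (ψ I)) v) : BoundaryCond ψ := by
  intro J hJ
  obtain ⟨v, hv⟩ := ht (insert 0 J)
  obtain ⟨hψ, C, hC⟩ := h
  obtain ⟨b, hb, hb1⟩ := exists_isTest_deriv_one
  have key : ∀ w : Bdry N → ℂ, IsTest w → ∫ x', w x' * conj (v x') = 0 := by
    intro w hw
    have h1 := (tendsto_innerW1_layerForm hJ hb hw hψ hv).norm
    have h2 := (tendsto_normW1_layerForm J hb hw).const_mul C
    have h3 := le_of_tendsto_of_tendsto h1 h2 (by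
      filter_upwards [self_mem_nhdsWithin] with ε hε
      exact hC _ (isTest_layerForm J hb hw hε))
    rw [mul_zero, hb1] at h3
    simpa using h3
  have h0 : v = 0 := by
    refine Lp.ext ?_
    have hvl : LocallyIntegrable (fun x' => conj (v x')) volume :=
      MemLp.locallyIntegrable (Lp.memLp v).star (by norm_num)
    have h1 : ∀ᵐ x', conj (v x') = 0 := by
      refine ae_eq_zero_of_integral_contDiff_smul_eq_zero hvl fun g hg hgc => ?_
      have h2 := key (fun x => (g x : ℂ)) ⟨Complex.ofRealCLM.contDiff.comp hg,
        hgc.comp_left Complex.ofReal_zero⟩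
      simpa using h2
    filter_upwards [h1, Lp.coeFn_zero ℂ 2 (volume : Measure (Bdry N))] with x hx h2
    rw [h2, Pi.zero_apply]
    simpa using hx
  rwa [h0] at hv

end Necessity

/-! ### Sobolev norms on the half space and symbols -/

section SobolevNorm

variable {N : ℕ} {s : ℝ} {u V : Amb N → ℂ}

lemma rpow_half_sq (x : ℝ≥0∞) : (x ^ (1 / 2 : ℝ)) ^ 2 = x := by
  rw [← ENNReal.rpow_natCast, ← ENNReal.rpow_mul]
  norm_num

lemma ennreal_le_of_sq_le_sq {x y : ℝ≥0∞} (h : x ^ 2 ≤ y ^ 2) : x ≤ y :=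
  le_of_not_gt fun hlt => absurd h (not_le.2 (ENNReal.pow_lt_pow_left two_ne_zero hlt))

lemma symWt_bounds (ξ : Amb N) :
    1 + ‖ξ‖ ^ 2 ≤ symWt ξ ∧ symWt ξ ≤ 4 * Real.pi ^ 2 * (1 + ‖ξ‖ ^ 2) := by
  have h1 : 1 ≤ 4 * Real.pi ^ 2 := by nlinarith [Real.pi_gt_three]
  have h2 : symWt ξ = 1 + 4 * Real.pi ^ 2 * ‖ξ‖ ^ 2 := by unfold symWt; ring
  have h3 : 1 * ‖ξ‖ ^ 2 ≤ 4 * Real.pi ^ 2 * ‖ξ‖ ^ 2 := by gcongr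
  constructor <;> linarith

lemma eSobolevNormWhole_sq (s : ℝ) (F : Lp ℂ 2 (volume : Measure (Amb N))) :
    eSobolevNormWhole s F ^ 2 = ∫⁻ ξ, ENNReal.ofReal ((1 + ‖ξ‖ ^ 2) ^ s) *
      ‖(𝓕 F : Lp ℂ 2 (volume : Measure (Amb N))) ξ‖ₑ ^ 2 := rpow_half_sq _

lemma HasSymbol.eSobolevNorm_sq_le (h : HasSymbol s u V) (hs : 0 ≤ s) :
    eSobolevNorm s u ^ 2 ≤ symInt s V := by
  obtain ⟨h1, h2, F, h3, h4⟩ := h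
  have h5 : eSobolevNorm s u ≤ eSobolevNormWhole s F := iInf₂_le F h3
  calc _ ≤ eSobolevNormWhole s F ^ 2 := by gcongr
    _ = ∫⁻ ξ, ENNReal.ofReal ((1 + ‖ξ‖ ^ 2) ^ s) * ‖V ξ‖ₑ ^ 2 := by
        rw [eSobolevNormWhole_sq]
        exact lintegral_congr_ae (h4.mono fun ξ hξ => by simp only; rw [hξ])
    _ ≤ _ := by
        unfold symInt
        gcongr with ξ
        exact (symWt_bounds ξ).1

lemma HasSymbol.memSob (h : HasSymbol s u V) (hs : 0 ≤ s) : MemSob s u := by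
  have h1 := (h.eSobolevNorm_sq_le hs).trans_lt h.2.1
  exact lt_top_iff_ne_top.2 fun h2 => by simp [h2] at h1

lemma lintegral_sq_le_eSobolevNorm_sq (hs : 0 ≤ s) (u : Amb N → ℂ) :
    ∫⁻ x, ‖u x‖ₑ ^ 2 ∂halfMeasure N ≤ eSobolevNorm s u ^ 2 := by
  rw [← rpow_half_sq (∫⁻ x, ‖u x‖ₑ ^ 2 ∂halfMeasure N)]
  gcongr
  refine le_iInf₂ fun F hF => ennreal_le_of_sq_le_sq ?_
  rw [rpow_half_sq, eSobolevNormWhole_sq]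
  calc ∫⁻ x, ‖u x‖ₑ ^ 2 ∂halfMeasure N = ∫⁻ x, ‖F x‖ₑ ^ 2 ∂halfMeasure N :=
        lintegral_congr_ae (hF.mono fun x hx => by simp only; rw [hx])
    _ ≤ ∫⁻ x, ‖F x‖ₑ ^ 2 := setLIntegral_le_lintegral _ _
    _ = ∫⁻ ξ, 1 * ‖(𝓕 F : Lp ℂ 2 (volume : Measure (Amb N))) ξ‖ₑ ^ 2 := by
        simp only [one_mul]
        rw [lintegral_fourier_Lp]
    _ ≤ _ := by
        gcongr with ξ
        rw [← ENNReal.ofReal_one]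
        exact ENNReal.ofReal_le_ofReal (Real.one_le_rpow (by nlinarith [sq_nonneg ‖ξ‖]) hs)

lemma hasSymbol_of_eSobolevNormWhole (hs : 0 ≤ s) {F : Lp ℂ 2 (volume : Measure (Amb N))}
    (hF : F =ᵐ[halfMeasure N] u) (h : eSobolevNormWhole s F < ⊤) :
    ∃ V, HasSymbol s u V ∧
      symInt s V ≤ ENNReal.ofReal ((4 * Real.pi ^ 2) ^ s) * eSobolevNormWhole s F ^ 2 := by
  have hle : symInt s (𝓕 F : Lp ℂ 2 (volume : Measure (Amb N))) ≤
      ENNReal.ofReal ((4 * Real.pi ^ 2) ^ s) * eSobolevNormWhole s F ^ 2 := by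
    rw [eSobolevNormWhole_sq, ← lintegral_const_mul' _ _ ENNReal.ofReal_ne_top]
    unfold symInt
    refine lintegral_mono fun ξ => ?_
    rw [← mul_assoc, ← ENNReal.ofReal_mul (by positivity),
      ← Real.mul_rpow (by positivity) (by positivity)]
    have := symWt_pos ξ
    gcongr
    exact (symWt_bounds ξ).2
  exact ⟨_, ⟨(Lp.stronglyMeasurable _).measurable, hle.trans_lt (by finiteness), F, hF,
    ae_eq_refl _⟩, hle⟩

/-- An extension that nearly attains the infimum in the norm of `W^s(ℝ^{N+1}_+)`. -/
lemma MemSob.exists_hasSymbol (h : MemSob s u) (hs : 0 ≤ s) :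
    ∃ V, HasSymbol s u V ∧
      symInt s V ≤ ENNReal.ofReal (4 * (4 * Real.pi ^ 2) ^ s) * eSobolevNorm s u ^ 2 := by
  by_cases h0 : eSobolevNorm s u = 0
  · -- here the infimum need not be nearly attained up to a factor, but `u = 0`
    have h1 := lintegral_sq_le_eSobolevNorm_sq hs u
    obtain ⟨V, hV, -⟩ : ∃ V, HasSymbol s u V ∧ True := by
      unfold MemSob eSobolevNorm at h
      simp only [iInf_lt_iff] at h
      obtain ⟨F, hF, hlt⟩ := h
      obtain ⟨V, hV, -⟩ := hasSymbol_of_eSobolevNormWhole hs hF hlt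
      exact ⟨V, hV, trivial⟩
    have h2 : u =ᵐ[halfMeasure N] fun _ => 0 := by
      rw [h0, zero_pow two_ne_zero, nonpos_iff_eq_zero,
        lintegral_eq_zero_iff' (hV.aestronglyMeasurable.enorm.pow_const 2)] at h1
      filter_upwards [h1] with x hx
      simpa using hx
    exact ⟨0, HasSymbol.zero.congr h2.symm, by simp [symInt]⟩
  · have h1 : eSobolevNorm s u < 2 * eSobolevNorm s u := by
      rw [two_mul]
      exact ENNReal.lt_add_right h.ne h0
    conv_lhs at h1 => unfold eSobolevNorm
    simp only [iInf_lt_iff] at h1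
    obtain ⟨F, hF, hlt⟩ := h1
    obtain ⟨V, hV, hle⟩ := hasSymbol_of_eSobolevNormWhole hs hF
      (hlt.trans (ENNReal.mul_lt_top (by norm_num) h))
    refine ⟨V, hV, hle.trans ?_⟩
    calc _ ≤ ENNReal.ofReal ((4 * Real.pi ^ 2) ^ s) * (2 * eSobolevNorm s u) ^ 2 := by gcongr
      _ = _ := by
        rw [ENNReal.ofReal_mul (by norm_num), ENNReal.ofReal_ofNat]
        ring

lemma IsTangFourier.congr {u' : Amb N → ℂ} {v : ℝ → Bdry N → ℂ} (h : IsTangFourier u v)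
    (hu : u =ᵐ[halfMeasure N] u') : IsTangFourier u' v := by
  filter_upwards [h, ae_half_glue hu] with x₀ ⟨hm, hm2⟩ hx2
  refine ⟨hm.ae_eq hx2, ?_⟩
  rwa [← MemLp.toLp_congr hm (hm.ae_eq hx2) hx2]

end SobolevNorm

/-! ### Well-posedness -/

section WellPosed

variable {N : ℕ} {s : ℝ}

lemma boundaryCond_of_memDomAdjoint_of_hasSymbol {t : ℝ} {ψ W : Form N}
    (h : ∀ I, HasSymbol t (ψ I) (W I)) (ht : 3 / 2 < t) (hd : MemDomAdjoint ψ) : BoundaryCond ψ :=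
  boundaryCond_of_memDomAdjoint hd fun I =>
    let ⟨v, hv, _⟩ := ((h I).weakDeriv (by linarith) 0).exists_trace (by linarith)
    ⟨v, hv⟩

lemma IsHilbertSolution.isSolution (hs : 1 / 2 < s) {q : ℕ} {α φ : Form N}
    (h : IsHilbertSolution q s α φ) : IsSolution q s α φ := by
  have hex := fun I => (h.memSob I).exists_hasSymbol (by linarith)
  choose V hV _ using hex
  exact { h.toSolvesEquation with
    bdry := boundaryCond_of_memDomAdjoint_of_hasSymbol hV (by linarith) h.dom
    bdry_d := boundaryCond_of_memDomAdjoint_of_hasSymbol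
      (fun K => hasSymbol_extD hV (by linarith) K) (by linarith) h.dom_d }

/-- Two solutions with the same right-hand side agree. -/
lemma IsSolution.ae_eq (hN : 1 ≤ N) (hs : 1 / 2 < s) {q : ℕ} {α φ φ' : Form N}
    (hα : ∀ I, MemSob s (α I)) (h : IsSolution q s α φ) (h' : IsSolution q s α φ')
    (I : Finset (Fin (N + 1))) : φ' I =ᵐ[halfMeasure N] φ I := by
  have hexα := fun I => (hα I).exists_hasSymbol (by linarith)
  have hex := fun I => (h.memSob I).exists_hasSymbol (by linarith)
  have hex' := fun I => (h'.memSob I).exists_hasSymbol (by linarith)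
  choose a ha _ using hexα
  choose V hV _ using hex
  choose V' hV' _ using hex'
  exact FiberSol.ae_eq hN hs (hV' I) (hV I)
    ((eqn_and_bdry_iff hV' hs ha).1 ⟨h'.eqn, h'.bdry, h'.bdry_d⟩ I)
    ((eqn_and_bdry_iff hV hs ha).1 ⟨h.eqn, h.bdry, h.bdry_d⟩ I)

/-- Existence of a solution with the estimate and the explicit formulas, the coefficients being
treated separately. -/
lemma exists_form_solution (hN : 1 ≤ N) (hs : 1 / 2 < s) (q : ℕ) {k : ℕ} (hk : k ≤ 2)
    (hkN : 4 ≤ N + 2 * k) :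
    ∃ C : ℝ≥0, ∀ α : Form N, IsQForm q α → (∀ I, MemSob s (α I)) →
      (∀ I, Integrable (α I) (halfMeasure N)) → (∀ I, absMoment k (α I) < ⊤) →
      (∀ I, MomentsVanish k (α I)) → ∃ φ V : Form N,
        (∀ I, HasSymbol (s + 2) (φ I) (V I)) ∧ IsSolution q s α φ ∧ IsExplicit α φ ∧
        ∀ I, eSobolevNorm (s + 2) (φ I) ^ 2 ≤
          C * (eSobolevNorm s (α I) ^ 2 + absMoment k (α I) ^ 2) := by
  obtain ⟨C₀, hC₀⟩ := exists_scalar_solution (N := N) hN hs hk hkN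
  obtain ⟨c, hc⟩ : ∃ c : ℝ≥0, (c : ℝ≥0∞) = ENNReal.ofReal (4 * (4 * Real.pi ^ 2) ^ s) := ⟨_, rfl⟩
  refine ⟨C₀ * (c + 1), fun α hq hα hint hM hv => ?_⟩
  have hexα := fun I => (hα I).exists_hasSymbol (by linarith)
  choose a ha hale using hexα
  have hex := fun I => hC₀ (α I) (a I) (ha I) (hint I) (hM I) (hv I) (0 ∈ I)
  choose φ₀ V hφ₀ hle hsol hn ht using hex
  have hexp : ∀ I, IsTangFourier (φ₀ I) (if 0 ∈ I then solHatNorm (α I) else solHatTang (α I)) := by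
    intro I
    split_ifs with h
    · exact hn I h
    · exact ht I h
  have hbound : ∀ I, symInt (s + 2) (V I) ≤
      (C₀ * (c + 1) : ℝ≥0) * (eSobolevNorm s (α I) ^ 2 + absMoment k (α I) ^ 2) := by
    intro I
    refine (hle I).trans ?_
    have h1 := hale I
    rw [← hc] at h1
    calc _ ≤ C₀ * (c * eSobolevNorm s (α I) ^ 2 + absMoment k (α I) ^ 2) := by gcongr
      _ ≤ C₀ * ((c + 1) * eSobolevNorm s (α I) ^ 2 + (c + 1) * absMoment k (α I) ^ 2) := by
          gcongr
          · exact le_self_add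
          · exact le_mul_of_one_le_left zero_le le_add_self
      _ = _ := by push_cast; ring
  -- the coefficients with the wrong number of indices are made literally zero
  have hzero : ∀ I, I.card ≠ q → φ₀ I =ᵐ[halfMeasure N] 0 := by
    intro I hI
    have h0 : eSobolevNorm s (0 : Amb N → ℂ) ^ 2 ≤ symInt s (0 : Amb N → ℂ) :=
      HasSymbol.zero.eSobolevNorm_sq_le (by linarith)
    have h1 := hbound I
    rw [hq I hI] at h1
    have h2 : eSobolevNorm s (0 : Amb N → ℂ) ^ 2 = 0 := by
      refine nonpos_iff_eq_zero.1 (h0.trans (le_of_eq ?_))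
      simp [symInt]
    have h3 : absMoment k (0 : Amb N → ℂ) = 0 := by simp [absMoment]
    rw [h2, h3, zero_pow two_ne_zero, add_zero, mul_zero] at h1
    have h4 := ((hφ₀ I).lintegral_sq_le (by linarith)).trans h1
    rw [nonpos_iff_eq_zero,
      lintegral_eq_zero_iff' ((hφ₀ I).aestronglyMeasurable.enorm.pow_const 2)] at h4
    filter_upwards [h4] with x hx
    simpa using hx
  obtain ⟨φ, hφ⟩ : ∃ φ : Form N, φ = fun I => if I.card = q then φ₀ I else 0 := ⟨_, rfl⟩
  have hae : ∀ I, φ₀ I =ᵐ[halfMeasure N] φ I := by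
    intro I
    rw [hφ]
    by_cases hI : I.card = q
    · simp only [if_pos hI]; exact ae_eq_refl _
    · simp only [if_neg hI]; exact hzero I hI
  have hsym : ∀ I, HasSymbol (s + 2) (φ I) (V I) := fun I => (hφ₀ I).congr (hae I)
  obtain ⟨h1, h2, h3⟩ := (eqn_and_bdry_iff hsym hs ha).2 hsol
  refine ⟨φ, V, hsym, ⟨⟨fun I hI => ?_, fun I => (hsym I).memSob (by linarith), h1⟩, h2, h3⟩,
    fun I => (hexp I).congr (hae I), fun I => ?_⟩
  · rw [hφ]; simp only [if_neg hI]
  · exact ((hsym I).eSobolevNorm_sq_le (by linarith)).trans (hbound I)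

lemma eSobolevNormForm_sq (s : ℝ) (φ : Form N) :
    eSobolevNormForm s φ ^ 2 = ∑ I, eSobolevNorm s (φ I) ^ 2 := rpow_half_sq _

lemma integrable_of_eWeightedL1 {α : Form N} (hα : ∀ I, MemSob s (α I)) (hs : 0 ≤ s)
    (h : eWeightedL1 0 α < ⊤) (I : Finset (Fin (N + 1))) : Integrable (α I) (halfMeasure N) := by
  obtain ⟨V, hV, -⟩ := (hα I).exists_hasSymbol hs
  refine ⟨hV.aestronglyMeasurable, ?_⟩
  have h1 := (ENNReal.sum_lt_top.1 h) I (Finset.mem_univ I)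
  simpa [HasFiniteIntegral] using h1

/-- The boundary value problem is well posed for data with finite moments of order `k`, the moments
of order less than `k` being zero, if `N + 2k ≥ 4`. -/
lemma wellPosed_of_moments (hN : 1 ≤ N) (hs : 1 / 2 < s) (q : ℕ) {k : ℕ} (hk : k ≤ 2)
    (hkN : 4 ≤ N + 2 * k) {adm : Form N → Prop} (h0 : ∀ α, adm α → eWeightedL1 0 α < ⊤)
    (h1 : ∀ α, adm α → eWeightedL1 k α < ⊤) (h2 : ∀ α, adm α → ∀ I, MomentsVanish k (α I)) :
    WellPosed N q s adm (fun α => eWeightedL1 k α) := by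
  obtain ⟨C, hC⟩ := exists_form_solution (N := N) hN hs q hk hkN
  refine ⟨NNReal.sqrt C, fun α hq hα had => ?_⟩
  have hM : ∀ I, absMoment k (α I) < ⊤ := fun I =>
    (ENNReal.sum_lt_top.1 (h1 α had)) I (Finset.mem_univ I)
  obtain ⟨φ, V, hsym, hsol, hexp, hle⟩ := hC α hq hα
    (integrable_of_eWeightedL1 hα (by linarith) (h0 α had)) hM (h2 α had)
  have hd : MemDomAdjoint φ := memDomAdjoint_of_boundaryCond hsym (by linarith) hsol.bdry
  refine ⟨φ, hsol, hd, fun hs1 => ?_, fun φ' h' => ?_, ?_, hexp⟩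
  · exact { hsol.toSolvesEquation with
      dom := hd
      dom_d := memDomAdjoint_of_boundaryCond (t := s + 2 - 1)
        (fun K => hasSymbol_extD hsym (by linarith) K) (by linarith) hsol.bdry_d }
  · exact IsSolution.ae_eq hN hs hα hsol (h'.elim id (IsHilbertSolution.isSolution hs))
  · refine ennreal_le_of_sq_le_sq ?_
    have h3 : ∑ I, absMoment k (α I) ^ 2 ≤ eWeightedL1 k α ^ 2 := by
      rw [sq (eWeightedL1 k α)]
      unfold eWeightedL1
      rw [Finset.sum_mul]
      refine Finset.sum_le_sum fun I _ => ?_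
      rw [sq]
      exact mul_le_mul_right (Finset.single_le_sum (f := fun I => absMoment k (α I))
        (fun _ _ => zero_le) (Finset.mem_univ I)) _
    calc eSobolevNormForm (s + 2) φ ^ 2
        ≤ ∑ I, C * (eSobolevNorm s (α I) ^ 2 + absMoment k (α I) ^ 2) := by
          rw [eSobolevNormForm_sq]
          exact Finset.sum_le_sum fun I _ => hle I
      _ ≤ C * (eSobolevNormForm s α ^ 2 + eWeightedL1 k α ^ 2) := by
          rw [← Finset.mul_sum, Finset.sum_add_distrib, eSobolevNormForm_sq]
          gcongr
      _ ≤ C * (eSobolevNormForm s α + eWeightedL1 k α) ^ 2 := by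
          gcongr
          rw [add_sq]
          gcongr
          exact le_self_add
      _ = _ := by
          rw [mul_pow, ← ENNReal.coe_pow, NNReal.sq_sqrt]

/-- On forms supported in a fixed ball, the weighted `L¹` norm is bounded through the `L²` norm, hence
by the `W^s` norm. -/
lemma eWeightedL1_le_of_supportedIn (hs : 0 ≤ s) (k : ℕ) (R : ℝ) : ∃ C : ℝ≥0, ∀ α : Form N,
    (∀ I, MemSob s (α I)) → SupportedIn R α → eWeightedL1 k α ≤ C * eSobolevNormForm s α := by
  obtain ⟨B, hB⟩ : ∃ B : ℝ≥0∞, B = ((volume : Measure (Amb N)) (Metric.ball 0 R)) ^ (1 / 2 : ℝ) :=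
    ⟨_, rfl⟩
  have hBt : B < ⊤ := hB ▸ ENNReal.rpow_lt_top_of_nonneg (by norm_num) measure_ball_lt_top.ne
  obtain ⟨C, hC⟩ : ∃ C : ℝ≥0, (C : ℝ≥0∞) = ENNReal.ofReal R ^ k * B :=
    ⟨_, ENNReal.coe_toNNReal (by finiteness)⟩
  refine ⟨Fintype.card (Finset (Fin (N + 1))) * C, fun α hα hsup => ?_⟩
  have key : ∀ I, ∫⁻ x, ‖x‖ₑ ^ k * ‖α I x‖ₑ ∂halfMeasure N ≤ C * eSobolevNormForm s α := by
    intro I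
    obtain ⟨V, hV, -⟩ := (hα I).exists_hasSymbol hs
    have hm : AEMeasurable (fun x => ‖α I x‖ₑ) (halfMeasure N) := hV.aestronglyMeasurable.enorm
    have hind : Measurable ((Metric.ball (0 : Amb N) R).indicator fun _ => (1 : ℝ≥0∞)) :=
      measurable_const.indicator Metric.isOpen_ball.measurableSet
    have h1 : ∫⁻ x, ‖x‖ₑ ^ k * ‖α I x‖ₑ ∂halfMeasure N ≤ ENNReal.ofReal R ^ k *
        ∫⁻ x, (Metric.ball (0 : Amb N) R).indicator (fun _ => 1) x * ‖α I x‖ₑ ∂halfMeasure N := by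
      rw [← lintegral_const_mul' _ _ (by finiteness)]
      refine lintegral_mono_ae ?_
      filter_upwards [hsup I] with x hx
      by_cases hxR : R ≤ ‖x‖
      · simp [hx hxR]
      · have hxb : x ∈ Metric.ball (0 : Amb N) R := by simpa using hxR
        rw [Set.indicator_of_mem hxb, one_mul, ← ofReal_norm]
        gcongr
        exact (not_le.1 hxR).le
    have h2 := ENNReal.lintegral_mul_le_Lp_mul_Lq (halfMeasure N) Real.HolderConjugate.two_two
      hind.aemeasurable hm
    have h3 : (∫⁻ x, (Metric.ball (0 : Amb N) R).indicator (fun _ => (1 : ℝ≥0∞)) x ^ (2 : ℝ)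
        ∂halfMeasure N) ^ (1 / 2 : ℝ) ≤ B := by
      rw [hB]
      gcongr
      calc _ ≤ ∫⁻ x, (Metric.ball (0 : Amb N) R).indicator (fun _ => (1 : ℝ≥0∞)) x := by
            refine lintegral_mono' halfMeasure_le fun x => ?_
            by_cases hx : x ∈ Metric.ball (0 : Amb N) R
            · simp [Set.indicator_of_mem hx]
            · simp [Set.indicator_of_notMem hx]
        _ = _ := by rw [lintegral_indicator_const Metric.isOpen_ball.measurableSet, one_mul]
    have h4 : (∫⁻ x, ‖α I x‖ₑ ^ (2 : ℝ) ∂halfMeasure N) ^ (1 / 2 : ℝ) ≤ eSobolevNormForm s α := by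
      unfold eSobolevNormForm
      gcongr
      simp only [ENNReal.rpow_ofNat]
      refine (lintegral_sq_le_eSobolevNorm_sq hs _).trans ?_
      exact Finset.single_le_sum (f := fun I => eSobolevNorm s (α I) ^ 2) (fun _ _ => zero_le)
        (Finset.mem_univ I)
    rw [hC, mul_assoc]
    refine h1.trans ?_
    gcongr
    exact h2.trans (by gcongr)
  calc eWeightedL1 k α ≤ ∑ _I : Finset (Fin (N + 1)), C * eSobolevNormForm s α :=
        Finset.sum_le_sum fun I _ => key I
    _ = _ := by
        rw [Finset.sum_const, nsmul_eq_mul, Finset.card_univ]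
        push_cast
        ring

lemma WellPosed.of_size_le {q : ℕ} {adm adm' : Form N → Prop} {size : Form N → ℝ≥0∞}
    (h : WellPosed N q s adm size) {C : ℝ≥0} (h' : ∀ α, (∀ I, MemSob s (α I)) → adm' α →
      adm α ∧ size α ≤ C * eSobolevNormForm s α) : WellPosed N q s adm' (fun _ => 0) := by
  obtain ⟨c, hc⟩ := h
  refine ⟨c * (1 + C), fun α hq hα had => ?_⟩
  obtain ⟨h1, h2⟩ := h' α hα had
  obtain ⟨φ, k1, k2, k3, k4, k5, k6⟩ := hc α hq hα h1
  refine ⟨φ, k1, k2, k3, k4, k5.trans ?_, k6⟩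
  calc _ ≤ c * (eSobolevNormForm s α + C * eSobolevNormForm s α) := by gcongr
    _ = _ := by push_cast; ring

lemma eSobolevNormForm_lt_top {α : Form N} (hα : ∀ I, MemSob s (α I)) :
    eSobolevNormForm s α < ⊤ := by
  refine ENNReal.rpow_lt_top_of_nonneg (by norm_num) ?_
  exact (ENNReal.sum_lt_top.2 fun I _ => ENNReal.pow_lt_top (hα I)).ne

/-- Well-posedness for forms supported in a fixed ball. -/
lemma wellPosed_of_supportedIn (hN : 1 ≤ N) (hs : 1 / 2 < s) (q : ℕ) {k : ℕ} (hk : k ≤ 2)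
    (hkN : 4 ≤ N + 2 * k) (h1 : 1 ≤ k → N ≤ 3) (h2 : 2 ≤ k → N ≤ 1) (R : ℝ) :
    WellPosed N q s (fun α => SupportedIn R α ∧ MomentCond α) (fun _ => 0) := by
  obtain ⟨C₀, hC₀⟩ := eWeightedL1_le_of_supportedIn (N := N) (s := s) (by linarith) 0 R
  obtain ⟨C, hC⟩ := eWeightedL1_le_of_supportedIn (N := N) (s := s) (by linarith) k R
  refine (wellPosed_of_moments hN hs q hk hkN (adm := fun α => eWeightedL1 0 α < ⊤ ∧
    eWeightedL1 k α < ⊤ ∧ ∀ I, MomentsVanish k (α I)) (fun _ h => h.1) (fun _ h => h.2.1)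
    (fun _ h => h.2.2)).of_size_le (C := C) fun α hα had => ?_
  obtain ⟨hR, hm⟩ := had
  have ht := eSobolevNormForm_lt_top hα
  have l0 := hC₀ α hα hR
  have l1 := hC α hα hR
  exact ⟨⟨l0.trans_lt (ENNReal.mul_lt_top ENNReal.coe_lt_top ht),
    l1.trans_lt (ENNReal.mul_lt_top ENNReal.coe_lt_top ht),
    fun I => ⟨fun h => hm.1 (h1 h) I, fun h i => hm.2 (h2 h) I i⟩⟩, l1⟩

end WellPosed

end HalfSpaceHodge

end

theorem mainTheorem3 (N q : ℕ) (s : ℝ) (hs : 1 / 2 < s) :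
    (4 ≤ N → HalfSpaceHodge.WellPosed N q s
      (fun α => HalfSpaceHodge.eWeightedL1 0 α < ⊤)
      (fun α => HalfSpaceHodge.eWeightedL1 0 α)) ∧
    (N = 2 ∨ N = 3 → HalfSpaceHodge.WellPosed N q s
      (fun α => HalfSpaceHodge.eWeightedL1 0 α < ⊤ ∧ HalfSpaceHodge.eWeightedL1 1 α < ⊤ ∧
        HalfSpaceHodge.ZerothMomentsVanish α)
      (fun α => HalfSpaceHodge.eWeightedL1 1 α)) ∧
    (N = 1 → HalfSpaceHodge.WellPosed N q s
      (fun α => HalfSpaceHodge.eWeightedL1 0 α < ⊤ ∧ HalfSpaceHodge.eWeightedL1 2 α < ⊤ ∧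
        HalfSpaceHodge.ZerothMomentsVanish α ∧ HalfSpaceHodge.FirstMomentsVanish α)
      (fun α => HalfSpaceHodge.eWeightedL1 2 α)) ∧
    (1 ≤ N → ∀ R : ℝ, HalfSpaceHodge.WellPosed N q s
      (fun α => HalfSpaceHodge.SupportedIn R α ∧ HalfSpaceHodge.MomentCond α)
      (fun _ => 0)) := by
  refine ⟨fun hN => ?_, fun hN => ?_, fun hN => ?_, fun hN R => ?_⟩
  · exact HalfSpaceHodge.wellPosed_of_moments (by lia) hs q (k := 0) (by norm_num) (by lia)
      (fun _ h => h) (fun _ h => h) (fun _ _ _ => ⟨fun h => by lia, fun h => by lia⟩)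
  · exact HalfSpaceHodge.wellPosed_of_moments (by lia) hs q (k := 1) (by norm_num) (by lia)
      (fun _ h => h.1) (fun _ h => h.2.1) (fun _ h I => ⟨fun _ => h.2.2 I, fun h => by lia⟩)
  · exact HalfSpaceHodge.wellPosed_of_moments (by lia) hs q (k := 2) (by norm_num) (by lia)
      (fun _ h => h.1) (fun _ h => h.2.1)
      (fun _ h I => ⟨fun _ => h.2.2.1 I, fun _ i => h.2.2.2 I i⟩)
  · rcases Nat.lt_or_ge 3 N with h3 | h3
    · exact HalfSpaceHodge.wellPosed_of_supportedIn hN hs q (k := 0) (by norm_num) (by lia) (by lia)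
        (by lia) R
    · rcases Nat.lt_or_ge 1 N with h1 | h1
      · exact HalfSpaceHodge.wellPosed_of_supportedIn hN hs q (k := 1) (by norm_num) (by lia)
          (by lia) (by lia) R
      · exact HalfSpaceHodge.wellPosed_of_supportedIn hN hs q (k := 2) (by norm_num) (by lia)
          (by lia) (by lia) R
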